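/- **Theorem (Universal properties of polynomials: cartesian setting).** Let $\mathcal E$ be a locally cartesian closed category with chosen pullbacks and chosen distributivity pullbacks, and let $\mathscr C$ be any bicategory. *Conventions.* For $X\xrightarrow{u}A\xrightarrow{f}B$ in $\mathcal E$, a *pullback around* $(f,u)$ consists of $p\colon T\to X$, $q\colon T\to Y$, $r\colon Y\to B$ such that $(up,q)$ is a pullback of $(f,r)$; a *distributivity pullback* is a terminal such diagram (for the morphisms $T\to T'$, $Y\to Y'$ commuting with the $p$'s, $q$'s and $r$'s). $\mathbf{Span}(\mathcal E)$ is the bicategory of spans, and $\mathbf{Span}_{\mathrm{iso}}(\mathcal E)$ is the same with only the invertible 2-cells. $\mathbf{Poly}_c(\mathcal E)$ is the bicategory whose objects are those of $\mathcal E$, whose 1-cells $I\to J$ are polynomials $I\xleftarrow{s}P\xrightarrow{p}Q\xrightarrow{t}J$, whose 2-cells are the pairs $P\to P'$, $Q\to Q'$ commuting with $s,t$ and forming a pullback square with $p,p'$, and whose composition is the usual one by pullbacks and distributivity pullbacks. The embeddings $(-)_{\Sigma\Delta}\colon\mathbf{Span}(\mathcal E)\to\mathbf{Poly}_c(\mathcal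 E)$, $(s,t)\mapsto(s,1,t)$, and $(-)_{\Delta\otimes}\colon\mathbf{Span}_{\mathrm{iso}}(\mathcal E)\to\mathbf{Poly}_c(\mathcal E)$, $(s,t)\mapsto(s,t,1)$, and their restrictions $f_\Sigma=(1,1,f)$, $f_\Delta=(f,1,1)$, $f_\otimes=(1,f,1)$ to $\mathcal E$, $\mathcal E^{\mathrm{op}}$, $\mathcal E$ are pseudofunctors; $F_{\Sigma\Delta},F_{\Delta\otimes},F_\Sigma,F_\Delta,F_\otimes$ denote the corresponding restrictions of an oplax functor $F\colon\mathbf{Poly}_c(\mathcal E)\to\mathscr C$. A *gregarious functor* is an oplax functor with invertible unit constraints for which the constraint $F(gf)\to Fg\cdot Ff$ is invertible whenever $g$ has a right adjoint. An *icon* between oplax functors which agree on objects is a family of natural transformations between their actions on hom-categories, compatible with the constraints. $\mathbf{Greg}_\otimes(\mathbf{Poly}_c(\mathcal E),\mathscr C)$ is the category of gregarious functors $F$ with $F_\otimes$ pseudo, and icons; $\mathbf{Greg}_{\Sigma\Delta,\Delta\otimes}$ is its full subcategory on those $F$ for which $F_{\Sigma\Delta}$ and $F_{\Delta\otimes}$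 are pseudo, and $\mathbf{Icon}(\mathbf{Poly}_c(\mathcal E),\mathscr C)$ its full subcategory on the pseudofunctors. A *lax Beck triple* consists of pseudofunctors $F_\Sigma\colon\mathcal E\to\mathscr C$, $F_\Delta\colon\mathcal E^{\mathrm{op}}\to\mathscr C$, $F_\otimes\colon\mathcal E\to\mathscr C$ which agree on objects, such that there are adjunctions $F_\Sigma f\dashv F_\Delta f$ for all $f$ under which the constraints of $F_\Delta$ are the inverses of the mates of those of $F_\Sigma$, together with a 2-cell $\mathfrak b_{f,g}^{f',g'}\colon F_\otimes f'\cdot F_\Delta g'\to F_\Delta g\cdot F_\otimes f$ for each pullback square $gf'=fg'$ (with $(f',g')$ a pullback of $(g,f)$). These 2-cells are compatible, modulo the constraints of $F_\otimes$ and $F_\Delta$, with horizontal and vertical pasting of pullback squares and with the two kinds of identity squares. A morphism of lax Beck triples is an invertible icon $\beta\colon F_\Delta\Rightarrow G_\Delta$ and an icon $\gamma\colon F_\otimes\Rightarrow G_\otimes$ with ${}^G\mathfrak b\circ(\gamma_{f'}*\beta_{g'})=(\beta_g*\gamma_f)\circ{}^F\mathfrak b$ for all pullback squares. A lax Beck triple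 is a *Beck triple* if all $\mathfrak b_{f,g}^{f',g'}$ are invertible and, for each pullback square, the mate $F_\Sigma f'\cdot F_\Delta g'\to F_\Delta g\cdot F_\Sigma f$ of the canonical isomorphism $F_\Sigma g\cdot F_\Sigma f'\cong F_\Sigma f\cdot F_\Sigma g'$ is invertible. It is a *distributive Beck triple* if, moreover, for each distributivity pullback $(p,q,r)$ around $(f,u)$ the composite $$F_\Sigma r\cdot F_\otimes q\cdot F_\Delta p\to F_\Sigma r\cdot F_\otimes q\cdot F_\Delta p\cdot F_\Delta u\cdot F_\Sigma u\cong F_\Sigma r\cdot F_\otimes q\cdot F_\Delta(up)\cdot F_\Sigma u\to F_\Sigma r\cdot F_\Delta r\cdot F_\otimes f\cdot F_\Sigma u\to F_\otimes f\cdot F_\Sigma u$$ of the unit at $u$, the constraint of $F_\Delta$, $\mathfrak b_{f,r}^{q,up}$ and the counit at $r$ is invertible. *The functor $\Upsilon$.* It sends $F$ to $(F_\Sigma,F_\Delta,F_\otimes)$ with the 2-cells $\mathfrak b_{f,g}^{f',g'}$ obtained by composing the inverse of the (invertible) constraint $F_{\Delta\otimes}(g',f')\to F_\otimes f'\cdot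 F_\Delta g'$, the image of the canonical isomorphism from the span $(g',f')$ to the composite of $(1,f)$ and $(g,1)$, and the constraint of $F_{\Delta\otimes}$ from the image of this composite to $F_\Delta g\cdot F_\otimes f$; it sends an icon to its restrictions to the $\Delta$ and $\otimes$ parts. *Claim.* $\Upsilon$ is a well-defined functor and an equivalence of categories $$\mathbf{Greg}_\otimes(\mathbf{Poly}_c(\mathcal E),\mathscr C)\simeq\mathbf{LaxBeckTriple}(\mathcal E,\mathscr C),$$ which restricts to an equivalence $$\mathbf{Greg}_{\Sigma\Delta,\Delta\otimes}(\mathbf{Poly}_c(\mathcal E),\mathscr C)\simeq\mathbf{BeckTriple}(\mathcal E,\mathscr C)$$ between the full subcategories on the left and on the Beck triples, and further to an equivalence $$\mathbf{Icon}(\mathbf{Poly}_c(\mathcal E),\mathscr C)\simeq\mathbf{DistBeckTriple}(\mathcal E,\mathscr C)$$ with the full subcategory of distributive Beck triples. -/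

import Mathlib

/-!
# Polynomials with cartesian 2-cells: definitions

The bicategories of spans and of polynomials with cartesian 2-cells, gregarious functors and icons,
lax Beck triples, and the functor comparing the two.
-/

open CategoryTheory Limits Bicategory

universe w₁ w₂ w₃ v₁ v₂ v₃ u₁ u₂ u₃ v u

namespace PolyCart

section Distributivity

variable {E : Type u} [Category.{v} E]

/-- A pullback around `(f, u)`: a diagram `Y ⟵q T ⟶p X ⟶u A`, `r : Y ⟶ B` whose outer
rectangle is a pullback of `f : A ⟶ B` and `r`. -/
structure PullbackAround {X A B : E} (u : X ⟶ A) (f : A ⟶ B) where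
  T : E
  Y : E
  p : T ⟶ X
  q : T ⟶ Y
  r : Y ⟶ B
  isPullback : IsPullback (p ≫ u) q f r

/-- Morphisms of pullbacks around `(f, u)`. -/
@[ext]
structure PullbackAround.Hom {X A B : E} {u : X ⟶ A} {f : A ⟶ B}
    (D D' : PullbackAround u f) where
  s : D.T ⟶ D'.T
  t : D.Y ⟶ D'.Y
  hp : s ≫ D'.p = D.p
  hq : s ≫ D'.q = D.q ≫ t
  hr : t ≫ D'.r = D.r

instance {X A B : E} (u : X ⟶ A) (f : A ⟶ B) : Category (PullbackAround u f) where
  Hom := PullbackAround.Hom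
  id D := ⟨𝟙 _, 𝟙 _, by simp, by simp, by simp⟩
  comp m n := ⟨m.s ≫ n.s, m.t ≫ n.t, by simp [n.hp, m.hp],
    by rw [Category.assoc, n.hq, reassoc_of% m.hq], by simp [n.hr, m.hr]⟩

/-- A distributivity pullback around `(f, u)` is a terminal pullback around `(f, u)`. -/
structure DistributivityPullback {X A B : E} (u : X ⟶ A) (f : A ⟶ B)
    extends PullbackAround u f where
  isTerminal : IsTerminal toPullbackAround

variable (E)

/-- A category with chosen pullbacks. -/
class PullbackChoice where
  pb {X Y S : E} (f : X ⟶ S) (g : Y ⟶ S) : ChosenPullback f g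

/-- Chosen distributivity pullbacks around all composable pairs. For a category with pullbacks,
these exist if and only if it is locally cartesian closed. -/
class DistributivityChoice where
  dpb {X A B : E} (u : X ⟶ A) (f : A ⟶ B) : DistributivityPullback u f

end Distributivity

/-! ### Polynomials and their cartesian morphisms -/

/-- A polynomial `I ⟵s pos ⟶p shp ⟶t J`. (In the categories with all distributivity pullbacks
considered here, every `p` is exponentiable.) -/
structure Poly {E : Type u} [Category.{v} E] (I J : E) where
  pos : E
  shp : E
  s : pos ⟶ I
  p : pos ⟶ shp
  t : shp ⟶ J

open PullbackChoice DistributivityChoice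

namespace Poly

variable {E : Type u} [Category.{v} E]

/-- Cartesian morphisms of polynomials. -/
@[ext]
structure Hom {I J : E} (P Q : Poly I J) where
  σ : P.pos ⟶ Q.pos
  ν : P.shp ⟶ Q.shp
  hs : σ ≫ Q.s = P.s
  ht : ν ≫ Q.t = P.t
  cart : IsPullback σ P.p Q.p ν

@[simps id_σ id_ν comp_σ comp_ν]
instance {I J : E} : Category.{v} (Poly I J) where
  Hom := Hom
  id P := ⟨𝟙 _, 𝟙 _, by simp, by simp, IsPullback.of_horiz_isIso ⟨by simp⟩⟩
  comp f g := ⟨f.σ ≫ g.σ, f.ν ≫ g.ν, by simp [g.hs, f.hs], by simp [g.ht, f.ht],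
    f.cart.paste_horiz g.cart⟩

@[ext]
lemma hom_ext {I J : E} {P Q : Poly I J} {f g : P ⟶ Q} (h₁ : f.σ = g.σ) (h₂ : f.ν = g.ν) :
    f = g := Hom.ext h₁ h₂

/-- A factorization of the middle map of a polynomial through an object over `J`. -/
structure Split {I K : E} (X : Poly I K) (J : E) where
  W : E
  k : X.pos ⟶ W
  j : W ⟶ X.shp
  h : W ⟶ J
  fac : k ≫ j = X.p

namespace Split

variable {I J K : E} {X X' X'' : Poly I K}

/-- The left half of a factorization. -/
abbrev left (A : Split X J) : Poly I J := ⟨X.pos, A.W, X.s, A.k, A.h⟩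

/-- The right half of a factorization. -/
abbrev right (A : Split X J) : Poly J K := ⟨A.W, X.shp, A.h, A.j, X.t⟩

/-- Morphisms of factorizations over a cartesian morphism. -/
structure Map (ρ : X ⟶ X') (A : Split X J) (A' : Split X' J) where
  ω : A.W ⟶ A'.W
  hk : A.k ≫ ω = ρ.σ ≫ A'.k
  hh : ω ≫ A'.h = A.h
  cart : IsPullback ω A.j A'.j ρ.ν

namespace Map

variable {ρ : X ⟶ X'} {ρ' : X' ⟶ X''} {A : Split X J} {A' : Split X' J} {A'' : Split X'' J}

abbrev left (m : Map ρ A A') : A.left ⟶ A'.left where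
  σ := ρ.σ
  ν := m.ω
  hs := ρ.hs
  ht := m.hh
  cart := IsPullback.of_bot (by rw [A.fac, A'.fac]; exact ρ.cart) m.hk.symm m.cart

abbrev right (m : Map ρ A A') : A.right ⟶ A'.right where
  σ := m.ω
  ν := ρ.ν
  hs := m.hh
  ht := ρ.ht
  cart := m.cart

abbrev comp (m : Map ρ A A') (m' : Map ρ' A' A'') : Map (ρ ≫ ρ') A A'' where
  ω := m.ω ≫ m'.ω
  hk := by simp [reassoc_of% m.hk, m'.hk]
  hh := by simp [m'.hh, m.hh]
  cart := m.cart.paste_horiz m'.cart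

end Map

end Split

section Comp

variable [PullbackChoice E] [DistributivityChoice E] {I J K : E}

/-- The distributivity pullback used in the composite of `P` and `Q`. -/
abbrev D (P : Poly I J) (Q : Poly J K) : DistributivityPullback (pb P.t Q.s).p₂ Q.p :=
  dpb (pb P.t Q.s).p₂ Q.p

/-- The left pullback used in the composite of `P` and `Q`. -/
abbrev S (P : Poly I J) (Q : Poly J K) : ChosenPullback P.p ((D P Q).p ≫ (pb P.t Q.s).p₁) :=
  pb P.p ((D P Q).p ≫ (pb P.t Q.s).p₁)

/-- Composition of polynomials. -/
abbrev comp (P : Poly I J) (Q : Poly J K) : Poly I K where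
  pos := (S P Q).pullback
  shp := (D P Q).Y
  s := (S P Q).p₁ ≫ P.s
  p := (S P Q).p₂ ≫ (D P Q).q
  t := (D P Q).r ≫ Q.t

/-- The canonical factorization of the composite. -/
abbrev U (P : Poly I J) (Q : Poly J K) : Split (comp P Q) J where
  W := (D P Q).T
  k := (S P Q).p₂
  j := (D P Q).q
  h := ((D P Q).p ≫ (pb P.t Q.s).p₁) ≫ P.t
  fac := rfl

abbrev πl (P : Poly I J) (Q : Poly J K) : (U P Q).left ⟶ P where
  σ := (S P Q).p₁
  ν := (D P Q).p ≫ (pb P.t Q.s).p₁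
  hs := rfl
  ht := rfl
  cart := (S P Q).isPullback

abbrev πr (P : Poly I J) (Q : Poly J K) : (U P Q).right ⟶ Q where
  σ := (D P Q).p ≫ (pb P.t Q.s).p₂
  ν := (D P Q).r
  hs := by simp [(pb P.t Q.s).condition]
  ht := rfl
  cart := (D P Q).isPullback

variable {X : Poly I K} {P P' P'' : Poly I J} {Q Q' Q'' : Poly J K}

section lift

variable (A : Split X J) (a : A.left ⟶ P) (b : A.right ⟶ Q)

lemma exists_pbLift : ∃ z : A.W ⟶ (pb P.t Q.s).pullback,
    z ≫ (pb P.t Q.s).p₁ = a.ν ∧ z ≫ (pb P.t Q.s).p₂ = b.σ :=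
  (pb P.t Q.s).isPullback.exists_lift a.ν b.σ (by rw [a.ht, b.hs])

/-- The pullback around `(Q.p, _)` determined by a factorization. -/
noncomputable abbrev around : PullbackAround (pb P.t Q.s).p₂ Q.p where
  T := A.W
  Y := X.shp
  p := (exists_pbLift A a b).choose
  q := A.j
  r := b.ν
  isPullback := by
    rw [(exists_pbLift A a b).choose_spec.2]; exact b.cart

/-- The map into the distributivity pullback. -/
noncomputable def aroundMap : PullbackAround.Hom (around A a b) (D P Q).toPullbackAround :=
  (D P Q).isTerminal.from (around A a b)

lemma aroundMap_p₁ : (aroundMap A a b).s ≫ (D P Q).p ≫ (pb P.t Q.s).p₁ = a.ν := by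
  rw [reassoc_of% (aroundMap A a b).hp]
  exact (exists_pbLift A a b).choose_spec.1

lemma aroundMap_p₂ : (aroundMap A a b).s ≫ (D P Q).p ≫ (pb P.t Q.s).p₂ = b.σ := by
  rw [reassoc_of% (aroundMap A a b).hp]
  exact (exists_pbLift A a b).choose_spec.2

lemma exists_liftσ : ∃ z : X.pos ⟶ (S P Q).pullback,
    z ≫ (S P Q).p₁ = a.σ ∧ z ≫ (S P Q).p₂ = A.k ≫ (aroundMap A a b).s :=
  (S P Q).isPullback.exists_lift _ _ (by
    rw [a.cart.w, Category.assoc, aroundMap_p₁])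

lemma aroundMap_cart : IsPullback (aroundMap A a b).s A.j (D P Q).q (aroundMap A a b).t := by
  refine IsPullback.of_right ?_ (aroundMap A a b).hq (D P Q).isPullback
  rw [aroundMap_p₂, (aroundMap A a b).hr]
  exact b.cart

/-- The universal property of composition: halves `a`, `b` of a factorization of `X` mapping to
`P` and `Q` induce a cartesian morphism into the composite. -/
noncomputable def lift : X ⟶ comp P Q where
  σ := (exists_liftσ A a b).choose
  ν := (aroundMap A a b).t
  hs := by
    dsimp
    rw [← Category.assoc, (exists_liftσ A a b).choose_spec.1]; exact a.hs
  ht := by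
    dsimp
    rw [← Category.assoc, (aroundMap A a b).hr]; exact b.ht
  cart := by
    have h₁ : IsPullback (exists_liftσ A a b).choose A.k (S P Q).p₂ (aroundMap A a b).s := by
      refine IsPullback.of_right ?_ (exists_liftσ A a b).choose_spec.2 (S P Q).isPullback
      rw [(exists_liftσ A a b).choose_spec.1, aroundMap_p₁]
      exact a.cart
    simpa [A.fac] using h₁.paste_vert (aroundMap_cart A a b)

/-- `g : X ⟶ P;Q` is the morphism induced by the halves `a` and `b`. -/
def Rep (g : X ⟶ comp P Q) : Prop :=
  ∃ m : Split.Map g A (U P Q), m.left ≫ πl P Q = a ∧ m.right ≫ πr P Q = b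

lemma rep_lift : Rep A a b (lift A a b) := by
  refine ⟨⟨(aroundMap A a b).s, (exists_liftσ A a b).choose_spec.2.symm, ?_,
    aroundMap_cart A a b⟩, ?_, ?_⟩
  · dsimp
    rw [← Category.assoc, aroundMap_p₁]
    exact a.ht
  · ext
    · exact (exists_liftσ A a b).choose_spec.1
    · exact aroundMap_p₁ A a b
  · ext
    · exact aroundMap_p₂ A a b
    · exact (aroundMap A a b).hr

variable {A a b}

lemma Rep.unique {g g' : X ⟶ comp P Q} (h : Rep A a b g) (h' : Rep A a b g') : g = g' := by
  obtain ⟨m, h₁, h₂⟩ := h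
  obtain ⟨m', h₁', h₂'⟩ := h'
  have e₁ : m.ω ≫ (D P Q).p ≫ (pb P.t Q.s).p₁ = a.ν := congrArg Hom.ν h₁
  have e₂ : m.ω ≫ (D P Q).p ≫ (pb P.t Q.s).p₂ = b.σ := congrArg Hom.σ h₂
  have e₁' : m'.ω ≫ (D P Q).p ≫ (pb P.t Q.s).p₁ = a.ν := congrArg Hom.ν h₁'
  have e₂' : m'.ω ≫ (D P Q).p ≫ (pb P.t Q.s).p₂ = b.σ := congrArg Hom.σ h₂'
  have hz := (exists_pbLift A a b).choose_spec
  let n : around A a b ⟶ (D P Q).toPullbackAround :=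
    ⟨m.ω, g.ν, (pb P.t Q.s).hom_ext (by simp [e₁, hz.1]) (by simp [e₂, hz.2]), m.cart.w,
      congrArg Hom.ν h₂⟩
  let n' : around A a b ⟶ (D P Q).toPullbackAround :=
    ⟨m'.ω, g'.ν, (pb P.t Q.s).hom_ext (by simp [e₁', hz.1]) (by simp [e₂', hz.2]), m'.cart.w,
      congrArg Hom.ν h₂'⟩
  have hn : n = n' := (D P Q).isTerminal.hom_ext _ _
  have hω : m.ω = m'.ω := congrArg PullbackAround.Hom.s hn
  refine hom_ext ?_ ?_
  · refine (S P Q).hom_ext ?_ ?_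
    · exact (congrArg Hom.σ h₁).trans (congrArg Hom.σ h₁').symm
    · exact m.hk.symm.trans ((by rw [hω] : A.k ≫ m.ω = A.k ≫ m'.ω).trans m'.hk)
  · exact congrArg PullbackAround.Hom.t hn

end lift

lemma eq_lift {A : Split X J} {a : A.left ⟶ P} {b : A.right ⟶ Q} {g : X ⟶ comp P Q}
    (m : Split.Map g A (U P Q)) (ha : m.left ≫ πl P Q = a) (hb : m.right ≫ πr P Q = b) :
    g = lift A a b :=
  Rep.unique ⟨m, ha, hb⟩ (rep_lift A a b)

lemma id_eq_lift (P : Poly I J) (Q : Poly J K) :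
    𝟙 (comp P Q) = lift (U P Q) (πl P Q) (πr P Q) :=
  eq_lift ⟨𝟙 _, by simp, by simp, IsPullback.id_horiz _⟩ (by ext <;> simp) (by ext <;> simp)

lemma comp_lift {X' : Poly I K} {A : Split X J} {A' : Split X' J} {ρ : X ⟶ X'}
    (m : Split.Map ρ A A') (a : A'.left ⟶ P) (b : A'.right ⟶ Q) :
    ρ ≫ lift A' a b = lift A (m.left ≫ a) (m.right ≫ b) := by
  obtain ⟨n, h₁, h₂⟩ := rep_lift A' a b
  exact eq_lift (m.comp n)
    ((by ext <;> simp : _ = m.left ≫ n.left ≫ πl P Q).trans (congrArg (m.left ≫ ·) h₁))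
    ((by ext <;> simp : _ = m.right ≫ n.right ≫ πr P Q).trans (congrArg (m.right ≫ ·) h₂))

lemma exists_eq_lift (g : X ⟶ comp P Q) : ∃ A a b, g = lift (P := P) (Q := Q) A a b := by
  have hW := (pb g.ν (D P Q).q).isPullback.flip
  obtain ⟨z, hz₁, hz₂⟩ := hW.exists_lift (g.σ ≫ (S P Q).p₂) X.p (by
    simpa using g.cart.w)
  exact ⟨⟨_, z, (pb g.ν (D P Q).q).p₁, (pb g.ν (D P Q).q).p₂ ≫ (U P Q).h, hz₂⟩, _, _,
    eq_lift ⟨_, hz₁, rfl, hW⟩ rfl rfl⟩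

/-- If a composite is induced by a factorization, so is its restriction, compatibly. -/
lemma exists_map_of_comp_eq_lift {X' : Poly I K} {A : Split X J} {A' : Split X' J} {ρ : X ⟶ X'}
    {a : A.left ⟶ P} {b : A.right ⟶ Q} {a' : A'.left ⟶ P} {b' : A'.right ⟶ Q}
    (h : ρ ≫ lift A' a' b' = lift A a b) :
    ∃ m : Split.Map ρ A A', m.left ≫ a' = a ∧ m.right ≫ b' = b := by
  obtain ⟨n', h₁', h₂'⟩ := rep_lift A' a' b'
  obtain ⟨n, h₁, h₂⟩ := rep_lift A a b
  have hν : (lift A a b).ν = ρ.ν ≫ (lift A' a' b').ν := by rw [← h]; rfl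
  have hσ : (lift A a b).σ = ρ.σ ≫ (lift A' a' b').σ := by rw [← h]; rfl
  obtain ⟨ω, hω₁, hω₂⟩ := n'.cart.exists_lift n.ω (A.j ≫ ρ.ν) (by
    rw [n.cart.w, hν, Category.assoc])
  have hk : A.k ≫ ω = ρ.σ ≫ A'.k := n'.cart.hom_ext
    (by rw [Category.assoc, hω₁, n.hk, hσ, Category.assoc, Category.assoc, n'.hk])
    (by rw [Category.assoc, hω₂, Category.assoc, A'.fac, ← Category.assoc, A.fac, ρ.cart.w])
  refine ⟨⟨ω, hk, by rw [← n'.hh, ← Category.assoc, hω₁, n.hh], ?_⟩, ?_, ?_⟩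
  · refine IsPullback.of_right ?_ hω₂ n'.cart
    rw [hω₁, ← hν]
    exact n.cart
  · refine (congrArg (_ ≫ ·) h₁'.symm).trans (Eq.trans ?_ h₁)
    ext
    · simp [hσ]
    · simp [reassoc_of% hω₁]
  · refine (congrArg (_ ≫ ·) h₂'.symm).trans (Eq.trans ?_ h₂)
    ext
    · simp [reassoc_of% hω₁]
    · simp [hν]

/-- Horizontal composition of cartesian morphisms. -/
noncomputable def hcomp (f : P ⟶ P') (g : Q ⟶ Q') : comp P Q ⟶ comp P' Q' :=
  lift (U P Q) (πl P Q ≫ f) (πr P Q ≫ g)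

lemma lift_hcomp (A : Split X J) (a : A.left ⟶ P) (b : A.right ⟶ Q) (f : P ⟶ P')
    (f' : Q ⟶ Q') : lift A a b ≫ hcomp f f' = lift A (a ≫ f) (b ≫ f') := by
  obtain ⟨n, h₁, h₂⟩ := rep_lift A a b
  rw [hcomp, comp_lift n, ← Category.assoc, ← Category.assoc, h₁, h₂]

lemma hcomp_id (P : Poly I J) (Q : Poly J K) : hcomp (𝟙 P) (𝟙 Q) = 𝟙 _ := by
  rw [hcomp, Category.comp_id, Category.comp_id, ← id_eq_lift]

lemma hcomp_comp (f : P ⟶ P') (f' : P' ⟶ P'') (g : Q ⟶ Q') (g' : Q' ⟶ Q'') :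
    hcomp f g ≫ hcomp f' g' = hcomp (f ≫ f') (g ≫ g') := by
  rw [hcomp, lift_hcomp, hcomp, Category.assoc, Category.assoc]

/-! #### Unitors -/

/-- The identity polynomial. -/
abbrev one (I : E) : Poly I I := ⟨I, I, 𝟙 I, 𝟙 I, 𝟙 I⟩

instance (X : Poly I I) : Subsingleton (X ⟶ one I) where
  allEq f g := by
    ext
    · simpa using f.hs.trans g.hs.symm
    · simpa using f.ht.trans g.ht.symm

abbrev splitL (P : Poly I J) : Split P I := ⟨P.pos, 𝟙 _, P.p, P.s, by simp⟩

abbrev splitR (P : Poly I J) : Split P J := ⟨P.shp, P.p, 𝟙 _, P.t, by simp⟩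

abbrev εl (P : Poly I J) : (splitL P).left ⟶ one I :=
  ⟨P.s, P.s, by simp, by simp, IsPullback.of_vert_isIso ⟨by simp⟩⟩

abbrev εr (P : Poly I J) : (splitR P).right ⟶ one J :=
  ⟨P.t, P.t, by simp, by simp, IsPullback.of_vert_isIso ⟨by simp⟩⟩

noncomputable def lInv (P : Poly I J) : P ⟶ comp (one I) P := lift (splitL P) (εl P) (𝟙 P)

noncomputable def rInv (P : Poly I J) : P ⟶ comp P (one J) := lift (splitR P) (𝟙 P) (εr P)

lemma comp_lInv (f : P ⟶ P') : f ≫ lInv P' = lift (splitL P) (εl P) f := by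
  rw [lInv, comp_lift (A := splitL P) ⟨f.σ, by simp, f.hs, f.cart⟩]
  congr 1
  · exact Subsingleton.elim _ _
  · exact Category.comp_id f

lemma comp_rInv (f : P ⟶ P') : f ≫ rInv P' = lift (splitR P) f (εr P) := by
  rw [rInv, comp_lift (A := splitR P) ⟨f.ν, f.cart.w.symm, f.ht, IsPullback.of_vert_isIso ⟨by simp⟩⟩]
  congr 1
  · exact Category.comp_id f
  · exact Subsingleton.elim _ _

lemma isIso_k {A : Split X I} (a : A.left ⟶ one I) : IsIso A.k :=
  a.cart.isIso_snd_of_isIso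

lemma isIso_j {A : Split X K} (b : A.right ⟶ one K) : IsIso A.j :=
  b.cart.isIso_snd_of_isIso

/-- If the left half of a factorization is trivial, the right half is everything. -/
noncomputable abbrev collapseL {A : Split X I} (a : A.left ⟶ one I) : X ⟶ A.right :=
  haveI := isIso_k a
  ⟨A.k, 𝟙 _, by
    have h₁ : a.σ = X.s := by simpa using a.hs
    have h₂ : a.ν = A.h := by simpa using a.ht
    have h₃ := a.cart.w
    simp only [Category.comp_id] at h₃
    change A.k ≫ A.h = X.s
    rw [← h₁, ← h₂, h₃], by simp, IsPullback.of_horiz_isIso ⟨by simp [A.fac]⟩⟩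

noncomputable abbrev collapseR {A : Split X K} (b : A.right ⟶ one K) : X ⟶ A.left :=
  haveI := isIso_j b
  ⟨𝟙 _, inv A.j, by simp, by
    have h₁ : b.σ = A.h := by simpa using b.hs
    have h₂ : b.ν = X.t := by simpa using b.ht
    have h₃ := b.cart.w
    simp only [Category.comp_id] at h₃
    change inv A.j ≫ A.h = X.t
    rw [← h₁, ← h₂, IsIso.inv_comp_eq, h₃], IsPullback.of_horiz_isIso ⟨by
      simp [← A.fac]⟩⟩

noncomputable def lHom (P : Poly I J) : comp (one I) P ⟶ P :=
  collapseL (πl (one I) P) ≫ πr (one I) P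

noncomputable def rHom (P : Poly I J) : comp P (one J) ⟶ P :=
  collapseR (πr P (one J)) ≫ πl P (one J)

lemma lInv_lHom (P : Poly I J) : lInv P ≫ lHom P = 𝟙 P := by
  obtain ⟨n, h₁, h₂⟩ := rep_lift (splitL P) (εl P) (𝟙 P)
  rw [lHom, ← Category.assoc]
  refine Eq.trans ?_ h₂
  congr 1
  ext
  · have := n.hk
    simpa [lInv] using this.symm
  · simp [lInv]

lemma rInv_rHom (P : Poly I J) : rInv P ≫ rHom P = 𝟙 P := by
  obtain ⟨n, h₁, h₂⟩ := rep_lift (splitR P) (𝟙 P) (εr P)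
  have := isIso_j (πr P (one J))
  rw [rHom, ← Category.assoc]
  refine Eq.trans ?_ h₁
  congr 1
  refine hom_ext (Category.comp_id _) ?_
  have h := n.cart.w
  simp only [Category.id_comp] at h
  change (lift _ _ _).ν ≫ inv (U P (one J)).j = n.ω
  rw [IsIso.comp_inv_eq]
  exact h.symm

lemma lHom_lInv (P : Poly I J) : lHom P ≫ lInv P = 𝟙 _ := by
  rw [lInv, comp_lift (A := U (one I) P) ⟨(πr (one I) P).σ, (Category.comp_id _).symm,
    (πr (one I) P).hs, by
      have := (πr (one I) P).cart
      simpa [lHom] using this⟩, id_eq_lift]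
  congr 1
  · exact Subsingleton.elim _ _
  · rw [Category.comp_id]
    exact hom_ext rfl (Category.id_comp _)

lemma rHom_rInv (P : Poly I J) : rHom P ≫ rInv P = 𝟙 _ := by
  have := isIso_j (πr P (one J))
  rw [rInv, comp_lift (A := U P (one J)) ⟨(πl P (one J)).ν, by
      have := (πl P (one J)).cart.w
      simpa [rHom] using this.symm,
    (πl P (one J)).ht, IsPullback.of_vert_isIso ⟨by simp [rHom]⟩⟩, id_eq_lift]
  congr 1
  · rw [Category.comp_id]
    exact hom_ext (Category.id_comp _) rfl
  · exact Subsingleton.elim _ _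

end Comp

/-! #### Associators -/

/-- A factorization of the middle map of a polynomial into three maps. -/
structure Split3 {I L : E} (X : Poly I L) (J K : E) where
  W₁ : E
  W₂ : E
  k : X.pos ⟶ W₁
  i : W₁ ⟶ W₂
  j : W₂ ⟶ X.shp
  h₁ : W₁ ⟶ J
  h₂ : W₂ ⟶ K
  ki : X.pos ⟶ W₂
  ij : W₁ ⟶ X.shp
  k_i : k ≫ i = ki
  i_j : i ≫ j = ij
  fac : ki ≫ j = X.p

namespace Split3

variable {I J K L : E} {X : Poly I L}

abbrev A (s : Split3 X J K) : Split X K := ⟨s.W₂, s.ki, s.j, s.h₂, s.fac⟩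

abbrev A₁ (s : Split3 X J K) : Split s.A.left J := ⟨s.W₁, s.k, s.i, s.h₁, s.k_i⟩

abbrev B (s : Split3 X J K) : Split X J :=
  ⟨s.W₁, s.k, s.ij, s.h₁, by rw [← s.i_j, ← Category.assoc, s.k_i, s.fac]⟩

abbrev B₁ (s : Split3 X J K) : Split s.B.right K := ⟨s.W₂, s.i, s.j, s.h₂, s.i_j⟩

abbrev ofA (A : Split X K) (A₁ : Split A.left J) : Split3 X J K :=
  ⟨A₁.W, A.W, A₁.k, A₁.j, A.j, A₁.h, A.h, A.k, A₁.j ≫ A.j, A₁.fac, rfl, A.fac⟩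

abbrev ofB (B : Split X J) (B₁ : Split B.right K) : Split3 X J K :=
  ⟨B.W, B₁.W, B.k, B₁.k, B₁.j, B.h, B₁.h, B.k ≫ B₁.k, B.j, rfl, B₁.fac,
    by rw [Category.assoc, B₁.fac]; exact B.fac⟩

end Split3

section Assoc

variable [PullbackChoice E] [DistributivityChoice E] {I J K L : E}

lemma exists_id_eq_lift_left (P : Poly I J) (Q : Poly J K) (R : Poly K L) :
    ∃ (s : Split3 (comp (comp P Q) R) J K) (a : s.A₁.left ⟶ P) (b : s.A₁.right ⟶ Q)
      (c : s.A.right ⟶ R), 𝟙 _ = lift s.A (lift s.A₁ a b) c := by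
  obtain ⟨A₁, a, b, h⟩ := exists_eq_lift (πl (comp P Q) R)
  refine ⟨.ofA (U (comp P Q) R) A₁, a, b, πr _ _, ?_⟩
  rw [id_eq_lift, h]

lemma exists_id_eq_lift_right (P : Poly I J) (Q : Poly J K) (R : Poly K L) :
    ∃ (s : Split3 (comp P (comp Q R)) J K) (a : s.B.left ⟶ P) (b : s.B₁.left ⟶ Q)
      (c : s.B₁.right ⟶ R), 𝟙 _ = lift s.B a (lift s.B₁ b c) := by
  obtain ⟨B₁, b, c, h⟩ := exists_eq_lift (πr P (comp Q R))
  refine ⟨.ofB (U P (comp Q R)) B₁, πl _ _, b, c, ?_⟩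
  rw [id_eq_lift, h]

noncomputable def αHom (P : Poly I J) (Q : Poly J K) (R : Poly K L) :
    comp (comp P Q) R ⟶ comp P (comp Q R) :=
  lift (exists_id_eq_lift_left P Q R).choose.B
    (exists_id_eq_lift_left P Q R).choose_spec.choose
    (lift (exists_id_eq_lift_left P Q R).choose.B₁
      (exists_id_eq_lift_left P Q R).choose_spec.choose_spec.choose
      (exists_id_eq_lift_left P Q R).choose_spec.choose_spec.choose_spec.choose)

noncomputable def αInv (P : Poly I J) (Q : Poly J K) (R : Poly K L) :
    comp P (comp Q R) ⟶ comp (comp P Q) R :=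
  lift (exists_id_eq_lift_right P Q R).choose.A
    (lift (exists_id_eq_lift_right P Q R).choose.A₁
      (exists_id_eq_lift_right P Q R).choose_spec.choose
      (exists_id_eq_lift_right P Q R).choose_spec.choose_spec.choose)
    (exists_id_eq_lift_right P Q R).choose_spec.choose_spec.choose_spec.choose

variable {X X' : Poly I L} {P P' : Poly I J} {Q Q' : Poly J K} {R R' : Poly K L}

lemma comp_lift_right_of_left {s : Split3 X J K} {s' : Split3 X' J K} {g : X ⟶ X'}
    {a : s.A₁.left ⟶ P} {b : s.A₁.right ⟶ Q} {c : s.A.right ⟶ R}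
    {a' : s'.A₁.left ⟶ P} {b' : s'.A₁.right ⟶ Q} {c' : s'.A.right ⟶ R}
    (h : g ≫ lift s'.A (lift s'.A₁ a' b') c' = lift s.A (lift s.A₁ a b) c) :
    g ≫ lift s'.B a' (lift s'.B₁ b' c') = lift s.B a (lift s.B₁ b c) := by
  obtain ⟨n, h₁, h₂⟩ := exists_map_of_comp_eq_lift h
  obtain ⟨m, h₃, h₄⟩ := exists_map_of_comp_eq_lift h₁
  rw [comp_lift (A := s.B) ⟨m.ω, m.hk, m.hh, by
    have := m.cart.paste_vert n.cart
    simpa [s.i_j, s'.i_j] using this⟩, comp_lift (A := s.B₁) ⟨n.ω, m.cart.w.symm, n.hh, n.cart⟩]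
  congr 1
  · exact congrArg₂ (lift _) h₄ h₂

lemma comp_lift_left_of_right {s : Split3 X J K} {s' : Split3 X' J K} {g : X ⟶ X'}
    {a : s.A₁.left ⟶ P} {b : s.A₁.right ⟶ Q} {c : s.A.right ⟶ R}
    {a' : s'.A₁.left ⟶ P} {b' : s'.A₁.right ⟶ Q} {c' : s'.A.right ⟶ R}
    (h : g ≫ lift s'.B a' (lift s'.B₁ b' c') = lift s.B a (lift s.B₁ b c)) :
    g ≫ lift s'.A (lift s'.A₁ a' b') c' = lift s.A (lift s.A₁ a b) c := by
  obtain ⟨n, h₁, h₂⟩ := exists_map_of_comp_eq_lift h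
  obtain ⟨m, h₃, h₄⟩ := exists_map_of_comp_eq_lift h₂
  rw [comp_lift (A := s.A) ⟨m.ω, by
    have h₅ := n.hk
    have h₆ := m.hk
    dsimp at h₅ h₆ ⊢
    rw [← s.k_i, ← s'.k_i, Category.assoc, h₆, reassoc_of% h₅], m.hh, m.cart⟩,
    comp_lift (A := s.A₁) ⟨n.ω, n.hk, n.hh,
      IsPullback.of_bot (by simpa [s.i_j, s'.i_j] using n.cart) m.hk.symm m.cart⟩]
  congr 1
  · exact congrArg₂ (lift _) h₁ h₃

lemma lift_αHom (s : Split3 X J K) (a : s.A₁.left ⟶ P) (b : s.A₁.right ⟶ Q)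
    (c : s.A.right ⟶ R) :
    lift s.A (lift s.A₁ a b) c ≫ αHom P Q R = lift s.B a (lift s.B₁ b c) := by
  refine comp_lift_right_of_left ?_
  rw [← (exists_id_eq_lift_left P Q R).choose_spec.choose_spec.choose_spec.choose_spec,
    Category.comp_id]

lemma lift_αInv (s : Split3 X J K) (a : s.A₁.left ⟶ P) (b : s.A₁.right ⟶ Q)
    (c : s.A.right ⟶ R) :
    lift s.B a (lift s.B₁ b c) ≫ αInv P Q R = lift s.A (lift s.A₁ a b) c := by
  refine comp_lift_left_of_right ?_
  rw [← (exists_id_eq_lift_right P Q R).choose_spec.choose_spec.choose_spec.choose_spec,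
    Category.comp_id]

lemma αHom_αInv (P : Poly I J) (Q : Poly J K) (R : Poly K L) :
    αHom P Q R ≫ αInv P Q R = 𝟙 _ := by
  obtain ⟨s, a, b, c, h⟩ := exists_id_eq_lift_left P Q R
  rw [← Category.id_comp (αHom P Q R), h, lift_αHom, lift_αInv]

lemma αInv_αHom (P : Poly I J) (Q : Poly J K) (R : Poly K L) :
    αInv P Q R ≫ αHom P Q R = 𝟙 _ := by
  obtain ⟨s, a, b, c, h⟩ := exists_id_eq_lift_right P Q R
  rw [← Category.id_comp (αInv P Q R), h, lift_αInv, lift_αHom]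

lemma αHom_naturality (f : P ⟶ P') (g : Q ⟶ Q') (h : R ⟶ R') :
    hcomp (hcomp f g) h ≫ αHom P' Q' R' = αHom P Q R ≫ hcomp f (hcomp g h) := by
  obtain ⟨s, a, b, c, e⟩ := exists_id_eq_lift_left P Q R
  rw [← Category.id_comp (αHom P Q R), ← Category.id_comp (hcomp (hcomp f g) h), e, lift_αHom,
    lift_hcomp, lift_hcomp, lift_αHom, lift_hcomp, lift_hcomp]

lemma triangle (P : Poly I J) (Q : Poly J K) :
    hcomp (rInv P) (𝟙 Q) ≫ αHom P (one J) Q = hcomp (𝟙 P) (lInv Q) := by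
  let s : Split3 (comp P Q) J J := ⟨_, _, (U P Q).k, 𝟙 _, (U P Q).j, (U P Q).h, (U P Q).h,
    (U P Q).k, (U P Q).j, by simp, by simp, rfl⟩
  rw [hcomp, hcomp, comp_rInv, comp_lInv, Category.comp_id, Category.comp_id]
  exact lift_αHom s _ (εr (U P Q).left) _

lemma pentagon {M : E} (P : Poly I J) (Q : Poly J K) (R : Poly K L) (T : Poly L M) :
    hcomp (αHom P Q R) (𝟙 T) ≫ αHom P (comp Q R) T ≫ hcomp (𝟙 P) (αHom Q R T) =
      αHom (comp P Q) R T ≫ αHom P Q (comp R T) := by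
  obtain ⟨s, x, c, d, e⟩ := exists_id_eq_lift_left (comp P Q) R T
  obtain ⟨A₂, a, b, rfl⟩ := exists_eq_lift x
  let s₁ : Split3 s.A.left J K := .ofA s.A₁ A₂
  let s₂ : Split3 (comp (comp (comp P Q) R) T) J L := .ofA s.A s₁.B
  let s₃ : Split3 s₂.B.right K L :=
    ⟨s.W₁, s.W₂, A₂.j, s.i, s.j, s.h₁, s.h₂, A₂.j ≫ s.i, s.ij, rfl, s.i_j, rfl⟩
  let t₂ : Split3 (comp (comp (comp P Q) R) T) J K :=
    ⟨A₂.W, s.W₁, A₂.k, A₂.j, s.ij, A₂.h, s.h₁, s.k, (A₂.j ≫ s.i) ≫ s.j, A₂.fac,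
      by rw [Category.assoc, s.i_j], s.B.fac⟩
  rw [← Category.id_comp (hcomp (αHom P Q R) (𝟙 T)), ← Category.id_comp (αHom (comp P Q) R T),
    e, Category.assoc, Category.assoc, ← Category.assoc _ (αHom (comp P Q) R T), lift_αHom,
    ← Category.assoc _ (hcomp (αHom P Q R) (𝟙 T)), lift_hcomp]
  have e₁ : lift s.A₁ (lift A₂ a b) c ≫ αHom P Q R = lift s₁.B a (lift s₁.B₁ b c) :=
    lift_αHom s₁ _ _ _
  have e₂ : lift s.A (lift s₁.B a (lift s₁.B₁ b c)) d ≫ αHom P (comp Q R) T =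
      lift s₂.B a (lift s₂.B₁ (lift s₁.B₁ b c) d) := lift_αHom s₂ _ _ _
  have e₃ : lift s₂.B₁ (lift s₁.B₁ b c) d ≫ αHom Q R T = lift s₃.B b (lift s₃.B₁ c d) :=
    lift_αHom s₃ _ _ _
  have e₄ : lift s.B (lift A₂ a b) (lift s.B₁ c d) ≫ αHom P Q (comp R T) =
      lift t₂.B a (lift t₂.B₁ b (lift s.B₁ c d)) := lift_αHom t₂ _ _ _
  rw [e₁, Category.comp_id, ← Category.assoc, e₂, lift_hcomp, e₃, Category.comp_id, e₄]

end Assoc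

end Poly

/-- The objects of the bicategory of polynomials and cartesian morphisms. -/
structure PolyC (E : Type u) where
  as : E

namespace PolyC

variable {E : Type u} [Category.{v} E] [PullbackChoice E] [DistributivityChoice E]

open PolyCart.Poly

noncomputable instance : Bicategory.{v, max u v} (PolyC E) where
  Hom I J := Poly I.as J.as
  id I := one I.as
  comp P Q := Poly.comp P Q
  whiskerLeft P _ _ η := hcomp (𝟙 P) η
  whiskerRight η Q := hcomp η (𝟙 Q)
  associator P Q R := ⟨αHom P Q R, αInv P Q R, αHom_αInv P Q R, αInv_αHom P Q R⟩
  leftUnitor P := ⟨lHom P, lInv P, lHom_lInv P, lInv_lHom P⟩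
  rightUnitor P := ⟨rHom P, rInv P, rHom_rInv P, rInv_rHom P⟩
  whiskerLeft_id P Q := hcomp_id P Q
  whiskerLeft_comp P _ _ _ η θ := by rw [hcomp_comp, Category.comp_id]
  id_whiskerLeft {_ _ P Q} η := by
    change _ = lHom P ≫ η ≫ lInv Q
    rw [comp_lInv, ← Category.id_comp (hcomp _ _), ← lHom_lInv, Category.assoc]
    congr 1
    rw [lInv, lift_hcomp, Category.comp_id, Category.id_comp]
  comp_whiskerLeft P Q _ _ η := by
    change _ = αHom _ _ _ ≫ _ ≫ αInv _ _ _
    rw [← Category.assoc, ← αHom_naturality, Category.assoc, αHom_αInv, Category.comp_id, hcomp_id]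
  id_whiskerRight P Q := hcomp_id P Q
  comp_whiskerRight η θ Q := by rw [hcomp_comp, Category.comp_id]
  whiskerRight_id {_ _ P Q} η := by
    change _ = rHom P ≫ η ≫ rInv Q
    rw [comp_rInv, ← Category.id_comp (hcomp _ _), ← rHom_rInv, Category.assoc]
    congr 1
    rw [rInv, lift_hcomp, Category.comp_id, Category.id_comp]
  whiskerRight_comp η Q R := by
    change _ = αInv _ _ _ ≫ _ ≫ αHom _ _ _
    rw [αHom_naturality, ← Category.assoc, αInv_αHom, Category.id_comp, hcomp_id]
  whisker_assoc P _ _ η R := by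
    change _ = αHom _ _ _ ≫ _ ≫ αInv _ _ _
    rw [← Category.assoc, ← αHom_naturality, Category.assoc, αHom_αInv, Category.comp_id]
  whisker_exchange η θ := by
    simp only [hcomp_comp, Category.comp_id, Category.id_comp]
  pentagon P Q R T := Poly.pentagon P Q R T
  triangle P Q := by
    change αHom _ _ _ ≫ hcomp (𝟙 P) (lHom Q) = hcomp (rHom P) (𝟙 Q)
    rw [← Category.id_comp (αHom P _ Q), ← hcomp_id, ← rHom_rInv P]
    conv_lhs => rw [← Category.comp_id (𝟙 Q), ← hcomp_comp]
    rw [Category.assoc (hcomp (rHom P) (𝟙 Q)), Poly.triangle, Category.assoc, hcomp_comp, lInv_lHom,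
      Category.comp_id, hcomp_id]
    exact Category.comp_id _

end PolyC

end PolyCart

namespace PolyCart

open PullbackChoice DistributivityChoice

/-! ### Spans -/

section

variable {E : Type u} [Category.{v} E] {X Y S T : E} {f : X ⟶ S} {g : Y ⟶ S}

/-- The map into a chosen pullback. -/
noncomputable def pbLift (h : ChosenPullback f g) (a : T ⟶ X) (b : T ⟶ Y) (w : a ≫ f = b ≫ g) :
    T ⟶ h.pullback := h.isPullback.lift a b w

@[simp]
lemma pbLift_p₁ (h : ChosenPullback f g) (a : T ⟶ X) (b : T ⟶ Y) (w : a ≫ f = b ≫ g) :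
    pbLift h a b w ≫ h.p₁ = a := by simp [pbLift]

@[simp]
lemma pbLift_p₁_assoc (h : ChosenPullback f g) (a : T ⟶ X) (b : T ⟶ Y) (w : a ≫ f = b ≫ g)
    {Z : E} (k : _ ⟶ Z) : pbLift h a b w ≫ h.p₁ ≫ k = a ≫ k := by simp [pbLift]

@[simp]
lemma pbLift_p₂ (h : ChosenPullback f g) (a : T ⟶ X) (b : T ⟶ Y) (w : a ≫ f = b ≫ g) :
    pbLift h a b w ≫ h.p₂ = b := by simp [pbLift]

@[simp]
lemma pbLift_p₂_assoc (h : ChosenPullback f g) (a : T ⟶ X) (b : T ⟶ Y) (w : a ≫ f = b ≫ g)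
    {Z : E} (k : _ ⟶ Z) : pbLift h a b w ≫ h.p₂ ≫ k = b ≫ k := by simp [pbLift]

end

/-- A span `I ⟵l apex ⟶r J`. -/
structure Sp {E : Type u} [Category.{v} E] (I J : E) where
  apex : E
  l : apex ⟶ I
  r : apex ⟶ J

namespace Sp

variable {E : Type u} [Category.{v} E]

/-- Morphisms of spans. -/
@[ext]
structure Hom {I J : E} (S T : Sp I J) where
  hom : S.apex ⟶ T.apex
  hl : hom ≫ T.l = S.l
  hr : hom ≫ T.r = S.r

@[simps id_hom comp_hom]
instance {I J : E} : Category.{v} (Sp I J) where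
  Hom := Hom
  id S := ⟨𝟙 _, by simp, by simp⟩
  comp f g := ⟨f.hom ≫ g.hom, by simp [g.hl, f.hl], by simp [g.hr, f.hr]⟩

@[ext]
lemma hom_ext {I J : E} {S T : Sp I J} {f g : S ⟶ T} (h : f.hom = g.hom) : f = g := Hom.ext h

variable [PullbackChoice E] {I J K : E}

/-- Composition of spans. -/
abbrev comp (S : Sp I J) (T : Sp J K) : Sp I K :=
  ⟨(pb S.r T.l).pullback, (pb S.r T.l).p₁ ≫ S.l, (pb S.r T.l).p₂ ≫ T.r⟩

/-- The identity span. -/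
abbrev one (I : E) : Sp I I := ⟨I, 𝟙 I, 𝟙 I⟩

lemma comp_ext {X : Sp I K} {S : Sp I J} {T : Sp J K} {f g : X ⟶ comp S T}
    (h₁ : f.hom ≫ (pb S.r T.l).p₁ = g.hom ≫ (pb S.r T.l).p₁)
    (h₂ : f.hom ≫ (pb S.r T.l).p₂ = g.hom ≫ (pb S.r T.l).p₂) : f = g :=
  Hom.ext ((pb S.r T.l).hom_ext h₁ h₂)

noncomputable def hcomp {S S' : Sp I J} {T T' : Sp J K} (f : S ⟶ S') (g : T ⟶ T') :
    comp S T ⟶ comp S' T' where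
  hom := pbLift _ ((pb S.r T.l).p₁ ≫ f.hom) ((pb S.r T.l).p₂ ≫ g.hom)
    (by simp only [Category.assoc, f.hr, g.hl, (pb S.r T.l).condition])
  hl := by simp [f.hl]
  hr := by simp [g.hr]

noncomputable def assoc {L : E} (S : Sp I J) (T : Sp J K) (R : Sp K L) :
    comp (comp S T) R ≅ comp S (comp T R) where
  hom :=
    { hom := pbLift _ ((pb (comp S T).r R.l).p₁ ≫ (pb S.r T.l).p₁)
        (pbLift _ ((pb (comp S T).r R.l).p₁ ≫ (pb S.r T.l).p₂) (pb (comp S T).r R.l).p₂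
          (by simpa using (pb (comp S T).r R.l).condition))
        (by simp only [Category.assoc, (pb S.r T.l).condition, pbLift_p₁_assoc])
      hl := by simp
      hr := by simp }
  inv :=
    { hom := pbLift _
        (pbLift _ (pb S.r (comp T R).l).p₁ ((pb S.r (comp T R).l).p₂ ≫ (pb T.r R.l).p₁)
          (by simpa using (pb S.r (comp T R).l).condition))
        ((pb S.r (comp T R).l).p₂ ≫ (pb T.r R.l).p₂)
        (by simp only [Category.assoc, (pb T.r R.l).condition, pbLift_p₂_assoc])
      hl := by simp
      hr := by simp }
  hom_inv_id := comp_ext (by apply ChosenPullback.hom_ext <;> simp) (by simp)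
  inv_hom_id := comp_ext (by simp) (by apply ChosenPullback.hom_ext <;> simp)

noncomputable def leftUnit (S : Sp I J) : comp (one I) S ≅ S where
  hom := ⟨(pb (𝟙 I) S.l).p₂, by simp only [← (pb (𝟙 I) S.l).condition], by simp⟩
  inv := ⟨pbLift _ S.l (𝟙 _) (by simp), by simp, by simp⟩
  hom_inv_id := comp_ext (by simpa using (pb (𝟙 I) S.l).condition.symm) (by simp)
  inv_hom_id := by ext; simp

noncomputable def rightUnit (S : Sp I J) : comp S (one J) ≅ S where
  hom := ⟨(pb S.r (𝟙 J)).p₁, by simp, by simp only [(pb S.r (𝟙 J)).condition]⟩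
  inv := ⟨pbLift _ (𝟙 _) S.r (by simp), by simp, by simp⟩
  hom_inv_id := comp_ext (by simp) (by simpa using (pb S.r (𝟙 J)).condition)
  inv_hom_id := by ext; simp

end Sp

/-- The objects of the bicategory of spans. -/
structure SpanC (E : Type u) where
  as : E

namespace SpanC

variable {E : Type u} [Category.{v} E] [PullbackChoice E]

noncomputable instance : Bicategory.{v, max u v} (SpanC E) where
  Hom I J := Sp I.as J.as
  id I := Sp.one I.as
  comp S T := Sp.comp S T
  whiskerLeft S _ _ η := Sp.hcomp (𝟙 S) η
  whiskerRight η T := Sp.hcomp η (𝟙 T)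
  associator := Sp.assoc
  leftUnitor := Sp.leftUnit
  rightUnitor := Sp.rightUnit
  whiskerLeft_id _ _ := by apply Sp.comp_ext <;> simp [Sp.hcomp]
  whiskerLeft_comp _ _ _ _ _ _ := by apply Sp.comp_ext <;> simp [Sp.hcomp]
  id_whiskerLeft {_ _ S _} η := by
    apply Sp.comp_ext
    · have := (pb (𝟙 _) S.l).condition
      simp only [Category.comp_id] at this
      simp [Sp.hcomp, Sp.leftUnit, η.hl, this]
    · simp [Sp.hcomp, Sp.leftUnit]
  comp_whiskerLeft S T _ _ η := by
    apply Sp.comp_ext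
    · apply ChosenPullback.hom_ext <;> simp [Sp.hcomp, Sp.assoc]
    · simp [Sp.hcomp, Sp.assoc]
  id_whiskerRight _ _ := by apply Sp.comp_ext <;> simp [Sp.hcomp]
  comp_whiskerRight _ _ _ := by apply Sp.comp_ext <;> simp [Sp.hcomp]
  whiskerRight_id {_ _ S _} η := by
    apply Sp.comp_ext
    · simp [Sp.hcomp, Sp.rightUnit]
    · have := (pb S.r (𝟙 _)).condition
      simp only [Category.comp_id] at this
      simp [Sp.hcomp, Sp.rightUnit, η.hr, this]
  whiskerRight_comp η T R := by
    apply Sp.comp_ext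
    · simp [Sp.hcomp, Sp.assoc]
    · apply ChosenPullback.hom_ext <;> simp [Sp.hcomp, Sp.assoc]
  whisker_assoc S _ _ η R := by
    apply Sp.comp_ext
    · apply ChosenPullback.hom_ext <;> simp [Sp.hcomp, Sp.assoc]
    · simp [Sp.hcomp, Sp.assoc]
  whisker_exchange η θ := by apply Sp.comp_ext <;> simp [Sp.hcomp]
  pentagon S T R Q := by
    apply Sp.comp_ext
    · simp [Sp.hcomp, Sp.assoc]
    · apply ChosenPullback.hom_ext
      · simp [Sp.hcomp, Sp.assoc]
      · apply ChosenPullback.hom_ext <;> simp [Sp.hcomp, Sp.assoc]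
  triangle S T := by
    apply Sp.comp_ext <;> simp [Sp.hcomp, Sp.assoc, Sp.leftUnit, Sp.rightUnit]

end SpanC

end PolyCart

namespace PolyCart

open PullbackChoice DistributivityChoice

/-! ### The embeddings -/

section Embeddings

variable {E : Type u} [Category.{v} E]

lemma Sp.subsingleton_graph {I J : E} (S : Sp I J) (f : I ⟶ J) :
    Subsingleton (S ⟶ (⟨I, 𝟙 I, f⟩ : Sp I J)) where
  allEq a b := by
    ext
    simpa using a.hl.trans b.hl.symm

lemma Sp.subsingleton_cograph {I J : E} (S : Sp I J) (f : J ⟶ I) :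
    Subsingleton (S ⟶ (⟨J, f, 𝟙 J⟩ : Sp I J)) where
  allEq a b := by
    ext
    simpa using a.hr.trans b.hr.symm

variable [PullbackChoice E]

noncomputable def Sp.graphComp {X Y Z : E} (f : X ⟶ Y) (g : Y ⟶ Z) :
    (⟨X, 𝟙 X, f ≫ g⟩ : Sp X Z) ≅ Sp.comp ⟨X, 𝟙 X, f⟩ ⟨Y, 𝟙 Y, g⟩ where
  hom := ⟨pbLift _ (𝟙 X) f (by simp), by simp, by simp⟩
  inv := ⟨(pb f (𝟙 Y)).p₁, rfl, by
    have := (pb f (𝟙 Y)).condition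
    rw [Category.comp_id] at this
    simp only [reassoc_of% this]⟩
  hom_inv_id := (Sp.subsingleton_graph _ _).elim _ _
  inv_hom_id := Sp.comp_ext (by simp) (by simpa using (pb f (𝟙 Y)).condition)

noncomputable def Sp.cographComp {X Y Z : E} (f : X ⟶ Y) (g : Y ⟶ Z) :
    (⟨X, f ≫ g, 𝟙 X⟩ : Sp Z X) ≅ Sp.comp ⟨Y, g, 𝟙 Y⟩ ⟨X, f, 𝟙 X⟩ where
  hom := ⟨pbLift _ f (𝟙 X) (by simp), by simp, by simp⟩
  inv := ⟨(pb (𝟙 Y) f).p₂, by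
    have := (pb (𝟙 Y) f).condition
    rw [Category.comp_id] at this
    simp only [reassoc_of% this], rfl⟩
  hom_inv_id := (Sp.subsingleton_cograph _ _).elim _ _
  inv_hom_id := Sp.comp_ext (by simpa using (pb (𝟙 Y) f).condition.symm) (by simp)

variable (E)

/-- `f ↦ (𝟙, f)`, from `E` to spans. -/
noncomputable def graphSpan : LocallyDiscrete E ⥤ᵖ SpanC E :=
  pseudofunctorOfIsLocallyDiscrete (fun X => ⟨X.as⟩) (fun {X _} f => (⟨X.as, 𝟙 X.as, f.as⟩ : Sp _ _))
    (fun _ => Iso.refl _) (fun f g => Sp.graphComp f.as g.as)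
    (fun _ _ _ => (Sp.subsingleton_graph _ _).elim _ _)
    (fun _ => (Sp.subsingleton_graph _ _).elim _ _)
    (fun _ => (Sp.subsingleton_graph _ _).elim _ _)

/-- `f ↦ (f, 𝟙)`, from the opposite of `E` to spans. -/
noncomputable def cographSpan : LocallyDiscrete Eᵒᵖ ⥤ᵖ SpanC E :=
  pseudofunctorOfIsLocallyDiscrete (fun X => ⟨X.as.unop⟩)
    (fun {_ Y} f => (⟨Y.as.unop, f.as.unop, 𝟙 Y.as.unop⟩ : Sp _ _))
    (fun _ => Iso.refl _) (fun f g => Sp.cographComp g.as.unop f.as.unop)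
    (fun _ _ _ => (Sp.subsingleton_cograph _ _).elim _ _)
    (fun _ => (Sp.subsingleton_cograph _ _).elim _ _)
    (fun _ => (Sp.subsingleton_cograph _ _).elim _ _)

noncomputable def graphSpanIso : LocallyDiscrete E ⥤ᵖ Pith (SpanC E) :=
  Pith.pseudofunctorToPith (graphSpan E)

noncomputable def cographSpanIso : LocallyDiscrete Eᵒᵖ ⥤ᵖ Pith (SpanC E) :=
  Pith.pseudofunctorToPith (cographSpan E)

end Embeddings

namespace DistributivityPullback

variable {E : Type u} [Category.{v} E] {X A B : E}

lemma isIso_of_id {u : X ⟶ A} (D : DistributivityPullback u (𝟙 A)) (ω : X ⟶ D.T)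
    (hp : ω ≫ D.p = 𝟙 X) : IsIso (ω ≫ D.q) := by
  have hq : IsIso D.q := D.isPullback.isIso_snd_of_isIso
  have hw := D.isPullback.w
  rw [Category.comp_id] at hw
  let e : D.toPullbackAround ⟶ D.toPullbackAround :=
    ⟨D.p ≫ ω, inv D.q ≫ D.p ≫ ω ≫ D.q, by simp [hp], by simp, by
      simp only [Category.assoc, ← hw]
      rw [reassoc_of% hp, IsIso.inv_comp_eq, hw]⟩
  have he : e = 𝟙 _ := D.isTerminal.hom_ext _ _
  have hs : D.p ≫ ω = 𝟙 _ := congrArg PullbackAround.Hom.s he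
  have : IsIso ω := ⟨D.p, hp, hs⟩
  infer_instance

lemma isIso_of_isIso {u : X ⟶ A} {f : A ⟶ B} [IsIso u] (D : DistributivityPullback u f)
    (ω : A ⟶ D.T) (ν : B ⟶ D.Y) (hp : ω ≫ D.p ≫ u = 𝟙 A) (hq : ω ≫ D.q = f ≫ ν)
    (hr : ν ≫ D.r = 𝟙 B) : IsIso ν := by
  have hw := D.isPullback.w
  rw [Category.assoc] at hw
  let e : D.toPullbackAround ⟶ D.toPullbackAround :=
    ⟨D.p ≫ u ≫ ω, D.r ≫ ν, by
      rw [← cancel_mono u]; simp only [Category.assoc, hp, Category.comp_id], by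
      simp only [Category.assoc]
      rw [hq, reassoc_of% hw], by simp only [Category.assoc, hr, Category.comp_id]⟩
  have he : e = 𝟙 _ := D.isTerminal.hom_ext _ _
  exact ⟨_, hr, congrArg PullbackAround.Hom.t he⟩

end DistributivityPullback

namespace Poly

variable {E : Type u} [Category.{v} E]

lemma isIso_of_isIso_ν {I J : E} {P Q : Poly I J} (f : P ⟶ Q) (h : IsIso f.ν) : IsIso f := by
  have : IsIso f.σ := f.cart.isIso_fst_of_isIso
  refine ⟨⟨⟨inv f.σ, inv f.ν, ?_, ?_, ?_⟩, ?_, ?_⟩⟩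
  · rw [IsIso.inv_comp_eq, f.hs]
  · rw [IsIso.inv_comp_eq, f.ht]
  · exact IsPullback.of_horiz_isIso ⟨by simp [f.cart.w]⟩
  · ext <;> simp
  · ext <;> simp

variable [PullbackChoice E] [DistributivityChoice E] {I J K : E}

lemma lift_eq_lift {X : Poly I K} {P : Poly I J} {Q : Poly J K} {A A' : Split X J}
    {a : A.left ⟶ P} {b : A.right ⟶ Q} {a' : A'.left ⟶ P} {b' : A'.right ⟶ Q}
    (m : Split.Map (𝟙 X) A A') (ha : m.left ≫ a' = a) (hb : m.right ≫ b' = b) :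
    lift A a b = lift A' a' b' := by
  rw [← Category.id_comp (lift A' a' b'), comp_lift m, ha, hb]

/-- The polynomial `(l, 𝟙, r)` associated to a span. -/
abbrev ofSpan (S : Sp I J) : Poly I J := ⟨S.apex, S.apex, S.l, 𝟙 _, S.r⟩

abbrev ofSpanMap {S T : Sp I J} (f : S ⟶ T) : ofSpan S ⟶ ofSpan T :=
  ⟨f.hom, f.hom, f.hl, f.hr, IsPullback.of_vert_isIso ⟨by simp⟩⟩

abbrev ofSpanSplit (S : Sp I J) (T : Sp J K) : Split (ofSpan (Sp.comp S T)) J :=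
  ⟨(Sp.comp S T).apex, 𝟙 _, 𝟙 _, (pb S.r T.l).p₁ ≫ S.r, by simp⟩

abbrev ofSpanL (S : Sp I J) (T : Sp J K) : (ofSpanSplit S T).left ⟶ ofSpan S :=
  ⟨(pb S.r T.l).p₁, (pb S.r T.l).p₁, rfl, rfl, IsPullback.of_vert_isIso ⟨by simp⟩⟩

abbrev ofSpanR (S : Sp I J) (T : Sp J K) : (ofSpanSplit S T).right ⟶ ofSpan T :=
  ⟨(pb S.r T.l).p₂, (pb S.r T.l).p₂, (pb S.r T.l).condition.symm, rfl,
    IsPullback.of_vert_isIso ⟨by simp⟩⟩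

noncomputable def ofSpanComp (S : Sp I J) (T : Sp J K) :
    ofSpan (Sp.comp S T) ⟶ comp (ofSpan S) (ofSpan T) :=
  lift (ofSpanSplit S T) (ofSpanL S T) (ofSpanR S T)

instance (S : Sp I J) (T : Sp J K) : IsIso (ofSpanComp S T) := by
  apply isIso_of_isIso_ν
  obtain ⟨n, h₁, h₂⟩ := rep_lift (ofSpanSplit S T) (ofSpanL S T) (ofSpanR S T)
  have hp : n.ω ≫ (D (ofSpan S) (ofSpan T)).p = 𝟙 _ :=
    (pb S.r T.l).hom_ext
      ((Category.assoc _ _ _).trans ((congrArg Hom.ν h₁).trans (Category.id_comp _).symm))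
      ((Category.assoc _ _ _).trans ((congrArg Hom.σ h₂).trans (Category.id_comp _).symm))
  have hq : n.ω ≫ (D (ofSpan S) (ofSpan T)).q = (ofSpanComp S T).ν :=
    n.cart.w.trans (Category.id_comp _)
  rw [← hq]
  exact (D (ofSpan S) (ofSpan T)).isIso_of_id _ hp

noncomputable def ofSpanCompIso (S : Sp I J) (T : Sp J K) :
    ofSpan (Sp.comp S T) ≅ comp (ofSpan S) (ofSpan T) := asIso (ofSpanComp S T)

/-- The polynomial `(l, r, 𝟙)` associated to a span. -/
abbrev ofSpan' (S : Sp I J) : Poly I J := ⟨S.apex, J, S.l, S.r, 𝟙 _⟩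

abbrev ofSpanMap' {S T : Sp I J} (f : S ≅ T) : ofSpan' S ⟶ ofSpan' T :=
  ⟨f.hom.hom, 𝟙 _, f.hom.hl, by simp,
    haveI : IsIso f.hom.hom := ⟨f.inv.hom, congrArg Sp.Hom.hom f.hom_inv_id,
      congrArg Sp.Hom.hom f.inv_hom_id⟩
    IsPullback.of_horiz_isIso ⟨by simpa using f.hom.hr⟩⟩

abbrev ofSpanSplit' (S : Sp I J) (T : Sp J K) : Split (ofSpan' (Sp.comp S T)) J :=
  ⟨T.apex, (pb S.r T.l).p₂, T.r, T.l, rfl⟩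

abbrev ofSpanL' (S : Sp I J) (T : Sp J K) : (ofSpanSplit' S T).left ⟶ ofSpan' S :=
  ⟨(pb S.r T.l).p₁, T.l, rfl, Category.comp_id _, (pb S.r T.l).isPullback⟩

noncomputable def ofSpanComp' (S : Sp I J) (T : Sp J K) :
    ofSpan' (Sp.comp S T) ⟶ comp (ofSpan' S) (ofSpan' T) :=
  lift (ofSpanSplit' S T) (ofSpanL' S T) (𝟙 (ofSpan' T))

instance (S : Sp I J) (T : Sp J K) : IsIso (ofSpanComp' S T) := by
  apply isIso_of_isIso_ν
  obtain ⟨n, h₁, h₂⟩ := rep_lift (ofSpanSplit' S T) (ofSpanL' S T) (𝟙 (ofSpan' T))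
  have : IsIso (pb (𝟙 J) T.l).p₂ := (pb (𝟙 J) T.l).isPullback.isIso_snd_of_isIso
  exact (D (ofSpan' S) (ofSpan' T)).isIso_of_isIso n.ω _ (congrArg Hom.σ h₂) n.cart.w
    (congrArg Hom.ν h₂)

noncomputable def ofSpanCompIso' (S : Sp I J) (T : Sp J K) :
    ofSpan' (Sp.comp S T) ≅ comp (ofSpan' S) (ofSpan' T) := asIso (ofSpanComp' S T)

lemma ofSpanComp_naturality {S S' : Sp I J} {T T' : Sp J K} (η : S ⟶ S') (θ : T ⟶ T') :
    ofSpanMap (Sp.hcomp η θ) ≫ ofSpanComp S' T' =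
      ofSpanComp S T ≫ hcomp (ofSpanMap η) (ofSpanMap θ) := by
  rw [ofSpanComp, ofSpanComp, lift_hcomp, comp_lift (A := ofSpanSplit S T)
    ⟨(Sp.hcomp η θ).hom, by simp,
      by simp only [Sp.hcomp, pbLift_p₁_assoc, Category.assoc, η.hr],
      IsPullback.of_vert_isIso ⟨by simp⟩⟩]
  congr 1 <;> ext <;> simp [Sp.hcomp]

lemma ofSpanComp_assoc {L : E} (S : Sp I J) (T : Sp J K) (R : Sp K L) :
    ofSpanMap (Sp.assoc S T R).hom ≫ ofSpanComp S (Sp.comp T R) ≫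
        hcomp (𝟙 _) (ofSpanComp T R) =
      ofSpanComp (Sp.comp S T) R ≫ hcomp (ofSpanComp S T) (𝟙 _) ≫ αHom _ _ _ := by
  let s : Split3 (ofSpan (Sp.comp (Sp.comp S T) R)) J K :=
    ⟨_, _, 𝟙 _, 𝟙 _, 𝟙 _, (pb (Sp.comp S T).r R.l).p₁ ≫ (pb S.r T.l).p₁ ≫ S.r,
      (pb (Sp.comp S T).r R.l).p₁ ≫ (Sp.comp S T).r, 𝟙 _, 𝟙 _, by simp, by simp, by simp⟩
  have e₁ : ofSpanComp (Sp.comp S T) R ≫ hcomp (ofSpanComp S T) (𝟙 _) = lift s.A _ _ :=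
    lift_hcomp _ _ _ _ _
  have e₂ : ofSpanL (Sp.comp S T) R ≫ ofSpanComp S T = lift s.A₁ _ _ :=
    comp_lift ⟨(pb (Sp.comp S T).r R.l).p₁, by simp [s], rfl,
      IsPullback.of_vert_isIso ⟨by simp [s]⟩⟩ _ _
  have e₃ : ofSpanR S (Sp.comp T R) ≫ ofSpanComp T R =
      lift (⟨_, 𝟙 _, 𝟙 _, (pb S.r (Sp.comp T R).l).p₂ ≫ (pb T.r R.l).p₁ ≫ T.r, by simp⟩) _ _ :=
    comp_lift ⟨(pb S.r (Sp.comp T R).l).p₂, by simp, rfl, IsPullback.of_vert_isIso ⟨by simp⟩⟩ _ _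
  rw [← Category.assoc (ofSpanComp (Sp.comp S T) R), e₁, e₂, lift_αHom]
  rw [ofSpanComp, lift_hcomp, e₃]
  rw [comp_lift (A := s.B) ⟨(Sp.assoc S T R).hom.hom, by simp [s], by
    simp [s, Sp.assoc, - ChosenPullback.hp₁, - ChosenPullback.hp₂],
    IsPullback.of_vert_isIso ⟨by simp [s]⟩⟩]
  rw [comp_lift (A := s.B₁) ⟨(Sp.assoc S T R).hom.hom, by simp [s], by
    simp [s, Sp.assoc, - ChosenPullback.hp₁, - ChosenPullback.hp₂],
    IsPullback.of_vert_isIso ⟨by simp [s]⟩⟩]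
  congr 1
  · ext <;> simp [Sp.assoc]
  · congr 1 <;> ext <;> simp [Sp.assoc]

lemma ofSpanComp_one_left (S : Sp I J) :
    ofSpanMap (Sp.leftUnit S).hom ≫ lInv (ofSpan S) = ofSpanComp (Sp.one _) S := by
  rw [comp_lInv, ofSpanComp]
  refine lift_eq_lift ⟨𝟙 _, by simp, by simp, IsPullback.of_vert_isIso ⟨by simp⟩⟩ ?_ ?_
  · exact Subsingleton.elim (α := (_ ⟶ one I)) _ _
  · ext <;> simp [Sp.leftUnit]

lemma ofSpanComp_one_right (S : Sp I J) :
    ofSpanMap (Sp.rightUnit S).hom ≫ rInv (ofSpan S) = ofSpanComp S (Sp.one _) := by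
  rw [comp_rInv, ofSpanComp]
  refine lift_eq_lift ⟨𝟙 _, by simp, ?_, IsPullback.of_vert_isIso ⟨by simp⟩⟩ ?_ ?_
  · exact (Category.id_comp _).trans (pb S.r (𝟙 J)).condition
  · ext <;> simp [Sp.rightUnit]
  · exact Subsingleton.elim (α := (_ ⟶ one J)) _ _

lemma ofSpanComp_naturality' {S S' : Sp I J} {T T' : Sp J K} (η : S ≅ S') (θ : T ≅ T')
    (e : Sp.comp S T ≅ Sp.comp S' T') (he : e.hom = Sp.hcomp η.hom θ.hom) :
    ofSpanMap' e ≫ ofSpanComp' S' T' =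
      ofSpanComp' S T ≫ hcomp (ofSpanMap' η) (ofSpanMap' θ) := by
  rw [ofSpanComp', ofSpanComp', lift_hcomp, comp_lift (A := ofSpanSplit' S T)
    ⟨θ.hom.hom, by simp [he, Sp.hcomp], θ.hom.hl, (ofSpanMap' θ).cart⟩]
  congr 1
  · ext <;> simp [he, Sp.hcomp, θ.hom.hl]
  · ext <;> simp

lemma ofSpanComp_assoc' {L : E} (S : Sp I J) (T : Sp J K) (R : Sp K L) :
    ofSpanMap' (Sp.assoc S T R) ≫ ofSpanComp' S (Sp.comp T R) ≫
        hcomp (𝟙 _) (ofSpanComp' T R) =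
      ofSpanComp' (Sp.comp S T) R ≫ hcomp (ofSpanComp' S T) (𝟙 _) ≫ αHom _ _ _ := by
  let s : Split3 (ofSpan' (Sp.comp (Sp.comp S T) R)) J K :=
    ⟨(Sp.comp T R).apex, R.apex, (Sp.assoc S T R).hom.hom ≫ (pb S.r (Sp.comp T R).l).p₂,
      (pb T.r R.l).p₂, R.r, (Sp.comp T R).l, R.l, (pb (Sp.comp S T).r R.l).p₂, (Sp.comp T R).r,
      by simp [Sp.assoc], rfl, rfl⟩
  have e₁ : ofSpanComp' (Sp.comp S T) R ≫ hcomp (ofSpanComp' S T) (𝟙 _) = lift s.A _ _ :=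
    lift_hcomp _ _ _ _ _
  have e₂ : ofSpanL' (Sp.comp S T) R ≫ ofSpanComp' S T = lift s.A₁ _ _ :=
    comp_lift ⟨(pb T.r R.l).p₁, by simp [s, Sp.assoc], rfl, (pb T.r R.l).isPullback⟩ _ _
  rw [← Category.assoc (ofSpanComp' (Sp.comp S T) R), e₁, e₂, lift_αHom]
  let m : Split.Map (ofSpanMap' (Sp.assoc S T R)) s.B (ofSpanSplit' S (Sp.comp T R)) :=
    ⟨𝟙 _, Category.comp_id _, Category.id_comp _, IsPullback.id_horiz _⟩
  have e₃ (x) (y) : ofSpanMap' (Sp.assoc S T R) ≫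
      lift (P := ofSpan' S) (Q := comp (ofSpan' T) (ofSpan' R))
        (ofSpanSplit' S (Sp.comp T R)) x y = lift s.B _ _ :=
    comp_lift m _ _
  rw [ofSpanComp', lift_hcomp, e₃]
  congr 1
  · ext <;> simp [Sp.assoc, m, - ChosenPullback.hp₁, - ChosenPullback.hp₂]
  · refine Eq.trans (b := 𝟙 (ofSpan' (Sp.comp T R)) ≫ 𝟙 _ ≫ ofSpanComp' T R) ?_ ?_
    · congr 1
    · rw [Category.id_comp, Category.id_comp, ofSpanComp']
      congr 1
      · ext <;> simp
      · exact (Category.comp_id _).symm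

lemma ofSpanComp_one_left' (S : Sp I J) :
    ofSpanMap' (Sp.leftUnit S) ≫ lInv (ofSpan' S) = ofSpanComp' (Sp.one _) S := by
  have : IsIso (pb (𝟙 I) S.l).p₂ := (pb (𝟙 I) S.l).isPullback.isIso_snd_of_isIso
  rw [comp_lInv, ofSpanComp']
  refine lift_eq_lift ⟨(pb (𝟙 I) S.l).p₂, by simp, (pb (𝟙 I) S.l).condition.symm,
    (ofSpanMap' (Sp.leftUnit S)).cart⟩ ?_ ?_
  · exact Subsingleton.elim (α := (_ ⟶ one I)) _ _
  · ext <;> simp [Sp.leftUnit]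

lemma ofSpanComp_one_right' (S : Sp I J) :
    ofSpanMap' (Sp.rightUnit S) ≫ rInv (ofSpan' S) = ofSpanComp' S (Sp.one _) := by
  rw [comp_rInv, ofSpanComp']
  refine lift_eq_lift ⟨𝟙 _, by simp, by simp, IsPullback.of_vert_isIso ⟨by simp⟩⟩ ?_ ?_
  · ext <;> simp [Sp.rightUnit]
  · exact Subsingleton.elim (α := (_ ⟶ one J)) _ _

end Poly

section Iota

variable (E : Type u) [Category.{v} E] [PullbackChoice E] [DistributivityChoice E]

open PolyCart.Poly

/-- The embedding of spans into polynomials sending `(s, t)` to `(s, 𝟙, t)`, as an oplax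
functor. -/
noncomputable def spanToPolyOplax : SpanC E ⥤ᵒᵖᴸ PolyC E where
  obj X := ⟨X.as⟩
  map S := ofSpan S
  map₂ f := ofSpanMap f
  map₂_id _ := rfl
  map₂_comp _ _ := rfl
  mapId X := 𝟙 (Poly.one X.as)
  mapComp S T := ofSpanComp S T
  mapComp_naturality_left η T := ofSpanComp_naturality η (𝟙 T)
  mapComp_naturality_right S _ _ η := ofSpanComp_naturality (𝟙 S) η
  map₂_associator S T R := ofSpanComp_assoc S T R
  map₂_leftUnitor S := by
    change ofSpanMap (Sp.leftUnit S).hom =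
      ofSpanComp (Sp.one _) S ≫ hcomp (𝟙 _) (𝟙 (ofSpan S)) ≫ lHom (ofSpan S)
    rw [hcomp_id, Category.id_comp, ← ofSpanComp_one_left, Category.assoc, lInv_lHom,
      Category.comp_id]
  map₂_rightUnitor S := by
    change ofSpanMap (Sp.rightUnit S).hom =
      ofSpanComp S (Sp.one _) ≫ hcomp (𝟙 (ofSpan S)) (𝟙 _) ≫ rHom (ofSpan S)
    rw [hcomp_id, Category.id_comp, ← ofSpanComp_one_right, Category.assoc, rInv_rHom,
      Category.comp_id]

/-- The embedding of spans into polynomials sending `(s, t)` to `(s, 𝟙, t)`. -/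
noncomputable def spanToPoly : SpanC E ⥤ᵖ PolyC E :=
  Pseudofunctor.mkOfOplax (spanToPolyOplax E)
    { mapIdIso _ := Iso.refl _
      mapCompIso S T := ofSpanCompIso S T
      mapIdIso_hom := rfl
      mapCompIso_hom _ _ := rfl }

/-- The embedding of spans and their invertible morphisms into polynomials sending `(s, t)` to
`(s, t, 𝟙)`, as an oplax functor. -/
noncomputable def spanIsoToPolyOplax : Pith (SpanC E) ⥤ᵒᵖᴸ PolyC E where
  obj X := ⟨X.as.as⟩
  map S := ofSpan' S.of
  map₂ f := ofSpanMap' f.iso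
  map₂_id _ := rfl
  map₂_comp _ _ := by
    refine Poly.hom_ext rfl ?_
    exact (Category.id_comp _).symm
  mapId X := 𝟙 (Poly.one X.as.as)
  mapComp S T := ofSpanComp' S.of T.of
  mapComp_naturality_left η T := ofSpanComp_naturality' η.iso (Iso.refl T.of) _ rfl
  mapComp_naturality_right S _ _ η := ofSpanComp_naturality' (Iso.refl S.of) η.iso _ rfl
  map₂_associator S T R := ofSpanComp_assoc' S.of T.of R.of
  map₂_leftUnitor S := by
    change ofSpanMap' (Sp.leftUnit S.of) =
      ofSpanComp' (Sp.one _) S.of ≫ hcomp (𝟙 _) (𝟙 (ofSpan' S.of)) ≫ lHom (ofSpan' S.of)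
    rw [hcomp_id, Category.id_comp, ← ofSpanComp_one_left', Category.assoc, lInv_lHom,
      Category.comp_id]
  map₂_rightUnitor S := by
    change ofSpanMap' (Sp.rightUnit S.of) =
      ofSpanComp' S.of (Sp.one _) ≫ hcomp (𝟙 (ofSpan' S.of)) (𝟙 _) ≫ rHom (ofSpan' S.of)
    rw [hcomp_id, Category.id_comp, ← ofSpanComp_one_right', Category.assoc, rInv_rHom,
      Category.comp_id]

/-- The embedding of spans and their invertible morphisms into polynomials sending `(s, t)` to
`(s, t, 𝟙)`. -/
noncomputable def spanIsoToPoly : Pith (SpanC E) ⥤ᵖ PolyC E :=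
  Pseudofunctor.mkOfOplax (spanIsoToPolyOplax E)
    { mapIdIso _ := Iso.refl _
      mapCompIso S T := ofSpanCompIso' S.of T.of
      mapIdIso_hom := rfl
      mapCompIso_hom _ _ := rfl }

end Iota

end PolyCart

namespace PolyCart

/-! ### Oplax functors with a fixed action on objects, and icons -/

section Oplax

variable {B : Type u₁} [Bicategory.{w₁, v₁} B] {C : Type u₂} [Bicategory.{w₂, v₂} C]

/-- An oplax functor with given action `o` on objects. -/
structure OplaxOver (o : B → C) where
  map {a b : B} (f : a ⟶ b) : o a ⟶ o b
  map₂ {a b : B} {f g : a ⟶ b} (η : f ⟶ g) : map f ⟶ map g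
  mapId (a : B) : map (𝟙 a) ⟶ 𝟙 (o a)
  mapComp {a b c : B} (f : a ⟶ b) (g : b ⟶ c) : map (f ≫ g) ⟶ map f ≫ map g
  map₂_id {a b : B} (f : a ⟶ b) : map₂ (𝟙 f) = 𝟙 (map f)
  map₂_comp {a b : B} {f g h : a ⟶ b} (η : f ⟶ g) (θ : g ⟶ h) :
    map₂ (η ≫ θ) = map₂ η ≫ map₂ θ
  mapComp_naturality_left {a b c : B} {f f' : a ⟶ b} (η : f ⟶ f') (g : b ⟶ c) :
    map₂ (η ▷ g) ≫ mapComp f' g = mapComp f g ≫ map₂ η ▷ map g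
  mapComp_naturality_right {a b c : B} (f : a ⟶ b) {g g' : b ⟶ c} (η : g ⟶ g') :
    map₂ (f ◁ η) ≫ mapComp f g' = mapComp f g ≫ map f ◁ map₂ η
  map₂_associator {a b c d : B} (f : a ⟶ b) (g : b ⟶ c) (h : c ⟶ d) :
    map₂ (α_ f g h).hom ≫ mapComp f (g ≫ h) ≫ map f ◁ mapComp g h =
      mapComp (f ≫ g) h ≫ mapComp f g ▷ map h ≫ (α_ (map f) (map g) (map h)).hom
  map₂_leftUnitor {a b : B} (f : a ⟶ b) :
    map₂ (λ_ f).hom = mapComp (𝟙 a) f ≫ mapId a ▷ map f ≫ (λ_ (map f)).hom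
  map₂_rightUnitor {a b : B} (f : a ⟶ b) :
    map₂ (ρ_ f).hom = mapComp f (𝟙 b) ≫ map f ◁ mapId b ≫ (ρ_ (map f)).hom

namespace OplaxOver

variable {o : B → C}

/-- The underlying oplax functor. -/
@[simps]
def toOplax (F : OplaxOver o) : B ⥤ᵒᵖᴸ C where
  obj := o
  map := F.map
  map₂ := F.map₂
  map₂_id := F.map₂_id
  map₂_comp := F.map₂_comp
  mapId := F.mapId
  mapComp := F.mapComp
  mapComp_naturality_left := F.mapComp_naturality_left
  mapComp_naturality_right := F.mapComp_naturality_right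
  map₂_associator := F.map₂_associator
  map₂_leftUnitor := F.map₂_leftUnitor
  map₂_rightUnitor := F.map₂_rightUnitor

/-- All constraint cells are invertible. -/
def IsPseudo (F : OplaxOver o) : Prop :=
  (∀ a, IsIso (F.mapId a)) ∧ ∀ ⦃a b c : B⦄ (f : a ⟶ b) (g : b ⟶ c), IsIso (F.mapComp f g)

/-- A gregarious functor: a normal oplax functor whose constraint cell `F (f ≫ g) ⟶ F f ≫ F g`
is invertible whenever `g` has a right adjoint. -/
def IsGregarious (F : OplaxOver o) : Prop :=
  (∀ a, IsIso (F.mapId a)) ∧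
    ∀ ⦃a b c : B⦄ (f : a ⟶ b) (g : b ⟶ c), IsLeftAdjoint g → IsIso (F.mapComp f g)

/-- An icon between oplax functors which agree on objects. -/
@[ext]
structure Icon (F G : OplaxOver o) where
  app {a b : B} (f : a ⟶ b) : F.map f ⟶ G.map f
  naturality {a b : B} {f g : a ⟶ b} (η : f ⟶ g) : F.map₂ η ≫ app g = app f ≫ G.map₂ η
  mapId (a : B) : app (𝟙 a) ≫ G.mapId a = F.mapId a
  mapComp {a b c : B} (f : a ⟶ b) (g : b ⟶ c) :
    app (f ≫ g) ≫ G.mapComp f g = F.mapComp f g ≫ app f ▷ F.map g ≫ G.map f ◁ app g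

instance : Category (OplaxOver o) where
  Hom := Icon
  id F := ⟨fun f => 𝟙 _, by simp, by simp, by simp⟩
  comp α β :=
    { app f := α.app f ≫ β.app f
      naturality η := by rw [← Category.assoc, α.naturality, Category.assoc, β.naturality,
        Category.assoc]
      mapId a := by rw [Category.assoc, β.mapId, α.mapId]
      mapComp f g := by
        rw [Category.assoc, β.mapComp, ← Category.assoc, α.mapComp]
        simp only [Category.assoc, comp_whiskerRight, whiskerLeft_comp]
        rw [whisker_exchange_assoc] }

@[simp]
lemma id_app (F : OplaxOver o) {a b : B} (f : a ⟶ b) : Icon.app (𝟙 F) f = 𝟙 _ := rfl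

@[simp]
lemma comp_app {F G H : OplaxOver o} (α : F ⟶ G) (β : G ⟶ H) {a b : B} (f : a ⟶ b) :
    Icon.app (α ≫ β) f = α.app f ≫ β.app f := rfl

@[ext]
lemma hom_ext {F G : OplaxOver o} {α β : F ⟶ G}
    (h : ∀ {a b : B} (f : a ⟶ b), α.app f = β.app f) : α = β :=
  Icon.ext (by ext; exact h _)

variable {A : Type u₃} [Bicategory.{w₃, v₃} A]

/-- Precomposition of an oplax functor with a pseudofunctor. -/
def precomp (K : A ⥤ᵖ B) (F : OplaxOver o) : OplaxOver (fun a => o (K.obj a)) where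
  map f := F.map (K.map f)
  map₂ η := F.map₂ (K.map₂ η)
  mapId a := F.map₂ (K.mapId a).hom ≫ F.mapId (K.obj a)
  mapComp f g := F.map₂ (K.mapComp f g).hom ≫ F.mapComp (K.map f) (K.map g)
  map₂_id := (K.toOplax.comp F.toOplax).map₂_id
  map₂_comp := (K.toOplax.comp F.toOplax).map₂_comp
  mapComp_naturality_left := (K.toOplax.comp F.toOplax).mapComp_naturality_left
  mapComp_naturality_right := (K.toOplax.comp F.toOplax).mapComp_naturality_right
  map₂_associator := (K.toOplax.comp F.toOplax).map₂_associator
  map₂_leftUnitor := (K.toOplax.comp F.toOplax).map₂_leftUnitor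
  map₂_rightUnitor := (K.toOplax.comp F.toOplax).map₂_rightUnitor

/-- Precomposition of icons with a pseudofunctor. -/
def precompMap (K : A ⥤ᵖ B) {F G : OplaxOver o} (α : F ⟶ G) : precomp K F ⟶ precomp K G where
  app f := α.app (K.map f)
  naturality η := α.naturality (K.map₂ η)
  mapId a := by
    dsimp only [precomp]
    rw [← Category.assoc, ← α.naturality, Category.assoc, α.mapId]
  mapComp f g := by
    dsimp only [precomp]
    rw [← Category.assoc, ← α.naturality, Category.assoc, α.mapComp, Category.assoc]

/-- Precomposition with a pseudofunctor. -/
def precompFunctor (K : A ⥤ᵖ B) (o : B → C) : OplaxOver o ⥤ OplaxOver (fun a => o (K.obj a)) where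
  obj := precomp K
  map := precompMap K
  map_id _ := rfl
  map_comp _ _ := rfl

end OplaxOver

/-! ### Constraint cells of gregarious functors at right adjoints -/

section

variable {o : B → C} (F : OplaxOver o) {a b c : B} {f : a ⟶ b} {u : b ⟶ a} (adj : f ⊣ u)

namespace OplaxOver

/-- The unit of the image of an adjunction. -/
noncomputable def unit (hF : F.IsGregarious) : 𝟙 (o a) ⟶ F.map f ≫ F.map u :=
  haveI := hF.1 a
  inv (F.mapId a) ≫ F.map₂ adj.unit ≫ F.mapComp f u

/-- The counit of the image of an adjunction. -/
noncomputable def counit (hF : F.IsGregarious) : F.map u ≫ F.map f ⟶ 𝟙 (o b) :=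
  haveI := hF.2 u f (IsLeftAdjoint.mk adj)
  inv (F.mapComp u f) ≫ F.map₂ adj.counit ≫ F.mapId b

lemma mapComp_counit (hF : F.IsGregarious) :
    F.mapComp u f ≫ F.counit adj hF = F.map₂ adj.counit ≫ F.mapId b := by
  simp [counit]

lemma mapId_unit (hF : F.IsGregarious) :
    F.mapId a ≫ F.unit adj hF = F.map₂ adj.unit ≫ F.mapComp f u := by
  simp [unit]

/-- The inverse of the constraint cell at `u` and `g`. -/
noncomputable def mapCompInv (hF : F.IsGregarious) (g : a ⟶ c) :
    F.map u ≫ F.map g ⟶ F.map (u ≫ g) :=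
  F.map u ◁ (F.map₂ ((λ_ g).inv ≫ adj.unit ▷ g ≫ (α_ f u g).hom) ≫ F.mapComp f (u ≫ g)) ≫
    (α_ _ _ _).inv ≫ F.counit adj hF ▷ _ ≫ (λ_ _).hom

lemma zigzag_aux (g : a ⟶ c) :
    u ◁ ((λ_ g).inv ≫ adj.unit ▷ g ≫ (α_ f u g).hom) ≫ (α_ u f (u ≫ g)).inv ≫
      adj.counit ▷ (u ≫ g) ≫ (λ_ (u ≫ g)).hom = 𝟙 _ := by
  calc
    _ = 𝟙 _ ⊗≫ rightZigzag adj.unit adj.counit ▷ g ⊗≫ 𝟙 _ := by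
      dsimp only [rightZigzag]; bicategory
    _ = _ := by rw [adj.right_triangle]; bicategory

lemma mapComp_whisker_mapComp (f : a ⟶ b) {d : B} (g : b ⟶ c) (h : c ⟶ d) :
    F.mapComp f (g ≫ h) ≫ F.map f ◁ F.mapComp g h = F.map₂ (α_ f g h).inv ≫
      F.mapComp (f ≫ g) h ≫ F.mapComp f g ▷ F.map h ≫
        (α_ (F.map f) (F.map g) (F.map h)).hom :=
  F.toOplax.mapComp_assoc_right f g h

lemma mapComp_mapCompInv (hF : F.IsGregarious) (g : a ⟶ c) :
    F.mapComp u g ≫ F.mapCompInv adj hF g = 𝟙 _ := by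
  dsimp only [mapCompInv]
  rw [whiskerLeft_comp, Category.assoc, ← Category.assoc, ← F.mapComp_naturality_right,
    Category.assoc, ← Category.assoc (F.mapComp u (f ≫ u ≫ g)), F.mapComp_whisker_mapComp]
  simp only [Category.assoc, Iso.hom_inv_id_assoc]
  rw [← comp_whiskerRight_assoc, mapComp_counit, comp_whiskerRight_assoc,
    ← Category.assoc (F.mapComp (u ≫ f) (u ≫ g)), ← F.mapComp_naturality_left, Category.assoc,
    ← F.map₂_leftUnitor, ← F.map₂_comp, ← F.map₂_comp, ← F.map₂_comp, zigzag_aux, F.map₂_id]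

lemma isIso_mapComp_id (hF : F.IsGregarious) (u : b ⟶ a) : IsIso (F.mapComp u (𝟙 a)) := by
  have := hF.1 a
  have h : F.mapComp u (𝟙 a) ≫ F.map u ◁ F.mapId a = F.map₂ (ρ_ u).hom ≫ (ρ_ (F.map u)).inv := by
    rw [F.map₂_rightUnitor]; simp
  have h' : IsIso (F.map₂ (ρ_ u).hom) := ⟨F.map₂ (ρ_ u).inv, by
    rw [← F.map₂_comp, Iso.hom_inv_id, F.map₂_id], by
    rw [← F.map₂_comp, Iso.inv_hom_id, F.map₂_id]⟩
  have : IsIso (F.mapComp u (𝟙 a) ≫ F.map u ◁ F.mapId a) := by rw [h]; infer_instance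
  exact IsIso.of_isIso_comp_right _ (F.map u ◁ F.mapId a)

lemma right_zigzag (hF : F.IsGregarious) :
    F.map u ◁ F.unit adj hF ≫ (α_ _ _ _).inv ≫ F.counit adj hF ▷ F.map u =
      (ρ_ _).hom ≫ (λ_ _).inv := by
  have := F.isIso_mapComp_id hF u
  have := hF.1 a
  rw [← cancel_epi (F.map u ◁ F.mapId a), ← cancel_epi (F.mapComp u (𝟙 a)),
    ← whiskerLeft_comp_assoc, mapId_unit, whiskerLeft_comp, Category.assoc, ← Category.assoc,
    ← F.mapComp_naturality_right, Category.assoc, ← Category.assoc (F.mapComp u (f ≫ u)),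
    F.mapComp_whisker_mapComp]
  simp only [Category.assoc, Iso.hom_inv_id_assoc]
  rw [← comp_whiskerRight, mapComp_counit, comp_whiskerRight,
    ← Category.assoc (F.mapComp (u ≫ f) u), ← F.mapComp_naturality_left, Category.assoc]
  rw [← cancel_mono (λ_ _).hom]
  simp only [Category.assoc, Iso.inv_hom_id, Category.comp_id]
  rw [← F.map₂_leftUnitor, ← F.map₂_rightUnitor, ← F.map₂_comp, ← F.map₂_comp, ← F.map₂_comp]
  congr 1
  have h := adj.right_triangle
  calc
    _ = rightZigzag adj.unit adj.counit ≫ (λ_ _).hom := by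
      dsimp only [rightZigzag]; bicategory
    _ = _ := by rw [h]; simp

lemma mapCompInv_mapComp (hF : F.IsGregarious) (g : a ⟶ c) :
    F.mapCompInv adj hF g ≫ F.mapComp u g = 𝟙 _ := by
  have := hF.1 a
  have e : F.map₂ ((λ_ g).inv ≫ adj.unit ▷ g ≫ (α_ f u g).hom) ≫ F.mapComp f (u ≫ g) ≫
      F.map f ◁ F.mapComp u g = (λ_ _).inv ≫ F.unit adj hF ▷ F.map g ≫ (α_ _ _ _).hom := by
    rw [F.mapComp_whisker_mapComp, ← Category.assoc, ← F.map₂_comp]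
    simp only [Category.assoc, Iso.hom_inv_id, Category.comp_id]
    rw [F.map₂_comp, Category.assoc, ← Category.assoc (F.map₂ (adj.unit ▷ g)),
      F.mapComp_naturality_left, Category.assoc, ← comp_whiskerRight_assoc, ← mapId_unit,
      comp_whiskerRight_assoc]
    have h : F.map₂ (λ_ g).inv ≫ F.mapComp (𝟙 a) g ≫ F.mapId a ▷ F.map g = (λ_ _).inv := by
      rw [← cancel_mono (λ_ _).hom, Category.assoc, Category.assoc, ← F.map₂_leftUnitor,
        ← F.map₂_comp, Iso.inv_hom_id, Iso.inv_hom_id, F.map₂_id]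
    rw [← Category.assoc, ← Category.assoc, Category.assoc (F.map₂ (λ_ g).inv), h]
  dsimp only [mapCompInv]
  calc
    _ = F.map u ◁ (F.map₂ ((λ_ g).inv ≫ adj.unit ▷ g ≫ (α_ f u g).hom) ≫ F.mapComp f (u ≫ g)) ≫
        (α_ _ _ _).inv ≫ (F.counit adj hF ▷ _ ≫ 𝟙 _ ◁ F.mapComp u g) ≫ (λ_ _).hom := by
      simp
    _ = F.map u ◁ (F.map₂ ((λ_ g).inv ≫ adj.unit ▷ g ≫ (α_ f u g).hom) ≫ F.mapComp f (u ≫ g) ≫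
        F.map f ◁ F.mapComp u g) ≫
        (α_ _ _ _).inv ≫ F.counit adj hF ▷ _ ≫ (λ_ _).hom := by
      rw [← whisker_exchange]; simp
    _ = 𝟙 _ ⊗≫ (F.map u ◁ F.unit adj hF ≫ (α_ _ _ _).inv ≫ F.counit adj hF ▷ F.map u) ▷ F.map g
        ⊗≫ 𝟙 _ := by
      rw [e]; bicategory
    _ = 𝟙 _ := by rw [right_zigzag]; bicategory

/-- Constraint cells of gregarious functors are invertible when the first 1-cell is a right
adjoint. -/
lemma isIso_mapComp_of_adj {f : a ⟶ b} {u : b ⟶ a} (adj : f ⊣ u) (hF : F.IsGregarious)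
    (g : a ⟶ c) : IsIso (F.mapComp u g) :=
  ⟨_, F.mapComp_mapCompInv adj hF g, F.mapCompInv_mapComp adj hF g⟩

end OplaxOver

end

end Oplax

end PolyCart

namespace PolyCart

open PullbackChoice DistributivityChoice

/-! ### The adjunctions between graphs and cographs -/

section

variable {E : Type u} [Category.{v} E] [PullbackChoice E]

/-- The span `(𝟙, f)`. -/
abbrev SpanC.graph {X Y : E} (f : X ⟶ Y) : (⟨X⟩ : SpanC E) ⟶ ⟨Y⟩ := (⟨X, 𝟙 X, f⟩ : Sp X Y)

/-- The span `(f, 𝟙)`. -/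
abbrev SpanC.cograph {X Y : E} (f : X ⟶ Y) : (⟨Y⟩ : SpanC E) ⟶ ⟨X⟩ := (⟨X, f, 𝟙 X⟩ : Sp Y X)

/-- In spans, `(𝟙, f)` is left adjoint to `(f, 𝟙)`. -/
noncomputable def spanAdj {X Y : E} (f : X ⟶ Y) :
    Bicategory.Adjunction (SpanC.graph f) (SpanC.cograph f) where
  unit := (⟨pbLift (pb f f) (𝟙 X) (𝟙 X) rfl, by simp, by simp⟩ :
    Sp.one X ⟶ Sp.comp ⟨X, 𝟙 X, f⟩ ⟨X, f, 𝟙 X⟩)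
  counit := (⟨(pb (𝟙 X) (𝟙 X)).p₁ ≫ f, by simp, by
    have := (pb (𝟙 X) (𝟙 X)).condition
    simp only [Category.comp_id] at this
    simp [this]⟩ : Sp.comp ⟨X, f, 𝟙 X⟩ ⟨X, 𝟙 X, f⟩ ⟶ Sp.one Y)
  left_triangle := by
    rw [← cancel_mono (ρ_ _).hom]
    exact (Sp.subsingleton_graph _ _).elim _ _
  right_triangle := by
    rw [← cancel_mono (λ_ _).hom]
    exact (Sp.subsingleton_cograph _ _).elim _ _

/-- The isomorphism between the span `(g, f)` and the composite of `(g, 𝟙)` and `(𝟙, f)`. -/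
noncomputable def spanFactor {W X Y : E} (g : W ⟶ Y) (f : W ⟶ X) :
    (⟨W, g, f⟩ : Sp Y X) ≅ Sp.comp ⟨W, g, 𝟙 W⟩ ⟨W, 𝟙 W, f⟩ where
  hom := ⟨pbLift _ (𝟙 W) (𝟙 W) rfl, by simp, by simp⟩
  inv := ⟨(pb (𝟙 W) (𝟙 W)).p₁, rfl, by
    have := (pb (𝟙 W) (𝟙 W)).condition
    simp only [Category.comp_id] at this
    simp [this]⟩
  hom_inv_id := by ext; simp
  inv_hom_id := Sp.comp_ext (by simp) (by simpa using (pb (𝟙 W) (𝟙 W)).condition)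

/-- For a pullback square, the isomorphism between the span `(g', f')` and the composite of
`(𝟙, f)` and `(g, 𝟙)`. -/
noncomputable def spanBaseChange {W X Y Z : E} {f' : W ⟶ X} {g' : W ⟶ Y} {g : X ⟶ Z} {f : Y ⟶ Z}
    (sq : IsPullback f' g' g f) :
    (⟨W, g', f'⟩ : Sp Y X) ≅ Sp.comp ⟨Y, 𝟙 Y, f⟩ ⟨X, g, 𝟙 X⟩ where
  hom := ⟨pbLift _ g' f' sq.w.symm, by simp, by simp⟩
  inv := ⟨sq.lift (pb f g).p₂ (pb f g).p₁ (pb f g).condition.symm, by simp, by simp⟩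
  hom_inv_id := Sp.hom_ext (sq.hom_ext (by simp) (by simp))
  inv_hom_id := Sp.comp_ext (by simp) (by simp)

end

/-! ### Lax Beck triples -/

section Triple

variable {E : Type u} [Category.{v} E] {C : Type u₂} [Bicategory.{w₂, v₂} C]

/-- Three oplax functors `F_Σ`, `F_⊗` from `E` and `F_Δ` from the opposite of `E`, which agree on
objects, together with a 2-cell for each pullback square. -/
structure RawTriple (o : E → C) where
  Sig : OplaxOver (fun X : LocallyDiscrete E => o X.as)
  Del : OplaxOver (fun X : LocallyDiscrete Eᵒᵖ => o X.as.unop)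
  Ten : OplaxOver (fun X : LocallyDiscrete E => o X.as)
  beck {W X Y Z : E} {f' : W ⟶ X} {g' : W ⟶ Y} {g : X ⟶ Z} {f : Y ⟶ Z}
    (sq : IsPullback f' g' g f) :
    Del.map g'.op.toLoc ≫ Ten.map f'.toLoc ⟶ Ten.map f.toLoc ≫ Del.map g.op.toLoc

namespace RawTriple

variable {o : E → C}

/-- Morphisms: icons between the `Δ` and `⊗` parts which commute with the Beck 2-cells. -/
@[ext]
structure Hom (T T' : RawTriple o) where
  β : T.Del ⟶ T'.Del
  γ : T.Ten ⟶ T'.Ten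
  comm {W X Y Z : E} {f' : W ⟶ X} {g' : W ⟶ Y} {g : X ⟶ Z} {f : Y ⟶ Z}
    (sq : IsPullback f' g' g f) :
    (β.app g'.op.toLoc ▷ T.Ten.map f'.toLoc ≫ T'.Del.map g'.op.toLoc ◁ γ.app f'.toLoc) ≫
        T'.beck sq =
      T.beck sq ≫ γ.app f.toLoc ▷ T.Del.map g.op.toLoc ≫
        T'.Ten.map f.toLoc ◁ β.app g.op.toLoc

lemma comm_comp {a b c d : C} {p p' p'' : a ⟶ b} {q q' q'' : b ⟶ d} {r r' r'' : a ⟶ c}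
    {s s' s'' : c ⟶ d} {b₀ : p ≫ q ⟶ r ≫ s} {b₁ : p' ≫ q' ⟶ r' ≫ s'} {b₂ : p'' ≫ q'' ⟶ r'' ≫ s''}
    {β : p ⟶ p'} {β' : p' ⟶ p''} {γ : q ⟶ q'} {γ' : q' ⟶ q''}
    {δ : r ⟶ r'} {δ' : r' ⟶ r''} {κ : s ⟶ s'} {κ' : s' ⟶ s''}
    (h₁ : (β ▷ q ≫ p' ◁ γ) ≫ b₁ = b₀ ≫ δ ▷ s ≫ r' ◁ κ)
    (h₂ : (β' ▷ q' ≫ p'' ◁ γ') ≫ b₂ = b₁ ≫ δ' ▷ s' ≫ r'' ◁ κ') :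
    ((β ≫ β') ▷ q ≫ p'' ◁ (γ ≫ γ')) ≫ b₂ = b₀ ≫ (δ ≫ δ') ▷ s ≫ r'' ◁ (κ ≫ κ') := by
  simp only [comp_whiskerRight, whiskerLeft_comp, Category.assoc] at h₁ h₂ ⊢
  rw [← whisker_exchange_assoc β', h₂, reassoc_of% h₁, whisker_exchange_assoc]

instance : Category (RawTriple o) where
  Hom := Hom
  id T := ⟨𝟙 _, 𝟙 _, fun sq => by simp⟩
  comp m n :=
    { β := m.β ≫ n.β
      γ := m.γ ≫ n.γ
      comm sq := comm_comp (m.comm sq) (n.comm sq) }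

variable (T : RawTriple o)

/-- `F_Σ f`. -/
abbrev S {X Y : E} (f : X ⟶ Y) : o X ⟶ o Y := T.Sig.map f.toLoc

/-- `F_Δ f`. -/
abbrev D {X Y : E} (f : X ⟶ Y) : o Y ⟶ o X := T.Del.map f.op.toLoc

/-- `F_⊗ f`. -/
abbrev N {X Y : E} (f : X ⟶ Y) : o X ⟶ o Y := T.Ten.map f.toLoc

abbrev Sc {X Y Z : E} (f : X ⟶ Y) (g : Y ⟶ Z) : T.S (f ≫ g) ⟶ T.S f ≫ T.S g :=
  T.Sig.mapComp f.toLoc g.toLoc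

abbrev Dc {X Y Z : E} (f : X ⟶ Y) (g : Y ⟶ Z) : T.D (f ≫ g) ⟶ T.D g ≫ T.D f :=
  T.Del.mapComp g.op.toLoc f.op.toLoc

abbrev Nc {X Y Z : E} (f : X ⟶ Y) (g : Y ⟶ Z) : T.N (f ≫ g) ⟶ T.N f ≫ T.N g :=
  T.Ten.mapComp f.toLoc g.toLoc

abbrev Si (X : E) : T.S (𝟙 X) ⟶ 𝟙 (o X) := T.Sig.mapId ⟨X⟩

abbrev Di (X : E) : T.D (𝟙 X) ⟶ 𝟙 (o X) := T.Del.mapId ⟨.op X⟩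

abbrev Ni (X : E) : T.N (𝟙 X) ⟶ 𝟙 (o X) := T.Ten.mapId ⟨X⟩

/-- A choice of adjunctions `F_Σ f ⊣ F_Δ f`. -/
abbrev Adj := ∀ ⦃X Y : E⦄ (f : X ⟶ Y), Bicategory.Adjunction (T.S f) (T.D f)

variable {T} in
/-- The constraint cells of `F_Δ` are inverse to the conjugates (mates) of those of `F_Σ`, that is,
`F_Δ` is right adjoint to `F_Σ` as a pseudofunctor. -/
def Adj.Compatible (adj : T.Adj) : Prop :=
  (∀ ⦃X Y Z : E⦄ (f : X ⟶ Y) (g : Y ⟶ Z),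
    T.Dc f g ≫ conjugateEquiv ((adj f).comp (adj g)) (adj (f ≫ g)) (T.Sc f g) = 𝟙 _) ∧
  ∀ X : E, T.Di X ≫ conjugateEquiv (Bicategory.Adjunction.id _) (adj (𝟙 X)) (T.Si X) = 𝟙 _

/-- The 2-cell `F_Σ f' ≫ F_Σ g ⟶ F_Σ g' ≫ F_Σ f` induced by a commutative square. -/
noncomputable def sigmaSquare (hS : T.Sig.IsPseudo) {W X Y Z : E} {f' : W ⟶ X} {g' : W ⟶ Y}
    {g : X ⟶ Z} {f : Y ⟶ Z} (w : f' ≫ g = g' ≫ f) :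
    T.S f' ≫ T.S g ⟶ T.S g' ≫ T.S f :=
  haveI : IsIso (T.Sc f' g) := hS.2 f'.toLoc g.toLoc
  inv (T.Sc f' g) ≫ eqToHom (by rw [w]) ≫ T.Sc g' f

variable {T} in
/-- The `F_Σ`-`F_Δ` Beck 2-cell of a square: the mate of the 2-cell induced by the square. -/
noncomputable def Adj.sigmaDeltaBeck (adj : T.Adj) (hS : T.Sig.IsPseudo) {W X Y Z : E}
    {f' : W ⟶ X} {g' : W ⟶ Y} {g : X ⟶ Z} {f : Y ⟶ Z} (w : f' ≫ g = g' ≫ f) :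
    T.D g' ≫ T.S f' ⟶ T.S f ≫ T.D g :=
  mateEquiv (adj g') (adj g) (T.sigmaSquare hS w)

variable {T} in
/-- The distributivity morphism
`F_Δ p ≫ F_⊗ q ≫ F_Σ r ⟶ F_Σ u ≫ F_⊗ f` of a pullback `(p, q, r)` around `(f, u)`. -/
noncomputable def Adj.distributivity (adj : T.Adj) (hD : T.Del.IsPseudo) {X A B : E} {u : X ⟶ A}
    {f : A ⟶ B} (P : PullbackAround u f) :
    (T.D P.p ≫ T.N P.q) ≫ T.S P.r ⟶ T.S u ≫ T.N f :=
  haveI : IsIso (T.Dc P.p u) := hD.2 u.op.toLoc P.p.op.toLoc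
  ((λ_ (T.D P.p)).inv ≫ (adj u).unit ▷ T.D P.p ≫ (α_ _ _ _).hom ≫
      T.S u ◁ inv (T.Dc P.p u)) ▷ T.N P.q ▷ T.S P.r ≫
    ((α_ _ _ _).hom ≫ T.S u ◁ T.beck P.isPullback.flip) ▷ T.S P.r ≫
    (α_ _ _ _).hom ≫ T.S u ◁ ((α_ _ _ _).hom ≫ T.N f ◁ (adj P.r).counit ≫ (ρ_ _).hom)

end RawTriple

/-- A lax Beck triple. -/
structure LaxBeckTriple (o : E → C) extends RawTriple o where
  sig_pseudo : Sig.IsPseudo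
  del_pseudo : Del.IsPseudo
  ten_pseudo : Ten.IsPseudo
  exists_adj : ∃ adj : toRawTriple.Adj, adj.Compatible
  /-- horizontal double pullback condition -/
  beck_horizontal {U V W X Y Z : E} {f₂' : U ⟶ V} {f₁' : V ⟶ W} {g'' : U ⟶ X} {g' : V ⟶ Y}
    {g : W ⟶ Z} {f₂ : X ⟶ Y} {f₁ : Y ⟶ Z} (sq₂ : IsPullback f₂' g'' g' f₂)
    (sq₁ : IsPullback f₁' g' g f₁) :
    toRawTriple.D g'' ◁ toRawTriple.Nc f₂' f₁' ≫ (α_ _ _ _).inv ≫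
        beck sq₂ ▷ toRawTriple.N f₁' ≫ (α_ _ _ _).hom ≫ toRawTriple.N f₂ ◁ beck sq₁ ≫
        (α_ _ _ _).inv =
      beck (sq₂.paste_horiz sq₁) ≫ toRawTriple.Nc f₂ f₁ ▷ toRawTriple.D g
  /-- vertical double pullback condition -/
  beck_vertical {U V W X Y Z : E} {f'' : U ⟶ V} {g₂' : U ⟶ W} {g₂ : V ⟶ X} {f' : W ⟶ X}
    {g₁' : W ⟶ Y} {g₁ : X ⟶ Z} {f : Y ⟶ Z} (sq₂ : IsPullback f'' g₂' g₂ f')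
    (sq₁ : IsPullback f' g₁' g₁ f) :
    beck (sq₂.paste_vert sq₁) ≫ toRawTriple.N f ◁ toRawTriple.Dc g₂ g₁ =
      toRawTriple.Dc g₂' g₁' ▷ toRawTriple.N f'' ≫ (α_ _ _ _).hom ≫
        toRawTriple.D g₁' ◁ beck sq₂ ≫ (α_ _ _ _).inv ≫ beck sq₁ ▷ toRawTriple.D g₂ ≫
        (α_ _ _ _).hom
  /-- horizontal nullary pullback condition -/
  beck_id_horizontal {X Y : E} (f : X ⟶ Y) :
    beck (IsPullback.id_vert f) ≫ toRawTriple.N f ◁ toRawTriple.Di Y ≫ (ρ_ _).hom =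
      toRawTriple.Di X ▷ toRawTriple.N f ≫ (λ_ _).hom
  /-- vertical nullary pullback condition -/
  beck_id_vertical {X Y : E} (g : X ⟶ Y) :
    beck (IsPullback.id_horiz g) ≫ toRawTriple.Ni Y ▷ toRawTriple.D g ≫ (λ_ _).hom =
      toRawTriple.D g ◁ toRawTriple.Ni X ≫ (ρ_ _).hom

namespace LaxBeckTriple

variable {o : E → C}

/-- Morphisms of lax Beck triples; the icon between the `Δ` parts is invertible. -/
@[ext]
structure Hom (T T' : LaxBeckTriple o) where
  raw : T.toRawTriple ⟶ T'.toRawTriple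
  isIso {X Y : LocallyDiscrete Eᵒᵖ} (f : X ⟶ Y) : IsIso (raw.β.app f)

instance : Category (LaxBeckTriple o) where
  Hom := Hom
  id T := ⟨𝟙 _, fun f => IsIso.id _⟩
  comp m n := ⟨m.raw ≫ n.raw, fun f =>
    haveI := m.isIso f
    haveI := n.isIso f
    IsIso.comp_isIso⟩

variable (o) in
/-- The underlying raw triple. -/
def forgetOver : LaxBeckTriple o ⥤ RawTriple o where
  obj T := T.toRawTriple
  map m := m.raw

/-- Beck triples: the `Δ⊗` and the `ΣΔ` Beck 2-cells of pullback squares are invertible.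
(The invertibility of the latter does not depend on the choice of the adjunctions.) -/
def IsBeck (T : LaxBeckTriple o) : Prop :=
  ∃ adj : T.Adj, adj.Compatible ∧
    ∀ ⦃W X Y Z : E⦄ ⦃f' : W ⟶ X⦄ ⦃g' : W ⟶ Y⦄ ⦃g : X ⟶ Z⦄ ⦃f : Y ⟶ Z⦄
      (sq : IsPullback f' g' g f),
      IsIso (T.beck sq) ∧ IsIso (adj.sigmaDeltaBeck T.sig_pseudo sq.w)

/-- Distributive Beck triples: Beck triples for which the distributivity morphisms of all
distributivity pullbacks are invertible. -/
def IsDistBeck (T : LaxBeckTriple o) : Prop :=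
  T.IsBeck ∧ ∃ adj : T.Adj, adj.Compatible ∧
    ∀ ⦃X A B : E⦄ ⦃u : X ⟶ A⦄ ⦃f : A ⟶ B⦄ (P : DistributivityPullback u f),
      IsIso (adj.distributivity T.del_pseudo P.toPullbackAround)

end LaxBeckTriple

end Triple

end PolyCart

namespace PolyCart

open PullbackChoice DistributivityChoice

/-! ### The comparison functor -/

section Comparison

/-- The category of gregarious functors and icons. Icons exist only between functors which agree
on objects, so this is the disjoint union over all actions on objects. -/
abbrev Greg (B : Type u₁) [Bicategory.{w₁, v₁} B] (C : Type u₂) [Bicategory.{w₂, v₂} C] :=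
  Σ o : B → C, ObjectProperty.FullSubcategory (fun F : OplaxOver o => F.IsGregarious)

variable {E : Type u} [Category.{v} E] [PullbackChoice E] [DistributivityChoice E]
  {C : Type u₂} [Bicategory.{w₂, v₂} C]

namespace OplaxOver

variable {o : PolyC E → C} (F : OplaxOver o)

/-- The restriction `F_ΣΔ` to spans. -/
noncomputable abbrev restrictSigmaDelta : OplaxOver (fun X : SpanC E => o ⟨X.as⟩) :=
  F.precomp (spanToPoly E)

/-- The restriction `F_Δ⊗` to spans and invertible morphisms of spans. -/
noncomputable abbrev restrictDeltaTensor : OplaxOver (fun X : Pith (SpanC E) => o ⟨X.as.as⟩) :=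
  F.precomp (spanIsoToPoly E)

/-- The restriction `F_Σ`. -/
noncomputable abbrev restrictSigma : OplaxOver (fun X : LocallyDiscrete E => o ⟨X.as⟩) :=
  F.restrictSigmaDelta.precomp (graphSpan E)

/-- The restriction `F_Δ`. -/
noncomputable abbrev restrictDelta : OplaxOver (fun X : LocallyDiscrete Eᵒᵖ => o ⟨X.as.unop⟩) :=
  F.restrictDeltaTensor.precomp (cographSpanIso E)

/-- The restriction `F_⊗`. -/
noncomputable abbrev restrictTensor : OplaxOver (fun X : LocallyDiscrete E => o ⟨X.as⟩) :=
  F.restrictDeltaTensor.precomp (graphSpanIso E)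

/-- The 2-cell `F (g', f') ⟶ F_Δ g' ≫ F_⊗ f'`. -/
noncomputable def beckIn {W X Y : E} (f' : W ⟶ X) (g' : W ⟶ Y) :
    F.restrictDeltaTensor.map (a := ⟨⟨Y⟩⟩) (b := ⟨⟨X⟩⟩) ⟨⟨W, g', f'⟩⟩ ⟶
      F.restrictDelta.map g'.op.toLoc ≫ F.restrictTensor.map f'.toLoc :=
  F.restrictDeltaTensor.map₂ (CoreHom.mk (spanFactor g' f')) ≫
    F.restrictDeltaTensor.mapComp ((cographSpanIso E).map g'.op.toLoc)
      ((graphSpanIso E).map f'.toLoc)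

/-- The 2-cell `F (g', f') ⟶ F_⊗ f ≫ F_Δ g` of a pullback square. -/
noncomputable def beckOut {W X Y Z : E} {f' : W ⟶ X} {g' : W ⟶ Y} {g : X ⟶ Z} {f : Y ⟶ Z}
    (sq : IsPullback f' g' g f) :
    F.restrictDeltaTensor.map (a := ⟨⟨Y⟩⟩) (b := ⟨⟨X⟩⟩) ⟨⟨W, g', f'⟩⟩ ⟶
      F.restrictTensor.map f.toLoc ≫ F.restrictDelta.map g.op.toLoc :=
  F.restrictDeltaTensor.map₂ (CoreHom.mk (spanBaseChange sq)) ≫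
    F.restrictDeltaTensor.mapComp ((graphSpanIso E).map f.toLoc)
      ((cographSpanIso E).map g.op.toLoc)

lemma isIso_map₂ {B : Type u₁} [Bicategory.{w₁, v₁} B] {o : B → C} (F : OplaxOver o) {a b : B}
    {f g : a ⟶ b} (η : f ⟶ g) [IsIso η] : IsIso (F.map₂ η) :=
  ⟨F.map₂ (inv η), by rw [← F.map₂_comp, IsIso.hom_inv_id, F.map₂_id],
    by rw [← F.map₂_comp, IsIso.inv_hom_id, F.map₂_id]⟩

lemma isIso_beckIn (hF : F.IsGregarious) {W X Y : E} (f' : W ⟶ X) (g' : W ⟶ Y) :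
    IsIso (F.beckIn f' g') := by
  have h₁ : IsIso (F.restrictDeltaTensor.map₂ (a := ⟨⟨Y⟩⟩) (b := ⟨⟨X⟩⟩)
    (CoreHom.mk (spanFactor g' f'))) := isIso_map₂ _ _
  have h₂ := F.isIso_mapComp_of_adj ((spanToPoly E).mapAdjunction (spanAdj g')) hF
    ((spanIsoToPoly E).map ((graphSpanIso E).map f'.toLoc))
  have h₃ : IsIso (F.restrictDeltaTensor.mapComp ((cographSpanIso E).map g'.op.toLoc)
      ((graphSpanIso E).map f'.toLoc)) := by
    have := F.isIso_map₂ ((spanIsoToPoly E).mapComp ((cographSpanIso E).map g'.op.toLoc)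
      ((graphSpanIso E).map f'.toLoc)).hom
    exact @IsIso.comp_isIso _ _ _ _ _ _ _ this h₂
  exact @IsIso.comp_isIso _ _ _ _ _ _ _ h₁ h₃

/-- The Beck 2-cells of a gregarious functor: the inverse of a constraint cell, followed by the
image of the canonical isomorphism of pullbacks and by a constraint cell. -/
noncomputable def beck (hF : F.IsGregarious) {W X Y Z : E} {f' : W ⟶ X} {g' : W ⟶ Y} {g : X ⟶ Z}
    {f : Y ⟶ Z} (sq : IsPullback f' g' g f) :
    F.restrictDelta.map g'.op.toLoc ≫ F.restrictTensor.map f'.toLoc ⟶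
      F.restrictTensor.map f.toLoc ≫ F.restrictDelta.map g.op.toLoc :=
  haveI := F.isIso_beckIn hF f' g'
  inv (F.beckIn f' g') ≫ F.beckOut sq

/-- The triple `(F_Σ, F_Δ, F_⊗)` with its Beck 2-cells. -/
noncomputable def triple (hF : F.IsGregarious) : RawTriple (fun X : E => o ⟨X⟩) where
  Sig := F.restrictSigma
  Del := F.restrictDelta
  Ten := F.restrictTensor
  beck := F.beck hF

lemma app_map₂_mapComp {B : Type u₁} [Bicategory.{w₁, v₁} B] {o : B → C} {F G : OplaxOver o}
    (κ : F ⟶ G) {a b c : B} {h : a ⟶ c} {f : a ⟶ b} {g : b ⟶ c} (η : h ⟶ f ≫ g) :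
    κ.app h ≫ G.map₂ η ≫ G.mapComp f g =
      (F.map₂ η ≫ F.mapComp f g) ≫ κ.app f ▷ F.map g ≫ G.map f ◁ κ.app g := by
  rw [← Category.assoc, ← κ.naturality, Category.assoc, κ.mapComp, Category.assoc]

lemma inv_comp_aux {D : Type u₁} [Category.{v₁} D] {a a' b b' c c' : D} {k : a ⟶ a'} {i : a ⟶ b}
    {i' : a' ⟶ b'} {j : a ⟶ c} {j' : a' ⟶ c'} {x : b ⟶ b'} {y : c ⟶ c'} [IsIso i] [IsIso i']
    (e₁ : k ≫ i' = i ≫ x) (e₂ : k ≫ j' = j ≫ y) :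
    x ≫ inv i' ≫ j' = (inv i ≫ j) ≫ y := by
  rw [Category.assoc, ← e₂, IsIso.eq_inv_comp, ← reassoc_of% e₁, IsIso.hom_inv_id_assoc]

/-- The action of icons on the associated triples. -/
noncomputable def tripleMap {F G : OplaxOver o} (hF : F.IsGregarious) (hG : G.IsGregarious)
    (κ : F ⟶ G) : F.triple hF ⟶ G.triple hG where
  β := precompMap (cographSpanIso E) (precompMap (spanIsoToPoly E) κ)
  γ := precompMap (graphSpanIso E) (precompMap (spanIsoToPoly E) κ)
  comm {W X Y Z f' g' g f} sq := by
    have h₁ := F.isIso_beckIn hF f' g'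
    have h₂ := G.isIso_beckIn hG f' g'
    have e₁ := app_map₂_mapComp (precompMap (spanIsoToPoly E) κ) (a := ⟨⟨Y⟩⟩) (b := ⟨⟨W⟩⟩)
      (c := ⟨⟨X⟩⟩) (h := ⟨⟨W, g', f'⟩⟩) (f := (cographSpanIso E).map g'.op.toLoc)
      (g := (graphSpanIso E).map f'.toLoc) (CoreHom.mk (spanFactor g' f'))
    have e₂ := app_map₂_mapComp (precompMap (spanIsoToPoly E) κ) (a := ⟨⟨Y⟩⟩) (b := ⟨⟨Z⟩⟩)
      (c := ⟨⟨X⟩⟩) (h := ⟨⟨W, g', f'⟩⟩) (f := (graphSpanIso E).map f.toLoc)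
      (g := (cographSpanIso E).map g.op.toLoc) (CoreHom.mk (spanBaseChange sq))
    exact inv_comp_aux (i := F.beckIn f' g') (i' := G.beckIn f' g') (j := F.beckOut sq)
      (j' := G.beckOut sq) e₁ e₂

end OplaxOver

end Comparison

end PolyCart

namespace PolyCart

section Main

variable (E : Type u) [Category.{v} E] [PullbackChoice E] [DistributivityChoice E]
  (C : Type u₂) [Bicategory.{w₂, v₂} C]

variable {E C} in
/-- The triples associated with gregarious functors having a given action on objects. -/
noncomputable def comparisonOver (o : PolyC E → C) :
    ObjectProperty.FullSubcategory (fun F : OplaxOver o => F.IsGregarious) ⥤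
      RawTriple (fun X : E => o ⟨X⟩) where
  obj F := F.obj.triple F.property
  map {F G} κ := OplaxOver.tripleMap F.property G.property κ.hom

/-- The assignment of `(F_Σ, F_Δ, F_⊗)` with its Beck 2-cells to a gregarious functor `F`. -/
noncomputable def comparison : Greg (PolyC E) C ⥤ Σ o : E → C, RawTriple o :=
  CategoryTheory.Sigma.desc fun o =>
    comparisonOver o ⋙ CategoryTheory.Sigma.incl (C := fun o : E → C => RawTriple o)
      (fun X => o ⟨X⟩)

/-- The category of lax Beck triples. -/
abbrev LaxBeckTriples := Σ o : E → C, LaxBeckTriple o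

/-- The inclusion of lax Beck triples into raw triples; it is faithful and injective on objects. -/
def LaxBeckTriples.forget : LaxBeckTriples E C ⥤ Σ o : E → C, RawTriple o :=
  CategoryTheory.Sigma.desc fun o =>
    LaxBeckTriple.forgetOver o ⋙ CategoryTheory.Sigma.incl (C := fun o : E → C => RawTriple o) o

/-- Beck triples. -/
def LaxBeckTriples.beck : ObjectProperty (LaxBeckTriples E C) := fun T => T.2.IsBeck

/-- Distributive Beck triples. -/
def LaxBeckTriples.distBeck : ObjectProperty (LaxBeckTriples E C) := fun T => T.2.IsDistBeck

/-- The gregarious functors `F` whose restriction `F_⊗` is pseudo. -/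
def gregTensor : ObjectProperty (Greg (PolyC E) C) := fun F => F.2.obj.restrictTensor.IsPseudo

/-- The category of gregarious functors `F` for which `F_⊗` is pseudo, and icons. -/
abbrev GregTensor := (gregTensor E C).FullSubcategory

/-- The gregarious functors `F` whose restrictions `F_ΣΔ` and `F_Δ⊗` are pseudo. -/
def GregTensor.sigmaDeltaTensor : ObjectProperty (GregTensor E C) := fun F =>
  F.obj.2.obj.restrictSigmaDelta.IsPseudo ∧ F.obj.2.obj.restrictDeltaTensor.IsPseudo

/-- The pseudofunctors. -/
def GregTensor.pseudo : ObjectProperty (GregTensor E C) := fun F => F.obj.2.obj.IsPseudo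

/-- A functor restricts to an equivalence between full subcategories. -/
def RestrictsToEquivalence {A : Type u₁} [Category.{v₁} A] {B : Type u₂} [Category.{v₂} B]
    (F : A ⥤ B) (P : ObjectProperty A) (Q : ObjectProperty B) : Prop :=
  ∃ h : ∀ X : P.FullSubcategory, Q ((P.ι ⋙ F).obj X), (Q.lift (P.ι ⋙ F) h).IsEquivalence

end Main

/-! ### Pseudofunctors and pseudo restrictions -/

section Pseudo

namespace OplaxOver

lemma IsPseudo.isGregarious {B : Type u₁} [Bicategory.{w₁, v₁} B] {C : Type u₂}
    [Bicategory.{w₂, v₂} C] {o : B → C} {F : OplaxOver o} (h : F.IsPseudo) : F.IsGregarious :=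
  ⟨h.1, fun _ _ _ f g _ => h.2 f g⟩

lemma IsPseudo.precomp {A : Type u₃} [Bicategory.{w₃, v₃} A] {B : Type u₁} [Bicategory.{w₁, v₁} B]
    {C : Type u₂} [Bicategory.{w₂, v₂} C] {o : B → C} {F : OplaxOver o} (h : F.IsPseudo)
    (K : A ⥤ᵖ B) : (F.precomp K).IsPseudo := by
  refine ⟨fun a => ?_, fun a b c f g => ?_⟩
  · have h₂ := F.isIso_map₂ (K.mapId a).hom
    exact @IsIso.comp_isIso _ _ _ _ _ _ _ h₂ (h.1 (K.obj a))
  · have h₂ := F.isIso_map₂ (K.mapComp f g).hom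
    exact @IsIso.comp_isIso _ _ _ _ _ _ _ h₂ (h.2 (K.map f) (K.map g))

variable {E : Type u} [Category.{v} E] [PullbackChoice E] [DistributivityChoice E]
  {C : Type u₂} [Bicategory.{w₂, v₂} C]

/-- The condition defining `GregTensor` holds for all functors with `F_Δ⊗` pseudo. -/
lemma isPseudo_restrictTensor {o : PolyC E → C} {F : OplaxOver o}
    (h : F.restrictDeltaTensor.IsPseudo) : F.restrictTensor.IsPseudo := h.precomp _

end OplaxOver

end Pseudo

end PolyCart

/-! A polynomial `(s, p, t)` is the composite of `Δ_s`, `⊗_p` and `Σ_t`, and `Σ_f` is left adjoint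
to `Δ_f`. The constraint cell of a gregarious functor is invertible when its second 1-cell is a left
adjoint or its first 1-cell is a right adjoint, so `F (s, p, t)` is isomorphic to `F_Δ s ≫ F_⊗ p ≫
F_Σ t` (`expand`, `isIso_expand`). The 1-cells of `F` are thus determined by its triple. So are the
2-cells. A cartesian morphism `(σ, ν)` acts by splitting off `F_Δ σ`, sliding it past `F_⊗` with a
Beck cell to become `F_Δ ν`, and cancelling this against `F_Σ ν` with a counit (`expand_map₂`). A
constraint cell splits `F_⊗` along a factorization of the middle map and inserts the unit of some
`F_Σ h ⊣ F_Δ h` in between (`expand_split`).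

What makes this computable is the universal property of composition: a morphism `X ⟶ P;Q` is
represented by a factorization of the middle map of `X` together with morphisms of the two halves to
`P` and `Q`. By a Yoneda argument, natural constraint cells amount to comultiplications `F X ⟶ F
(left) ≫ F (right)`, one for each factorization, coassociative for factorizations into three maps
and counital for the two trivial ones (`SplitFunctor`). In this form no distributivity pullback
occurs. Every cell built from constraints is a comultiplication followed by images of morphisms
(`cut`), and relations between such cells are instances of coassociativity (`cut_cut`).

From functors to triples, a Beck cell is the cut `bOut` divided by the invertible cut `bIn`, and the
axioms of a lax Beck triple become coassociativity after cancelling `bIn`. From triples to functors,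
`realize` defines the action and the comultiplications by the formulas above: functoriality on
2-cells is the vertical pasting axiom (`mapCell_comp`), naturality of the comultiplications is the
horizontal one together with a triangle identity (`mapCell_splitCell`). The result is gregarious
since the left adjoints among polynomials are, up to isomorphism, the `Σ_f`
(`isIso_of_isLeftAdjoint`), where the constraint cell reduces to one of `F_Σ`.

Essential surjectivity holds because `realize` gives back the original `F_Δ` and `F_⊗` up to
isomorphism (`ofFunctorTriple`). Full faithfulness holds because the comparison `recover` between a
gregarious functor and the realization of its triple is invertible and natural in icons: the
component of an icon at `Σ_f` is the mate of the inverse of its component at `Δ_f`, so the `Δ` and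
`⊗` components determine the rest.

For the two restrictions, pullbacks compute the composites of `⊗_f` or `Σ_f` with `Δ_g`, and
distributivity pullbacks compute those of `Σ_u` with `⊗_f`. Hence the Beck cells, the `ΣΔ` mates and
the distributivity cells are, up to isomorphisms, the constraint cells at these three kinds of
pairs. Decomposing arbitrary polynomials, the coherence of the constraints shows that these cells
control all others. -/

namespace PolyCart

open PullbackChoice DistributivityChoice PolyCart.Poly

/-! ### Oplax functors on polynomials in terms of factorizations -/

section SplitFunctor

variable {E : Type u} [Category.{v} E] {C : Type u₂} [Bicategory.{w₂, v₂} C]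

/-- A presentation of an oplax functor on polynomials: its constraint cells are encoded by a
comultiplication for each factorization of the middle map of a polynomial. -/
structure SplitFunctor (o : E → C) where
  map {I J : E} (P : Poly I J) : o I ⟶ o J
  map₂ {I J : E} {P Q : Poly I J} (ρ : P ⟶ Q) : map P ⟶ map Q
  split {I J K : E} {X : Poly I K} (A : Split X J) : map X ⟶ map A.left ≫ map A.right
  counit (I : E) : map (one I) ⟶ 𝟙 (o I)
  map₂_id {I J : E} (P : Poly I J) : map₂ (𝟙 P) = 𝟙 (map P)
  map₂_comp {I J : E} {P Q R : Poly I J} (ρ : P ⟶ Q) (τ : Q ⟶ R) :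
    map₂ (ρ ≫ τ) = map₂ ρ ≫ map₂ τ
  split_natural {I J K : E} {X X' : Poly I K} {ρ : X ⟶ X'} {A : Split X J} {A' : Split X' J}
    (m : Split.Map ρ A A') :
    map₂ ρ ≫ split A' = split A ≫ map₂ m.left ▷ map A.right ≫ map A'.left ◁ map₂ m.right
  split_assoc {I J K L : E} {X : Poly I L} (s : Split3 X J K) :
    split s.A ≫ split s.A₁ ▷ map s.A.right ≫ (α_ _ _ _).hom =
      split s.B ≫ map s.B.left ◁ split s.B₁
  left_counit {I J : E} (P : Poly I J) :
    split (splitL P) ≫ (map₂ (εl P) ≫ counit I) ▷ map P ≫ (λ_ _).hom = 𝟙 (map P)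
  right_counit {I J : E} (P : Poly I J) :
    split (splitR P) ≫ map P ◁ (map₂ (εr P) ≫ counit J) ≫ (ρ_ _).hom = 𝟙 (map P)

namespace SplitFunctor

variable {o : E → C} (G : SplitFunctor o) {I J K L : E}

lemma isIso_map₂ {P Q : Poly I J} (ρ : P ⟶ Q) [IsIso ρ] : IsIso (G.map₂ ρ) :=
  ⟨G.map₂ (inv ρ), by rw [← G.map₂_comp, IsIso.hom_inv_id, G.map₂_id],
    by rw [← G.map₂_comp, IsIso.inv_hom_id, G.map₂_id]⟩

/-- The 2-cell induced by a factorization and maps out of its halves. -/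
def cut {X : Poly I K} {P : Poly I J} {Q : Poly J K} (A : Split X J) (a : A.left ⟶ P)
    (b : A.right ⟶ Q) : G.map X ⟶ G.map P ≫ G.map Q :=
  G.split A ≫ G.map₂ a ▷ G.map A.right ≫ G.map P ◁ G.map₂ b

variable {X X' : Poly I K} {P P' : Poly I J} {Q Q' : Poly J K}

lemma cut_id (A : Split X J) : G.cut A (𝟙 _) (𝟙 _) = G.split A := by
  simp [cut, G.map₂_id]

lemma cut_map₂ (A : Split X J) (a : A.left ⟶ P) (b : A.right ⟶ Q) (f : P ⟶ P') (g : Q ⟶ Q') :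
    G.cut A a b ≫ G.map₂ f ▷ G.map Q ≫ G.map P' ◁ G.map₂ g = G.cut A (a ≫ f) (b ≫ g) := by
  simp only [cut, Category.assoc, G.map₂_comp, comp_whiskerRight, whiskerLeft_comp]
  rw [whisker_exchange_assoc]

lemma map₂_cut {ρ : X ⟶ X'} {A : Split X J} {A' : Split X' J} (m : Split.Map ρ A A')
    (a : A'.left ⟶ P) (b : A'.right ⟶ Q) :
    G.map₂ ρ ≫ G.cut A' a b = G.cut A (m.left ≫ a) (m.right ≫ b) := by
  rw [cut, ← Category.assoc, G.split_natural m, ← G.cut_map₂]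
  rfl

/-- Coassociativity with morphisms applied to the three pieces: all of them can be postponed, by the
interchange law, until after both comultiplications. The identities stand on the half that is still
to be cut. -/
lemma cut_assoc {X : Poly I L} {R : Poly K L} (s : Split3 X J K) (a : s.A₁.left ⟶ P)
    (b : s.A₁.right ⟶ Q) (c : s.A.right ⟶ R) :
    G.cut s.A (𝟙 _) c ≫ G.cut s.A₁ a b ▷ G.map R ≫ (α_ _ _ _).hom =
      G.cut s.B a (𝟙 _) ≫ G.map P ◁ G.cut s.B₁ b c := by
  have h := G.split_assoc s
  calc
    _ = (G.split s.A ≫ G.split s.A₁ ▷ G.map s.A.right ≫ (α_ _ _ _).hom) ≫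
        G.map₂ a ▷ (G.map s.A₁.right ≫ G.map s.A.right) ≫ G.map P ◁
          (G.map₂ b ▷ G.map s.A.right ≫ G.map Q ◁ G.map₂ c) := by
      simp only [cut, Category.assoc, G.map₂_id, id_whiskerRight, Category.id_comp,
        comp_whiskerRight, whiskerLeft_comp, whisker_assoc, whiskerRight_comp,
        Iso.inv_hom_id, Iso.hom_inv_id_assoc, Category.comp_id]
      rw [whisker_exchange_assoc, whisker_exchange_assoc]
      simp only [comp_whiskerLeft, Category.assoc, Iso.inv_hom_id_assoc, ← whiskerLeft_comp,
        whisker_exchange]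
    _ = _ := by
      rw [h]
      simp only [cut, Category.assoc, G.map₂_id, whiskerLeft_id, Category.comp_id,
        whiskerLeft_comp]
      rw [whisker_exchange_assoc]

/-- Families of 2-cells compatible with comultiplications. -/
structure Hom (G G' : SplitFunctor o) where
  app {I J : E} (P : Poly I J) : G.map P ⟶ G'.map P
  natural {I J : E} {P Q : Poly I J} (ρ : P ⟶ Q) : G.map₂ ρ ≫ app Q = app P ≫ G'.map₂ ρ
  counit (I : E) : app (one I) ≫ G'.counit I = G.counit I
  split {I J K : E} {X : Poly I K} (A : Split X J) :
    app X ≫ G'.split A = G.split A ≫ app A.left ▷ G.map A.right ≫ G'.map A.left ◁ app A.right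

lemma Hom.app_cut {G G' : SplitFunctor o} (m : Hom G G') (A : Split X J) (a : A.left ⟶ P)
    (b : A.right ⟶ Q) :
    m.app X ≫ G'.cut A a b = G.cut A a b ≫ m.app P ▷ G.map Q ≫ G'.map P ◁ m.app Q := by
  rw [cut, ← Category.assoc, m.split, cut]
  simp only [Category.assoc]
  rw [whisker_exchange_assoc, whisker_exchange_assoc, ← whiskerLeft_comp, ← whiskerLeft_comp,
    ← m.natural, ← comp_whiskerRight_assoc, ← comp_whiskerRight_assoc, ← m.natural]

section Oplax

variable [PullbackChoice E] [DistributivityChoice E]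

/-- This is the Yoneda step. By `rep_lift`, the morphism `lift A a b` underlies a map of
factorizations from `A` to the canonical one, whose halves followed by the projections are `a` and
`b`. Naturality therefore derives every cut from the one at the canonical factorization of a
composite. -/
lemma map₂_lift_cut (A : Split X J) (a : A.left ⟶ P) (b : A.right ⟶ Q) :
    G.map₂ (lift A a b) ≫ G.cut (U P Q) (πl P Q) (πr P Q) = G.cut A a b := by
  obtain ⟨m, h₁, h₂⟩ := rep_lift A a b
  rw [G.map₂_cut m, h₁, h₂]

/-- The constraint cells determined by the comultiplications. -/
noncomputable def mapComp (P : Poly I J) (Q : Poly J K) :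
    G.map (comp P Q) ⟶ G.map P ≫ G.map Q := G.cut (U P Q) (πl P Q) (πr P Q)

lemma map₂_lift_mapComp (A : Split X J) (a : A.left ⟶ P) (b : A.right ⟶ Q) :
    G.map₂ (lift A a b) ≫ G.mapComp P Q = G.cut A a b := G.map₂_lift_cut A a b

lemma mapComp_natural (f : P ⟶ P') (g : Q ⟶ Q') :
    G.map₂ (hcomp f g) ≫ G.mapComp P' Q' =
      G.mapComp P Q ≫ G.map₂ f ▷ G.map Q ≫ G.map P' ◁ G.map₂ g := by
  rw [hcomp, map₂_lift_mapComp, mapComp, cut_map₂]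

lemma map₂_lHom (P : Poly I J) :
    G.map₂ (lHom P) = G.mapComp (one _) P ≫ G.counit _ ▷ G.map P ≫ (λ_ _).hom := by
  have h' : IsIso (G.map₂ (lInv P)) :=
    haveI : IsIso (lInv P) := ⟨lHom P, lInv_lHom P, lHom_lInv P⟩
    G.isIso_map₂ _
  -- The inverse unitor is a `lift` from the trivial factorization `splitL P`, so precomposing with
  -- its invertible image turns the claim into `left_counit`.
  rw [← cancel_epi (G.map₂ (lInv P)), ← G.map₂_comp, lInv_lHom, G.map₂_id, ← Category.assoc, lInv,
    map₂_lift_mapComp, ← G.left_counit P]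
  simp only [cut, Category.assoc, G.map₂_id, whiskerLeft_id, Category.id_comp,
    comp_whiskerRight]

lemma map₂_rHom (P : Poly I J) :
    G.map₂ (rHom P) = G.mapComp P (one _) ≫ G.map P ◁ G.counit _ ≫ (ρ_ _).hom := by
  have h' : IsIso (G.map₂ (rInv P)) :=
    haveI : IsIso (rInv P) := ⟨rHom P, rInv_rHom P, rHom_rInv P⟩
    G.isIso_map₂ _
  rw [← cancel_epi (G.map₂ (rInv P)), ← G.map₂_comp, rInv_rHom, G.map₂_id, ← Category.assoc, rInv,
    map₂_lift_mapComp, ← G.right_counit P]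
  simp only [cut, Category.assoc, G.map₂_id, id_whiskerRight, Category.id_comp,
    whiskerLeft_comp]

/-- The oplax functor determined by its comultiplications. -/
noncomputable def toOplaxOver : OplaxOver (fun X : PolyC E => o X.as) where
  map P := G.map P
  map₂ ρ := G.map₂ ρ
  mapId I := G.counit I.as
  mapComp P Q := G.mapComp P Q
  map₂_id P := G.map₂_id P
  map₂_comp ρ τ := G.map₂_comp ρ τ
  mapComp_naturality_left η Q := by
    refine (G.mapComp_natural η (𝟙 _)).trans ?_
    rw [G.map₂_id, whiskerLeft_id, Category.comp_id]
  mapComp_naturality_right P _ _ η := by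
    refine (G.mapComp_natural (𝟙 _) η).trans ?_
    rw [G.map₂_id, id_whiskerRight, Category.id_comp]
  map₂_associator P Q R := by
    -- The identity of the triple composite is itself a `lift` from a factorization into three maps.
    -- This rewrites all constraint cells as cuts at `s`, and `αHom` as the passage from one
    -- bracketing of `s` to the other.
    obtain ⟨s, a, b, c, e⟩ := exists_id_eq_lift_left P Q R
    have e₁ : G.map₂ (αHom P Q R) ≫ G.mapComp P (comp Q R) = G.cut s.B a (lift s.B₁ b c) := by
      have h : αHom P Q R = lift s.B a (lift s.B₁ b c) := by
        rw [← lift_αHom s a b c, ← e, Category.id_comp]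
      rw [h, map₂_lift_mapComp]
    have e₂ : G.mapComp (comp P Q) R = G.cut s.A (lift s.A₁ a b) c := by
      rw [← Category.id_comp (G.mapComp _ _), ← G.map₂_id, e, map₂_lift_mapComp]
    have e₃ : G.cut s.B a (lift s.B₁ b c) =
        G.cut s.B a (𝟙 _) ≫ G.map P ◁ G.map₂ (lift s.B₁ b c) := by
      have := G.cut_map₂ s.B a (𝟙 _) (𝟙 _) (lift s.B₁ b c)
      rw [G.map₂_id, id_whiskerRight, Category.id_comp, Category.comp_id, Category.id_comp] at this
      exact this.symm
    have e₄ : G.cut s.A (lift s.A₁ a b) c =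
        G.cut s.A (𝟙 _) c ≫ G.map₂ (lift s.A₁ a b) ▷ G.map R := by
      have := G.cut_map₂ s.A (𝟙 _) c (lift s.A₁ a b) (𝟙 _)
      rw [G.map₂_id, whiskerLeft_id, Category.comp_id, Category.comp_id, Category.id_comp] at this
      exact this.symm
    change G.map₂ (αHom P Q R) ≫ G.mapComp P (comp Q R) ≫ G.map P ◁ G.mapComp Q R =
      G.mapComp (comp P Q) R ≫ G.mapComp P Q ▷ G.map R ≫ _
    rw [← Category.assoc, e₁, e₂, e₃, e₄, Category.assoc, Category.assoc, ← whiskerLeft_comp,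
      ← comp_whiskerRight_assoc, map₂_lift_mapComp, map₂_lift_mapComp]
    exact (G.cut_assoc s a b c).symm
  map₂_leftUnitor P := G.map₂_lHom P
  map₂_rightUnitor P := G.map₂_rHom P

end Oplax

end SplitFunctor

end SplitFunctor

/-! ### The comultiplications of a given oplax functor -/

section ToSplit

variable {E : Type u} [Category.{v} E] [PullbackChoice E] [DistributivityChoice E]
  {C : Type u₂} [Bicategory.{w₂, v₂} C] {o : PolyC E → C} (F : OplaxOver o) {I J K L : E}

namespace OplaxOver

/-- The image of a polynomial. -/
abbrev polyMap (P : Poly I J) : o ⟨I⟩ ⟶ o ⟨J⟩ := F.map (a := ⟨I⟩) (b := ⟨J⟩) P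

abbrev polyMap₂ {P Q : Poly I J} (ρ : P ⟶ Q) : F.polyMap P ⟶ F.polyMap Q :=
  F.map₂ (a := ⟨I⟩) (b := ⟨J⟩) ρ

abbrev polyMapComp (P : Poly I J) (Q : Poly J K) :
    F.polyMap (comp P Q) ⟶ F.polyMap P ≫ F.polyMap Q :=
  F.mapComp (a := ⟨I⟩) (b := ⟨J⟩) (c := ⟨K⟩) P Q

variable {X : Poly I K} {P P' : Poly I J} {Q Q' : Poly J K}

lemma polyMap₂_comp {P Q R : Poly I J} (ρ : P ⟶ Q) (τ : Q ⟶ R) :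
    F.polyMap₂ (ρ ≫ τ) = F.polyMap₂ ρ ≫ F.polyMap₂ τ :=
  F.map₂_comp (a := ⟨I⟩) (b := ⟨J⟩) ρ τ

lemma polyMap₂_id (P : Poly I J) : F.polyMap₂ (𝟙 P) = 𝟙 _ :=
  F.map₂_id (a := ⟨I⟩) (b := ⟨J⟩) P

lemma polyMapComp_natural (f : P ⟶ P') (g : Q ⟶ Q') :
    F.polyMap₂ (hcomp f g) ≫ F.polyMapComp P' Q' =
      F.polyMapComp P Q ≫ F.polyMap₂ f ▷ F.polyMap Q ≫ F.polyMap P' ◁ F.polyMap₂ g := by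
  have h : hcomp f g = hcomp f (𝟙 Q) ≫ hcomp (𝟙 P') g := by
    rw [hcomp_comp, Category.comp_id, Category.id_comp]
  rw [h, polyMap₂_comp, Category.assoc]
  have e₁ := F.mapComp_naturality_left (a := ⟨I⟩) (b := ⟨J⟩) (c := ⟨K⟩) f Q
  have e₂ := F.mapComp_naturality_right (a := ⟨I⟩) (b := ⟨J⟩) (c := ⟨K⟩) P' g
  refine (congrArg (_ ≫ ·) e₂).trans ?_
  rw [← Category.assoc]
  exact (congrArg (· ≫ _) e₁).trans (Category.assoc _ _ _)

/-- A `lift` with halves `a`, `b` is the `lift` with identity halves followed by `hcomp a b`, and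
constraint cells are natural. So the cells with identity halves already carry all the information.
-/
lemma polyMap₂_lift (A : Split X J) (a : A.left ⟶ P) (b : A.right ⟶ Q) :
    F.polyMap₂ (lift A a b) ≫ F.polyMapComp P Q =
      (F.polyMap₂ (lift A (𝟙 _) (𝟙 _)) ≫ F.polyMapComp _ _) ≫
        F.polyMap₂ a ▷ F.polyMap A.right ≫ F.polyMap P ◁ F.polyMap₂ b := by
  rw [Category.assoc, ← polyMapComp_natural, ← Category.assoc, ← polyMap₂_comp, lift_hcomp,
    Category.id_comp, Category.id_comp]

/-- The comultiplications of an oplax functor on polynomials. -/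
noncomputable def toSplit : SplitFunctor (fun X : E => o ⟨X⟩) where
  map P := F.polyMap P
  map₂ ρ := F.polyMap₂ ρ
  split A := F.polyMap₂ (lift A (𝟙 _) (𝟙 _)) ≫ F.polyMapComp _ _
  counit I := F.mapId ⟨I⟩
  map₂_id P := F.polyMap₂_id P
  map₂_comp ρ τ := F.polyMap₂_comp ρ τ
  split_natural m := by
    rw [← polyMap₂_lift, ← Category.assoc, ← polyMap₂_comp, comp_lift m, Category.comp_id,
      Category.comp_id]
  split_assoc {I J K L X} s := by
    -- With identity halves, `αHom` exchanges the two iterated lifts. The associativity coherence of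
    -- `F` at the three pieces is then the required equation.
    have e₁ := lift_αHom s (𝟙 _) (𝟙 _) (𝟙 _)
    have e₂ := F.polyMap₂_lift s.A (lift s.A₁ (𝟙 _) (𝟙 _)) (𝟙 _)
    have e₃ := F.polyMap₂_lift s.B (𝟙 _) (lift s.B₁ (𝟙 _) (𝟙 _))
    have e₄ := F.map₂_associator (a := ⟨I⟩) (b := ⟨J⟩) (c := ⟨K⟩) (d := ⟨L⟩) s.A₁.left s.A₁.right
      s.A.right
    have e₅ : F.polyMap₂ (lift s.A (lift s.A₁ (𝟙 _) (𝟙 _)) (𝟙 _)) ≫ F.polyMap₂ (αHom _ _ _) =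
        F.polyMap₂ (lift s.B (𝟙 _) (lift s.B₁ (𝟙 _) (𝟙 _))) := by
      rw [← polyMap₂_comp, e₁]
    rw [polyMap₂_id, whiskerLeft_id, Category.comp_id] at e₂
    rw [polyMap₂_id, id_whiskerRight, Category.id_comp] at e₃
    rw [comp_whiskerRight_assoc, ← Category.assoc]
    refine (congrArg (· ≫ F.polyMapComp s.A₁.left s.A₁.right ▷ F.polyMap s.A.right ≫
      (α_ _ _ _).hom) e₂.symm).trans ?_
    rw [whiskerLeft_comp]
    refine Eq.trans ?_ ((congrArg (· ≫ F.polyMap s.B.left ◁ F.polyMapComp s.B₁.left s.B₁.right)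
      e₃).trans (Category.assoc _ _ _))
    rw [Category.assoc, Category.assoc, ← e₅, Category.assoc]
    exact congrArg (F.polyMap₂ _ ≫ ·) e₄.symm
  left_counit {I J} P := by
    have e := F.map₂_leftUnitor (a := ⟨I⟩) (b := ⟨J⟩) P
    have e₂ := F.polyMap₂_lift (splitL P) (εl P) (𝟙 P)
    rw [polyMap₂_id, whiskerLeft_id, Category.comp_id] at e₂
    rw [comp_whiskerRight_assoc, ← Category.assoc]
    refine (congrArg (· ≫ F.mapId ⟨I⟩ ▷ F.polyMap P ≫ (λ_ (F.polyMap P)).hom) e₂.symm).trans ?_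
    rw [Category.assoc]
    refine (congrArg (F.polyMap₂ _ ≫ ·) e.symm).trans ?_
    refine (F.polyMap₂_comp (lInv P) (lHom P)).symm.trans ?_
    rw [lInv_lHom, polyMap₂_id]
  right_counit {I J} P := by
    have e := F.map₂_rightUnitor (a := ⟨I⟩) (b := ⟨J⟩) P
    have e₂ := F.polyMap₂_lift (splitR P) (𝟙 P) (εr P)
    rw [polyMap₂_id, id_whiskerRight, Category.id_comp] at e₂
    rw [whiskerLeft_comp_assoc, ← Category.assoc]
    refine (congrArg (· ≫ F.polyMap P ◁ F.mapId ⟨J⟩ ≫ (ρ_ (F.polyMap P)).hom) e₂.symm).trans ?_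
    rw [Category.assoc]
    refine (congrArg (F.polyMap₂ _ ≫ ·) e.symm).trans ?_
    refine (F.polyMap₂_comp (rInv P) (rHom P)).symm.trans ?_
    rw [rInv_rHom, polyMap₂_id]

/-- The bridge to actual constraint cells: a cut differs from one by the image of `lift A a b`.
Whenever this `lift` is invertible, the cut is invertible exactly when the constraint cell is. -/
lemma cut_eq (A : Split X J) (a : A.left ⟶ P) (b : A.right ⟶ Q) :
    F.toSplit.cut A a b = F.polyMap₂ (lift A a b) ≫ F.polyMapComp P Q :=
  (F.polyMap₂_lift A a b).symm

lemma polyMapComp_eq (P : Poly I J) (Q : Poly J K) :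
    F.polyMapComp P Q = F.toSplit.mapComp P Q := by
  rw [SplitFunctor.mapComp, cut_eq, ← id_eq_lift, polyMap₂_id, Category.id_comp]

/-- A family of 2-cells compatible with comultiplications is an icon. -/
def iconOfSplit {F G : OplaxOver o} (m : F.toSplit.Hom G.toSplit) : F ⟶ G where
  app {a b} P := m.app (I := a.as) (J := b.as) P
  naturality ρ := m.natural ρ
  mapId a := m.counit a.as
  mapComp {a b c} P Q := by
    refine (congrArg (_ ≫ ·) (G.polyMapComp_eq (I := a.as) (J := b.as) (K := c.as) P Q)).trans ?_
    refine Eq.trans ?_ (congrArg (· ≫ m.app (I := a.as) (J := b.as) P ▷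
        F.polyMap (I := b.as) (J := c.as) Q ≫
          G.polyMap (I := a.as) (J := b.as) P ◁ m.app (I := b.as) (J := c.as) Q)
      (F.polyMapComp_eq (I := a.as) (J := b.as) (K := c.as) P Q)).symm
    exact m.app_cut _ _ _

/-- Icons are compatible with comultiplications. -/
lemma icon_cut {F G : OplaxOver o} (κ : F ⟶ G) (A : Split X J) (a : A.left ⟶ P)
    (b : A.right ⟶ Q) :
    κ.app (a := ⟨I⟩) (b := ⟨K⟩) X ≫ G.toSplit.cut A a b = F.toSplit.cut A a b ≫
      κ.app (a := ⟨I⟩) (b := ⟨J⟩) P ▷ F.polyMap Q ≫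
        G.polyMap P ◁ κ.app (a := ⟨J⟩) (b := ⟨K⟩) Q := by
  rw [cut_eq, cut_eq]
  exact app_map₂_mapComp κ (a := ⟨I⟩) (b := ⟨J⟩) (c := ⟨K⟩) (h := X) (f := P) (g := Q) (lift A a b)

end OplaxOver

lemma SplitFunctor.toOplaxOver_cut {o : E → C} (G : SplitFunctor o) {X : Poly I K} {P : Poly I J}
    {Q : Poly J K} (A : Split X J) (a : A.left ⟶ P) (b : A.right ⟶ Q) :
    G.toOplaxOver.toSplit.cut A a b = G.cut A a b :=
  (G.toOplaxOver.cut_eq A a b).trans (G.map₂_lift_mapComp A a b)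

end ToSplit

end PolyCart

namespace PolyCart

/-! ### Left-bracketed whiskering

For a 1-cell `H : x ⟶ a`, a 2-cell between composites of 1-cells out of `a` is turned into a 2-cell
between the left-bracketed composites of `H` with these 1-cells. -/

section Whisker

variable {C : Type u₂} [Bicategory.{w₂, v₂} C] {x y a b c d e : C}

def wSplit {f : a ⟶ c} {g : a ⟶ b} {h : b ⟶ c} (η : f ⟶ g ≫ h) (H : x ⟶ a) :
    H ≫ f ⟶ (H ≫ g) ≫ h := H ◁ η ≫ (α_ H g h).inv

def wSwap {f : a ⟶ b} {g : b ⟶ d} {f' : a ⟶ c} {g' : c ⟶ d} (η : f ≫ g ⟶ f' ≫ g')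
    (H : x ⟶ a) : (H ≫ f) ≫ g ⟶ (H ≫ f') ≫ g' :=
  (α_ H f g).hom ≫ H ◁ η ≫ (α_ H f' g').inv

def wUnit {g : a ⟶ b} {h : b ⟶ a} (η : 𝟙 a ⟶ g ≫ h) (H : x ⟶ a) : H ⟶ (H ≫ g) ≫ h :=
  (ρ_ H).inv ≫ H ◁ η ≫ (α_ H g h).inv

def wCounit {g : a ⟶ b} {h : b ⟶ a} (η : g ≫ h ⟶ 𝟙 a) (H : x ⟶ a) : (H ≫ g) ≫ h ⟶ H :=
  (α_ H g h).hom ≫ H ◁ η ≫ (ρ_ H).hom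

def wDrop {f : a ⟶ a} (η : f ⟶ 𝟙 a) (H : x ⟶ a) : H ≫ f ⟶ H := H ◁ η ≫ (ρ_ H).hom

/-! Naturality -/

lemma wSplit_natural {f : a ⟶ c} {g : a ⟶ b} {h : b ⟶ c} (η : f ⟶ g ≫ h) {H H' : x ⟶ a}
    (θ : H ⟶ H') : θ ▷ f ≫ wSplit η H' = wSplit η H ≫ θ ▷ g ▷ h := by
  simp only [wSplit, Category.assoc, ← whisker_exchange_assoc]
  simp

lemma wSwap_natural {f : a ⟶ b} {g : b ⟶ d} {f' : a ⟶ c} {g' : c ⟶ d} (η : f ≫ g ⟶ f' ≫ g')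
    {H H' : x ⟶ a} (θ : H ⟶ H') : θ ▷ f ▷ g ≫ wSwap η H' = wSwap η H ≫ θ ▷ f' ▷ g' := by
  have := whisker_exchange θ η
  simp only [wSwap, Category.assoc]
  rw [associator_naturality_left_assoc, ← whisker_exchange_assoc, ← associator_inv_naturality_left]

lemma wUnit_natural {g : a ⟶ b} {h : b ⟶ a} (η : 𝟙 a ⟶ g ≫ h) {H H' : x ⟶ a}
    (θ : H ⟶ H') : θ ≫ wUnit η H' = wUnit η H ≫ θ ▷ g ▷ h := by
  simp only [wUnit, Category.assoc]
  rw [← associator_inv_naturality_left, whisker_exchange_assoc]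
  simp

lemma wCounit_natural {g : a ⟶ b} {h : b ⟶ a} (η : g ≫ h ⟶ 𝟙 a) {H H' : x ⟶ a}
    (θ : H ⟶ H') : θ ▷ g ▷ h ≫ wCounit η H' = wCounit η H ≫ θ := by
  simp only [wCounit, Category.assoc]
  rw [associator_naturality_left_assoc, ← whisker_exchange_assoc]
  simp

lemma wDrop_natural {f : a ⟶ a} (η : f ⟶ 𝟙 a) {H H' : x ⟶ a} (θ : H ⟶ H') :
    θ ▷ f ≫ wDrop η H' = wDrop η H ≫ θ := by
  simp only [wDrop, Category.assoc, ← whisker_exchange_assoc]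
  simp

instance {f : a ⟶ c} {g : a ⟶ b} {h : b ⟶ c} (η : f ⟶ g ≫ h) [IsIso η] (H : x ⟶ a) :
    IsIso (wSplit η H) := by
  dsimp only [wSplit]; infer_instance

instance {f : a ⟶ a} (η : f ⟶ 𝟙 a) [IsIso η] (H : x ⟶ a) : IsIso (wDrop η H) := by
  dsimp only [wDrop]; infer_instance

/-! Composition of whiskered cells -/

lemma whiskerLeft_wSplit {f f' : a ⟶ c} {g : a ⟶ b} {h : b ⟶ c} (ρ : f' ⟶ f) (η : f ⟶ g ≫ h)
    (H : x ⟶ a) : H ◁ ρ ≫ wSplit η H = wSplit (ρ ≫ η) H := by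
  simp [wSplit]

lemma wSplit_whiskerLeft {f : a ⟶ c} {g g' : a ⟶ b} {h h' : b ⟶ c} (η : f ⟶ g ≫ h)
    (ρ : g ⟶ g') (τ : h ⟶ h') (H : x ⟶ a) :
    wSplit η H ≫ (H ◁ ρ) ▷ h ≫ (H ≫ g') ◁ τ = wSplit (η ≫ ρ ▷ h ≫ g' ◁ τ) H := by
  simp [wSplit]

lemma whiskerLeft_wDrop {f f' : a ⟶ a} (ρ : f' ⟶ f) (η : f ⟶ 𝟙 a) (H : x ⟶ a) :
    H ◁ ρ ≫ wDrop η H = wDrop (ρ ≫ η) H := by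
  simp [wDrop]

/-- The gain of left-bracketing: a coassociativity law containing an associator becomes a plain
commutative square, to which `rw` applies. -/
lemma wSplit_assoc {f : a ⟶ d} {g : a ⟶ b} {h : b ⟶ c} {k : c ⟶ d} {gh : a ⟶ c} {hk : b ⟶ d}
    {η₁ : f ⟶ gh ≫ k} {η₂ : gh ⟶ g ≫ h} {η₃ : f ⟶ g ≫ hk} {η₄ : hk ⟶ h ≫ k}
    (e : η₁ ≫ η₂ ▷ k ≫ (α_ g h k).hom = η₃ ≫ g ◁ η₄) (H : x ⟶ a) :
    wSplit η₁ H ≫ wSplit η₂ H ▷ k = wSplit η₃ H ≫ wSplit η₄ (H ≫ g) := by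
  simp only [wSplit]
  calc
    _ = 𝟙 _ ⊗≫ H ◁ (η₁ ≫ η₂ ▷ k ≫ (α_ g h k).hom) ⊗≫ 𝟙 _ := by bicategory
    _ = _ := by rw [e]; bicategory

lemma wSplit_drop_right {f : a ⟶ b} {g : b ⟶ b} {η : f ⟶ f ≫ g} {ζ : g ⟶ 𝟙 b}
    (e : η ≫ f ◁ ζ ≫ (ρ_ f).hom = 𝟙 f) (H : x ⟶ a) :
    wSplit η H ≫ wDrop ζ (H ≫ f) = 𝟙 _ := by
  simp only [wSplit, wDrop]
  calc
    _ = 𝟙 _ ⊗≫ H ◁ (η ≫ f ◁ ζ ≫ (ρ_ f).hom) ⊗≫ 𝟙 _ := by bicategory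
    _ = _ := by rw [e]; bicategory

lemma wSplit_drop_left {f : a ⟶ b} {g : a ⟶ a} {η : f ⟶ g ≫ f} {ζ : g ⟶ 𝟙 a}
    (e : η ≫ ζ ▷ f ≫ (λ_ f).hom = 𝟙 f) (H : x ⟶ a) :
    wSplit η H ≫ wDrop ζ H ▷ f = 𝟙 _ := by
  simp only [wSplit, wDrop]
  calc
    _ = 𝟙 _ ⊗≫ H ◁ (η ≫ ζ ▷ f ≫ (λ_ f).hom) ⊗≫ 𝟙 _ := by bicategory
    _ = _ := by rw [e]; bicategory

lemma wUnit_wCounit_left {f : a ⟶ b} {u : b ⟶ a} (adj : Bicategory.Adjunction f u) (H : x ⟶ a) :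
    wUnit adj.unit H ▷ f ≫ wCounit adj.counit (H ≫ f) = 𝟙 _ := by
  simp only [wUnit, wCounit]
  calc
    _ = 𝟙 _ ⊗≫ H ◁ leftZigzag adj.unit adj.counit ⊗≫ 𝟙 _ := by
      dsimp only [leftZigzag]; bicategory
    _ = _ := by rw [adj.left_triangle]; bicategory

lemma wUnit_wCounit_right {f : a ⟶ b} {u : b ⟶ a} (adj : Bicategory.Adjunction f u) (H : x ⟶ b) :
    wUnit adj.unit (H ≫ u) ≫ wCounit adj.counit H ▷ u = 𝟙 _ := by
  simp only [wUnit, wCounit]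
  calc
    _ = 𝟙 _ ⊗≫ H ◁ rightZigzag adj.unit adj.counit ⊗≫ 𝟙 _ := by
      dsimp only [rightZigzag]; bicategory
    _ = _ := by rw [adj.right_triangle]; bicategory

/-! Equivariance -/

/-- Extension of a comparison `L ≫ K ⟶ K'` along a 1-cell. -/
def wExt {L : x ⟶ y} {K : y ⟶ a} {K' : x ⟶ a} (κ : L ≫ K ⟶ K') (f : a ⟶ b) :
    L ≫ (K ≫ f) ⟶ K' ≫ f := (α_ L K f).inv ≫ κ ▷ f

instance {L : x ⟶ y} {K : y ⟶ a} {K' : x ⟶ a} (κ : L ≫ K ⟶ K') [IsIso κ] (f : a ⟶ b) :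
    IsIso (wExt κ f) := by
  dsimp only [wExt]; infer_instance

section Ext

variable {L : x ⟶ y} {K : y ⟶ a} {K' : x ⟶ a} (κ : L ≫ K ⟶ K')

/-- This lemma and those that follow show that precomposition with `L` commutes with every whiskered
cell, up to extensions of the comparison `κ`. A cell computed over an identity can thus be moved
over an arbitrary 1-cell. -/
lemma wExt_whiskerRight {K₁ : y ⟶ a} {K₁' : x ⟶ a} {κ : L ≫ K ⟶ K'} {κ₁ : L ≫ K₁ ⟶ K₁'}
    {θ : K ⟶ K₁} {θ' : K' ⟶ K₁'} (e : L ◁ θ ≫ κ₁ = κ ≫ θ') (f : a ⟶ b) :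
    L ◁ (θ ▷ f) ≫ wExt κ₁ f = wExt κ f ≫ θ' ▷ f := by
  simp only [wExt, Category.assoc]
  rw [← comp_whiskerRight, ← e]
  simp

lemma wExt_wSplit {f : a ⟶ c} {g : a ⟶ b} {h : b ⟶ c} (η : f ⟶ g ≫ h) :
    L ◁ wSplit η K ≫ wExt (wExt κ g) h = wExt κ f ≫ wSplit η K' := by
  simp only [wExt, Category.assoc]
  rw [wSplit_natural]
  simp only [wSplit]
  bicategory

lemma wExt_wSwap {f : a ⟶ b} {g : b ⟶ d} {f' : a ⟶ c} {g' : c ⟶ d} (η : f ≫ g ⟶ f' ≫ g') :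
    L ◁ wSwap η K ≫ wExt (wExt κ f') g' = wExt (wExt κ f) g ≫ wSwap η K' := by
  simp only [wExt, comp_whiskerRight, Category.assoc]
  rw [wSwap_natural]
  simp only [wSwap]
  bicategory

lemma wExt_wUnit {g : a ⟶ b} {h : b ⟶ a} (η : 𝟙 a ⟶ g ≫ h) :
    L ◁ wUnit η K ≫ wExt (wExt κ g) h = κ ≫ wUnit η K' := by
  rw [wUnit_natural]
  simp only [wExt, wUnit]
  bicategory

lemma wExt_wCounit {g : a ⟶ b} {h : b ⟶ a} (η : g ≫ h ⟶ 𝟙 a) :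
    L ◁ wCounit η K ≫ κ = wExt (wExt κ g) h ≫ wCounit η K' := by
  simp only [wExt, comp_whiskerRight, Category.assoc]
  rw [wCounit_natural]
  simp only [wCounit]
  bicategory

lemma wExt_wDrop {f : a ⟶ a} (η : f ⟶ 𝟙 a) :
    L ◁ wDrop η K ≫ κ = wExt κ f ≫ wDrop η K' := by
  simp only [wExt, Category.assoc]
  rw [wDrop_natural]
  simp only [wDrop]
  bicategory

end Ext

end Whisker

/-! ### The calculus of a lax Beck triple -/

section Calculus

variable {E : Type u} [Category.{v} E] {C : Type u₂} [Bicategory.{w₂, v₂} C]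

namespace OplaxOver

variable {B : Type u₁} [Bicategory.{w₁, v₁} B] {o : B → C} (F : OplaxOver o)

lemma map₂_eqToHom {a b : B} {f g : a ⟶ b} (h : f = g) :
    F.map₂ (eqToHom h) = eqToHom (by rw [h]) := by
  subst h; exact F.map₂_id f

end OplaxOver

namespace RawTriple

variable {o : E → C} (T : RawTriple o) {V W X Y Z : E}

/-- The constraint cell of `F_Δ` at a factorization. -/
def dc {f : X ⟶ Y} {g : Y ⟶ Z} {h : X ⟶ Z} (w : f ≫ g = h) : T.D h ⟶ T.D g ≫ T.D f :=
  eqToHom (by rw [w]) ≫ T.Dc f g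

/-- The constraint cell of `F_⊗` at a factorization. -/
def nc {f : X ⟶ Y} {g : Y ⟶ Z} {h : X ⟶ Z} (w : f ≫ g = h) : T.N h ⟶ T.N f ≫ T.N g :=
  eqToHom (by rw [w]) ≫ T.Nc f g

/-- The constraint cell of `F_Σ` at a factorization. -/
def sc {f : X ⟶ Y} {g : Y ⟶ Z} {h : X ⟶ Z} (w : f ≫ g = h) : T.S h ⟶ T.S f ≫ T.S g :=
  eqToHom (by rw [w]) ≫ T.Sc f g

lemma dc_rfl (f : X ⟶ Y) (g : Y ⟶ Z) : T.dc (rfl : f ≫ g = _) = T.Dc f g := by simp [dc]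

lemma nc_rfl (f : X ⟶ Y) (g : Y ⟶ Z) : T.nc (rfl : f ≫ g = _) = T.Nc f g := by simp [nc]

lemma sc_rfl (f : X ⟶ Y) (g : Y ⟶ Z) : T.sc (rfl : f ≫ g = _) = T.Sc f g := by simp [sc]

variable {f : W ⟶ X} {g : X ⟶ Y} {h : Y ⟶ Z} {fg : W ⟶ Y} {gh : X ⟶ Z} {k : W ⟶ Z}
  (w₁ : f ≫ g = fg) (w₂ : fg ≫ h = k) (w₃ : g ≫ h = gh) (w₄ : f ≫ gh = k) {x : C}

/-- The source is locally discrete, hence strict, so the image of its associator is an `eqToHom`.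
Stating the constraint at a factorization absorbs this transport, and the law has no casts left. -/
lemma nc_assoc (H : x ⟶ o W) : wSplit (T.nc w₂) H ≫ wSplit (T.nc w₁) H ▷ T.N h =
    wSplit (T.nc w₄) H ≫ wSplit (T.nc w₃) (H ≫ T.N f) := by
  apply wSplit_assoc
  subst w₁ w₃ w₂
  have e := T.Ten.map₂_associator f.toLoc g.toLoc h.toLoc
  have e' : T.Ten.map₂ (α_ f.toLoc g.toLoc h.toLoc).hom = eqToHom (by simp) :=
    T.Ten.map₂_eqToHom (Strict.assoc _ _ _)
  rw [e'] at e
  rw [nc_rfl, nc_rfl, nc_rfl]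
  exact e.symm.trans (Category.assoc _ _ _).symm

lemma sc_assoc (H : x ⟶ o W) : wSplit (T.sc w₂) H ≫ wSplit (T.sc w₁) H ▷ T.S h =
    wSplit (T.sc w₄) H ≫ wSplit (T.sc w₃) (H ≫ T.S f) := by
  apply wSplit_assoc
  subst w₁ w₃ w₂
  have e := T.Sig.map₂_associator f.toLoc g.toLoc h.toLoc
  have e' : T.Sig.map₂ (α_ f.toLoc g.toLoc h.toLoc).hom = eqToHom (by simp) :=
    T.Sig.map₂_eqToHom (Strict.assoc _ _ _)
  rw [e'] at e
  rw [sc_rfl, sc_rfl, sc_rfl]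
  exact e.symm.trans (Category.assoc _ _ _).symm

lemma dc_assoc (H : x ⟶ o Z) : wSplit (T.dc w₄) H ≫ wSplit (T.dc w₃) H ▷ T.D f =
    wSplit (T.dc w₂) H ≫ wSplit (T.dc w₁) (H ≫ T.D h) := by
  apply wSplit_assoc
  subst w₁ w₃ w₄
  have e := T.Del.map₂_associator h.op.toLoc g.op.toLoc f.op.toLoc
  have e' : T.Del.map₂ (α_ h.op.toLoc g.op.toLoc f.op.toLoc).hom = eqToHom (by simp) :=
    T.Del.map₂_eqToHom (Strict.assoc _ _ _)
  rw [e'] at e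
  rw [dc_rfl, dc_rfl, dc_rfl]
  exact e.symm.trans (Category.assoc _ _ _).symm

variable (l : X ⟶ Y)

lemma nc_id_left (w : 𝟙 X ≫ l = l) (H : x ⟶ o X) :
    wSplit (T.nc w) H ≫ wDrop (T.Ni X) H ▷ T.N l = 𝟙 _ := by
  apply wSplit_drop_left
  have e := T.Ten.map₂_leftUnitor l.toLoc
  have e' : T.Ten.map₂ (λ_ l.toLoc).hom = eqToHom (by simp) := T.Ten.map₂_eqToHom (Strict.id_comp _)
  rw [e'] at e
  rw [nc, Category.assoc]
  exact (congrArg (_ ≫ ·) e.symm).trans ((eqToHom_trans _ _).trans (eqToHom_refl _ _))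

lemma nc_id_right (w : l ≫ 𝟙 Y = l) (H : x ⟶ o X) :
    wSplit (T.nc w) H ≫ wDrop (T.Ni Y) (H ≫ T.N l) = 𝟙 _ := by
  apply wSplit_drop_right
  have e := T.Ten.map₂_rightUnitor l.toLoc
  have e' : T.Ten.map₂ (ρ_ l.toLoc).hom = eqToHom (by simp) := T.Ten.map₂_eqToHom (Strict.comp_id _)
  rw [e'] at e
  rw [nc, Category.assoc]
  exact (congrArg (_ ≫ ·) e.symm).trans ((eqToHom_trans _ _).trans (eqToHom_refl _ _))

lemma sc_id_left (w : 𝟙 X ≫ l = l) (H : x ⟶ o X) :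
    wSplit (T.sc w) H ≫ wDrop (T.Si X) H ▷ T.S l = 𝟙 _ := by
  apply wSplit_drop_left
  have e := T.Sig.map₂_leftUnitor l.toLoc
  have e' : T.Sig.map₂ (λ_ l.toLoc).hom = eqToHom (by simp) := T.Sig.map₂_eqToHom (Strict.id_comp _)
  rw [e'] at e
  rw [sc, Category.assoc]
  exact (congrArg (_ ≫ ·) e.symm).trans ((eqToHom_trans _ _).trans (eqToHom_refl _ _))

lemma sc_id_right (w : l ≫ 𝟙 Y = l) (H : x ⟶ o X) :
    wSplit (T.sc w) H ≫ wDrop (T.Si Y) (H ≫ T.S l) = 𝟙 _ := by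
  apply wSplit_drop_right
  have e := T.Sig.map₂_rightUnitor l.toLoc
  have e' : T.Sig.map₂ (ρ_ l.toLoc).hom = eqToHom (by simp) := T.Sig.map₂_eqToHom (Strict.comp_id _)
  rw [e'] at e
  rw [sc, Category.assoc]
  exact (congrArg (_ ≫ ·) e.symm).trans ((eqToHom_trans _ _).trans (eqToHom_refl _ _))

lemma dc_id_left (w : 𝟙 X ≫ l = l) (H : x ⟶ o Y) :
    wSplit (T.dc w) H ≫ wDrop (T.Di X) (H ≫ T.D l) = 𝟙 _ := by
  apply wSplit_drop_right
  have e := T.Del.map₂_rightUnitor l.op.toLoc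
  have e' : T.Del.map₂ (ρ_ l.op.toLoc).hom = eqToHom (by simp) := T.Del.map₂_eqToHom (Strict.comp_id _)
  rw [e'] at e
  rw [dc, Category.assoc]
  exact (congrArg (_ ≫ ·) e.symm).trans ((eqToHom_trans _ _).trans (eqToHom_refl _ _))

lemma dc_id_right (w : l ≫ 𝟙 Y = l) (H : x ⟶ o Y) :
    wSplit (T.dc w) H ≫ wDrop (T.Di Y) H ▷ T.D l = 𝟙 _ := by
  apply wSplit_drop_left
  have e := T.Del.map₂_leftUnitor l.op.toLoc
  have e' : T.Del.map₂ (λ_ l.op.toLoc).hom = eqToHom (by simp) := T.Del.map₂_eqToHom (Strict.id_comp _)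
  rw [e'] at e
  rw [dc, Category.assoc]
  exact (congrArg (_ ≫ ·) e.symm).trans ((eqToHom_trans _ _).trans (eqToHom_refl _ _))

/-- The unit at `f`. -/
def u (adj : T.Adj) (f : X ⟶ Y) (H : x ⟶ o X) : H ⟶ (H ≫ T.S f) ≫ T.D f :=
  wUnit (adj f).unit H

/-- The counit at `f`. -/
def c (adj : T.Adj) (f : X ⟶ Y) (H : x ⟶ o Y) : (H ≫ T.D f) ≫ T.S f ⟶ H :=
  wCounit (adj f).counit H

end RawTriple

section Adjunction

variable {a b c d x : C}

/-- The conjugate is built from the unit of `adj₂` and the counit of `adj₁`. Applying the counit of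
`adj₂` cancels that unit by a triangle identity. -/
lemma whiskerLeft_conjugate_counit {l₁ l₂ : a ⟶ b} {r₁ r₂ : b ⟶ a}
    (adj₁ : Bicategory.Adjunction l₁ r₁) (adj₂ : Bicategory.Adjunction l₂ r₂) (α : l₂ ⟶ l₁) :
    r₁ ◁ α ≫ adj₁.counit = conjugateEquiv adj₁ adj₂ α ▷ l₂ ≫ adj₂.counit := by
  rw [conjugateEquiv_apply']
  symm
  calc
    _ = 𝟙 _ ⊗≫ r₁ ◁ (adj₂.unit ≫ α ▷ r₂) ▷ l₂ ⊗≫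
        (adj₁.counit ▷ (r₂ ≫ l₂) ≫ 𝟙 _ ◁ adj₂.counit) ⊗≫ 𝟙 _ := by bicategory
    _ = 𝟙 _ ⊗≫ r₁ ◁ adj₂.unit ▷ l₂ ⊗≫ r₁ ◁ (α ▷ (r₂ ≫ l₂) ≫ l₁ ◁ adj₂.counit) ⊗≫
        adj₁.counit ⊗≫ 𝟙 _ := by
      rw [← whisker_exchange]; bicategory
    _ = 𝟙 _ ⊗≫ r₁ ◁ leftZigzag adj₂.unit adj₂.counit ⊗≫ r₁ ◁ α ⊗≫ adj₁.counit ⊗≫ 𝟙 _ := by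
      rw [← whisker_exchange]; bicategory
    _ = _ := by rw [adj₂.left_triangle]; bicategory

lemma unit_whiskerLeft_conjugate {l₁ l₂ : a ⟶ b} {r₁ r₂ : b ⟶ a}
    (adj₁ : Bicategory.Adjunction l₁ r₁) (adj₂ : Bicategory.Adjunction l₂ r₂) (α : l₂ ⟶ l₁) :
    adj₁.unit ≫ l₁ ◁ conjugateEquiv adj₁ adj₂ α = adj₂.unit ≫ α ▷ r₂ := by
  rw [conjugateEquiv_apply']
  calc
    _ = 𝟙 _ ⊗≫ (adj₁.unit ▷ 𝟙 _ ≫ (l₁ ≫ r₁) ◁ (adj₂.unit ≫ α ▷ r₂)) ⊗≫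
        l₁ ◁ adj₁.counit ▷ r₂ ⊗≫ 𝟙 _ := by bicategory
    _ = 𝟙 _ ⊗≫ (adj₂.unit ≫ α ▷ r₂) ⊗≫ leftZigzag adj₁.unit adj₁.counit ▷ r₂ ⊗≫ 𝟙 _ := by
      rw [← whisker_exchange]; dsimp only [leftZigzag]; bicategory
    _ = _ := by rw [adj₁.left_triangle]; bicategory

/-- A 2-cell into a right adjoint is determined by its transpose; `key` reconstructs it from the
transpose and the unit. -/
lemma eq_of_whiskerRight_counit {l : a ⟶ b} {r r' : b ⟶ a} (adj : Bicategory.Adjunction l r)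
    {α β : r' ⟶ r} (h : α ▷ l ≫ adj.counit = β ▷ l ≫ adj.counit) : α = β := by
  have key (γ : r' ⟶ r) : γ = (ρ_ _).inv ≫ r' ◁ adj.unit ≫ (α_ _ _ _).inv ≫
      (γ ▷ l ≫ adj.counit) ▷ r ≫ (λ_ _).hom := by
    symm
    calc
      _ = 𝟙 _ ⊗≫ (r' ◁ adj.unit ≫ γ ▷ (l ≫ r)) ⊗≫ adj.counit ▷ r ⊗≫ 𝟙 _ := by bicategory
      _ = 𝟙 _ ⊗≫ γ ⊗≫ rightZigzag adj.unit adj.counit ⊗≫ 𝟙 _ := by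
        rw [whisker_exchange]; dsimp only [rightZigzag]; bicategory
      _ = _ := by rw [adj.right_triangle]; bicategory
  rw [key α, key β, h]

end Adjunction

namespace RawTriple

variable {o : E → C} {T : RawTriple o} {V W X Y Z : E} {x : C} (adj : T.Adj)

lemma u_c (f : X ⟶ Y) (H : x ⟶ o X) : T.u adj f H ▷ T.S f ≫ T.c adj f (H ≫ T.S f) = 𝟙 _ :=
  wUnit_wCounit_left (adj f) H

lemma u_c' (f : X ⟶ Y) (H : x ⟶ o Y) : T.u adj f (H ≫ T.D f) ≫ T.c adj f H ▷ T.D f = 𝟙 _ :=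
  wUnit_wCounit_right (adj f) H

lemma u_natural (f : X ⟶ Y) {H H' : x ⟶ o X} (θ : H ⟶ H') :
    θ ≫ T.u adj f H' = T.u adj f H ≫ θ ▷ T.S f ▷ T.D f := wUnit_natural _ θ

lemma c_natural (f : X ⟶ Y) {H H' : x ⟶ o Y} (θ : H ⟶ H') :
    θ ▷ T.D f ▷ T.S f ≫ T.c adj f H' = T.c adj f H ≫ θ := wCounit_natural _ θ

variable {adj} {f : X ⟶ Y} {g : Y ⟶ Z} {h : X ⟶ Z}
  (w : f ≫ g = h)

/-- Compatibility makes the constraint of `F_Δ` inverse to the conjugate of that of `F_Σ`. Through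
these constraints, the counit at a composite becomes the counit of the composite adjunction. -/
lemma c_comp (hadj : adj.Compatible) (H : x ⟶ o Z) :
    wSplit (T.dc w) H ▷ T.S h ≫ wSplit (T.sc w) ((H ≫ T.D g) ≫ T.D f) ≫
      T.c adj f (H ≫ T.D g) ▷ T.S g ≫ T.c adj g H = T.c adj h H := by
  subst w
  rw [dc_rfl, sc_rfl]
  have e := whiskerLeft_conjugate_counit ((adj f).comp (adj g)) (adj (f ≫ g)) (T.Sc f g)
  have e₁ : T.Dc f g ▷ T.S (f ≫ g) ≫ (T.D g ≫ T.D f) ◁ T.Sc f g ≫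
      ((adj f).comp (adj g)).counit = (adj (f ≫ g)).counit := by
    rw [e, ← comp_whiskerRight_assoc, hadj.1]; simp
  simp only [wSplit, c, wCounit]
  rw [← e₁]
  dsimp only [Bicategory.Adjunction.comp, Bicategory.Adjunction.compCounit]
  bicategory

lemma u_comp (hadj : adj.Compatible) (hD : T.Del.IsPseudo) (H : x ⟶ o X) :
    T.u adj h H ≫ wSplit (T.sc w) H ▷ T.D h ≫ wSplit (T.dc w) ((H ≫ T.S f) ≫ T.S g) =
      T.u adj f H ≫ T.u adj g (H ≫ T.S f) ▷ T.D f := by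
  subst w
  rw [dc_rfl, sc_rfl]
  have e := unit_whiskerLeft_conjugate ((adj f).comp (adj g)) (adj (f ≫ g)) (T.Sc f g)
  have : IsIso (T.Dc f g) := hD.2 _ _
  -- `Compatible` provides one of the two composites only. The other one follows since the
  -- constraint cell of `F_Δ` is invertible.
  have e₀ : conjugateEquiv ((adj f).comp (adj g)) (adj (f ≫ g)) (T.Sc f g) ≫ T.Dc f g = 𝟙 _ := by
    rw [← cancel_epi (T.Dc f g), ← Category.assoc, hadj.1]; simp
  have e₁ : (adj (f ≫ g)).unit ≫ T.Sc f g ▷ T.D (f ≫ g) ≫ (T.S f ≫ T.S g) ◁ T.Dc f g =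
      ((adj f).comp (adj g)).unit := by
    rw [← reassoc_of% e, ← whiskerLeft_comp, e₀]; simp
  simp only [wSplit, u, wUnit]
  calc
    _ = 𝟙 _ ⊗≫ H ◁ ((adj (f ≫ g)).unit ≫ T.Sc f g ▷ T.D (f ≫ g) ≫
        (T.S f ≫ T.S g) ◁ T.Dc f g) ⊗≫ 𝟙 _ := by bicategory
    _ = _ := by
      rw [e₁]
      dsimp only [Bicategory.Adjunction.comp, Bicategory.Adjunction.compUnit]
      bicategory

lemma c_id (hadj : adj.Compatible) (H : x ⟶ o X) :
    T.c adj (𝟙 X) H = wDrop (T.Di X) H ▷ T.S (𝟙 X) ≫ wDrop (T.Si X) H := by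
  have e := whiskerLeft_conjugate_counit (Bicategory.Adjunction.id _) (adj (𝟙 X)) (T.Si X)
  have e₁ : T.Di X ▷ T.S (𝟙 X) ≫ 𝟙 _ ◁ T.Si X ≫ (ρ_ _).hom = (adj (𝟙 X)).counit := by
    refine (congrArg (T.Di X ▷ _ ≫ ·) e).trans ?_
    rw [← comp_whiskerRight_assoc, hadj.2]; simp
  simp only [c, wCounit, wDrop]
  rw [← e₁]
  bicategory

lemma u_id (hadj : adj.Compatible) (hD : T.Del.IsPseudo) (H : x ⟶ o X) :
    T.u adj (𝟙 X) H ≫ wDrop (T.Si X) H ▷ T.D (𝟙 X) ≫ wDrop (T.Di X) H = 𝟙 _ := by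
  have e := unit_whiskerLeft_conjugate (Bicategory.Adjunction.id _) (adj (𝟙 X)) (T.Si X)
  have : IsIso (T.Di X) := hD.1 _
  have e₀ : conjugateEquiv (Bicategory.Adjunction.id _) (adj (𝟙 X)) (T.Si X) ≫ T.Di X = 𝟙 _ := by
    rw [← cancel_epi (T.Di X), ← Category.assoc, hadj.2]; simp
  have e₁ : (adj (𝟙 X)).unit ≫ T.Si X ▷ T.D (𝟙 X) ≫ 𝟙 _ ◁ T.Di X = (ρ_ _).inv := by
    rw [← reassoc_of% e, ← whiskerLeft_comp, e₀]
    simp [Bicategory.Adjunction.id]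
  simp only [u, wUnit, wDrop]
  calc
    _ = 𝟙 _ ⊗≫ H ◁ ((adj (𝟙 X)).unit ≫ T.Si X ▷ T.D (𝟙 X) ≫ 𝟙 _ ◁ T.Di X) ⊗≫ 𝟙 _ := by
      bicategory
    _ = _ := by rw [e₁]; bicategory

end RawTriple

namespace LaxBeckTriple

variable {o : E → C} (T : LaxBeckTriple o) {U V W X Y Z : E} {x : C}

/-- The outer square and the two factorizations are arbitrary, so that rewriting does not depend on
how the square or the composite maps are presented; proof irrelevance identifies the squares. -/
lemma bk_horizontal {f₂' : U ⟶ V} {f₁' : V ⟶ W} {g'' : U ⟶ X} {g' : V ⟶ Y}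
    {g : W ⟶ Z} {f₂ : X ⟶ Y} {f₁ : Y ⟶ Z} {f' : U ⟶ W} {f : X ⟶ Z}
    (sq₂ : IsPullback f₂' g'' g' f₂) (sq₁ : IsPullback f₁' g' g f₁)
    (sq : IsPullback f' g'' g f) (w₁ : f₂' ≫ f₁' = f') (w₂ : f₂ ≫ f₁ = f) (H : x ⟶ o X) :
    wSplit (T.nc w₁) (H ≫ T.D g'') ≫ wSwap (T.beck sq₂) H ▷ T.N f₁' ≫
        wSwap (T.beck sq₁) (H ≫ T.N f₂) =
      wSwap (T.beck sq) H ≫ wSplit (T.nc w₂) H ▷ T.D g := by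
  subst w₁ w₂
  rw [RawTriple.nc_rfl, RawTriple.nc_rfl]
  have e := T.beck_horizontal sq₂ sq₁
  simp only [wSplit, wSwap]
  calc
    _ = 𝟙 _ ⊗≫ H ◁ (T.D g'' ◁ T.Nc f₂' f₁' ≫ (α_ _ _ _).inv ≫
        T.beck sq₂ ▷ T.N f₁' ≫ (α_ _ _ _).hom ≫ T.N f₂ ◁ T.beck sq₁ ≫
        (α_ _ _ _).inv) ⊗≫ 𝟙 _ := by bicategory
    _ = _ := by rw [e]; bicategory

lemma bk_vertical {f'' : U ⟶ V} {g₂' : U ⟶ W} {g₂ : V ⟶ X} {f' : W ⟶ X}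
    {g₁' : W ⟶ Y} {g₁ : X ⟶ Z} {f : Y ⟶ Z} {g' : U ⟶ Y} {g : V ⟶ Z}
    (sq₂ : IsPullback f'' g₂' g₂ f') (sq₁ : IsPullback f' g₁' g₁ f)
    (sq : IsPullback f'' g' g f) (w₁ : g₂' ≫ g₁' = g') (w₂ : g₂ ≫ g₁ = g) (H : x ⟶ o Y) :
    wSwap (T.beck sq) H ≫ wSplit (T.dc w₂) (H ≫ T.N f) =
      wSplit (T.dc w₁) H ▷ T.N f'' ≫ wSwap (T.beck sq₂) (H ≫ T.D g₁') ≫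
        wSwap (T.beck sq₁) H ▷ T.D g₂ := by
  subst w₁ w₂
  rw [RawTriple.dc_rfl, RawTriple.dc_rfl]
  have e := T.beck_vertical sq₂ sq₁
  simp only [wSplit, wSwap]
  calc
    _ = 𝟙 _ ⊗≫ H ◁ (T.beck (sq₂.paste_vert sq₁) ≫ T.N f ◁ T.Dc g₂ g₁) ⊗≫ 𝟙 _ := by bicategory
    _ = _ := by rw [e]; bicategory

lemma bk_id_horizontal {f : X ⟶ Y} (sq : IsPullback f (𝟙 X) (𝟙 Y) f) (H : x ⟶ o X) :
    wSwap (T.beck sq) H ≫ wDrop (T.Di Y) (H ≫ T.N f) = wDrop (T.Di X) H ▷ T.N f := by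
  have e := T.beck_id_horizontal f
  simp only [wDrop, wSwap]
  calc
    _ = 𝟙 _ ⊗≫ H ◁ (T.beck sq ≫ T.N f ◁ T.Di Y ≫ (ρ_ _).hom) ⊗≫ 𝟙 _ := by bicategory
    _ = _ := by rw [e]; bicategory

lemma bk_id_vertical {g : X ⟶ Y} (sq : IsPullback (𝟙 X) g g (𝟙 Y)) (H : x ⟶ o Y) :
    wSwap (T.beck sq) H ≫ wDrop (T.Ni Y) H ▷ T.D g = wDrop (T.Ni X) (H ≫ T.D g) := by
  have e := T.beck_id_vertical g
  simp only [wDrop, wSwap]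
  calc
    _ = 𝟙 _ ⊗≫ H ◁ (T.beck sq ≫ T.Ni Y ▷ T.D g ≫ (λ_ _).hom) ⊗≫ 𝟙 _ := by bicategory
    _ = _ := by rw [e]; bicategory

end LaxBeckTriple

end Calculus

end PolyCart

namespace PolyCart

open PolyCart.Poly

/-! ### The action of polynomials associated with a lax Beck triple -/

section Action

variable {E : Type u} [Category.{v} E] {C : Type u₂} [Bicategory.{w₂, v₂} C] {o : E → C}

lemma whiskerRight_sq {a b c : C} {f₁ f₂ f₂' f₃ : a ⟶ b} {α : f₁ ⟶ f₂} {β : f₂ ⟶ f₃}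
    {α' : f₁ ⟶ f₂'} {β' : f₂' ⟶ f₃} (e : α ≫ β = α' ≫ β') (g : b ⟶ c) :
    α ▷ g ≫ β ▷ g = α' ▷ g ≫ β' ▷ g := by
  rw [← comp_whiskerRight, e, comp_whiskerRight]

lemma whiskerRight_eq_id {a b c : C} {f₁ f₂ : a ⟶ b} {α : f₁ ⟶ f₂} {β : f₂ ⟶ f₁}
    (e : α ≫ β = 𝟙 _) (g : b ⟶ c) : α ▷ g ≫ β ▷ g = 𝟙 _ := by
  rw [← comp_whiskerRight, e, id_whiskerRight]

namespace LaxBeckTriple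

variable (T : LaxBeckTriple o) (adj : T.Adj) {I J K L : E} {x y : C}

/-- The composite of `H` with `F_Δ s`, `F_⊗ p` and `F_Σ t`. -/
abbrev act {P Q : E} (s : P ⟶ I) (p : P ⟶ Q) (t : Q ⟶ J) (H : x ⟶ o I) : x ⟶ o J :=
  ((H ≫ T.D s) ≫ T.N p) ≫ T.S t

section Cells

variable {P P' P'' Q Q' Q'' : E}
  {s' : P' ⟶ I} {p' : P' ⟶ Q'} {t' : Q' ⟶ J} {s'' : P'' ⟶ I} {p'' : P'' ⟶ Q''} {t'' : Q'' ⟶ J}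
  {σ : P ⟶ P'} {ν : Q ⟶ Q'} {σ' : P' ⟶ P''} {ν' : Q' ⟶ Q''} {s : P ⟶ I} {p : P ⟶ Q} {t : Q ⟶ J}

/-- The action of a cartesian morphism. -/
def mapCell (hs : σ ≫ s' = s) (ht : ν ≫ t' = t) (sq : IsPullback p σ ν p') (H : x ⟶ o I) :
    T.act s p t H ⟶ T.act s' p' t' H :=
  -- Split off `F_Δ σ`, slide it past `F_⊗ p` with the Beck cell to obtain `F_Δ ν`, then split off
  -- `F_Σ ν` and cancel the two with the counit.
  (wSplit (T.dc hs) H ▷ T.N p ≫ wSwap (T.beck sq) (H ≫ T.D s')) ▷ T.S t ≫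
    wSplit (T.sc ht) _ ≫ T.c adj ν _ ▷ T.S t'

/-- By `c_id`, the counit at an identity consists of the unit constraints of `F_Δ` and `F_Σ`. These
cancel the constraint cells at the trivial factorizations, the one for `F_Δ` after being moved
through the Beck cell of an identity square. -/
lemma mapCell_id {adj : T.Adj} (hadj : adj.Compatible) (hs : 𝟙 P ≫ s = s) (ht : 𝟙 Q ≫ t = t)
    (sq : IsPullback p (𝟙 P) (𝟙 Q) p) (H : x ⟶ o I) :
    T.mapCell adj hs ht sq H = 𝟙 (T.act s p t H) := by
  simp only [mapCell, RawTriple.c_id hadj, comp_whiskerRight, Category.assoc]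
  rw [← reassoc_of% wSplit_natural (T.sc ht), RawTriple.sc_id_left, Category.comp_id,
    ← comp_whiskerRight, T.bk_id_horizontal, whiskerRight_eq_id]
  exact whiskerRight_eq_id (T.dc_id_left s hs H) _

/-- The vertical pasting axiom decomposes the Beck cell and `c_comp` decomposes the counit.
Coassociativity for `F_Δ` and `F_Σ` and interchange then bring the cells of the two steps into
order. -/
lemma mapCell_comp {adj : T.Adj} (hadj : adj.Compatible) (hs : σ ≫ s' = s) (ht : ν ≫ t' = t)
    (sq : IsPullback p σ ν p') (hs' : σ' ≫ s'' = s') (ht' : ν' ≫ t'' = t')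
    (sq' : IsPullback p' σ' ν' p'') (hs₂ : (σ ≫ σ') ≫ s'' = s) (ht₂ : (ν ≫ ν') ≫ t'' = t)
    (sq₂ : IsPullback p (σ ≫ σ') (ν ≫ ν') p'') (H : x ⟶ o I) :
    T.mapCell adj hs₂ ht₂ sq₂ H = T.mapCell adj hs ht sq H ≫ T.mapCell adj hs' ht' sq' H := by
  have e := T.bk_vertical sq sq' sq₂ rfl rfl (H ≫ T.D s'')
  have e₁ := T.dc_assoc rfl hs₂ hs' hs H
  have e₃ := congrArg (· ▷ T.S t) e
  simp only [mapCell, ← RawTriple.c_comp (rfl : ν ≫ ν' = _) hadj, comp_whiskerRight,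
    Category.assoc] at e₃ ⊢
  rw [← reassoc_of% wSplit_natural (T.sc ht₂), reassoc_of% e₃,
    ← reassoc_of% whiskerRight_sq (whiskerRight_sq e₁ (T.N p)) (T.S t),
    reassoc_of% T.sc_assoc rfl ht₂ ht' ht,
    ← reassoc_of% whiskerRight_sq (RawTriple.c_natural adj ν _) (T.S t'),
    ← reassoc_of% whiskerRight_sq (RawTriple.c_natural adj ν _) (T.S t'),
    reassoc_of% wSplit_natural (T.sc ht'),
    ← reassoc_of% wSplit_natural (T.sc ht), ← reassoc_of% wSplit_natural (T.sc ht),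
    ← reassoc_of% whiskerRight_sq (wSwap_natural (T.beck sq) _) (T.S t)]

variable {W : E} {k : P ⟶ W} {j : W ⟶ Q} {h : W ⟶ K}

/-- The comultiplication of a factorization. -/
def splitCell (s : P ⟶ I) (t : Q ⟶ J) (fac : k ≫ j = p) (h : W ⟶ K) (H : x ⟶ o I) :
    T.act s p t H ⟶ T.act h j t (T.act s k h H) :=
  -- Comultiply `F_⊗` along the factorization, then insert the unit of `F_Σ h ⊣ F_Δ h` at the
  -- intermediate object.
  (wSplit (T.nc fac) (H ≫ T.D s) ≫ T.u adj h _ ▷ T.N j) ▷ T.S t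

lemma splitCell_assoc {W₁ W₂ : E} {k : P ⟶ W₁} {i : W₁ ⟶ W₂} {j : W₂ ⟶ Q} {ki : P ⟶ W₂}
    {ij : W₁ ⟶ Q} (s : P ⟶ I) (t : Q ⟶ J) (h₁ : W₁ ⟶ K) (h₂ : W₂ ⟶ L) (k_i : k ≫ i = ki)
    (i_j : i ≫ j = ij) (fac : ki ≫ j = p) (fac' : k ≫ ij = p) (H : x ⟶ o I) :
    T.splitCell adj s t fac h₂ H ≫ T.splitCell adj s h₂ k_i h₁ H ▷ T.D h₂ ▷ T.N j ▷ T.S t =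
      T.splitCell adj s t fac' h₁ H ≫ T.splitCell adj h₁ t i_j h₂ (T.act s k h₁ H) := by
  simp only [splitCell, comp_whiskerRight, Category.assoc]
  rw [reassoc_of% whiskerRight_sq (wSplit_natural (T.nc i_j) _) _,
    ← reassoc_of% whiskerRight_sq (T.nc_assoc k_i fac i_j fac' _) _,
    ← reassoc_of% whiskerRight_sq (whiskerRight_sq (RawTriple.u_natural adj h₂ _) _) _,
    ← whiskerRight_sq (whiskerRight_sq (RawTriple.u_natural adj h₂ _) _) _]

/-- The counit. -/
def counitCell (I : E) (H : x ⟶ o I) : T.act (𝟙 I) (𝟙 I) (𝟙 I) H ⟶ H :=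
  (wDrop (T.Di I) H ▷ T.N (𝟙 I) ≫ wDrop (T.Ni I) H) ▷ T.S (𝟙 I) ≫ wDrop (T.Si I) H

instance (I : E) (H : x ⟶ o I) : IsIso (T.counitCell I H) := by
  have : IsIso (T.Di I) := T.del_pseudo.1 _
  have : IsIso (T.Ni I) := T.ten_pseudo.1 _
  have : IsIso (T.Si I) := T.sig_pseudo.1 _
  dsimp only [counitCell]; infer_instance

/-- The horizontal pasting axiom compares the Beck cell of `p` with those of `k` and `j`. The left
half also creates a counit at `ω`, which is absorbed by the unit inserted at `h`; what remains is
the unit at `h'`. -/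
lemma mapCell_splitCell {adj : T.Adj} (hadj : adj.Compatible) {W W' : E} {k : P ⟶ W} {j : W ⟶ Q}
    {h : W ⟶ K} {k' : P' ⟶ W'} {j' : W' ⟶ Q'} {h' : W' ⟶ K} {ω : W ⟶ W'}
    (hs : σ ≫ s' = s) (ht : ν ≫ t' = t) (sq : IsPullback p σ ν p')
    (fac : k ≫ j = p) (fac' : k' ≫ j' = p') (hh : ω ≫ h' = h) (sql : IsPullback k σ ω k')
    (sqr : IsPullback j ω ν j') (H : x ⟶ o I) :
    T.mapCell adj hs ht sq H ≫ T.splitCell adj s' t' fac' h' H =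
      T.splitCell adj s t fac h H ≫ T.mapCell adj hs hh sql H ▷ T.D h ▷ T.N j ▷ T.S t ≫
        T.mapCell adj hh ht sqr (T.act s' k' h' H) := by
  have e := congrArg (· ▷ T.S t) (T.bk_horizontal sql sqr sq fac fac' (H ≫ T.D s'))
  -- Since `h` factors through `ω`, its unit decomposes into those at `ω` and at `h'`, and the
  -- former cancels the counit at `ω` by a triangle identity.
  have e₁ (K₁ : x ⟶ o W') : T.u adj h (K₁ ≫ T.D ω) ≫ wSplit (T.sc hh) (K₁ ≫ T.D ω) ▷ T.D h ≫
      T.c adj ω K₁ ▷ T.S h' ▷ T.D h ≫ wSplit (T.dc hh) (K₁ ≫ T.S h') = T.u adj h' K₁ ▷ T.D ω := by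
    rw [wSplit_natural, reassoc_of% RawTriple.u_comp hh hadj T.del_pseudo,
      whiskerRight_sq (g := T.D ω) (RawTriple.u_natural adj h' _).symm,
      reassoc_of% RawTriple.u_c' adj ω]
  have e₂ := congrArg (· ▷ T.N j ▷ T.S t) (e₁ ((H ≫ T.D s') ≫ T.N k'))
  simp only [mapCell, splitCell, comp_whiskerRight, Category.assoc] at e e₂ ⊢
  rw [← reassoc_of% whiskerRight_sq (whiskerRight_sq (RawTriple.u_natural adj h _) _) _,
    ← reassoc_of% whiskerRight_sq (whiskerRight_sq (RawTriple.u_natural adj h _) _) _,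
    reassoc_of% e₂, ← reassoc_of% whiskerRight_sq (wSplit_natural (T.nc fac) _) _,
    reassoc_of% whiskerRight_sq (wSwap_natural (T.beck sqr) _) _, reassoc_of% e,
    ← reassoc_of% whiskerRight_sq (RawTriple.c_natural adj ν _) (T.S t'),
    ← whiskerRight_sq (RawTriple.c_natural adj ν _) (T.S t'),
    ← reassoc_of% wSplit_natural (T.sc ht), ← reassoc_of% wSplit_natural (T.sc ht)]

/-- The nullary axiom for Beck cells removes the square, and the unit constraints absorb the split
identities. Only the counit at `s` survives, and the two counit laws thereby become triangle
identities. -/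
lemma mapCell_counitCell {adj : T.Adj} (hs : s ≫ 𝟙 I = s) (sq : IsPullback (𝟙 P) s s (𝟙 I))
    (H : x ⟶ o I) : T.mapCell adj hs hs sq H ≫ T.counitCell I H =
      wDrop (T.Ni P) (H ≫ T.D s) ▷ T.S s ≫ T.c adj s H := by
  have e₁ := congrArg (· ▷ T.S s) (T.bk_id_vertical sq H)
  simp only [mapCell, counitCell, comp_whiskerRight, Category.assoc] at e₁ ⊢
  rw [← e₁, ← reassoc_of% whiskerRight_sq (RawTriple.c_natural adj s _) (T.S (𝟙 I)),
    ← reassoc_of% whiskerRight_sq (RawTriple.c_natural adj s _) (T.S (𝟙 I)),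
    ← reassoc_of% wSplit_natural (T.sc hs), ← reassoc_of% wSplit_natural (T.sc hs),
    wDrop_natural, reassoc_of% T.sc_id_right s hs,
    ← reassoc_of% whiskerRight_sq (wSwap_natural (T.beck sq) _) (T.S s),
    reassoc_of% whiskerRight_eq_id (whiskerRight_eq_id (T.dc_id_right s hs H) _) (T.S s),
    Category.assoc]

lemma splitCell_counit_left (adj : T.Adj) (fac : 𝟙 P ≫ p = p)
    (hs : s ≫ 𝟙 I = s) (sq : IsPullback (𝟙 P) s s (𝟙 I)) (H : x ⟶ o I) :
    T.splitCell adj s t fac s H ≫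
      (T.mapCell adj hs hs sq H ≫ T.counitCell I H) ▷ T.D s ▷ T.N p ▷ T.S t = 𝟙 _ := by
  have e₁ : T.u adj s ((H ≫ T.D s) ≫ T.N (𝟙 P)) ≫ (T.mapCell adj hs hs sq H ≫
      T.counitCell I H) ▷ T.D s = wDrop (T.Ni P) (H ≫ T.D s) := by
    rw [T.mapCell_counitCell, comp_whiskerRight, ← reassoc_of% RawTriple.u_natural adj s,
      RawTriple.u_c', Category.comp_id]
  have e₂ := congrArg (· ▷ T.N p ▷ T.S t) e₁
  simp only [splitCell, comp_whiskerRight, Category.assoc] at e₂ ⊢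
  rw [e₂]
  exact whiskerRight_eq_id (T.nc_id_left p fac _) _

lemma splitCell_counit_right (adj : T.Adj) (fac : p ≫ 𝟙 Q = p)
    (ht : t ≫ 𝟙 J = t) (sq : IsPullback (𝟙 Q) t t (𝟙 J)) (H : x ⟶ o I) :
    T.splitCell adj s t fac t H ≫
      T.mapCell adj ht ht sq _ ≫ T.counitCell J (T.act s p t H) = 𝟙 _ := by
  rw [T.mapCell_counitCell]
  simp only [splitCell, comp_whiskerRight, Category.assoc]
  rw [reassoc_of% whiskerRight_sq (wDrop_natural (T.Ni Q) _) (T.S t), RawTriple.u_c,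
    Category.comp_id]
  exact whiskerRight_eq_id (T.nc_id_right p fac _) _

end Cells

end LaxBeckTriple

end Action

end PolyCart

namespace PolyCart

open PolyCart.Poly

/-! ### The oplax functor associated with a lax Beck triple -/

section Whisker

variable {C : Type u₂} [Bicategory.{w₂, v₂} C] {x y z a b c d e : C}

lemma wExt_wExt {L : x ⟶ y} {M : y ⟶ z} {K : z ⟶ a} {K' : y ⟶ a} {K'' : x ⟶ a}
    {κ₁ : M ≫ K ⟶ K'} {κ₂ : L ≫ K' ⟶ K''} {κ₃ : (L ≫ M) ≫ K ⟶ K''}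
    (e : L ◁ κ₁ ≫ κ₂ = (α_ L M K).inv ≫ κ₃) (f : a ⟶ b) :
    L ◁ wExt κ₁ f ≫ wExt κ₂ f = (α_ L M (K ≫ f)).inv ≫ wExt κ₃ f := by
  simp only [wExt]
  calc
    _ = 𝟙 _ ⊗≫ (L ◁ κ₁ ≫ κ₂) ▷ f := by bicategory
    _ = _ := by rw [e]; bicategory

lemma wExt_comp {L : x ⟶ y} {K : y ⟶ a} {K' K'' : x ⟶ a} (κ : L ≫ K ⟶ K') (θ : K' ⟶ K'')
    (f : a ⟶ b) : wExt (κ ≫ θ) f = wExt κ f ≫ θ ▷ f := by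
  simp [wExt]

lemma whiskerRight_wExt {L L' : x ⟶ y} {K : y ⟶ a} {K' K'' : x ⟶ a} {κ : L ≫ K ⟶ K'}
    {κ' : L' ≫ K ⟶ K''} {θ : L ⟶ L'} {θ' : K' ⟶ K''} (e : θ ▷ K ≫ κ' = κ ≫ θ') (f : a ⟶ b) :
    θ ▷ (K ≫ f) ≫ wExt κ' f = wExt κ f ≫ θ' ▷ f := by
  simp only [wExt, Category.assoc]
  rw [← comp_whiskerRight, ← e]
  simp

lemma wExt_leftUnitor (K : x ⟶ a) (f : a ⟶ b) : wExt (λ_ K).hom f = (λ_ (K ≫ f)).hom := by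
  simp [wExt]

end Whisker

section Realize

variable {E : Type u} [Category.{v} E] {C : Type u₂} [Bicategory.{w₂, v₂} C] {o : E → C}

namespace LaxBeckTriple

variable (T : LaxBeckTriple o) (adj : T.Adj) {I J K L : E} {x y z : C}

section Ext

variable {P P' Q Q' : E}

/-- Extension of a comparison along the action of a polynomial. -/
abbrev actExt {M : x ⟶ y} {H : y ⟶ o I} {H' : x ⟶ o I} (s : P ⟶ I) (p : P ⟶ Q) (t : Q ⟶ J)
    (κ : M ≫ H ⟶ H') : M ≫ T.act s p t H ⟶ T.act s p t H' :=
  wExt (wExt (wExt κ (T.D s)) (T.N p)) (T.S t)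

variable {s : P ⟶ I} {p : P ⟶ Q} {t : Q ⟶ J} {s' : P' ⟶ I} {p' : P' ⟶ Q'} {t' : Q' ⟶ J}
  {σ : P ⟶ P'} {ν : Q ⟶ Q'} {M : x ⟶ y} {H : y ⟶ o I} {H' : x ⟶ o I}

lemma actExt_mapCell (hs : σ ≫ s' = s) (ht : ν ≫ t' = t) (sq : IsPullback p σ ν p')
    (κ : M ≫ H ⟶ H') :
    M ◁ T.mapCell adj hs ht sq H ≫ T.actExt s' p' t' κ =
      T.actExt s p t κ ≫ T.mapCell adj hs ht sq H' := by
  simp only [mapCell, RawTriple.c, actExt, whiskerLeft_comp, comp_whiskerRight, Category.assoc]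
  rw [wExt_whiskerRight (wExt_wCounit _ _), reassoc_of% wExt_wSplit,
    reassoc_of% wExt_whiskerRight (wExt_wSwap _ (T.beck sq)),
    reassoc_of% wExt_whiskerRight (wExt_whiskerRight (wExt_wSplit κ (T.dc hs)) _)]

lemma actExt_splitCell {W : E} {k : P ⟶ W} {j : W ⟶ Q} (fac : k ≫ j = p) (h : W ⟶ K)
    (κ : M ≫ H ⟶ H') :
    M ◁ T.splitCell adj s t fac h H ≫ T.actExt h j t (T.actExt s k h κ) =
      T.actExt s p t κ ≫ T.splitCell adj s t fac h H' := by
  simp only [splitCell, RawTriple.u, actExt, whiskerLeft_comp, comp_whiskerRight, Category.assoc]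
  rw [wExt_whiskerRight (wExt_whiskerRight (wExt_wUnit _ _) _),
    reassoc_of% wExt_whiskerRight (wExt_wSplit _ (T.nc fac))]

lemma actExt_counitCell (κ : M ≫ H ⟶ H') :
    M ◁ T.counitCell I H ≫ κ = T.actExt (𝟙 I) (𝟙 I) (𝟙 I) κ ≫ T.counitCell I H' := by
  simp only [counitCell, actExt, whiskerLeft_comp, comp_whiskerRight, Category.assoc]
  rw [wExt_wDrop κ, reassoc_of% wExt_whiskerRight (wExt_wDrop κ (T.Ni I)),
    reassoc_of% wExt_whiskerRight (wExt_whiskerRight (wExt_wDrop κ (T.Di I)) _)]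

end Ext

/-- The 1-cell associated with a polynomial. -/
abbrev real (P : Poly I J) : o I ⟶ o J := T.act P.s P.p P.t (𝟙 _)

/-- The comparison of the composite with the 1-cell of a polynomial with the action. -/
abbrev realExt (M : x ⟶ o I) (P : Poly I J) : M ≫ T.real P ⟶ T.act P.s P.p P.t M :=
  T.actExt P.s P.p P.t (ρ_ M).hom

lemma realExt_natural {M M' : x ⟶ o I} (θ : M ⟶ M') (P : Poly I J) :
    θ ▷ T.real P ≫ T.realExt M' P = T.realExt M P ≫ θ ▷ T.D P.s ▷ T.N P.p ▷ T.S P.t :=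
  whiskerRight_wExt (whiskerRight_wExt (whiskerRight_wExt (by simp) _) _) _

lemma inv_realExt_natural {M M' : x ⟶ o I} (θ : M ⟶ M') (P : Poly I J) :
    inv (T.realExt M P) ≫ θ ▷ T.real P =
      θ ▷ T.D P.s ▷ T.N P.p ▷ T.S P.t ≫ inv (T.realExt M' P) := by
  rw [IsIso.inv_comp_eq, ← Category.assoc, IsIso.eq_comp_inv, realExt_natural]

lemma realExt_id (P : Poly I J) : T.realExt (𝟙 _) P = (λ_ _).hom := by
  dsimp only [realExt, actExt]
  rw [← unitors_equal, wExt_leftUnitor, wExt_leftUnitor, wExt_leftUnitor]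

/-- Compatibility of the comparison with composition: the action of two polynomials in succession
can be compared with the composite 1-cell in either order. Coassociativity of the realized
comultiplications rests on it. -/
lemma realExt_realExt (M : x ⟶ o I) (P : Poly I J) (Q : Poly J K) :
    M ◁ T.realExt (T.real P) Q ≫ T.actExt Q.s Q.p Q.t (T.realExt M P) =
      (α_ _ _ _).inv ≫ T.realExt (M ≫ T.real P) Q ≫
        T.realExt M P ▷ T.D Q.s ▷ T.N Q.p ▷ T.S Q.t := by
  have e : M ◁ (ρ_ (T.real P)).hom ≫ T.realExt M P =
      (α_ _ _ _).inv ≫ (ρ_ _).hom ≫ T.realExt M P := by simp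
  refine (wExt_wExt (wExt_wExt (wExt_wExt e _) _) _).trans ?_
  rw [wExt_comp, wExt_comp, wExt_comp]

/-- The oplax functor associated with a lax Beck triple, in terms of factorizations. -/
noncomputable abbrev realize (hadj : adj.Compatible) : SplitFunctor o where
  map P := T.real P
  map₂ ρ := T.mapCell adj ρ.hs ρ.ht ρ.cart.flip (𝟙 _)
  -- The cell `splitCell` lands in the action of the right half on the 1-cell of the left half.
  -- Inverting the comparison turns this into a composite of 1-cells.
  split {I J K X} A := T.splitCell adj X.s X.t A.fac A.h (𝟙 _) ≫ inv (T.realExt (T.real A.left) A.right)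
  counit I := T.counitCell I (𝟙 _)
  map₂_id P := T.mapCell_id hadj _ _ _ _
  map₂_comp ρ τ := T.mapCell_comp hadj _ _ _ _ _ _ _ _ _ _
  split_natural {I J K X X' ρ A A'} m := by
    have e := T.actExt_mapCell adj m.right.hs m.right.ht m.right.cart.flip
      (ρ_ (T.real A'.left)).hom
    rw [Category.assoc, reassoc_of% T.inv_realExt_natural, ← Category.assoc,
      T.mapCell_splitCell hadj ρ.hs ρ.ht ρ.cart.flip A.fac A'.fac m.hh m.left.cart.flip
        m.cart.flip, Category.assoc, Category.assoc]
    congr 2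
    rw [IsIso.comp_inv_eq, Category.assoc, e, IsIso.inv_hom_id_assoc]
  -- The content is `e₂`, coassociativity of the action. The other equations move the inverse
  -- comparisons out of the way: `e₁` is the equivariance of `splitCell`, and `e` reconciles the two
  -- ways of comparing.
  split_assoc {I J K L X} s := by
    have e := T.realExt_realExt (T.real s.A₁.left) s.A₁.right s.A.right
    have e₁ := T.actExt_splitCell adj (s := s.B.right.s) (t := s.B.right.t) s.B₁.fac s.B₁.h
      (ρ_ (T.real s.B.left)).hom
    have e₂ := T.splitCell_assoc adj X.s X.t s.h₁ s.h₂ s.k_i s.i_j s.A.fac s.B.fac (𝟙 _)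
    rw [comp_whiskerRight, Category.assoc, Category.assoc, Category.assoc,
      reassoc_of% T.inv_realExt_natural, reassoc_of% T.inv_realExt_natural,
      whiskerLeft_comp]
    have e₃ : inv (T.realExt (T.real s.B.left) s.B.right) ≫
        T.real s.B.left ◁ T.splitCell adj s.B.right.s s.B.right.t s.B₁.fac s.B₁.h (𝟙 _) =
        T.splitCell adj s.B.right.s s.B.right.t s.B₁.fac s.B₁.h (T.real s.B.left) ≫
          inv (T.actExt s.A.right.s s.A.right.p s.A.right.t
            (T.realExt (T.real s.A₁.left) s.A₁.right)) := by
      rw [IsIso.inv_comp_eq, ← Category.assoc, IsIso.eq_comp_inv]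
      exact e₁
    refine Eq.trans ?_ (congrArg (fun t => T.splitCell adj X.s X.t s.B.fac s.B.h (𝟙 _) ≫ t ≫
      T.real s.B.left ◁ inv (T.realExt (T.real s.B₁.left) s.B₁.right)) e₃.symm |>.trans
        (by simp only [Category.assoc]))
    refine Eq.trans ?_ (congrArg (· ≫ inv (T.actExt s.A.right.s s.A.right.p s.A.right.t
            (T.realExt (T.real s.A₁.left) s.A₁.right)) ≫
      T.real s.B.left ◁ inv (T.realExt (T.real s.B₁.left) s.B₁.right)) e₂ |>.trans
        (by simp only [Category.assoc]))
    simp only [Category.assoc]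
    congr 2
    rw [IsIso.eq_inv_comp, ← cancel_epi (T.real s.B.left ◁ T.realExt (T.real s.B₁.left) s.B₁.right),
      ← whiskerLeft_comp, IsIso.hom_inv_id, whiskerLeft_id]
    refine ((Category.assoc _ _ _).symm.trans ((congrArg (· ≫ _) e).trans (Category.assoc _ _ _))).trans ?_
    rw [Category.assoc]
    rw [reassoc_of% whiskerRight_eq_id (whiskerRight_eq_id (whiskerRight_eq_id
      (IsIso.hom_inv_id (T.realExt (T.real s.A₁.left) s.A₁.right)) _) _) _,
      IsIso.hom_inv_id_assoc, Iso.inv_hom_id]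
  left_counit P := by
    rw [Category.assoc, reassoc_of% T.inv_realExt_natural, ← realExt_id, IsIso.inv_hom_id,
      Category.comp_id]
    exact T.splitCell_counit_left adj _ _ _ _
  right_counit {I J} P := by
    have e := T.actExt_mapCell adj (εr P).hs (εr P).ht (εr P).cart.flip
      (ρ_ (T.real P)).hom
    rw [Category.assoc, whiskerLeft_comp, Category.assoc, T.actExt_counitCell (ρ_ _).hom,
      reassoc_of% e, IsIso.inv_hom_id_assoc]
    exact T.splitCell_counit_right adj _ _ _ _

end LaxBeckTriple

end Realize

end PolyCart

namespace PolyCart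

open PullbackChoice DistributivityChoice

/-! ### Recognition of composites and of left adjoints in polynomials -/

lemma left_triangle_components {B : Type u₁} [Bicategory.{w₁, v₁} B] {a b : B} {f : a ⟶ b}
    {g : b ⟶ a} (adj : Bicategory.Adjunction f g) :
    (λ_ f).inv ≫ adj.unit ▷ f ≫ (α_ f g f).hom ≫ f ◁ adj.counit = (ρ_ f).inv := by
  have e := adj.left_triangle
  rw [← cancel_epi (λ_ f).hom, Iso.hom_inv_id_assoc, ← e]
  dsimp only [leftZigzag]
  bicategory

namespace Poly

variable {E : Type u} [Category.{v} E]

section Lift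

variable [PullbackChoice E] [DistributivityChoice E] {I J K : E} {X : Poly I K} {P : Poly I J}
  {Q : Poly J K} {A : Split X J} {a : A.left ⟶ P} {b : A.right ⟶ Q}

/-- Invertibility of a cartesian morphism can be tested on its second component. Here that component
belongs to the map into the terminal pullback around, and `e` is inverse to it because neither side
has nontrivial endomorphisms. -/
lemma isIso_lift_of_around (e : (D P Q).toPullbackAround ⟶ around A a b)
    (he : ∀ φ : around A a b ⟶ around A a b, φ = 𝟙 _) : IsIso (lift A a b) := by
  apply isIso_of_isIso_ν
  let φ : around A a b ⟶ (D P Q).toPullbackAround := aroundMap A a b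
  exact ⟨e.t, congrArg PullbackAround.Hom.t (he (φ ≫ e)),
    congrArg PullbackAround.Hom.t ((D P Q).isTerminal.hom_ext (e ≫ φ) (𝟙 _))⟩

/-- Composites with a polynomial whose middle map is invertible. -/
lemma isIso_lift_of_isIso_p [IsIso Q.p] (h : IsPullback a.ν b.σ P.t Q.s) :
    IsIso (lift A a b) := by
  have h₁ := (exists_pbLift A a b).choose_spec.1
  have h₂ := (exists_pbLift A a b).choose_spec.2
  set z := (exists_pbLift A a b).choose
  have hz : IsIso z := by
    have : z = (h.isoIsPullback _ _ (pb P.t Q.s).isPullback).hom :=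
      (pb P.t Q.s).hom_ext (by simp [h₁]) (by simp [h₂])
    rw [this]; infer_instance
  have hq : IsIso (D P Q).q := (D P Q).isPullback.isIso_snd_of_isIso
  have hj : IsIso A.j := b.cart.isIso_snd_of_isIso
  have e₁ : inv z ≫ b.σ = (pb P.t Q.s).p₂ := by rw [IsIso.inv_comp_eq, h₂]
  refine isIso_lift_of_around ⟨(D P Q).p ≫ inv z, inv (D P Q).q ≫ (D P Q).p ≫ inv z ≫ A.j,
    ?_, ?_, ?_⟩ fun φ => ?_
  · change ((D P Q).p ≫ inv z) ≫ z = _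
    simp
  · change ((D P Q).p ≫ inv z) ≫ A.j = _
    simp
  · change (inv (D P Q).q ≫ (D P Q).p ≫ inv z ≫ A.j) ≫ b.ν = _
    have e₂ := (D P Q).isPullback.w
    rw [Category.assoc] at e₂
    rw [Category.assoc, Category.assoc, Category.assoc, ← b.cart.w, reassoc_of% e₁, e₂,
      IsIso.inv_hom_id_assoc]
  -- An endomorphism commutes with the invertible `z`, so its first component is trivial; the second
  -- one then is trivial because `A.j` is invertible.
  · have e₂ : φ.s = 𝟙 _ := (cancel_mono z).1 (φ.hp.trans (Category.id_comp _).symm)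
    refine PullbackAround.Hom.ext e₂ ((cancel_epi A.j).1 (φ.hq.symm.trans ?_))
    rw [e₂]
    exact (Category.id_comp _).trans (Category.comp_id _).symm

/-- Composites with a polynomial whose last map is invertible. -/
lemma isIso_lift_of_isIso_t [IsIso P.t] [IsIso b.ν] : IsIso (lift A a b) := by
  have h₂ := (exists_pbLift A a b).choose_spec.2
  set z := (exists_pbLift A a b).choose
  have hp : IsIso (pb P.t Q.s).p₂ := (pb P.t Q.s).isPullback.isIso_snd_of_isIso
  have hb : IsIso b.σ := b.cart.isIso_fst_of_isIso
  have hz : IsIso z := by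
    have : IsIso (z ≫ (pb P.t Q.s).p₂) := by rw [h₂]; exact hb
    exact IsIso.of_isIso_comp_right z (pb P.t Q.s).p₂
  have e₂ := (D P Q).isPullback.w
  rw [Category.assoc] at e₂
  -- Here `z` and `b.ν` are both invertible, which yields the comparison map and leaves no freedom
  -- to endomorphisms.
  refine isIso_lift_of_around ⟨(D P Q).p ≫ (pb P.t Q.s).p₂ ≫ inv b.σ, (D P Q).r ≫ inv b.ν,
    ?_, ?_, ?_⟩ fun φ => ?_
  · change ((D P Q).p ≫ (pb P.t Q.s).p₂ ≫ inv b.σ) ≫ z = _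
    rw [← cancel_mono (pb P.t Q.s).p₂]
    simp [h₂]
  · change ((D P Q).p ≫ (pb P.t Q.s).p₂ ≫ inv b.σ) ≫ A.j = _
    rw [← cancel_mono b.ν]
    simp [← b.cart.w, e₂]
  · change ((D P Q).r ≫ inv b.ν) ≫ b.ν = _
    simp
  · exact PullbackAround.Hom.ext ((cancel_mono z).1 (φ.hp.trans (Category.id_comp _).symm))
      ((cancel_mono b.ν).1 (φ.hr.trans (Category.id_comp _).symm))

end Lift

/-- The polynomial `Σ_f`. -/
abbrev sig {X Y : E} (f : X ⟶ Y) : Poly X Y := ⟨X, X, 𝟙 X, 𝟙 X, f⟩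

/-- The polynomial `Δ_f`. -/
abbrev del {X Y : E} (f : X ⟶ Y) : Poly Y X := ⟨X, X, f, 𝟙 X, 𝟙 X⟩

/-- The polynomial `⊗_f`. -/
abbrev ten {X Y : E} (f : X ⟶ Y) : Poly X Y := ⟨X, Y, 𝟙 X, f, 𝟙 Y⟩

/-- A distributivity pullback as a factorization. -/
abbrev splitDist {X A B : E} {u : X ⟶ A} {f : A ⟶ B} (R : PullbackAround u f) :
    Split (⟨R.T, R.Y, R.p, R.q, R.r⟩ : Poly X B) A := ⟨R.T, 𝟙 _, R.q, R.p ≫ u, by simp⟩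

abbrev distL {X A B : E} {u : X ⟶ A} {f : A ⟶ B} (R : PullbackAround u f) :
    (splitDist R).left ⟶ sig u :=
  ⟨R.p, R.p, by simp, rfl, IsPullback.of_vert_isIso ⟨by simp⟩⟩

abbrev distR {X A B : E} {u : X ⟶ A} {f : A ⟶ B} (R : PullbackAround u f) :
    (splitDist R).right ⟶ ten f :=
  ⟨R.p ≫ u, R.r, by simp, by simp, R.isPullback⟩

section

variable [PullbackChoice E] [DistributivityChoice E] {I J K : E}

/-- The composite of `Σ_u` and `⊗_f` uses a distributivity pullback around the chosen pullback of
`u` along an identity. Its projection to `X` is invertible, so terminality of `R` transfers along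
it. -/
lemma isIso_lift_dist {X A B : E} {u : X ⟶ A} {f : A ⟶ B} (R : DistributivityPullback u f) :
    IsIso (lift (splitDist R.toPullbackAround) (distL R.toPullbackAround)
      (distR R.toPullbackAround)) := by
  have h₁ := (exists_pbLift _ (distL R.toPullbackAround) (distR R.toPullbackAround)).choose_spec.1
  have hp : IsIso (pb u (𝟙 A)).p₁ := (pb u (𝟙 A)).isPullback.isIso_fst_of_isIso
  have hc := (pb u (𝟙 A)).condition
  rw [Category.comp_id] at hc
  have hpb := (D (sig u) (ten f)).isPullback
  let e : PullbackAround.Hom ⟨_, _, (D (sig u) (ten f)).p ≫ (pb u (𝟙 A)).p₁, _, _,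
      by rw [Category.assoc, hc]; exact hpb⟩ R.toPullbackAround := R.isTerminal.from _
  refine isIso_lift_of_around ⟨e.s, e.t, ?_, e.hq, e.hr⟩ fun φ => ?_
  · refine (cancel_mono (pb u (𝟙 A)).p₁).1 ?_
    exact (Category.assoc _ _ _).trans ((congrArg (e.s ≫ ·) h₁).trans e.hp)
  · let ψ : R.toPullbackAround ⟶ R.toPullbackAround := ⟨φ.s, φ.t, by
      have := congrArg (· ≫ (pb u (𝟙 A)).p₁) φ.hp
      dsimp only at this
      rw [Category.assoc] at this
      exact (congrArg (φ.s ≫ ·) h₁.symm).trans (this.trans h₁), φ.hq, φ.hr⟩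
    have hψ : ψ = 𝟙 _ := R.isTerminal.hom_ext _ _
    have hs : ψ.s = 𝟙 _ := congrArg PullbackAround.Hom.s hψ
    have ht : ψ.t = 𝟙 _ := congrArg PullbackAround.Hom.t hψ
    exact PullbackAround.Hom.ext hs ht

/-- The first two maps of a left adjoint are invertible. -/
lemma isIso_of_isLeftAdjoint {Q : Poly I J}
    (h : IsLeftAdjoint (B := PolyC E) (a := ⟨I⟩) (b := ⟨J⟩) Q) : IsIso Q.s ∧ IsIso Q.p := by
  obtain ⟨R, adj⟩ : ∃ R : (⟨J⟩ : PolyC E) ⟶ ⟨I⟩,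
      Nonempty (Bicategory.Adjunction (B := PolyC E) (a := ⟨I⟩) (b := ⟨J⟩) Q R) :=
    ⟨_, ⟨Bicategory.Adjunction.ofIsLeftAdjoint _⟩⟩
  obtain ⟨adj⟩ := adj
  let R' : Poly J I := R
  let η : one I ⟶ comp Q R' := adj.unit
  let ζ : comp R' Q ⟶ one J := adj.counit
  have tri : lInv Q ≫ hcomp η (𝟙 Q) ≫ αHom Q R' Q ≫ hcomp (𝟙 Q) ζ = rInv Q :=
    left_triangle_components adj
  -- Represent the unit, and its restriction along `εl Q`, by factorizations. The triangle identity
  -- is then an equality of two lifts out of `Q`, which can be compared half by half.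
  obtain ⟨A₀, a₀, b₀, h₀⟩ := exists_eq_lift η
  obtain ⟨A₁, a, b, h₁⟩ := exists_eq_lift (εl Q ≫ η)
  let s : Split3 Q J I := .ofA (splitL Q) A₁
  have e : 𝟙 Q ≫ lift s.B a (lift s.B₁ b (𝟙 Q) ≫ ζ) = lift (splitR Q) (𝟙 Q) (εr Q) := by
    have e₁ := lift_αHom s a b (𝟙 Q)
    rw [Category.id_comp]
    refine Eq.trans ?_ tri
    rw [lInv, ← Category.assoc, lift_hcomp, Category.comp_id, h₁, ← Category.assoc]
    refine Eq.trans ?_ (congrArg (· ≫ hcomp (𝟙 Q) ζ) e₁).symm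
    rw [lift_hcomp, Category.comp_id]
  -- The comparison with the trivial factorization `splitR Q` yields `a.σ = 𝟙`. The comparison of
  -- the restricted unit with the unit writes `a.σ` as `Q.s ≫ a₀.σ`, and `a₀` lies over the identity
  -- of `I`, so `a₀.σ` is inverse to `Q.s`.
  obtain ⟨m, hm, -⟩ := exists_map_of_comp_eq_lift e
  rw [h₀] at h₁
  obtain ⟨m', hm', -⟩ := exists_map_of_comp_eq_lift h₁
  have hσ : a.σ = 𝟙 _ := by simpa using congrArg Hom.σ hm
  have hσ' : Q.s ≫ a₀.σ = a.σ := congrArg Hom.σ hm'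
  refine ⟨⟨a₀.σ, hσ'.trans hσ, a₀.hs⟩, ?_⟩
  -- The counit maps the right half to an identity polynomial, so the middle map of this half is
  -- invertible. Its first factor `A₁.j` is then mono, and it is split epi by `A₁.fac`; hence both
  -- factors are invertible.
  have hi : IsIso (A₁.j ≫ Q.p) := isIso_j (A := s.B) (lift s.B₁ b (𝟙 Q) ≫ ζ)
  have hk : A₁.k ≫ A₁.j = 𝟙 _ := A₁.fac
  have hj : IsIso A₁.j := by
    have : Mono A₁.j := mono_of_mono A₁.j Q.p
    exact ⟨A₁.k, by rw [← cancel_mono A₁.j, Category.assoc, hk]; simp, hk⟩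
  exact IsIso.of_isIso_comp_left A₁.j Q.p

end

end Poly

end PolyCart

namespace PolyCart

open PolyCart.Poly

/-! ### The calculus of comultiplications -/

section Cut

variable {E : Type u} [Category.{v} E] {C : Type u₂} [Bicategory.{w₂, v₂} C] {o : E → C}

/-- The identity morphism of a factorization. -/
abbrev Poly.Split.Map.refl {I J K : E} {X : Poly I K} (A : Split X J) : Split.Map (𝟙 X) A A :=
  ⟨𝟙 _, by simp, by simp, IsPullback.id_horiz _⟩

namespace SplitFunctor

variable (G : SplitFunctor o) {I J K L : E}

section

variable {X : Poly I L} {P : Poly I J} {Q : Poly J K} {R : Poly K L}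
  {Y : Poly I K} {Z : Poly J L}

lemma cut_comp_left {X : Poly I K} {Q : Poly J K} {P' : Poly I J} (A : Split X J)
    (a : A.left ⟶ P) (b : A.right ⟶ Q) (f : P ⟶ P') :
    G.cut A a b ≫ G.map₂ f ▷ G.map Q = G.cut A (a ≫ f) b := by
  have := G.cut_map₂ A a b f (𝟙 _)
  rw [G.map₂_id, whiskerLeft_id, Category.comp_id, Category.comp_id] at this
  exact this

lemma cut_comp_right {X : Poly I K} {Q Q' : Poly J K} (A : Split X J)
    (a : A.left ⟶ P) (b : A.right ⟶ Q) (g : Q ⟶ Q') :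
    G.cut A a b ≫ G.map P ◁ G.map₂ g = G.cut A a (b ≫ g) := by
  have := G.cut_map₂ A a b (𝟙 _) g
  rw [G.map₂_id, id_whiskerRight, Category.id_comp, Category.comp_id] at this
  exact this

/-- Coassociativity. -/
lemma cut_cut {A : Split X K} {a₀ : A.left ⟶ Y} {c : A.right ⟶ R} {B : Split Y J}
    {a : B.left ⟶ P} {b : B.right ⟶ Q} {A' : Split X J} {a' : A'.left ⟶ P} {b₀ : A'.right ⟶ Z}
    {B' : Split Z K} {b' : B'.left ⟶ Q} {c' : B'.right ⟶ R} (i : A'.W ⟶ A.W)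
    (hk : A'.k ≫ i = A.k) (hj : i ≫ A.j = A'.j)
    (m : Split.Map a₀ ⟨A'.W, A'.k, i, A'.h, hk⟩ B) (m' : Split.Map b₀ ⟨A.W, i, A.j, A.h, hj⟩ B')
    (ha : m.left ≫ a = a') (hb : m.right ≫ b = m'.left ≫ b') (hc : m'.right ≫ c' = c) :
    G.cut A a₀ c ≫ G.cut B a b ▷ G.map R ≫ (α_ _ _ _).hom =
      G.cut A' a' b₀ ≫ G.map P ◁ G.cut B' b' c' := by
  -- The factorizations `A` and `A'` are combined, through `i`, into one factorization into three
  -- maps. The maps `m` and `m'` carry its halves to the factorizations `B` and `B'`.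
  let s : Split3 X J K := ⟨A'.W, A.W, A'.k, i, A.j, A'.h, A.h, A.k, A'.j, hk, hj, A.fac⟩
  have e := G.cut_assoc s a' (m'.left ≫ b') c
  have e₁ : G.cut A a₀ c = G.cut s.A (𝟙 _) c ≫ G.map₂ a₀ ▷ G.map R := by
    rw [cut_comp_left, Category.id_comp]
  have e₂ : G.cut A' a' b₀ = G.cut s.B a' (𝟙 _) ≫ G.map P ◁ G.map₂ b₀ := by
    rw [cut_comp_right, Category.id_comp]
  rw [e₁, e₂, Category.assoc, Category.assoc, ← whiskerLeft_comp, ← comp_whiskerRight_assoc,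
    G.map₂_cut m, G.map₂_cut m', ha, hb, hc]
  exact e

end

/-- The map to the identity polynomial. -/
abbrev toOne {X Y : E} (f : X ⟶ Y) : (⟨X, X, f, 𝟙 X, f⟩ : Poly Y Y) ⟶ one Y :=
  ⟨f, f, by simp, by simp, IsPullback.of_vert_isIso ⟨by simp⟩⟩

section Cells

variable {P Q W X Y Z : E}

/-- `F_Δ h ⟶ F_Δ g ≫ F_Δ f`. -/
def cD {f : X ⟶ Y} {g : Y ⟶ Z} {h : X ⟶ Z} (w : f ≫ g = h) :
    G.map (del h) ⟶ G.map (del g) ≫ G.map (del f) :=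
  G.cut ⟨X, 𝟙 X, 𝟙 X, f, by simp⟩ ⟨f, f, w, by simp, IsPullback.of_vert_isIso ⟨by simp⟩⟩ (𝟙 _)

/-- `F_Σ h ⟶ F_Σ f ≫ F_Σ g`. -/
def cS {f : X ⟶ Y} {g : Y ⟶ Z} {h : X ⟶ Z} (w : f ≫ g = h) :
    G.map (sig h) ⟶ G.map (sig f) ≫ G.map (sig g) :=
  G.cut ⟨X, 𝟙 X, 𝟙 X, f, by simp⟩ (𝟙 _) ⟨f, f, by simp, w, IsPullback.of_vert_isIso ⟨by simp⟩⟩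

/-- `F_⊗ h ⟶ F_⊗ f ≫ F_⊗ g`. -/
def cN {f : X ⟶ Y} {g : Y ⟶ Z} {h : X ⟶ Z} (w : f ≫ g = h) :
    G.map (ten h) ⟶ G.map (ten f) ≫ G.map (ten g) :=
  G.cut ⟨Y, f, g, 𝟙 Y, w⟩ (𝟙 _) (𝟙 _)

/-- `F (s, p, 1) ⟶ F_Δ s ≫ F_⊗ p`. -/
def bIn (s : P ⟶ I) (p : P ⟶ Q) :
    G.map ⟨P, Q, s, p, 𝟙 Q⟩ ⟶ G.map (del s) ≫ G.map (ten p) :=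
  G.cut ⟨P, 𝟙 P, p, 𝟙 P, by simp⟩ (𝟙 _) (𝟙 _)

/-- `F (s, p, t) ⟶ F (s, p, 1) ≫ F_Σ t`. -/
def sIn (s : P ⟶ I) (p : P ⟶ Q) (t : Q ⟶ J) :
    G.map ⟨P, Q, s, p, t⟩ ⟶ G.map ⟨P, Q, s, p, 𝟙 Q⟩ ≫ G.map (sig t) :=
  G.cut ⟨Q, p, 𝟙 Q, 𝟙 Q, by simp⟩ (𝟙 _) (𝟙 _)

/-- The morphism of polynomials given by a pullback square. -/
abbrev sqMap {f' : W ⟶ X} {g' : W ⟶ Y} {g : X ⟶ Z} {f : Y ⟶ Z} (sq : IsPullback f' g' g f) :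
    (⟨W, X, g', f', g⟩ : Poly Y Z) ⟶ ten f := ⟨g', g, by simp, by simp, sq.flip⟩

/-- `F (g', f', 1) ⟶ F_⊗ f ≫ F_Δ g`. -/
def bOut {f' : W ⟶ X} {g' : W ⟶ Y} {g : X ⟶ Z} {f : Y ⟶ Z} (sq : IsPullback f' g' g f) :
    G.map ⟨W, X, g', f', 𝟙 X⟩ ⟶ G.map (ten f) ≫ G.map (del g) :=
  G.cut ⟨X, f', 𝟙 X, g, by simp⟩ (sqMap sq) (𝟙 _)

/-- `F 1 ⟶ F_Σ f ≫ F_Δ f`. -/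
def cU (f : X ⟶ Y) : G.map (one X) ⟶ G.map (sig f) ≫ G.map (del f) :=
  G.cut ⟨X, 𝟙 X, 𝟙 X, f, by simp⟩ (𝟙 _) (𝟙 _)

end Cells

/-- Gregarious functors in terms of comultiplications. -/
structure IsGregarious : Prop where
  isIso_counit (I : E) : IsIso (G.counit I)
  isIso_sIn {I J P Q : E} (s : P ⟶ I) (p : P ⟶ Q) (t : Q ⟶ J) : IsIso (G.sIn s p t)
  isIso_bIn {I P Q : E} (s : P ⟶ I) (p : P ⟶ Q) : IsIso (G.bIn s p)

variable {G} (hG : G.IsGregarious) {P Q U V W X Y Z : E}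

namespace IsGregarious

/-- The Beck 2-cells. -/
noncomputable def bk {f' : W ⟶ X} {g' : W ⟶ Y} {g : X ⟶ Z} {f : Y ⟶ Z} (sq : IsPullback f' g' g f) :
    G.map (del g') ≫ G.map (ten f') ⟶ G.map (ten f) ≫ G.map (del g) :=
  haveI := hG.isIso_bIn g' f'
  inv (G.bIn g' f') ≫ G.bOut sq

lemma bIn_bk {f' : W ⟶ X} {g' : W ⟶ Y} {g : X ⟶ Z} {f : Y ⟶ Z} (sq : IsPullback f' g' g f) :
    G.bIn g' f' ≫ hG.bk sq = G.bOut sq := by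
  have := hG.isIso_bIn g' f'
  simp [bk]

end IsGregarious

variable (G)

/-- This and the next two lemmas are instances of coassociativity. They rewrite each composite of
cells in the horizontal axiom as a double cut of the polynomial `(g'', f', 1)`. -/
lemma bIn_cN {s : P ⟶ I} {k : P ⟶ W} {j : W ⟶ Q} {p : P ⟶ Q} (w : k ≫ j = p) :
    G.bIn s p ≫ G.map (del s) ◁ G.cN w =
      G.cut (X := ⟨P, Q, s, p, 𝟙 Q⟩) ⟨W, k, j, 𝟙 W, w⟩ (𝟙 _) (𝟙 _) ≫
        G.bIn s k ▷ G.map (ten j) ≫ (α_ _ _ _).hom := by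
  dsimp only [bIn, cN]
  symm
  refine G.cut_cut k (Category.id_comp k) w (.refl _) (.refl _) ?_ ?_ ?_ <;> ext <;> simp

lemma cut_bOut {f₂' : U ⟶ V} {f₁' : V ⟶ W} {g'' : U ⟶ X} {g' : V ⟶ Y}
    {f₂ : X ⟶ Y} {f' : U ⟶ W}
    (sq₂ : IsPullback f₂' g'' g' f₂) (w₁ : f₂' ≫ f₁' = f') :
    G.cut (X := ⟨U, W, g'', f', 𝟙 W⟩) ⟨V, f₂', f₁', 𝟙 V, w₁⟩ (𝟙 _) (𝟙 _) ≫
        G.bOut sq₂ ▷ G.map (ten f₁') ≫ (α_ _ _ _).hom =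
      G.cut (X := ⟨U, W, g'', f', 𝟙 W⟩) ⟨V, f₂', f₁', g', w₁⟩ (sqMap sq₂) (𝟙 _) ≫
        G.map (ten f₂) ◁ G.bIn g' f₁' := by
  dsimp only [bIn, bOut]
  refine G.cut_cut (𝟙 V) (Category.comp_id _) (Category.id_comp _) (.refl _) (.refl _) ?_ ?_ ?_ <;>
    ext <;> simp

lemma cut_bOut_right {f₂' : U ⟶ V} {f₁' : V ⟶ W} {g'' : U ⟶ X} {g' : V ⟶ Y}
    {g : W ⟶ Z} {f₂ : X ⟶ Y} {f₁ : Y ⟶ Z} {f' : U ⟶ W} {f : X ⟶ Z}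
    (sq₂ : IsPullback f₂' g'' g' f₂) (sq₁ : IsPullback f₁' g' g f₁)
    (sq : IsPullback f' g'' g f) (w₁ : f₂' ≫ f₁' = f') (w₂ : f₂ ≫ f₁ = f) :
    G.bOut sq ≫ G.cN w₂ ▷ G.map (del g) ≫ (α_ _ _ _).hom =
      G.cut (X := ⟨U, W, g'', f', 𝟙 W⟩) ⟨V, f₂', f₁', g', w₁⟩ (sqMap sq₂) (𝟙 _) ≫
        G.map (ten f₂) ◁ G.bOut sq₁ := by
  dsimp only [bOut, cN]
  refine G.cut_cut f₁' w₁ (Category.comp_id _) ⟨g', sq₂.w, by simp, sq₁.flip⟩ (.refl _)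
    ?_ ?_ ?_ <;> ext <;> simp

variable {G}

/-- Precomposing with the invertible `bIn` replaces each Beck cell by `bOut`, and both sides become
the same double cut of `(g'', f', 1)`. -/
lemma IsGregarious.bk_horizontal {f₂' : U ⟶ V} {f₁' : V ⟶ W} {g'' : U ⟶ X} {g' : V ⟶ Y}
    {g : W ⟶ Z} {f₂ : X ⟶ Y} {f₁ : Y ⟶ Z} {f' : U ⟶ W} {f : X ⟶ Z}
    (sq₂ : IsPullback f₂' g'' g' f₂) (sq₁ : IsPullback f₁' g' g f₁)
    (sq : IsPullback f' g'' g f) (w₁ : f₂' ≫ f₁' = f') (w₂ : f₂ ≫ f₁ = f) :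
    G.map (del g'') ◁ G.cN w₁ ≫ (α_ _ _ _).inv ≫ hG.bk sq₂ ▷ G.map (ten f₁') ≫ (α_ _ _ _).hom ≫
        G.map (ten f₂) ◁ hG.bk sq₁ ≫ (α_ _ _ _).inv =
      hG.bk sq ≫ G.cN w₂ ▷ G.map (del g) := by
  have := hG.isIso_bIn g'' f'
  rw [← cancel_epi (G.bIn g'' f'), reassoc_of% G.bIn_cN, reassoc_of% hG.bIn_bk, Category.assoc,
    Iso.hom_inv_id_assoc, ← comp_whiskerRight_assoc, hG.bIn_bk, reassoc_of% G.cut_bOut sq₂ w₁,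
    ← whiskerLeft_comp_assoc, hG.bIn_bk, ← reassoc_of% G.cut_bOut_right sq₂ sq₁ sq w₁ w₂,
    Iso.hom_inv_id, Category.comp_id]

variable (G)

/-- `F (s, p, t) ⟶ F_Δ s' ≫ F (σ, p, t)`. -/
def gL {σ : P ⟶ X} {s' : X ⟶ I} {s : P ⟶ I} (w : σ ≫ s' = s) (p : P ⟶ Q) (t : Q ⟶ J) :
    G.map ⟨P, Q, s, p, t⟩ ⟶ G.map (del s') ≫ G.map ⟨P, Q, σ, p, t⟩ :=
  G.cut ⟨P, 𝟙 P, p, σ, by simp⟩ ⟨σ, σ, w, by simp, IsPullback.of_vert_isIso ⟨by simp⟩⟩ (𝟙 _)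

/-- `F (s, p, 1) ⟶ F (s', p', 1) ≫ F_Δ ν`. -/
def gR {s : P ⟶ I} {p : P ⟶ Q} {X Y : E} {σ : P ⟶ X} {ν : Q ⟶ Y} {s' : X ⟶ I} {p' : X ⟶ Y}
    (w : σ ≫ s' = s) (sq : IsPullback p σ ν p') :
    G.map ⟨P, Q, s, p, 𝟙 Q⟩ ⟶ G.map ⟨X, Y, s', p', 𝟙 Y⟩ ≫ G.map (del ν) :=
  G.cut ⟨Q, p, 𝟙 Q, ν, by simp⟩ ⟨σ, ν, w, by simp, sq.flip⟩ (𝟙 _)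

lemma bIn_cD {σ : P ⟶ X} {s' : X ⟶ I} {s : P ⟶ I} (w : σ ≫ s' = s) (p : P ⟶ Q) :
    G.bIn s p ≫ G.cD w ▷ G.map (ten p) ≫ (α_ _ _ _).hom =
      G.gL w p (𝟙 Q) ≫ G.map (del s') ◁ G.bIn σ p := by
  dsimp only [bIn, cD, gL]
  refine G.cut_cut (𝟙 P) (Category.comp_id _) (Category.id_comp p) (.refl _) (.refl _) ?_ ?_ ?_ <;>
    ext <;> simp

lemma gL_bOut {s : P ⟶ I} {p : P ⟶ Q} {σ : P ⟶ X} {ν : Q ⟶ Y} {s' : X ⟶ I} {p' : X ⟶ Y}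
    (w : σ ≫ s' = s) (sq : IsPullback p σ ν p') :
    G.gL w p (𝟙 Q) ≫ G.map (del s') ◁ G.bOut sq =
      G.gR w sq ≫ G.bIn s' p' ▷ G.map (del ν) ≫ (α_ _ _ _).hom := by
  dsimp only [bIn, bOut, gL, gR]
  symm
  refine G.cut_cut p (Category.id_comp p) (Category.comp_id p) ⟨σ, by simp, by simp, sq.flip⟩
    (.refl _) ?_ ?_ ?_ <;> ext <;> simp

lemma gR_bOut {f'' : U ⟶ V} {g₂' : U ⟶ W} {g₂ : V ⟶ X} {f' : W ⟶ X}
    {g₁' : W ⟶ Y} {g₁ : X ⟶ Z} {f : Y ⟶ Z} {g' : U ⟶ Y} {g : V ⟶ Z}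
    (sq₂ : IsPullback f'' g₂' g₂ f') (sq₁ : IsPullback f' g₁' g₁ f)
    (sq : IsPullback f'' g' g f) (w₁ : g₂' ≫ g₁' = g') (w₂ : g₂ ≫ g₁ = g) :
    G.gR w₁ sq₂ ≫ G.bOut sq₁ ▷ G.map (del g₂) ≫ (α_ _ _ _).hom =
      G.bOut sq ≫ G.map (ten f) ◁ G.cD w₂ := by
  dsimp only [bOut, gR, cD]
  refine G.cut_cut (𝟙 V) (Category.comp_id _) (Category.comp_id _)
    ⟨g₂, by simpa using sq₂.w, by simpa using w₂, IsPullback.of_vert_isIso ⟨by simp⟩⟩ (.refl _) ?_ ?_ ?_ <;>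
    ext <;> simp [w₁, w₂]

variable {G}

/-- As for the horizontal axiom, but the double cuts now pass through `gL` and `gR`, which split a
`Δ` off the left and the right end of the polynomial. -/
lemma IsGregarious.bk_vertical {f'' : U ⟶ V} {g₂' : U ⟶ W} {g₂ : V ⟶ X} {f' : W ⟶ X}
    {g₁' : W ⟶ Y} {g₁ : X ⟶ Z} {f : Y ⟶ Z} {g' : U ⟶ Y} {g : V ⟶ Z}
    (sq₂ : IsPullback f'' g₂' g₂ f') (sq₁ : IsPullback f' g₁' g₁ f)
    (sq : IsPullback f'' g' g f) (w₁ : g₂' ≫ g₁' = g') (w₂ : g₂ ≫ g₁ = g) :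
    hG.bk sq ≫ G.map (ten f) ◁ G.cD w₂ =
      G.cD w₁ ▷ G.map (ten f'') ≫ (α_ _ _ _).hom ≫ G.map (del g₁') ◁ hG.bk sq₂ ≫
        (α_ _ _ _).inv ≫ hG.bk sq₁ ▷ G.map (del g₂) ≫ (α_ _ _ _).hom := by
  have := hG.isIso_bIn g' f''
  rw [← cancel_epi (G.bIn g' f''), reassoc_of% hG.bIn_bk, reassoc_of% G.bIn_cD,
    ← whiskerLeft_comp_assoc, hG.bIn_bk, reassoc_of% G.gL_bOut,
    Iso.hom_inv_id_assoc, ← comp_whiskerRight_assoc, hG.bIn_bk, G.gR_bOut sq₂ sq₁ sq w₁ w₂]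

variable (G)

/-- Morphisms to an identity polynomial are unique, so `b` may be arbitrary. The left half agrees
with `P` by structure eta, which is why `a` enters through an equation. -/
lemma split_counit_right {P : Poly I J} (a : (splitR P).left ⟶ P) (ha : a = 𝟙 P)
    (b : (splitR P).right ⟶ one J) :
    G.cut (splitR P) a b ≫ G.map P ◁ G.counit J = (ρ_ _).inv := by
  have e := G.right_counit P
  rw [← cancel_mono (ρ_ _).hom, Iso.inv_hom_id, ← e, ha, Subsingleton.elim b (εr P), cut, G.map₂_id]
  simp

lemma split_counit_left {P : Poly I J} (b : (splitL P).right ⟶ P) (hb : b = 𝟙 P)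
    (a : (splitL P).left ⟶ one I) :
    G.cut (splitL P) a b ≫ G.counit I ▷ G.map P = (λ_ _).inv := by
  have e := G.left_counit P
  rw [← cancel_mono (λ_ _).hom, Iso.inv_hom_id, ← e, hb, Subsingleton.elim a (εl P), cut, G.map₂_id]
  simp

variable {G}

lemma IsGregarious.bk_id_horizontal {f : X ⟶ Y} (sq : IsPullback f (𝟙 X) (𝟙 Y) f) :
    hG.bk sq ≫ G.map (ten f) ◁ G.counit Y ≫ (ρ_ _).hom =
      G.counit X ▷ G.map (ten f) ≫ (λ_ _).hom := by
  have := hG.isIso_bIn (𝟙 X) f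
  have e₁ := G.split_counit_left (P := ten f) (𝟙 _) rfl (𝟙 _)
  have e₂ := G.split_counit_right (P := ten f) (𝟙 _) rfl (𝟙 _)
  rw [← cancel_epi (G.bIn (𝟙 X) f), reassoc_of% hG.bIn_bk]
  refine Eq.trans (b := 𝟙 _) ?_ ?_
  · refine (Category.assoc _ _ _).symm.trans ((congrArg (· ≫ (ρ_ _).hom) e₂).trans ?_)
    simp
  · refine Eq.symm ((Category.assoc _ _ _).symm.trans ((congrArg (· ≫ (λ_ _).hom) e₁).trans ?_))
    simp

lemma IsGregarious.bk_id_vertical {g : X ⟶ Y} (sq : IsPullback (𝟙 X) g g (𝟙 Y)) :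
    hG.bk sq ≫ G.counit Y ▷ G.map (del g) ≫ (λ_ _).hom =
      G.map (del g) ◁ G.counit X ≫ (ρ_ _).hom := by
  have := hG.isIso_bIn g (𝟙 X)
  have e₁ := G.split_counit_left (P := del g) (𝟙 _) rfl (toOne g)
  have e₂ := G.split_counit_right (P := del g) (𝟙 _) rfl (𝟙 _)
  rw [← cancel_epi (G.bIn g (𝟙 X)), reassoc_of% hG.bIn_bk]
  refine Eq.trans (b := 𝟙 _) ?_ ?_
  · refine (Category.assoc _ _ _).symm.trans ((congrArg (· ≫ (λ_ _).hom) e₁).trans ?_)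
    simp
  · refine Eq.symm ((Category.assoc _ _ _).symm.trans ((congrArg (· ≫ (ρ_ _).hom) e₂).trans ?_))
    simp

/-- The unit of the adjunction `F_Σ f ⊣ F_Δ f`. -/
noncomputable def IsGregarious.ut (f : X ⟶ Y) : 𝟙 (o X) ⟶ G.map (sig f) ≫ G.map (del f) :=
  haveI := hG.isIso_counit X
  inv (G.counit X) ≫ G.cU f

/-- The counit of the adjunction `F_Σ f ⊣ F_Δ f`. -/
noncomputable def IsGregarious.ct (f : X ⟶ Y) : G.map (del f) ≫ G.map (sig f) ⟶ 𝟙 (o Y) :=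
  haveI := hG.isIso_sIn f (𝟙 X) f
  inv (G.sIn f (𝟙 X) f) ≫ G.map₂ (toOne f) ≫ G.counit Y

lemma IsGregarious.counit_ut (f : X ⟶ Y) : G.counit X ≫ hG.ut f = G.cU f := by
  have := hG.isIso_counit X
  simp [ut]

lemma IsGregarious.sIn_ct (f : X ⟶ Y) :
    G.sIn f (𝟙 X) f ≫ hG.ct f = G.map₂ (toOne f) ≫ G.counit Y := by
  have := hG.isIso_sIn f (𝟙 X) f
  simp [ct]

/-- The adjunction `F_Σ f ⊣ F_Δ f`. -/
noncomputable def IsGregarious.adj (f : X ⟶ Y) :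
    Bicategory.Adjunction (G.map (sig f)) (G.map (del f)) where
  unit := hG.ut f
  counit := hG.ct f
  left_triangle := by
    have e₁ := G.split_counit_left (P := sig f) (𝟙 _) rfl (𝟙 _)
    have e₂ := G.split_counit_right (P := sig f) (𝟙 _) rfl (toOne f)
    -- Coassociativity trades the unit cut `cU` for `sIn`, against which the counit `ct` cancels by
    -- definition. The two counit laws `e₁` and `e₂` take care of the ends.
    have e₃ : G.cut (splitL (sig f)) (𝟙 _) (𝟙 _) ≫ G.cU f ▷ G.map (sig f) ≫ (α_ _ _ _).hom =
        G.cut (splitR (sig f)) (𝟙 _) (𝟙 _) ≫ G.map (sig f) ◁ G.sIn f (𝟙 X) f := by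
      dsimp only [cU, sIn]
      refine G.cut_cut (𝟙 X) (Category.comp_id _) (Category.comp_id _) (.refl _) (.refl _)
        ?_ ?_ ?_ <;> ext <;> simp
    have e₄ : leftZigzag (hG.ut f) (hG.ct f) =
        hG.ut f ▷ _ ≫ (α_ _ _ _).hom ≫ _ ◁ hG.ct f := by dsimp only [leftZigzag]; bicategory
    rw [e₄, ← cancel_epi (λ_ _).inv, Iso.inv_hom_id_assoc]
    refine (congrArg (· ≫ _) e₁.symm).trans ?_
    rw [Category.assoc, ← comp_whiskerRight_assoc, hG.counit_ut]
    refine ((reassoc_of% e₃) _).trans ?_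
    rw [← whiskerLeft_comp, hG.sIn_ct, whiskerLeft_comp, ← Category.assoc, cut_comp_right,
      ← e₂, Category.id_comp]
  right_triangle := by
    have e₁ := G.split_counit_left (P := del f) (𝟙 _) rfl (toOne f)
    have e₂ := G.split_counit_right (P := del f) (𝟙 _) rfl (𝟙 _)
    have e₃ : G.cut (splitL (del f)) (𝟙 _) (𝟙 _) ≫ G.sIn f (𝟙 X) f ▷ G.map (del f) ≫ (α_ _ _ _).hom =
        G.cut (splitR (del f)) (𝟙 _) (𝟙 _) ≫ G.map (del f) ◁ G.cU f := by
      dsimp only [cU, sIn]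
      refine G.cut_cut (𝟙 X) (Category.comp_id _) (Category.comp_id _) (.refl _) (.refl _)
        ?_ ?_ ?_ <;> ext <;> simp
    have e₄ : rightZigzag (hG.ut f) (hG.ct f) =
        _ ◁ hG.ut f ≫ (α_ _ _ _).inv ≫ hG.ct f ▷ _ := by dsimp only [rightZigzag]; bicategory
    rw [e₄, ← cancel_epi (ρ_ _).inv, Iso.inv_hom_id_assoc]
    refine (congrArg (· ≫ _) e₂.symm).trans ?_
    rw [Category.assoc, ← whiskerLeft_comp_assoc, hG.counit_ut]
    refine ((reassoc_of% e₃.symm) _).trans ?_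
    rw [Iso.hom_inv_id_assoc, ← comp_whiskerRight, hG.sIn_ct, comp_whiskerRight, ← Category.assoc,
      cut_comp_left, ← e₁, Category.id_comp]

end SplitFunctor

end Cut

end PolyCart

namespace PolyCart

open PullbackChoice DistributivityChoice PolyCart.Poly

/-! ### The lax Beck triple of a gregarious functor -/

section Compatible

variable {E : Type u} [Category.{v} E] {C : Type u₂} [Bicategory.{w₂, v₂} C] {o : E → C}

namespace SplitFunctor

variable {G : SplitFunctor o} (hG : G.IsGregarious) {X Y Z : E}

/-- `F (s, p, h) ⟶ F (s, p, f) ≫ F_Σ g`. -/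
def gS (G : SplitFunctor o) {I P Q J K : E} (s : P ⟶ I) (p : P ⟶ Q) {f : Q ⟶ J} {g : J ⟶ K}
    {h : Q ⟶ K} (w : f ≫ g = h) :
    G.map ⟨P, Q, s, p, h⟩ ⟶ G.map ⟨P, Q, s, p, f⟩ ≫ G.map (sig g) :=
  G.cut ⟨Q, p, 𝟙 Q, f, by simp⟩ (𝟙 _) ⟨f, f, by simp, w, IsPullback.of_vert_isIso ⟨by simp⟩⟩

lemma sIn_cS (G : SplitFunctor o) {I P Q J K : E} (s : P ⟶ I) (p : P ⟶ Q) {f : Q ⟶ J} {g : J ⟶ K}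
    {h : Q ⟶ K} (w : f ≫ g = h) :
    G.sIn s p h ≫ G.map ⟨P, Q, s, p, 𝟙 Q⟩ ◁ G.cS w =
      G.gS s p w ≫ G.sIn s p f ▷ G.map (sig g) ≫ (α_ _ _ _).hom := by
  dsimp only [sIn, cS, gS]
  symm
  refine G.cut_cut (𝟙 Q) (Category.comp_id _) (Category.comp_id _) (.refl _) (.refl _)
    ?_ ?_ ?_ <;> ext <;> simp

/-- Sending the left half to the identity polynomial turns this cut into the trivial cut of `Σ_g`,
restricted along the map from `(f, 1, h)`; there the counit law applies. -/
lemma gS_counit (G : SplitFunctor o) {f : X ⟶ Y} {g : Y ⟶ Z} {h : X ⟶ Z} (w : f ≫ g = h) :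
    G.gS f (𝟙 X) w ≫ (G.map₂ (toOne f) ≫ G.counit Y) ▷ G.map (sig g) ≫ (λ_ _).hom =
      G.map₂ (P := ⟨X, X, f, 𝟙 X, h⟩) (Q := sig g)
        ⟨f, f, by simp, w, IsPullback.of_vert_isIso ⟨by simp⟩⟩ := by
  let ρ : (⟨X, X, f, 𝟙 X, h⟩ : Poly Y Z) ⟶ sig g :=
    ⟨f, f, by simp, w, IsPullback.of_vert_isIso ⟨by simp⟩⟩
  have e := G.split_counit_left (P := sig g) (𝟙 _) rfl (𝟙 _)
  have e' : G.gS f (𝟙 X) w ≫ G.map₂ (toOne f) ▷ G.map (sig g) =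
      G.map₂ ρ ≫ G.cut (splitL (sig g)) (𝟙 _) (𝟙 _) := by
    rw [G.map₂_cut (A := ⟨X, 𝟙 X, 𝟙 X, f, by simp⟩)
      ⟨f, by simp [ρ], by simp, IsPullback.of_vert_isIso ⟨by simp [ρ]⟩⟩]
    refine (G.cut_comp_left _ _ _ _).trans ?_
    congr 1 <;> ext <;> simp [ρ]
  rw [comp_whiskerRight, Category.assoc, reassoc_of% e', reassoc_of% e, Iso.inv_hom_id,
    Category.comp_id]

/-- The counit form of compatibility. After cancelling `sIn` at `h`, coassociativity exposes `sIn`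
at `f`, where the inner counit is explicit; `gS_counit` then leaves `sIn` at `g`, where the outer
one is. -/
lemma cD_cS_counit {f : X ⟶ Y} {g : Y ⟶ Z} {h : X ⟶ Z} (w : f ≫ g = h) :
    G.cD w ▷ G.map (sig h) ≫ (G.map (del g) ≫ G.map (del f)) ◁ G.cS w ≫
      ((hG.adj f).comp (hG.adj g)).counit = (hG.adj h).counit := by
  have := hG.isIso_sIn h (𝟙 X) h
  have e₁ : G.sIn h (𝟙 X) h ≫ G.cD w ▷ G.map (sig h) ≫ (α_ _ _ _).hom =
      G.gL w (𝟙 X) h ≫ G.map (del g) ◁ G.sIn f (𝟙 X) h := by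
    dsimp only [sIn, cD, gL]
    refine G.cut_cut (𝟙 X) (Category.comp_id _) (Category.comp_id _) (.refl _) (.refl _)
      ?_ ?_ ?_ <;> ext <;> simp
  let ρ : (⟨X, X, f, 𝟙 X, h⟩ : Poly Y Z) ⟶ sig g :=
    ⟨f, f, by simp, w, IsPullback.of_vert_isIso ⟨by simp⟩⟩
  let ρ' : (⟨X, X, h, 𝟙 X, h⟩ : Poly Z Z) ⟶ ⟨Y, Y, g, 𝟙 Y, g⟩ :=
    ⟨f, f, w, w, IsPullback.of_vert_isIso ⟨by simp⟩⟩
  have e₃ := G.gS_counit w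
  have e₄ : G.gL w (𝟙 X) h ≫ G.map (del g) ◁ G.map₂ ρ = G.map₂ ρ' ≫ G.sIn g (𝟙 Y) g := by
    dsimp only [gL, sIn]
    rw [G.map₂_cut (A := ⟨X, 𝟙 X, 𝟙 X, f, by simp⟩)
      ⟨f, by simp [ρ'], by simp, IsPullback.of_vert_isIso ⟨by simp [ρ']⟩⟩, cut_comp_right]
    congr 1 <;> ext <;> simp [ρ, ρ']
  have e₅ : ((hG.adj f).comp (hG.adj g)).counit = (α_ _ _ _).hom ≫
      G.map (del g) ◁ ((α_ _ _ _).inv ≫ hG.ct f ▷ G.map (sig g) ≫ (λ_ _).hom) ≫ hG.ct g := by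
    dsimp only [Bicategory.Adjunction.comp, Bicategory.Adjunction.compCounit, IsGregarious.adj]
    bicategory
  rw [← cancel_epi (G.sIn h (𝟙 X) h), e₅]
  refine Eq.trans ?_ (hG.sIn_ct h).symm
  rw [comp_whiskerLeft]
  simp only [Category.assoc, Iso.inv_hom_id_assoc, whiskerLeft_comp]
  rw [reassoc_of% e₁, ← whiskerLeft_comp_assoc, G.sIn_cS]
  simp only [whiskerLeft_comp, Category.assoc, whiskerLeft_hom_inv_assoc]
  rw [← whiskerLeft_comp_assoc (G.map (del g)) (G.sIn f (𝟙 X) f ▷ _), ← comp_whiskerRight,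
    hG.sIn_ct, ← whiskerLeft_comp_assoc, ← whiskerLeft_comp_assoc, Category.assoc, e₃, reassoc_of% e₄,
    hG.sIn_ct, ← Category.assoc, ← G.map₂_comp]
  congr 2
  exact Subsingleton.elim (α := (_ ⟶ one _)) _ _

lemma counit_counit (X : E) : G.counit X ▷ G.map (sig (𝟙 X)) ≫ 𝟙 (o X) ◁ G.counit X ≫ (ρ_ _).hom =
    (hG.adj (𝟙 X)).counit := by
  have := hG.isIso_sIn (𝟙 X) (𝟙 X) (𝟙 X)
  have e := G.split_counit_left (P := sig (𝟙 X)) (𝟙 _) rfl (𝟙 _)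
  rw [← cancel_epi (G.sIn (𝟙 X) (𝟙 X) (𝟙 X))]
  refine Eq.trans ?_ (hG.sIn_ct (𝟙 X)).symm
  refine (Category.assoc _ _ _).symm.trans ((congrArg (· ≫ _ ◁ G.counit X ≫ (ρ_ _).hom) e).trans ?_)
  have h : G.map₂ (toOne (𝟙 X)) = 𝟙 _ := by
    rw [← G.map₂_id]; congr 1
  rw [h]
  simp

lemma cD_conjugate {f : X ⟶ Y} {g : Y ⟶ Z} {h : X ⟶ Z} (w : f ≫ g = h) :
    G.cD w ≫ conjugateEquiv ((hG.adj f).comp (hG.adj g)) (hG.adj h) (G.cS w) = 𝟙 _ := by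
  apply eq_of_whiskerRight_counit (hG.adj h)
  rw [comp_whiskerRight, Category.assoc, ← whiskerLeft_conjugate_counit, cD_cS_counit]
  simp

lemma counit_conjugate (X : E) :
    G.counit X ≫ conjugateEquiv (Bicategory.Adjunction.id _) (hG.adj (𝟙 X)) (G.counit X) = 𝟙 _ := by
  apply eq_of_whiskerRight_counit (hG.adj (𝟙 X))
  have e := whiskerLeft_conjugate_counit (Bicategory.Adjunction.id _) (hG.adj (𝟙 X)) (G.counit X)
  rw [comp_whiskerRight, Category.assoc, ← e]
  refine (counit_counit hG X).trans ?_
  simp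

end SplitFunctor

end Compatible

section Lax

variable {E : Type u} [Category.{v} E] [PullbackChoice E] [DistributivityChoice E]
  {C : Type u₂} [Bicategory.{w₂, v₂} C] {o : PolyC E → C} {F : OplaxOver o}
  (hF : F.IsGregarious) {I J K W X Y Z : E}

namespace OplaxOver

lemma isIso_cut {X : Poly I K} {P : Poly I J} {Q : Poly J K} {A : Split X J} {a : A.left ⟶ P}
    {b : A.right ⟶ Q} (h : IsIso (F.polyMapComp P Q)) (h' : IsIso (lift A a b)) :
    IsIso (F.toSplit.cut A a b) := by
  rw [cut_eq]
  have : IsIso (F.polyMap₂ (lift A a b)) := F.isIso_map₂ (a := ⟨I⟩) (b := ⟨K⟩) (lift A a b)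
  exact @IsIso.comp_isIso _ _ _ _ _ _ _ this h

lemma isIso_polyMapComp_of_cut {X : Poly I K} {P : Poly I J} {Q : Poly J K} {A : Split X J}
    {a : A.left ⟶ P} {b : A.right ⟶ Q} (h : IsIso (F.toSplit.cut A a b)) (h' : IsIso (lift A a b)) :
    IsIso (F.polyMapComp P Q) := by
  rw [cut_eq] at h
  have : IsIso (F.polyMap₂ (lift A a b)) := F.isIso_map₂ (a := ⟨I⟩) (b := ⟨K⟩) (lift A a b)
  exact @IsIso.of_isIso_comp_left _ _ _ _ _ (F.polyMap₂ (lift A a b)) _ this h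

noncomputable def sigDelAdj (f : X ⟶ Y) : Bicategory.Adjunction (B := PolyC E) (a := ⟨X⟩) (b := ⟨Y⟩)
    (sig f) (del f) := (spanToPoly E).mapAdjunction (spanAdj f)

lemma isIso_polyMapComp_sig (hF : F.IsGregarious) (P : Poly I X) (f : X ⟶ Y) : IsIso (F.polyMapComp P (sig f)) :=
  have h := hF.2
  @h ⟨I⟩ ⟨X⟩ ⟨Y⟩ P (sig f) (IsLeftAdjoint.mk (sigDelAdj f))

lemma isIso_polyMapComp_del (hF : F.IsGregarious) (f : X ⟶ Y) (P : Poly X I) : IsIso (F.polyMapComp (del f) P) :=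
  F.isIso_mapComp_of_adj (a := ⟨X⟩) (b := ⟨Y⟩) (c := ⟨I⟩) (sigDelAdj f) hF P

/-- The cells `sIn` and `bIn` are the constraint cells before a left adjoint `Σ_t` and after a right
adjoint `Δ_s`, composed with images of invertible lifts. -/
lemma isGregarious_toSplit (hF : F.IsGregarious) : F.toSplit.IsGregarious where
  isIso_counit I := hF.1 ⟨I⟩
  isIso_sIn s p t := isIso_cut (isIso_polyMapComp_sig hF _ _)
    (isIso_lift_of_isIso_p (IsPullback.id_horiz (𝟙 _)))
  isIso_bIn {I P Q} s p := by
    have : IsIso (𝟙 (⟨P, Q, 𝟙 P, p, 𝟙 Q⟩ : Poly P Q) : Hom _ _).ν := IsIso.id _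
    exact isIso_cut (isIso_polyMapComp_del hF _ _) isIso_lift_of_isIso_t

/-- A constraint cell of a restriction is one of `F` preceded by images of two structural
isomorphisms. Their composite is a single `lift`, so the cell is a cut; the same argument gives the
other identifications below. -/
lemma triple_Dc (f : X ⟶ Y) (g : Y ⟶ Z) : (F.triple hF).Dc f g = F.toSplit.cD rfl := by
  refine Eq.trans ?_ (cut_eq ..).symm
  change F.polyMap₂ (ofSpanMap' (Sp.cographComp f g)) ≫ F.polyMap₂ (ofSpanComp' _ _) ≫
    F.polyMapComp _ _ = _
  rw [← Category.assoc, ← polyMap₂_comp, ofSpanComp', comp_lift (A := ⟨X, 𝟙 X, 𝟙 X, f, by simp⟩)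
    ⟨𝟙 X, by simp [Sp.cographComp], by simp, IsPullback.of_horiz_isIso ⟨by simp⟩⟩]
  congr 3 <;> ext <;> simp [Sp.cographComp] <;> rfl

lemma triple_Sc (f : X ⟶ Y) (g : Y ⟶ Z) : (F.triple hF).Sc f g = F.toSplit.cS rfl := by
  refine Eq.trans ?_ (cut_eq ..).symm
  change F.polyMap₂ (ofSpanMap (Sp.graphComp f g).hom) ≫ F.polyMap₂ (ofSpanComp _ _) ≫
    F.polyMapComp _ _ = _
  rw [← Category.assoc, ← polyMap₂_comp, ofSpanComp, comp_lift (A := ⟨X, 𝟙 X, 𝟙 X, f, by simp⟩)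
    ⟨(Sp.graphComp f g).hom.hom, by simp, by
      simp only [Sp.graphComp]
      rw [pbLift_p₁_assoc, Category.id_comp],
      IsPullback.of_vert_isIso ⟨by simp⟩⟩]
  congr 3 <;> ext <;> simp [Sp.graphComp] <;> rfl

lemma triple_Nc (f : X ⟶ Y) (g : Y ⟶ Z) : (F.triple hF).Nc f g = F.toSplit.cN rfl := by
  refine Eq.trans ?_ (cut_eq ..).symm
  change F.polyMap₂ (ofSpanMap' (Sp.graphComp f g)) ≫ F.polyMap₂ (ofSpanComp' _ _) ≫
    F.polyMapComp _ _ = _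
  rw [← Category.assoc, ← polyMap₂_comp, ofSpanComp', comp_lift (A := ⟨Y, f, g, 𝟙 Y, rfl⟩)
    ⟨𝟙 Y, by simp [Sp.graphComp], by simp, IsPullback.of_horiz_isIso ⟨by simp⟩⟩]
  congr 3 <;> ext <;> simp [Sp.graphComp] <;> rfl

lemma beckIn_eq (f' : W ⟶ X) (g' : W ⟶ Y) : F.beckIn f' g' = F.toSplit.bIn g' f' := by
  refine Eq.trans ?_ (cut_eq ..).symm
  change F.polyMap₂ (ofSpanMap' (spanFactor g' f')) ≫ F.polyMap₂ (ofSpanComp' _ _) ≫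
    F.polyMapComp _ _ = _
  rw [← Category.assoc, ← polyMap₂_comp, ofSpanComp', comp_lift (A := ⟨W, 𝟙 W, f', 𝟙 W, by simp⟩)
    ⟨𝟙 W, by simp [spanFactor], by simp, IsPullback.of_horiz_isIso ⟨by simp⟩⟩]
  congr 3 <;> ext <;> simp [spanFactor]

lemma beckOut_eq {f' : W ⟶ X} {g' : W ⟶ Y} {g : X ⟶ Z} {f : Y ⟶ Z} (sq : IsPullback f' g' g f) :
    F.beckOut sq = F.toSplit.bOut sq := by
  refine Eq.trans ?_ (cut_eq ..).symm
  change F.polyMap₂ (ofSpanMap' (spanBaseChange sq)) ≫ F.polyMap₂ (ofSpanComp' _ _) ≫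
    F.polyMapComp _ _ = _
  rw [← Category.assoc, ← polyMap₂_comp, ofSpanComp', comp_lift (A := ⟨X, f', 𝟙 X, g, by simp⟩)
    ⟨𝟙 X, by simp [spanBaseChange], by simp, IsPullback.of_horiz_isIso ⟨by simp⟩⟩]
  congr 3 <;> ext <;> simp [spanBaseChange]

lemma triple_beck {f' : W ⟶ X} {g' : W ⟶ Y} {g : X ⟶ Z} {f : Y ⟶ Z} (sq : IsPullback f' g' g f) :
    (F.triple hF).beck sq = (isGregarious_toSplit hF).bk sq := by
  have := (isGregarious_toSplit hF).isIso_bIn g' f'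
  have h := F.isIso_beckIn hF f' g'
  refine (cancel_epi (F.beckIn f' g')).1 ((IsIso.hom_inv_id_assoc (F.beckIn f' g') _).trans ?_)
  rw [beckOut_eq, beckIn_eq]
  exact ((isGregarious_toSplit hF).bIn_bk sq).symm

lemma triple_Di (X : E) : (F.triple hF).Di X = F.toSplit.counit X := by
  change F.polyMap₂ (𝟙 _) ≫ F.polyMap₂ (𝟙 _) ≫ F.mapId ⟨X⟩ = _
  rw [polyMap₂_id, Category.id_comp, Category.id_comp]
  rfl

lemma triple_Si (X : E) : (F.triple hF).Si X = F.toSplit.counit X := triple_Di hF X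

lemma triple_Ni (X : E) : (F.triple hF).Ni X = F.toSplit.counit X := triple_Di hF X

/-- The adjunctions of the triple of a gregarious functor. -/
noncomputable def tripleAdj : (F.triple hF).Adj := fun _ _ f => (isGregarious_toSplit hF).adj f

lemma tripleAdj_compatible : (tripleAdj hF).Compatible := by
  refine ⟨fun X Y Z f g => ?_, fun X => ?_⟩
  · rw [triple_Dc, triple_Sc]
    exact SplitFunctor.cD_conjugate (isGregarious_toSplit hF) rfl
  · rw [triple_Di, triple_Si]
    exact SplitFunctor.counit_conjugate (isGregarious_toSplit hF) X

/-- The lax Beck triple of a gregarious functor. -/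
noncomputable def laxTriple (hN : F.restrictTensor.IsPseudo) :
    LaxBeckTriple (fun X : E => o ⟨X⟩) where
  toRawTriple := F.triple hF
  sig_pseudo := by
    refine ⟨fun X => ?_, fun X Y Z f g => ?_⟩
    · have := (isGregarious_toSplit hF).isIso_counit X.as
      exact (congrArg IsIso (triple_Si hF X.as)).mpr this
    · have : IsIso (F.toSplit.cS (rfl : f.as ≫ g.as = _)) := isIso_cut
        (isIso_polyMapComp_sig hF _ _) (isIso_lift_of_isIso_p (IsPullback.id_horiz f.as))
      exact (congrArg IsIso (triple_Sc hF f.as g.as)).mpr this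
  del_pseudo := by
    refine ⟨fun X => ?_, fun X Y Z f g => ?_⟩
    · have := (isGregarious_toSplit hF).isIso_counit X.as.unop
      exact (congrArg IsIso (triple_Di hF X.as.unop)).mpr this
    · have : IsIso (𝟙 (del g.as.unop) : Hom _ _).ν := IsIso.id _
      have : IsIso (F.toSplit.cD (rfl : g.as.unop ≫ f.as.unop = _)) := isIso_cut
        (isIso_polyMapComp_del hF _ _) isIso_lift_of_isIso_t
      exact (congrArg IsIso (triple_Dc hF g.as.unop f.as.unop)).mpr this
  ten_pseudo := hN
  exists_adj := ⟨_, tripleAdj_compatible hF⟩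
  beck_horizontal sq₂ sq₁ := by
    rw [triple_Nc, triple_Nc, triple_beck, triple_beck, triple_beck]
    exact (isGregarious_toSplit hF).bk_horizontal sq₂ sq₁ _ rfl rfl
  beck_vertical sq₂ sq₁ := by
    rw [triple_Dc, triple_Dc, triple_beck, triple_beck, triple_beck]
    exact (isGregarious_toSplit hF).bk_vertical sq₂ sq₁ _ rfl rfl
  beck_id_horizontal f := by
    rw [triple_Di, triple_Di, triple_beck]
    exact (isGregarious_toSplit hF).bk_id_horizontal _
  beck_id_vertical f := by
    rw [triple_Ni, triple_Ni, triple_beck]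
    exact (isGregarious_toSplit hF).bk_id_vertical _

end OplaxOver

end Lax

end PolyCart

namespace PolyCart

open PullbackChoice DistributivityChoice PolyCart.Poly

/-! ### A gregarious functor is recovered from its lax Beck triple -/

section Whisker

variable {C : Type u₂} [Bicategory.{w₂, v₂} C] {x y z a b c d e : C}

lemma wSplit_wSwap {f : a ⟶ d} {g : a ⟶ b} {h : b ⟶ d} {g' : a ⟶ c} {h' : c ⟶ d} (η : f ⟶ g ≫ h)
    (ζ : g ≫ h ⟶ g' ≫ h') (H : x ⟶ a) : wSplit η H ≫ wSwap ζ H = wSplit (η ≫ ζ) H := by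
  simp [wSplit, wSwap]

lemma wSplit_wCounit {f : a ⟶ a} {g : a ⟶ b} {h : b ⟶ a} (η : f ⟶ g ≫ h) (ζ : g ≫ h ⟶ 𝟙 a)
    (H : x ⟶ a) : wSplit η H ≫ wCounit ζ H = wDrop (η ≫ ζ) H := by
  simp [wSplit, wCounit, wDrop]

lemma wDrop_wUnit {f : a ⟶ a} {g : a ⟶ b} {h : b ⟶ a} (η : f ⟶ 𝟙 a) (ζ : 𝟙 a ⟶ g ≫ h)
    (H : x ⟶ a) : wDrop η H ≫ wUnit ζ H = wSplit (η ≫ ζ) H := by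
  simp [wSplit, wUnit, wDrop]

lemma wSplit_whiskerRight {f : a ⟶ c} {g g' : a ⟶ b} {h : b ⟶ c} (η : f ⟶ g ≫ h)
    (ρ : g ⟶ g') (H : x ⟶ a) : wSplit η H ≫ (H ◁ ρ) ▷ h = wSplit (η ≫ ρ ▷ h) H := by
  simp [wSplit]

lemma wSplit_whiskerLeft_right {f : a ⟶ c} {g : a ⟶ b} {h h' : b ⟶ c} (η : f ⟶ g ≫ h)
    (τ : h ⟶ h') (H : x ⟶ a) : wSplit η H ≫ (H ≫ g) ◁ τ = wSplit (η ≫ g ◁ τ) H := by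
  simp [wSplit]

end Whisker

section Recover

variable {E : Type u} [Category.{v} E] {C : Type u₂} [Bicategory.{w₂, v₂} C] {o : E → C}

namespace SplitFunctor

variable (G : SplitFunctor o) {I J K L P Q X Y W : E} {x y : C}

/-- The comparison of a functor with the composite of its parts. -/
def expand (s : P ⟶ I) (p : P ⟶ Q) (t : Q ⟶ J) (H : x ⟶ o I) :
    H ≫ G.map ⟨P, Q, s, p, t⟩ ⟶ ((H ≫ G.map (del s)) ≫ G.map (ten p)) ≫ G.map (sig t) :=
  wSplit (G.sIn s p t) H ≫ wSplit (G.bIn s p) H ▷ G.map (sig t)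

lemma expand_natural (s : P ⟶ I) (p : P ⟶ Q) (t : Q ⟶ J) {H H' : x ⟶ o I} (κ : H ⟶ H') :
    κ ▷ G.map ⟨P, Q, s, p, t⟩ ≫ G.expand s p t H' =
      G.expand s p t H ≫ κ ▷ G.map (del s) ▷ G.map (ten p) ▷ G.map (sig t) := by
  simp only [expand, Category.assoc]
  rw [reassoc_of% wSplit_natural, whiskerRight_sq (wSplit_natural _ κ) _]

lemma wExt_expand (s : P ⟶ I) (p : P ⟶ Q) (t : Q ⟶ J) {M : x ⟶ y} {H : y ⟶ o I} {H' : x ⟶ o I}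
    (κ : M ≫ H ⟶ H') :
    M ◁ G.expand s p t H ≫
        wExt (wExt (wExt κ (G.map (del s))) (G.map (ten p))) (G.map (sig t)) =
      wExt κ _ ≫ G.expand s p t H' := by
  simp only [expand, whiskerLeft_comp, Category.assoc]
  rw [wExt_whiskerRight (wExt_wSplit κ _), reassoc_of% wExt_wSplit]

variable {G} (hG : G.IsGregarious)

/-- Splitting off `F_Σ ν` and then `F_Δ ν` is, by coassociativity, a cut whose right half carries
`sIn` at `ν`. Applying the counit there leaves the right counit law, so only the image of `(σ, ν)`
remains. -/
lemma sIn_gR_ct {s : P ⟶ I} {p : P ⟶ Q} {σ : P ⟶ X} {ν : Q ⟶ Y} {s' : X ⟶ I} {p' : X ⟶ Y}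
    (w : σ ≫ s' = s) (sq : IsPullback p σ ν p') (H : x ⟶ o I) :
    wSplit (G.sIn s p ν) H ≫ wSplit (G.gR w sq) H ▷ G.map (sig ν) ≫ wCounit (hG.ct ν) _ =
      H ◁ G.map₂ (P := ⟨P, Q, s, p, ν⟩) (Q := ⟨X, Y, s', p', 𝟙 Y⟩)
        ⟨σ, ν, w, by simp, sq.flip⟩ := by
  let R : Poly I Y := ⟨X, Y, s', p', 𝟙 Y⟩
  let ρ : (⟨P, Q, s, p, ν⟩ : Poly I Y) ⟶ R := ⟨σ, ν, w, by simp [R], sq.flip⟩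
  have e₁ : G.sIn s p ν ≫ G.gR w sq ▷ G.map (sig ν) ≫ (α_ _ _ _).hom =
      G.cut (X := ⟨P, Q, s, p, ν⟩) ⟨Q, p, 𝟙 Q, ν, by simp⟩ ρ (𝟙 _) ≫
        G.map R ◁ G.sIn ν (𝟙 Q) ν := by
    dsimp only [sIn, gR]
    refine G.cut_cut (𝟙 Q) (Category.comp_id _) (Category.comp_id _) (.refl _) (.refl _)
      ?_ ?_ ?_ <;> ext <;> simp [ρ]
  have e₂ : G.cut (X := ⟨P, Q, s, p, ν⟩) ⟨Q, p, 𝟙 Q, ν, by simp⟩ ρ (𝟙 _) ≫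
      G.map R ◁ G.map₂ (toOne ν) = G.map₂ ρ ≫ G.cut (splitR R) (𝟙 _) (𝟙 _) := by
    rw [G.map₂_cut (A := ⟨Q, p, 𝟙 Q, ν, by simp⟩)
      ⟨ν, by simpa [ρ] using sq.w, by simp [R], IsPullback.of_vert_isIso ⟨by simp [ρ]⟩⟩]
    refine (G.cut_comp_right _ _ _ _).trans ?_
    congr 1 <;> ext <;> simp [ρ]
  have e₃ := G.right_counit R
  rw [← Category.assoc, wSplit_assoc e₁, Category.assoc, wSplit_wCounit, hG.sIn_ct,
    ← whiskerLeft_wDrop, ← Category.assoc]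
  refine (congrArg (· ≫ _) ((wSplit_whiskerLeft_right _ _ _).trans
    (congrArg (fun t => wSplit t H) e₂))).trans ?_
  rw [← whiskerLeft_wSplit, Category.assoc, wSplit_drop_right, Category.comp_id]
  have e₄ := G.split_counit_right (P := R) (𝟙 _) rfl (𝟙 _)
  refine (Category.assoc _ _ _).symm.trans ((congrArg (· ≫ (ρ_ _).hom) e₄).trans ?_)
  simp

/-- The action on cartesian morphisms in terms of the lax Beck triple. -/
lemma expand_map₂ {P' Q' : E} {s : P ⟶ I} {p : P ⟶ Q} {t : Q ⟶ J} {s' : P' ⟶ I} {p' : P' ⟶ Q'}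
    {t' : Q' ⟶ J} {σ : P ⟶ P'} {ν : Q ⟶ Q'} (hs : σ ≫ s' = s) (ht : ν ≫ t' = t)
    (sq : IsPullback p σ ν p') {d : G.map (del s) ⟶ G.map (del s') ≫ G.map (del σ)}
    (hd : d = G.cD hs) {n : G.map (del σ) ≫ G.map (ten p) ⟶ G.map (ten p') ≫ G.map (del ν)}
    (hn : n = hG.bk sq) {r : G.map (sig t) ⟶ G.map (sig ν) ≫ G.map (sig t')} (hr : r = G.cS ht)
    (H : x ⟶ o I) :
    G.expand s p t H ≫ (wSplit d H ▷ G.map (ten p) ≫ wSwap n _) ▷ G.map (sig t) ≫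
        wSplit r _ ≫ wCounit (hG.ct ν) _ ▷ G.map (sig t') =
      H ◁ G.map₂ (P := ⟨P, Q, s, p, t⟩) (Q := ⟨P', Q', s', p', t'⟩) ⟨σ, ν, hs, ht, sq.flip⟩ ≫
        G.expand s' p' t' H := by
  -- The cells enter through equations so that those of the triple, which equal the cuts only
  -- propositionally, can be supplied directly.
  subst hd hn hr
  -- After `bIn`, splitting off `F_Δ σ` and applying the Beck cell amounts to the single cut `gR`
  -- followed by `bIn` of the target.
  have e₁ : wSplit (G.bIn s p) H ≫ wSplit (G.cD hs) H ▷ G.map (ten p) ≫ wSwap (hG.bk sq) _ =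
      wSplit (G.gR hs sq) H ≫ wSplit (G.bIn s' p') H ▷ G.map (del ν) := by
    rw [← Category.assoc, wSplit_assoc (G.bIn_cD hs p), Category.assoc, wSplit_wSwap, hG.bIn_bk]
    exact (wSplit_assoc (G.gL_bOut hs sq).symm H).symm
  -- By naturality, cutting off `F_Σ t'` commutes with the morphism `(σ, ν)`. So once `e₁` and
  -- `sIn_gR_ct` have produced this morphism on the left half, it can be moved in front.
  have e₂ : G.gS s p ht ≫ G.map₂ (P := ⟨P, Q, s, p, ν⟩) (Q := ⟨P', Q', s', p', 𝟙 Q'⟩)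
        ⟨σ, ν, hs, by simp, sq.flip⟩ ▷ G.map (sig t') =
      G.map₂ (P := ⟨P, Q, s, p, t⟩) (Q := ⟨P', Q', s', p', t'⟩) ⟨σ, ν, hs, ht, sq.flip⟩ ≫
        G.sIn s' p' t' := by
    dsimp only [gS, sIn]
    rw [G.map₂_cut (A := ⟨Q, p, 𝟙 Q, ν, by simp⟩)
      ⟨ν, by simpa using sq.w, by simp, IsPullback.of_vert_isIso ⟨by simp⟩⟩, cut_comp_left]
    congr 1 <;> ext <;> simp
  have e₃ := congrArg (· ▷ G.map (sig t)) e₁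
  simp only [expand, comp_whiskerRight, Category.assoc] at e₃ ⊢
  rw [reassoc_of% e₃, reassoc_of% wSplit_natural (G.cS ht), reassoc_of% wSplit_natural (G.cS ht),
    whiskerRight_sq (wCounit_natural (hG.ct ν) _) _, ← reassoc_of% wSplit_assoc (G.sIn_cS s p ht).symm]
  have e₄ := congrArg (· ▷ G.map (sig t')) (sIn_gR_ct hG hs sq H)
  simp only [comp_whiskerRight] at e₄
  rw [reassoc_of% e₄, reassoc_of% wSplit_whiskerRight, e₂, ← whiskerLeft_wSplit, Category.assoc]

/-- The unit factors through the counit of `G`, which the trivial cut of `(s, k, 1)` can supply.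
Coassociativity then exhibits the inserted unit as a genuine cut. -/
lemma wUnit_ut (s : P ⟶ I) (k : P ⟶ W) (h : W ⟶ J) (H : x ⟶ o I) :
    wUnit (hG.ut h) (H ≫ G.map ⟨P, W, s, k, 𝟙 W⟩) =
      wSplit (G.cut (X := ⟨P, W, s, k, 𝟙 W⟩) (P := ⟨P, W, s, k, h⟩) (Q := del h)
        ⟨W, k, 𝟙 W, h, by simp⟩ (𝟙 _) (𝟙 _)) H ≫ wSplit (G.sIn s k h) H ▷ G.map (del h) := by
  let R : Poly I W := ⟨P, W, s, k, 𝟙 W⟩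
  have e₁ : G.cut (X := R) (P := ⟨P, W, s, k, h⟩) (Q := del h)
      ⟨W, k, 𝟙 W, h, by simp [R]⟩ (𝟙 _) (𝟙 _) ≫ G.sIn s k h ▷ G.map (del h) ≫ (α_ _ _ _).hom =
      G.cut (splitR R) (𝟙 _) (𝟙 _) ≫ G.map R ◁ G.cU h := by
    dsimp only [sIn, cU]
    refine G.cut_cut (𝟙 W) (Category.comp_id _) (Category.comp_id _) (.refl _) (.refl _)
      ?_ ?_ ?_ <;> ext <;> simp [R]
  have e₂ := G.split_counit_right (P := R) (𝟙 _) rfl (𝟙 _)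
  refine Eq.trans ?_ (wSplit_assoc e₁ H).symm
  rw [← hG.counit_ut, ← wDrop_wUnit, ← Category.assoc, wSplit_drop_right, Category.id_comp]
  refine (Category.assoc _ _ _).symm.trans ((congrArg (· ≫ (ρ_ _).hom) e₂).trans ?_)
  simp

/-- The comultiplications in terms of the lax Beck triple. -/
lemma expand_split {s : P ⟶ I} {p : P ⟶ Q} {t : Q ⟶ J} {k : P ⟶ W} {j : W ⟶ Q} (fac : k ≫ j = p)
    (h : W ⟶ K) {n : G.map (ten p) ⟶ G.map (ten k) ≫ G.map (ten j)} (hn : n = G.cN fac)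
    (H : x ⟶ o I) :
    G.expand s p t H ≫ (wSplit n _ ≫ wUnit (hG.ut h) _ ▷ G.map (ten j)) ▷ G.map (sig t) =
      wSplit (G.split (X := ⟨P, Q, s, p, t⟩) ⟨W, k, j, h, fac⟩) H ≫
        G.expand s k h H ▷ _ ≫ G.expand h j t _ := by
  subst hn
  have e₁ := congrArg (· ▷ G.map (sig t)) (wSplit_assoc (G.bIn_cN (s := s) fac).symm H)
  -- The equations `e₂` and `e₃` move the cut at `W` to the front, past the splitting of `Σ_t` and
  -- past that of `⊗_p` respectively.
  have e₂ : G.cut (X := ⟨P, Q, s, p, t⟩) (P := ⟨P, Q, s, p, 𝟙 Q⟩) (Q := sig t)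
      ⟨Q, p, 𝟙 Q, 𝟙 Q, by simp⟩ (𝟙 _) (𝟙 _) ≫
      G.cut (X := ⟨P, Q, s, p, 𝟙 Q⟩) ⟨W, k, j, h, fac⟩ (𝟙 _) (𝟙 _) ▷ G.map (sig t) ≫
        (α_ _ _ _).hom =
      G.cut (X := ⟨P, Q, s, p, t⟩) ⟨W, k, j, h, fac⟩ (𝟙 _) (𝟙 _) ≫ _ ◁ G.sIn h j t := by
    dsimp only [sIn]
    refine G.cut_cut j fac (Category.comp_id _) (.refl _) (.refl _)
      ?_ ?_ ?_ <;> ext <;> simp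
  have e₃ : G.cut (X := ⟨P, Q, s, p, 𝟙 Q⟩) (P := ⟨P, W, s, k, 𝟙 W⟩) (Q := ten j)
      ⟨W, k, j, 𝟙 W, fac⟩ (𝟙 _) (𝟙 _) ≫
      G.cut (X := ⟨P, W, s, k, 𝟙 W⟩) (P := ⟨P, W, s, k, h⟩) (Q := del h)
        ⟨W, k, 𝟙 W, h, by simp⟩ (𝟙 _) (𝟙 _) ▷ G.map (ten j) ≫ (α_ _ _ _).hom =
      G.cut (X := ⟨P, Q, s, p, 𝟙 Q⟩) ⟨W, k, j, h, fac⟩ (𝟙 _) (𝟙 _) ≫ _ ◁ G.bIn h j := by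
    dsimp only [bIn]
    refine G.cut_cut (𝟙 W) (Category.comp_id _) (Category.id_comp _) (.refl _) (.refl _)
      ?_ ?_ ?_ <;> ext <;> simp
  have e₄ := wUnit_ut hG s k h H
  have e₅ := congrArg (· ▷ G.map (sig t)) (wSplit_assoc e₃ H)
  rw [← cut_id, expand_natural]
  simp only [expand, comp_whiskerRight, Category.assoc] at e₁ e₅ ⊢
  rw [← reassoc_of% e₁, whiskerRight_sq (whiskerRight_sq (wUnit_natural (hG.ut h) _) _) _, e₄]
  simp only [comp_whiskerRight, Category.assoc]
  rw [reassoc_of% e₅, ← reassoc_of% wSplit_assoc e₂ H]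
  rfl

lemma expand_counit {d n r : G.map (one I) ⟶ 𝟙 (o I)} (hd : d = G.counit I) (hn : n = G.counit I)
    (hr : r = G.counit I) (H : x ⟶ o I) :
    G.expand (𝟙 I) (𝟙 I) (𝟙 I) H ≫ (wDrop d H ▷ G.map (ten (𝟙 I)) ≫
      wDrop n H) ▷ G.map (sig (𝟙 I)) ≫ wDrop r H = wDrop (G.counit I) H := by
  subst hd hn hr
  have e₂ := G.split_counit_left (P := one I) (𝟙 _) rfl (𝟙 _)
  have e₁ : G.bIn (𝟙 I) (𝟙 I) ≫ G.counit I ▷ G.map (one I) ≫ (λ_ _).hom = 𝟙 _ := by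
    refine (Category.assoc _ _ _).symm.trans ((congrArg (· ≫ (λ_ _).hom) e₂).trans ?_)
    simp
  have e₃ := congrArg (· ▷ G.map (sig (𝟙 I))) (wSplit_drop_left e₁ H)
  simp only [expand, comp_whiskerRight, Category.assoc] at e₃ ⊢
  rw [reassoc_of% e₃, id_whiskerRight, Category.id_comp, ← Category.assoc]
  exact (congrArg (· ≫ _) (wSplit_drop_left e₁ H)).trans (Category.id_comp _)

lemma map₂_expand_id {P' Q' : E} {s : P ⟶ I} {p : P ⟶ Q} {t : Q ⟶ J} {s' : P' ⟶ I} {p' : P' ⟶ Q'}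
    {t' : Q' ⟶ J} {m : G.map ⟨P, Q, s, p, t⟩ ⟶ G.map ⟨P', Q', s', p', t'⟩} {m'}
    (e : G.expand s p t (𝟙 _) ≫ m' = 𝟙 _ ◁ m ≫ G.expand s' p' t' (𝟙 _)) :
    m ≫ (λ_ _).inv ≫ G.expand s' p' t' (𝟙 _) = ((λ_ _).inv ≫ G.expand s p t (𝟙 _)) ≫ m' := by
  rw [Category.assoc, e]
  simp

lemma expand_id_wExt (s : P ⟶ I) (p : P ⟶ Q) (t : Q ⟶ J) (M : x ⟶ o I) :
    M ◁ ((λ_ _).inv ≫ G.expand s p t (𝟙 _)) ≫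
        wExt (wExt (wExt (ρ_ M).hom (G.map (del s))) (G.map (ten p))) (G.map (sig t)) =
      G.expand s p t M := by
  rw [whiskerLeft_comp, Category.assoc, wExt_expand]
  simp [wExt]

lemma expand_id_split {s : P ⟶ I} {p : P ⟶ Q} {t : Q ⟶ J} {k : P ⟶ W} {j : W ⟶ Q} (fac : k ≫ j = p)
    (h : W ⟶ K) {n : G.map (ten p) ⟶ G.map (ten k) ≫ G.map (ten j)} (hn : n = G.cN fac) :
    ((λ_ _).inv ≫ G.expand s p t (𝟙 _)) ≫
        (wSplit n _ ≫ wUnit (hG.ut h) _ ▷ G.map (ten j)) ▷ G.map (sig t) =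
      (G.split (X := ⟨P, Q, s, p, t⟩) ⟨W, k, j, h, fac⟩ ≫
        ((λ_ _).inv ≫ G.expand s k h (𝟙 _)) ▷ _) ≫ G.expand h j t _ := by
  rw [Category.assoc, expand_split hG fac h hn]
  simp [wSplit]

lemma IsGregarious.isIso_expand (hG : G.IsGregarious) (s : P ⟶ I) (p : P ⟶ Q) (t : Q ⟶ J)
    (H : x ⟶ o I) : IsIso (G.expand s p t H) := by
  have := hG.isIso_sIn s p t
  have := hG.isIso_bIn s p
  dsimp only [expand]; infer_instance

end SplitFunctor

end Recover

section Compare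

variable {E : Type u} [Category.{v} E] [PullbackChoice E] [DistributivityChoice E]
  {C : Type u₂} [Bicategory.{w₂, v₂} C] {o : PolyC E → C} {F : OplaxOver o}
  (hF : F.IsGregarious) (hN : F.restrictTensor.IsPseudo) {I J K P Q P' Q' W X Y Z : E}

namespace OplaxOver

lemma triple_dc {f : X ⟶ Y} {g : Y ⟶ Z} {h : X ⟶ Z} (w : f ≫ g = h) :
    (F.triple hF).dc w = F.toSplit.cD w := by
  subst w; rw [RawTriple.dc_rfl]; exact triple_Dc hF f g

lemma triple_nc {f : X ⟶ Y} {g : Y ⟶ Z} {h : X ⟶ Z} (w : f ≫ g = h) :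
    (F.triple hF).nc w = F.toSplit.cN w := by
  subst w; rw [RawTriple.nc_rfl]; exact triple_Nc hF f g

lemma triple_sc {f : X ⟶ Y} {g : Y ⟶ Z} {h : X ⟶ Z} (w : f ≫ g = h) :
    (F.triple hF).sc w = F.toSplit.cS w := by
  subst w; rw [RawTriple.sc_rfl]; exact triple_Sc hF f g

/-- The comparison of a gregarious functor with the one recovered from its triple. -/
noncomputable def recoverApp (P : Poly I J) : F.toSplit.map P ⟶ (laxTriple hF hN).real P :=
  (λ_ _).inv ≫ F.toSplit.expand P.s P.p P.t (𝟙 _)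

lemma isIso_recoverApp (P : Poly I J) : IsIso (recoverApp hF hN P) := by
  have := (isGregarious_toSplit hF).isIso_expand P.s P.p P.t (𝟙 _)
  exact @IsIso.comp_isIso _ _ _ _ _ _ _ inferInstance this

lemma recoverApp_realExt {x : C} (M : x ⟶ o ⟨I⟩) (P : Poly I J) :
    M ◁ recoverApp hF hN P ≫ (laxTriple hF hN).realExt M P = F.toSplit.expand P.s P.p P.t M :=
  F.toSplit.expand_id_wExt P.s P.p P.t M

/-- A gregarious functor is recovered from its lax Beck triple. -/
noncomputable def recover : F.toSplit.Hom
    ((laxTriple hF hN).realize (tripleAdj hF) (tripleAdj_compatible hF)) where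
  app P := recoverApp hF hN P
  natural {I J P Q} ρ := SplitFunctor.map₂_expand_id (SplitFunctor.expand_map₂
    (isGregarious_toSplit hF) ρ.hs ρ.ht ρ.cart.flip (triple_dc hF _) (triple_beck hF _)
    (triple_sc hF _) (𝟙 _))
  counit I := by
    have e := SplitFunctor.expand_counit (G := F.toSplit) (I := I) (triple_Di hF I)
      (triple_Ni hF I) (triple_Si hF I) (𝟙 _)
    refine (Category.assoc _ _ _).trans ((congrArg (_ ≫ ·) e).trans ?_)
    simp [wDrop]
  split {I J K X} A := by
    have e := SplitFunctor.expand_id_split (isGregarious_toSplit hF) (s := X.s) (t := X.t) A.fac A.h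
      (triple_nc hF A.fac)
    -- Composing with the comparison removes its inverse from the comultiplication of the
    -- realization, and both sides become expressions in `expand`.
    refine (cancel_mono ((laxTriple hF hN).realExt ((laxTriple hF hN).real A.left) A.right)).1 ?_
    refine Eq.trans (b := recoverApp hF hN X ≫ (laxTriple hF hN).splitCell (tripleAdj hF) X.s X.t
      A.fac A.h (𝟙 _)) ?_ (Eq.trans e ?_)
    · dsimp only [LaxBeckTriple.realize]
      rw [Category.assoc, Category.assoc, IsIso.inv_hom_id, Category.comp_id]
    · refine Eq.symm (((Category.assoc _ _ _).trans (congrArg (_ ≫ ·) (Category.assoc _ _ _))).trans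
        ?_)
      exact ((congrArg (fun t => _ ≫ _ ≫ t) (recoverApp_realExt hF hN _ _))).trans
        (Category.assoc _ _ _).symm

end OplaxOver

end Compare

end PolyCart

namespace PolyCart

open PullbackChoice DistributivityChoice PolyCart.Poly

/-! ### Functoriality of the oplax functor associated with a lax Beck triple -/

section Whisker

variable {C : Type u₂} [Bicategory.{w₂, v₂} C] {x y z a b c d e : C}

/-- Horizontal composition of 2-cells. -/
def hc {H H' : x ⟶ a} {f f' : a ⟶ b} (κ : H ⟶ H') (φ : f ⟶ f') : H ≫ f ⟶ H' ≫ f' :=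
  κ ▷ f ≫ H' ◁ φ

lemma hc_id (H : x ⟶ a) {f f' : a ⟶ b} (φ : f ⟶ f') : hc (𝟙 H) φ = H ◁ φ := by simp [hc]

lemma hc_id_id (H : x ⟶ a) (f : a ⟶ b) : hc (𝟙 H) (𝟙 f) = 𝟙 _ := by simp [hc]

lemma whiskerRight_hc {H H' H'' : x ⟶ a} {f f' : a ⟶ b} (κ : H ⟶ H') (κ' : H' ⟶ H'') (φ : f ⟶ f') :
    κ ▷ f ≫ hc κ' φ = hc (κ ≫ κ') φ := by simp [hc]

lemma hc_comp {H H' H'' : x ⟶ a} {f f' f'' : a ⟶ b} (κ : H ⟶ H') (κ' : H' ⟶ H'') (φ : f ⟶ f')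
    (φ' : f' ⟶ f'') : hc κ φ ≫ hc κ' φ' = hc (κ ≫ κ') (φ ≫ φ') := by
  simp [hc, whisker_exchange_assoc]

instance {H H' : x ⟶ a} {f f' : a ⟶ b} (κ : H ⟶ H') (φ : f ⟶ f') [IsIso κ] [IsIso φ] :
    IsIso (hc κ φ) := by
  dsimp only [hc]; infer_instance

variable {H H' : x ⟶ a} (κ : H ⟶ H')

lemma hc_whiskerRight {H₁ H₁' : x ⟶ a} {κ : H ⟶ H'} {κ₁ : H₁ ⟶ H₁'} {θ : H ⟶ H₁} {θ' : H' ⟶ H₁'}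
    (e : κ ≫ θ' = θ ≫ κ₁) {f f' : a ⟶ b} (φ : f ⟶ f') :
    hc κ φ ≫ θ' ▷ f' = θ ▷ f ≫ hc κ₁ φ := by
  rw [whiskerRight_hc, ← e]
  simp [hc, whisker_exchange]

/-- The lemmas of this group push a horizontal composite through one whiskered cell at a time. They
reduce naturality of the action in the triple to naturality of each ingredient. -/
lemma hc_wSplit {f f' : a ⟶ c} {g g' : a ⟶ b} {h h' : b ⟶ c} {η : f ⟶ g ≫ h} {η' : f' ⟶ g' ≫ h'}
    {φ : f ⟶ f'} {ψ : g ⟶ g'} {χ : h ⟶ h'} (e : φ ≫ η' = η ≫ ψ ▷ h ≫ g' ◁ χ) :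
    hc κ φ ≫ wSplit η' H' = wSplit η H ≫ hc (hc κ ψ) χ := by
  simp only [hc, Category.assoc]
  rw [whiskerLeft_wSplit, e, ← wSplit_whiskerLeft, reassoc_of% wSplit_natural, comp_whiskerRight,
    Category.assoc]

lemma hc_wSwap {f₁ f₁' : a ⟶ b} {g₁ g₁' : b ⟶ d} {f₂ f₂' : a ⟶ c} {g₂ g₂' : c ⟶ d}
    {η : f₁ ≫ g₁ ⟶ f₂ ≫ g₂} {η' : f₁' ≫ g₁' ⟶ f₂' ≫ g₂'} {φ₁ : f₁ ⟶ f₁'} {χ₁ : g₁ ⟶ g₁'}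
    {φ₂ : f₂ ⟶ f₂'} {χ₂ : g₂ ⟶ g₂'}
    (e : (φ₁ ▷ g₁ ≫ f₁' ◁ χ₁) ≫ η' = η ≫ φ₂ ▷ g₂ ≫ f₂' ◁ χ₂) :
    hc (hc κ φ₁) χ₁ ≫ wSwap η' H' = wSwap η H ≫ hc (hc κ φ₂) χ₂ := by
  simp only [hc, comp_whiskerRight, Category.assoc, wSwap]
  calc
    _ = 𝟙 _ ⊗≫ κ ▷ (f₁ ≫ g₁) ⊗≫ H' ◁ ((φ₁ ▷ g₁ ≫ f₁' ◁ χ₁) ≫ η') ⊗≫ 𝟙 _ := by bicategory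
    _ = 𝟙 _ ⊗≫ (κ ▷ (f₁ ≫ g₁) ≫ H' ◁ η) ⊗≫ H' ◁ (φ₂ ▷ g₂ ≫ f₂' ◁ χ₂) ⊗≫ 𝟙 _ := by
      rw [e]; bicategory
    _ = _ := by rw [← whisker_exchange]; bicategory

lemma hc_wUnit {g g' : a ⟶ b} {h h' : b ⟶ a} {η : 𝟙 a ⟶ g ≫ h} {η' : 𝟙 a ⟶ g' ≫ h'}
    {ψ : g ⟶ g'} {χ : h ⟶ h'} (e : η ≫ ψ ▷ h ≫ g' ◁ χ = η') :
    κ ≫ wUnit η' H' = wUnit η H ≫ hc (hc κ ψ) χ := by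
  subst e
  rw [wUnit_natural]
  simp only [hc, comp_whiskerRight, Category.assoc, wUnit]
  calc
    _ = 𝟙 _ ⊗≫ H ◁ η ⊗≫ (H ◁ (ψ ▷ h ≫ g' ◁ χ) ≫ κ ▷ (g' ≫ h')) ⊗≫ 𝟙 _ := by bicategory
    _ = _ := by rw [whisker_exchange]; bicategory

lemma hc_wCounit {g g' : a ⟶ b} {h h' : b ⟶ a} {η : g ≫ h ⟶ 𝟙 a} {η' : g' ≫ h' ⟶ 𝟙 a}
    {ψ : g ⟶ g'} {χ : h ⟶ h'} (e : (ψ ▷ h ≫ g' ◁ χ) ≫ η' = η) :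
    hc (hc κ ψ) χ ≫ wCounit η' H' = wCounit η H ≫ κ := by
  subst e
  rw [← wCounit_natural]
  simp only [hc, comp_whiskerRight, Category.assoc, wCounit]
  bicategory

lemma hc_wDrop {f f' : a ⟶ a} {η : f ⟶ 𝟙 a} {η' : f' ⟶ 𝟙 a} {φ : f ⟶ f'} (e : φ ≫ η' = η) :
    hc κ φ ≫ wDrop η' H' = wDrop η H ≫ κ := by
  subst e
  rw [← wDrop_natural, ← whiskerLeft_wDrop]
  simp [hc]

lemma hc_wExt {L L' : x ⟶ y} {K K' : y ⟶ a} {H H' : x ⟶ a} {η : L ≫ K ⟶ H} {η' : L' ≫ K' ⟶ H'}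
    {κ : L ⟶ L'} {ψ : K ⟶ K'} {χ : H ⟶ H'} (e : hc κ ψ ≫ η' = η ≫ χ) {f f' : a ⟶ b} (φ : f ⟶ f') :
    hc κ (hc ψ φ) ≫ wExt η' f' = wExt η f ≫ hc χ φ := by
  have e₁ := congrArg (· ▷ f) e
  simp only [hc, comp_whiskerRight, whiskerLeft_comp, Category.assoc, wExt] at e₁ ⊢
  calc
    _ = (α_ _ _ _).inv ≫ κ ▷ K ▷ f ≫ (L' ◁ ψ) ▷ f ≫ ((L' ≫ K') ◁ φ ≫ η' ▷ f') := by
      bicategory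
    _ = _ := by
      rw [whisker_exchange, reassoc_of% e₁]

end Whisker

section Functorial

variable {E : Type u} [Category.{v} E] {C : Type u₂} [Bicategory.{w₂, v₂} C] {o : E → C}

namespace LaxBeckTriple

variable {T T' : LaxBeckTriple o} (m : T ⟶ T') (adj : T.Adj) (adj' : T'.Adj)
  {I J K P Q W X Y Z : E} {x y : C}

namespace Hom

/-- The `Δ` part of a morphism of lax Beck triples. -/
abbrev appD (m : T ⟶ T') (f : X ⟶ Y) : T.D f ⟶ T'.D f := m.raw.β.app f.op.toLoc

/-- The `⊗` part of a morphism of lax Beck triples. -/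
abbrev appN (m : T ⟶ T') (f : X ⟶ Y) : T.N f ⟶ T'.N f := m.raw.γ.app f.toLoc

instance (m : T ⟶ T') (f : X ⟶ Y) : IsIso (appD m f) := m.isIso _

/-- The `Σ` part of a morphism of lax Beck triples. -/
noncomputable def appS (m : T ⟶ T') (adj : T.Adj) (adj' : T'.Adj) (f : X ⟶ Y) : T.S f ⟶ T'.S f :=
  (conjugateEquiv (adj' f) (adj f)).symm (inv (appD m f))

/-- The component `appS` is defined as the mate of the inverse of `appD` precisely so that the
counits, and in `unit_β` the units, are preserved. -/
lemma β_counit (f : X ⟶ Y) :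
    (appD m f ▷ T.S f ≫ T'.D f ◁ appS m adj adj' f) ≫ (adj' f).counit = (adj f).counit := by
  rw [Category.assoc, whiskerLeft_conjugate_counit (adj' f) (adj f), appS, Equiv.apply_symm_apply,
    ← comp_whiskerRight_assoc, IsIso.hom_inv_id, id_whiskerRight, Category.id_comp]

lemma unit_β (f : X ⟶ Y) :
    (adj f).unit ≫ appS m adj adj' f ▷ T.D f ≫ T'.S f ◁ appD m f = (adj' f).unit := by
  rw [← reassoc_of% unit_whiskerLeft_conjugate (adj' f) (adj f), appS, Equiv.apply_symm_apply,
    ← whiskerLeft_comp, IsIso.inv_hom_id, whiskerLeft_id, Category.comp_id]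

instance (f : X ⟶ Y) : IsIso (appS m adj adj' f) := by
  dsimp only [appS]
  exact conjugateEquiv_symm_iso _ _ _

variable {f : X ⟶ Y} {g : Y ⟶ Z} {h : X ⟶ Z} (w : f ≫ g = h)

lemma β_dc : appD m h ≫ T'.dc w = T.dc w ≫ appD m g ▷ T.D f ≫ T'.D g ◁ appD m f := by
  subst w
  rw [RawTriple.dc_rfl, RawTriple.dc_rfl]
  exact m.raw.β.mapComp g.op.toLoc f.op.toLoc

lemma γ_nc : appN m h ≫ T'.nc w = T.nc w ≫ appN m f ▷ T.N g ≫ T'.N f ◁ appN m g := by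
  subst w
  rw [RawTriple.nc_rfl, RawTriple.nc_rfl]
  exact m.raw.γ.mapComp f.toLoc g.toLoc

lemma β_Di (X : E) : appD m (𝟙 X) ≫ T'.Di X = T.Di X := m.raw.β.mapId _

lemma γ_Ni (X : E) : appN m (𝟙 X) ≫ T'.Ni X = T.Ni X := m.raw.γ.mapId _

variable {adj' adj}

/-- Taking conjugates is injective and reverses direction. It turns `appS` into the inverse of
`appD` and the constraints of `F_Σ` into the inverses of those of `F_Δ`, so the claim is the
inverted form of `β_dc`. -/
lemma τ_sc (hadj : adj.Compatible) (hadj' : adj'.Compatible) :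
    appS m adj adj' h ≫ T'.sc w = T.sc w ≫ appS m adj adj' f ▷ T.S g ≫ T'.S f ◁ appS m adj adj' g := by
  subst w
  rw [RawTriple.sc_rfl, RawTriple.sc_rfl]
  have : IsIso (T.Dc f g) := T.del_pseudo.2 _ _
  have : IsIso (T'.Dc f g) := T'.del_pseudo.2 _ _
  have e := β_dc m (rfl : f ≫ g = _)
  rw [RawTriple.dc_rfl, RawTriple.dc_rfl] at e
  have h₁ := hadj.1 f g
  have h₂ := hadj'.1 f g
  apply (conjugateEquiv ((adj' f).comp (adj' g)) (adj (f ≫ g))).injective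
  rw [← conjugateEquiv_comp _ (adj' (f ≫ g)), ← conjugateEquiv_comp _ ((adj f).comp (adj g)),
    ← conjugateEquiv_comp _ ((adj' f).comp (adj g)), Bicategory.conjugateEquiv_whiskerLeft,
    Bicategory.conjugateEquiv_whiskerRight, appS, appS, appS, Equiv.apply_symm_apply, Equiv.apply_symm_apply,
    Equiv.apply_symm_apply, ← cancel_epi (T'.Dc f g), reassoc_of% h₂,
    ← cancel_epi (appD m (f ≫ g)), IsIso.hom_inv_id, reassoc_of% e]
  simp only [Category.assoc]
  rw [whisker_exchange_assoc, ← whiskerLeft_comp_assoc, IsIso.hom_inv_id, whiskerLeft_id,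
    Category.id_comp, ← comp_whiskerRight_assoc, IsIso.hom_inv_id, id_whiskerRight,
    Category.id_comp, h₁]

lemma τ_Si (hadj : adj.Compatible) (hadj' : adj'.Compatible) (X : E) :
    appS m adj adj' (𝟙 X) ≫ T'.Si X = T.Si X := by
  have : IsIso (T'.Di X) := T'.del_pseudo.1 _
  apply (conjugateEquiv (Bicategory.Adjunction.id _) (adj (𝟙 X))).injective
  rw [← conjugateEquiv_comp _ (adj' (𝟙 X)), appS, Equiv.apply_symm_apply,
    ← cancel_epi (T'.Di X), reassoc_of% hadj'.2 X, ← cancel_epi (appD m (𝟙 X)), IsIso.hom_inv_id,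
    reassoc_of% β_Di m X, hadj.2]

/-- The comparison of actions. -/
noncomputable def actMap (m : T ⟶ T') (adj : T.Adj) (adj' : T'.Adj) (s : P ⟶ I) (p : P ⟶ Q)
    (t : Q ⟶ J) {H H' : x ⟶ o I} (κ : H ⟶ H') : T.act s p t H ⟶ T'.act s p t H' :=
  hc (hc (hc κ (appD m s)) (appN m p)) (appS m adj adj' t)

variable {s : P ⟶ I} {p : P ⟶ Q} {t : Q ⟶ J} {H H' : x ⟶ o I} (κ : H ⟶ H')

lemma actMap_mapCell (hadj : adj.Compatible) (hadj' : adj'.Compatible) {P' Q' : E} {s' : P' ⟶ I}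
    {p' : P' ⟶ Q'} {t' : Q' ⟶ J} {σ : P ⟶ P'} {ν : Q ⟶ Q'} (hs : σ ≫ s' = s) (ht : ν ≫ t' = t)
    (sq : IsPullback p σ ν p') :
    actMap m adj adj' s p t κ ≫ T'.mapCell adj' hs ht sq H' =
      T.mapCell adj hs ht sq H ≫ actMap m adj adj' s' p' t' κ := by
  simp only [mapCell, actMap, comp_whiskerRight, Category.assoc, RawTriple.c]
  rw [reassoc_of% hc_whiskerRight (hc_whiskerRight (hc_wSplit κ (β_dc m hs)) (appN m p))
      (appS m adj adj' t),
    reassoc_of% hc_whiskerRight (hc_wSwap (hc κ (appD m s')) (m.raw.comm sq)) (appS m adj adj' t),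
    reassoc_of% hc_wSplit _ (τ_sc m ht hadj hadj'),
    hc_whiskerRight (hc_wCounit _ (β_counit m adj adj' ν))]

lemma actMap_splitCell {k : P ⟶ W} {j : W ⟶ Q} (fac : k ≫ j = p) (h : W ⟶ K) :
    actMap m adj adj' s p t κ ≫ T'.splitCell adj' s t fac h H' =
      T.splitCell adj s t fac h H ≫ actMap m adj adj' h j t (actMap m adj adj' s k h κ) := by
  simp only [splitCell, actMap, comp_whiskerRight, Category.assoc, RawTriple.u]
  rw [reassoc_of% hc_whiskerRight (hc_wSplit (hc κ (appD m s)) (γ_nc m fac)) (appS m adj adj' t),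
    hc_whiskerRight (hc_whiskerRight (hc_wUnit _ (unit_β m adj adj' h)) _)]

lemma actMap_counitCell (hadj : adj.Compatible) (hadj' : adj'.Compatible) :
    actMap m adj adj' (𝟙 I) (𝟙 I) (𝟙 I) κ ≫ T'.counitCell I H' = T.counitCell I H ≫ κ := by
  simp only [counitCell, actMap, comp_whiskerRight, Category.assoc]
  rw [reassoc_of% hc_whiskerRight (hc_whiskerRight (hc_wDrop κ (β_Di m I)) (appN m (𝟙 I))) _,
    reassoc_of% hc_whiskerRight (hc_wDrop κ (γ_Ni m I)) _, hc_wDrop κ (τ_Si m hadj hadj' I)]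

variable (adj' adj)

/-- The component of the comparison at a polynomial. -/
noncomputable abbrev realMap (m : T ⟶ T') (adj : T.Adj) (adj' : T'.Adj) (P : Poly I J) :
    T.real P ⟶ T'.real P := actMap m adj adj' P.s P.p P.t (𝟙 _)

lemma realMap_realExt {M M' : x ⟶ o I} (κ : M ⟶ M') (P : Poly I J) :
    hc κ (realMap m adj adj' P) ≫ T'.realExt M' P = T.realExt M P ≫ actMap m adj adj' P.s P.p P.t κ :=
  hc_wExt (hc_wExt (hc_wExt (by simp [hc]) _) _) _

variable {adj' adj}

/-- Functoriality of the oplax functor associated with a lax Beck triple. -/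
noncomputable def realize (hadj : adj.Compatible) (hadj' : adj'.Compatible) :
    (T.realize adj hadj).Hom (T'.realize adj' hadj') where
  app P := realMap m adj adj' P
  natural ρ := (actMap_mapCell m _ hadj hadj' _ _ _).symm
  counit I := by
    refine (actMap_counitCell m (𝟙 _) hadj hadj').trans (Category.comp_id _)
  split {I J K X} A := by
    change realMap m adj adj' X ≫ T'.splitCell adj' X.s X.t A.fac A.h (𝟙 _) ≫
        inv (T'.realExt (T'.real A.left) A.right) =
      (T.splitCell adj X.s X.t A.fac A.h (𝟙 _) ≫ inv (T.realExt (T.real A.left) A.right)) ≫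
        hc (realMap m adj adj' A.left) (realMap m adj adj' A.right)
    rw [← Category.assoc, actMap_splitCell, Category.assoc, Category.assoc]
    congr 1
    rw [IsIso.comp_inv_eq, Category.assoc, realMap_realExt, IsIso.inv_hom_id_assoc]

end Hom

end LaxBeckTriple

end Functorial

end PolyCart

namespace PolyCart

open PullbackChoice DistributivityChoice PolyCart.Poly

/-! ### The oplax functor of a lax Beck triple is gregarious -/

section Strip

variable {E : Type u} [Category.{v} E] {C : Type u₂} [Bicategory.{w₂, v₂} C] {o : E → C}

namespace LaxBeckTriple

variable (T : LaxBeckTriple o) (adj : T.Adj) {I J K P Q W X Y Z : E} {x y : C}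

instance (X : E) : IsIso (T.Di X) := T.del_pseudo.1 _

instance (X : E) : IsIso (T.Ni X) := T.ten_pseudo.1 _

instance (X : E) : IsIso (T.Si X) := T.sig_pseudo.1 _

instance {f : X ⟶ Y} {g : Y ⟶ Z} {h : X ⟶ Z} (w : f ≫ g = h) : IsIso (T.nc w) := by
  have : IsIso (T.Nc f g) := T.ten_pseudo.2 _ _
  dsimp only [RawTriple.nc]; infer_instance

instance {f : X ⟶ Y} {g : Y ⟶ Z} {h : X ⟶ Z} (w : f ≫ g = h) : IsIso (T.sc w) := by
  have : IsIso (T.Sc f g) := T.sig_pseudo.2 _ _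
  dsimp only [RawTriple.sc]; infer_instance

/-- The action of `Δ_f` is composition with `F_Δ f`. -/
def stripDel (f : X ⟶ Y) (H : x ⟶ o Y) : T.act f (𝟙 X) (𝟙 X) H ⟶ H ≫ T.D f :=
  wDrop (T.Si X) _ ≫ wDrop (T.Ni X) _

/-- The action of `⊗_f` is composition with `F_⊗ f`. -/
def stripTen (f : X ⟶ Y) (H : x ⟶ o X) : T.act (𝟙 X) f (𝟙 Y) H ⟶ H ≫ T.N f :=
  wDrop (T.Si Y) _ ≫ wDrop (T.Di X) H ▷ T.N f

instance (f : X ⟶ Y) (H : x ⟶ o Y) : IsIso (T.stripDel f H) := by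
  dsimp only [stripDel]; infer_instance

instance (f : X ⟶ Y) (H : x ⟶ o X) : IsIso (T.stripTen f H) := by
  dsimp only [stripTen]; infer_instance

lemma stripDel_natural (f : X ⟶ Y) {H H' : x ⟶ o Y} (θ : H ⟶ H') :
    θ ▷ T.D f ▷ T.N (𝟙 X) ▷ T.S (𝟙 X) ≫ T.stripDel f H' = T.stripDel f H ≫ θ ▷ T.D f := by
  simp only [stripDel, Category.assoc]
  rw [reassoc_of% wDrop_natural, wDrop_natural]

/-- With a trivial second factor, the comultiplication of `F_⊗` is undone by the unit constraint,
and only the inserted unit remains. -/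
lemma splitCell_stripDel {s : P ⟶ I} {p : P ⟶ Q} (fac : p ≫ 𝟙 Q = p) (h : Q ⟶ K) (H : x ⟶ o I) :
    T.splitCell adj s (𝟙 Q) fac h H ≫ T.stripDel h _ =
      wDrop (T.Si Q) _ ≫ T.u adj h ((H ≫ T.D s) ≫ T.N p) := by
  simp only [splitCell, stripDel]
  rw [reassoc_of% wDrop_natural, Category.assoc, wDrop_natural, reassoc_of% T.nc_id_right p fac]

lemma splitCell_stripTen {adj : T.Adj} (hadj : adj.Compatible) {s : P ⟶ I} {p : P ⟶ Q} {k : P ⟶ W}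
    {j : W ⟶ Q} (fac : k ≫ j = p) (H : x ⟶ o I) :
    T.splitCell adj s (𝟙 Q) fac (𝟙 W) H ≫ T.stripTen j _ ≫ wDrop (T.Si W) _ ▷ T.N j =
      wDrop (T.Si Q) _ ≫ wSplit (T.nc fac) (H ≫ T.D s) := by
  have e := congrArg (· ▷ T.N j) (RawTriple.u_id hadj T.del_pseudo ((H ≫ T.D s) ≫ T.N k))
  simp only [comp_whiskerRight, id_whiskerRight] at e
  simp only [splitCell, stripTen, Category.assoc]
  rw [reassoc_of% wDrop_natural, Category.assoc, ← whiskerRight_sq (wDrop_natural _ _), e,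
    Category.comp_id]

lemma mapCell_drop {P' Q' : E} {s : P ⟶ I} {p : P ⟶ Q} {s' : P' ⟶ I} {p' : P' ⟶ Q'} {σ : P ⟶ P'}
    {ν : Q ⟶ Q'} (hs : σ ≫ s' = s) (ht : ν ≫ 𝟙 Q' = ν) (sq : IsPullback p σ ν p') (H : x ⟶ o I) :
    T.mapCell adj hs ht sq H ≫ wDrop (T.Si Q') _ =
      (wSplit (T.dc hs) H ▷ T.N p ≫ wSwap (T.beck sq) (H ≫ T.D s')) ▷ T.S ν ≫ T.c adj ν _ := by
  simp only [mapCell, Category.assoc]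
  rw [wDrop_natural, reassoc_of% T.sc_id_right]

/-- Mapping the left half to `Δ_g` produces a counit at `f`, the cut produces a unit at `f`, and a
triangle identity leaves the constraint cell of `F_Δ`. -/
lemma split_stripDel {f : X ⟶ Y} {g : Y ⟶ Z} {h : X ⟶ Z} (w : f ≫ g = h) (fac : 𝟙 X ≫ 𝟙 X = 𝟙 X)
    (ht : f ≫ 𝟙 Y = f) (sq : IsPullback (𝟙 X) f f (𝟙 Y)) (H : x ⟶ o Z) :
    T.splitCell adj h (𝟙 X) fac f H ≫
        T.mapCell adj w ht sq H ▷ T.D f ▷ T.N (𝟙 X) ▷ T.S (𝟙 X) ≫ T.stripDel f _ ≫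
        T.stripDel g H ▷ T.D f =
      T.stripDel h H ≫ wSplit (T.dc w) H := by
  rw [reassoc_of% T.stripDel_natural, reassoc_of% T.splitCell_stripDel]
  have e : T.mapCell adj w ht sq H ≫ T.stripDel g H =
      (wDrop (T.Ni X) _ ≫ wSplit (T.dc w) H) ▷ T.S f ≫ T.c adj f _ := by
    rw [stripDel, reassoc_of% T.mapCell_drop, ← RawTriple.c_natural, ← comp_whiskerRight_assoc,
      Category.assoc, T.bk_id_vertical, wDrop_natural]
  rw [← comp_whiskerRight, e, comp_whiskerRight, ← reassoc_of% RawTriple.u_natural,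
    RawTriple.u_c', Category.comp_id, stripDel, Category.assoc]

/-- The unit inserted by this cut is the one at an identity, which `u_id` cancels against unit
constraints. -/
lemma split_stripTen {adj : T.Adj} (hadj : adj.Compatible) {f : X ⟶ Y} {g : Y ⟶ Z} {h : X ⟶ Z}
    (w : f ≫ g = h) (H : x ⟶ o X) :
    T.splitCell adj (𝟙 X) (𝟙 Z) w (𝟙 Y) H ≫ T.stripTen g _ ≫ T.stripTen f H ▷ T.N g =
      T.stripTen h H ≫ wSplit (T.nc w) H := by
  rw [stripTen, stripTen, comp_whiskerRight]
  have e := T.splitCell_stripTen hadj (s := 𝟙 X) w H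
  rw [stripTen] at e
  simp only [Category.assoc] at e ⊢
  rw [reassoc_of% e, stripTen, Category.assoc, wSplit_natural]

lemma split_stripDel_stripTen {adj : T.Adj} (hadj : adj.Compatible) {s : P ⟶ I} {p : P ⟶ Q}
    (fac : 𝟙 P ≫ p = p) (H : x ⟶ o I) :
    T.splitCell adj s (𝟙 Q) fac (𝟙 P) H ≫ T.stripTen p _ ≫ T.stripDel s H ▷ T.N p =
      wDrop (T.Si Q) _ := by
  rw [stripDel, comp_whiskerRight, reassoc_of% T.splitCell_stripTen hadj, T.nc_id_left,
    Category.comp_id]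

/-- The map to `⊗_f` contributes the original Beck cell and a counit at `g`; the latter cancels the
unit inserted by the cut. This recovers the Beck cells from the realization. -/
lemma split_stripTen_stripDel {f' : W ⟶ X} {g' : W ⟶ Y} {g : X ⟶ Z} {f : Y ⟶ Z}
    (sq : IsPullback f' g' g f) (fac : f' ≫ 𝟙 X = f') (hs : g' ≫ 𝟙 Y = g') (ht : g ≫ 𝟙 Z = g)
    (H : x ⟶ o Y) :
    T.splitCell adj g' (𝟙 X) fac g H ≫ T.mapCell adj hs ht sq H ▷ T.D g ▷ T.N (𝟙 X) ▷ T.S (𝟙 X) ≫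
        T.stripDel g _ ≫ T.stripTen f H ▷ T.D g =
      wDrop (T.Si X) _ ≫ wSwap (T.beck sq) H := by
  rw [reassoc_of% T.stripDel_natural, reassoc_of% T.splitCell_stripDel]
  have e : T.mapCell adj hs ht sq H ≫ T.stripTen f H =
      wSwap (T.beck sq) H ▷ T.S g ≫ T.c adj g _ := by
    rw [stripTen, reassoc_of% T.mapCell_drop, ← RawTriple.c_natural, ← comp_whiskerRight_assoc,
      Category.assoc, ← wSwap_natural, reassoc_of% whiskerRight_eq_id (T.dc_id_right _ hs H)]
  rw [← comp_whiskerRight, e, comp_whiskerRight, ← reassoc_of% RawTriple.u_natural,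
    RawTriple.u_c', Category.comp_id]

/-- The action of a polynomial, followed by that of `Σ_f`. -/
lemma split_stripSig {s : P ⟶ I} {p : P ⟶ Q} {f : Q ⟶ Y} {g : Y ⟶ Z} {h : Q ⟶ Z} (w : f ≫ g = h)
    (fac : p ≫ 𝟙 Q = p) (hs : f ≫ 𝟙 Y = f) (sq : IsPullback (𝟙 Q) f f (𝟙 Y)) (H : x ⟶ o I) :
    T.splitCell adj s h fac f H ≫ T.mapCell adj hs w sq (T.act s p f H) ≫
        (wDrop (T.Di Y) _ ▷ T.N (𝟙 Y) ≫ wDrop (T.Ni Y) _) ▷ T.S g =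
      wSplit (T.sc w) _ := by
  have e₁ := congrArg (· ▷ T.S h) (T.bk_id_vertical sq (T.act s p f H))
  simp only [mapCell, splitCell, comp_whiskerRight, Category.assoc] at e₁ ⊢
  rw [← reassoc_of% whiskerRight_sq (RawTriple.c_natural adj f _) (T.S g),
    ← whiskerRight_sq (RawTriple.c_natural adj f _) (T.S g),
    ← reassoc_of% wSplit_natural (T.sc w), ← reassoc_of% wSplit_natural (T.sc w),
    ← reassoc_of% whiskerRight_sq (wSwap_natural (T.beck sq) _) (T.S h),
    reassoc_of% whiskerRight_eq_id (whiskerRight_eq_id (T.dc_id_right f hs _) _) (T.S h),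
    reassoc_of% e₁, reassoc_of% whiskerRight_sq (wDrop_natural (T.Ni Q) _) (T.S h),
    reassoc_of% whiskerRight_eq_id (T.nc_id_right p fac _) _, reassoc_of% wSplit_natural (T.sc w),
    whiskerRight_eq_id (RawTriple.u_c adj f _), Category.comp_id]

end LaxBeckTriple

end Strip

end PolyCart

namespace PolyCart

open PullbackChoice DistributivityChoice PolyCart.Poly

/-! ### The `Δ`, `⊗` and `Σ` parts of the realization -/

section Realize

variable {E : Type u} [Category.{v} E] {C : Type u₂} [Bicategory.{w₂, v₂} C] {o : E → C}

namespace LaxBeckTriple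

variable (T : LaxBeckTriple o) {adj : T.Adj} (hadj : adj.Compatible) {I J K P Q W X Y Z : E} {x y : C}

lemma split_realExt {X : Poly I K} (A : Split X J) :
    (T.realize adj hadj).split A ≫ T.realExt (T.real A.left) A.right =
      T.splitCell adj X.s X.t A.fac A.h (𝟙 _) := by
  dsimp only [realize]
  rw [Category.assoc, IsIso.inv_hom_id, Category.comp_id]

lemma cut_realExt {X : Poly I K} {P : Poly I J} (A : Split X J) (a : A.left ⟶ P) :
    (T.realize adj hadj).cut A a (𝟙 _) ≫ T.realExt (T.real P) A.right =
      T.splitCell adj X.s X.t A.fac A.h (𝟙 _) ≫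
        T.mapCell adj a.hs a.ht a.cart.flip (𝟙 _) ▷ T.D A.h ▷ T.N A.j ▷ T.S X.t := by
  have e := (T.realize adj hadj).cut_comp_left A (𝟙 _) (𝟙 _) a
  rw [Category.id_comp, SplitFunctor.cut_id] at e
  rw [← e, Category.assoc]
  refine (congrArg (_ ≫ ·) (T.realExt_natural _ _)).trans ?_
  rw [← Category.assoc]
  exact congrArg (· ≫ _) (T.split_realExt hadj A)

lemma cut_id_realExt {X : Poly I K} (A : Split X J) :
    (T.realize adj hadj).cut A (𝟙 _) (𝟙 _) ≫ T.realExt (T.real A.left) A.right =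
      T.splitCell adj X.s X.t A.fac A.h (𝟙 _) := by
  rw [SplitFunctor.cut_id]
  exact T.split_realExt hadj A

/-- The 1-cell of `Δ_f` is `F_Δ f`. -/
def realDel (f : X ⟶ Y) : T.real (del f) ⟶ T.D f := T.stripDel f (𝟙 _) ≫ (λ_ _).hom

/-- The 1-cell of `⊗_f` is `F_⊗ f`. -/
def realTen (f : X ⟶ Y) : T.real (ten f) ⟶ T.N f := T.stripTen f (𝟙 _) ≫ (λ_ _).hom

instance (f : X ⟶ Y) : IsIso (T.realDel f) := by dsimp only [realDel]; infer_instance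

instance (f : X ⟶ Y) : IsIso (T.realTen f) := by dsimp only [realTen]; infer_instance

lemma whiskerLeft_realDel (f : X ⟶ Y) (M : x ⟶ o Y) :
    M ◁ T.realDel f = T.realExt M (del f) ≫ T.stripDel f M := by
  have e : wExt (ρ_ M).hom (T.D f) = M ◁ (λ_ _).hom := by simp [wExt]
  simp only [realDel, stripDel, realExt, actExt, whiskerLeft_comp]
  rw [← e, Category.assoc, wExt_wDrop (wExt (ρ_ M).hom (T.D f)),
    reassoc_of% wExt_wDrop (wExt (wExt (ρ_ M).hom (T.D f)) (T.N (𝟙 X)))]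

lemma whiskerLeft_realTen (f : X ⟶ Y) (M : x ⟶ o X) :
    M ◁ T.realTen f = T.realExt M (ten f) ≫ T.stripTen f M := by
  have e : wExt (ρ_ M).hom (T.N f) = M ◁ (λ_ _).hom := by simp [wExt]
  simp only [realTen, stripTen, realExt, actExt, whiskerLeft_comp]
  rw [← e, Category.assoc, wExt_whiskerRight (wExt_wDrop _ _),
    reassoc_of% wExt_wDrop (wExt (wExt (ρ_ M).hom (T.D (𝟙 X))) (T.N f))]

lemma wSplit_leftUnitor {a b c : C} {f : a ⟶ c} {g : a ⟶ b} {h : b ⟶ c} (η : f ⟶ g ≫ h) :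
    wSplit η (𝟙 a) ≫ (λ_ g).hom ▷ h = (λ_ f).hom ≫ η := by
  simp [wSplit]

lemma wSwap_leftUnitor {a b c d : C} {f : a ⟶ b} {g : b ⟶ d} {f' : a ⟶ c} {g' : c ⟶ d}
    (η : f ≫ g ⟶ f' ≫ g') :
    wSwap η (𝟙 a) ≫ (λ_ f').hom ▷ g' = (λ_ f).hom ▷ g ≫ η := by
  simp [wSwap]

/-- Composing with `realDel` amounts to the comparison followed by stripping, which turns the
realized cut into the cell computed in `split_stripDel`. The analogues for `⊗` and for Beck cells
follow the same route. -/
lemma realDel_dc {f : X ⟶ Y} {g : Y ⟶ Z} {h : X ⟶ Z} (w : f ≫ g = h) :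
    T.realDel h ≫ T.dc w = (T.realize adj hadj).cD w ≫ T.realDel g ▷ T.real (del f) ≫
      T.D g ◁ T.realDel f := by
  have e := T.split_stripDel adj w (by simp) (by simp) (IsPullback.id_horiz f) (𝟙 _)
  rw [← whisker_exchange, whiskerLeft_realDel, Category.assoc, SplitFunctor.cD,
    reassoc_of% T.cut_realExt hadj, realDel, realDel, Category.assoc, comp_whiskerRight,
    ← wSplit_leftUnitor, ← reassoc_of% e]

lemma realTen_nc {f : X ⟶ Y} {g : Y ⟶ Z} {h : X ⟶ Z} (w : f ≫ g = h) :
    T.realTen h ≫ T.nc w = (T.realize adj hadj).cN w ≫ T.realTen f ▷ T.real (ten g) ≫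
      T.N f ◁ T.realTen g := by
  have e := T.split_stripTen hadj w (𝟙 _)
  rw [← whisker_exchange, whiskerLeft_realTen, Category.assoc, SplitFunctor.cN,
    reassoc_of% T.cut_id_realExt hadj, realTen, realTen, Category.assoc,
    comp_whiskerRight, ← wSplit_leftUnitor, ← reassoc_of% e]

lemma bIn_realDel_realTen (s : P ⟶ I) (p : P ⟶ Q) :
    (T.realize adj hadj).bIn s p ≫ T.realDel s ▷ T.real (ten p) ≫ T.D s ◁ T.realTen p =
      wDrop (T.Si Q) _ ≫ (λ_ _).hom ▷ T.N p := by
  have e := T.split_stripDel_stripTen hadj (s := s) (p := p) (by simp) (𝟙 _)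
  rw [← whisker_exchange, whiskerLeft_realTen, Category.assoc, SplitFunctor.bIn,
    reassoc_of% T.cut_id_realExt hadj, realDel, comp_whiskerRight,
    ← reassoc_of% e]

lemma bOut_realTen_realDel {f' : W ⟶ X} {g' : W ⟶ Y} {g : X ⟶ Z} {f : Y ⟶ Z}
    (sq : IsPullback f' g' g f) :
    (T.realize adj hadj).bOut sq ≫ T.realTen f ▷ T.real (del g) ≫ T.N f ◁ T.realDel g =
      wDrop (T.Si X) _ ≫ (λ_ _).hom ▷ T.N f' ≫ T.beck sq := by
  have e := T.split_stripTen_stripDel adj sq (by simp) (by simp) (by simp) (𝟙 _)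
  rw [← whisker_exchange, whiskerLeft_realDel, Category.assoc, SplitFunctor.bOut,
    reassoc_of% T.cut_realExt hadj, realTen, comp_whiskerRight, ← wSwap_leftUnitor,
    ← reassoc_of% e]

lemma wDrop_id {a : C} {f : a ⟶ a} (η : f ⟶ 𝟙 a) : wDrop η (𝟙 a) = (λ_ f).hom ≫ η := by
  simp [wDrop]

lemma realDel_Di (X : E) : T.realDel (𝟙 X) ≫ T.Di X = (T.realize adj hadj).counit X := by
  dsimp only [realize, realDel, stripDel, counitCell]
  rw [wDrop_natural (T.Si X), Category.assoc, Category.assoc, ← wDrop_id,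
    wDrop_natural (T.Ni X)]

lemma realTen_Ni (X : E) : T.realTen (𝟙 X) ≫ T.Ni X = (T.realize adj hadj).counit X := by
  dsimp only [realize, realTen, stripTen, counitCell]
  rw [wDrop_natural, Category.assoc, Category.assoc, ← wDrop_id]

lemma isIso_split_ten {f : X ⟶ Y} {g : Y ⟶ Z} {h : X ⟶ Z} (w : f ≫ g = h) :
    IsIso ((T.realize adj hadj).cN w) := by
  have h := T.realTen_nc hadj w
  have : IsIso ((T.realize adj hadj).cN w ≫ T.realTen f ▷ T.real (ten g) ≫
      T.N f ◁ T.realTen g) := by rw [← h]; infer_instance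
  exact IsIso.of_isIso_comp_right _ (T.realTen f ▷ T.real (ten g) ≫ T.N f ◁ T.realTen g)

/-- The map to `Σ_g`. -/
abbrev _root_.PolyCart.Poly.toSig {f : Q ⟶ Y} {g : Y ⟶ Z} {h : Q ⟶ Z} (w : f ≫ g = h) :
    (⟨Q, Q, f, 𝟙 Q, h⟩ : Poly Y Z) ⟶ sig g :=
  ⟨f, f, by simp, w, IsPullback.of_vert_isIso ⟨by simp⟩⟩

/-- Up to the invertible comparison and the invertible unit constraints of `F_Δ` and `F_⊗`, this cut
is the constraint cell `sc w` of the pseudofunctor `F_Σ`. -/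
lemma isIso_cut_sig {s : P ⟶ I} {p : P ⟶ Q} {f : Q ⟶ Y} {g : Y ⟶ Z} {h : Q ⟶ Z} (w : f ≫ g = h) :
    IsIso ((T.realize adj hadj).cut (X := ⟨P, Q, s, p, h⟩) ⟨Q, p, 𝟙 Q, f, by simp⟩ (𝟙 _)
      (toSig w)) := by
  let A : Split (⟨P, Q, s, p, h⟩ : Poly I Z) Y := ⟨Q, p, 𝟙 Q, f, by simp⟩
  have e := (T.realize adj hadj).cut_comp_right A (𝟙 _) (𝟙 _) (toSig w)
  rw [Category.id_comp, SplitFunctor.cut_id] at e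
  have e₁ := T.actExt_mapCell adj (toSig w).hs (toSig w).ht (toSig w).cart.flip
    (ρ_ (T.real A.left)).hom
  have e₂ : (T.realize adj hadj).cut A (𝟙 _) (toSig w) ≫ T.realExt (T.real A.left) (sig g) =
      T.splitCell adj s h A.fac f (𝟙 _) ≫
        T.mapCell adj (toSig w).hs (toSig w).ht (toSig w).cart.flip (T.real A.left) := by
    rw [← e, Category.assoc]
    refine (congrArg (_ ≫ ·) e₁).trans ?_
    rw [← Category.assoc]
    exact congrArg (· ≫ _) (T.split_realExt hadj A)
  have e₃ := T.split_stripSig adj (s := s) w A.fac (toSig w).hs (toSig w).cart.flip (𝟙 _)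
  rw [← reassoc_of% e₂] at e₃
  have e₄ : IsIso ((T.realize adj hadj).cut A (𝟙 _) (toSig w) ≫
      T.realExt (T.real A.left) (sig g) ≫ (wDrop (T.Di Y) _ ▷ T.N (𝟙 Y) ≫ wDrop (T.Ni Y) _) ▷ T.S g) := by
    rw [e₃]; infer_instance
  exact IsIso.of_isIso_comp_right _ (T.realExt (T.real A.left) (sig g) ≫
    (wDrop (T.Di Y) _ ▷ T.N (𝟙 Y) ≫ wDrop (T.Ni Y) _) ▷ T.S g)

variable [PullbackChoice E] [DistributivityChoice E]

lemma isIso_mapComp_sig (R : Poly I Y) (g : Y ⟶ Z) :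
    IsIso ((T.realize adj hadj).mapComp R (sig g)) := by
  have h₁ := T.isIso_cut_sig hadj (s := R.s) (p := R.p) (f := R.t) (g := g) rfl
  have h₂ := (T.realize adj hadj).map₂_lift_mapComp
    (X := ⟨R.pos, R.shp, R.s, R.p, R.t ≫ g⟩) (P := R) ⟨R.shp, R.p, 𝟙 _, R.t, Category.comp_id _⟩ (𝟙 _)
      (toSig (rfl : R.t ≫ g = _))
  have h₃ : IsIso (lift (X := ⟨R.pos, R.shp, R.s, R.p, R.t ≫ g⟩) (P := R)
      ⟨R.shp, R.p, 𝟙 _, R.t, Category.comp_id _⟩ (𝟙 _) (toSig (rfl : R.t ≫ g = _))) :=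
    isIso_lift_of_isIso_p (IsPullback.id_horiz R.t)
  have h₄ := (T.realize adj hadj).isIso_map₂ (lift (X := ⟨R.pos, R.shp, R.s, R.p, R.t ≫ g⟩) (P := R)
      ⟨R.shp, R.p, 𝟙 _, R.t, Category.comp_id _⟩ (𝟙 _) (toSig (rfl : R.t ≫ g = _)))
  refine @IsIso.of_isIso_comp_left _ _ _ _ _ _ _ h₄ ?_
  rw [h₂]
  exact h₁

lemma isIso_mapComp_of_iso (G : SplitFunctor o) (R : Poly I J) {S S' : Poly J K} (e : S ⟶ S')
    [IsIso e] (h : IsIso (G.mapComp R S)) : IsIso (G.mapComp R S') := by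
  have e₁ := G.mapComp_natural (𝟙 R) e
  have : IsIso (hcomp (𝟙 R) e) := ⟨hcomp (𝟙 R) (inv e), by
    rw [hcomp_comp, IsIso.hom_inv_id, Category.comp_id, hcomp_id], by
    rw [hcomp_comp, IsIso.inv_hom_id, Category.comp_id, hcomp_id]⟩
  have := G.isIso_map₂ (hcomp (𝟙 R) e)
  have := G.isIso_map₂ e
  refine @IsIso.of_isIso_comp_left _ _ _ _ _ (G.map₂ (hcomp (𝟙 R) e)) _ _ ?_
  rw [e₁, G.map₂_id]
  infer_instance

/-- A polynomial with a right adjoint has invertible `s` and `p`, hence is isomorphic to some `Σ_f`,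
where `isIso_mapComp_sig` applies. Naturality carries the result along the isomorphism. -/
lemma isGregarious_realize : (T.realize adj hadj).toOplaxOver.IsGregarious := by
  refine ⟨fun X => inferInstanceAs (IsIso (T.counitCell X.as (𝟙 _))), fun X Y Z R S hS => ?_⟩
  obtain ⟨h₁, h₂⟩ := isIso_of_isLeftAdjoint (I := Y.as) (J := Z.as) hS
  let S' : Poly Y.as Z.as := S
  have : IsIso S'.s := h₁
  have : IsIso S'.p := h₂
  let e : sig (inv S'.s ≫ S'.p ≫ S'.t) ⟶ S' :=
    ⟨inv S'.s, inv S'.s ≫ S'.p, by simp, by simp, IsPullback.of_vert_isIso ⟨by simp⟩⟩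
  have : IsIso e := isIso_of_isIso_ν _ (inferInstanceAs (IsIso (inv S'.s ≫ S'.p)))
  exact isIso_mapComp_of_iso (T.realize adj hadj) (I := X.as) R e (T.isIso_mapComp_sig hadj _ _)

end LaxBeckTriple

end Realize

end PolyCart

namespace PolyCart

open PullbackChoice DistributivityChoice PolyCart.Poly

/-! ### A lax Beck triple is recovered from its oplax functor -/

namespace OplaxOver

variable {B : Type u₁} [Bicategory.{w₁, v₁} B] {C : Type u₂} [Bicategory.{w₂, v₂} C]

/-- Icons between functors on a locally discrete bicategory. -/
def iconOfLoc {A : Type u₁} [Category.{v₁} A] {o : LocallyDiscrete A → C} {F G : OplaxOver o}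
    (app : ∀ {a b : LocallyDiscrete A} (f : a ⟶ b), F.map f ⟶ G.map f)
    (mapId : ∀ a, app (𝟙 a) ≫ G.mapId a = F.mapId a)
    (mapComp : ∀ {a b c : LocallyDiscrete A} (f : a ⟶ b) (g : b ⟶ c), app (f ≫ g) ≫ G.mapComp f g =
      F.mapComp f g ≫ app f ▷ F.map g ≫ G.map f ◁ app g) : F ⟶ G where
  app := app
  mapId := mapId
  mapComp := mapComp
  naturality {a b f g} η := by
    obtain rfl := LocallyDiscrete.eq_of_hom η
    rw [Subsingleton.elim η (𝟙 _), F.map₂_id, G.map₂_id, Category.id_comp, Category.comp_id]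

/-- The inverse of an icon with invertible components. -/
noncomputable def iconInv {o : B → C} {F G : OplaxOver o} (κ : F ⟶ G)
    (h : ∀ {a b : B} (f : a ⟶ b), IsIso (κ.app f)) : G ⟶ F where
  app f := haveI := h f; inv (κ.app f)
  naturality {a b f g} η := by
    have := h f
    have := h g
    rw [IsIso.comp_inv_eq, Category.assoc, κ.naturality, IsIso.inv_hom_id_assoc]
  mapId a := by
    have := h (𝟙 a)
    rw [IsIso.inv_comp_eq, κ.mapId]
  mapComp f g := by
    have := h f
    have := h g
    have := h (f ≫ g)
    rw [IsIso.inv_comp_eq, reassoc_of% κ.mapComp f g, whisker_exchange_assoc,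
      ← comp_whiskerRight_assoc, IsIso.hom_inv_id, id_whiskerRight,
      Category.id_comp, ← whiskerLeft_comp, IsIso.hom_inv_id, whiskerLeft_id, Category.comp_id]

end OplaxOver

section

variable {E : Type u} [Category.{v} E] {C : Type u₂} [Bicategory.{w₂, v₂} C] {o : E → C}

namespace LaxBeckTriple

lemma hom_ext {T T' : LaxBeckTriple o} {m n : T ⟶ T'}
    (h₁ : ∀ {X Y : E} (f : X ⟶ Y), Hom.appD m f = Hom.appD n f)
    (h₂ : ∀ {X Y : E} (f : X ⟶ Y), Hom.appN m f = Hom.appN n f) : m = n := by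
  refine Hom.ext (RawTriple.Hom.ext ?_ ?_)
  · exact OplaxOver.hom_ext fun f => h₁ f.as.unop
  · exact OplaxOver.hom_ext fun f => h₂ f.as

/-- The `Δ` component is invertible by definition of a morphism, so the `⊗` component alone decides.
-/
lemma isIso_of_isIso_appN {T T' : LaxBeckTriple o} (m : T ⟶ T')
    (h : ∀ {X Y : E} (f : X ⟶ Y), IsIso (Hom.appN m f)) : IsIso m := by
  let n : T' ⟶ T :=
    { raw :=
        { β := OplaxOver.iconInv m.raw.β fun f => m.isIso f
          γ := OplaxOver.iconInv m.raw.γ fun f => h f.as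
          comm {W X Y Z f' g' g f} sq := by
            have e := m.raw.comm sq
            have := h f
            have := h f'
            change hc (inv (Hom.appD m g')) (inv (Hom.appN m f')) ≫ T.beck sq =
              T'.beck sq ≫ hc (inv (Hom.appN m f)) (inv (Hom.appD m g))
            change hc (Hom.appD m g') (Hom.appN m f') ≫ T'.beck sq =
              T.beck sq ≫ hc (Hom.appN m f) (Hom.appD m g) at e
            rw [← cancel_epi (hc (Hom.appD m g') (Hom.appN m f')), reassoc_of% e,
              ← Category.assoc, hc_comp, hc_comp]
            simp [hc_id_id] }
      isIso f := by
        have := m.isIso f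
        exact inferInstanceAs (IsIso (inv (m.raw.β.app f))) }
  refine ⟨n, hom_ext (fun f => ?_) (fun f => ?_), hom_ext (fun f => ?_) (fun f => ?_)⟩
  · exact IsIso.hom_inv_id (Hom.appD m f)
  · have := h f
    exact IsIso.hom_inv_id (Hom.appN m f)
  · exact IsIso.inv_hom_id (Hom.appD m f)
  · have := h f
    exact IsIso.inv_hom_id (Hom.appN m f)

variable (T : LaxBeckTriple o) {adj : T.Adj} (hadj : adj.Compatible) [PullbackChoice E]
  [DistributivityChoice E]

/-- The oplax functor of a lax Beck triple. -/
noncomputable abbrev functor : OplaxOver (fun X : PolyC E => o X.as) :=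
  (T.realize adj hadj).toOplaxOver

lemma isPseudo_restrictTensor_realize : (T.functor hadj).restrictTensor.IsPseudo := by
  have hF := T.isGregarious_realize hadj
  refine ⟨fun X => ?_, fun X Y Z f g => ?_⟩
  · have : IsIso (T.counitCell X.as (𝟙 _)) := inferInstance
    exact (congrArg IsIso (OplaxOver.triple_Ni hF X.as)).mpr this
  · have h := T.isIso_split_ten hadj (rfl : f.as ≫ g.as = _)
    refine (congrArg IsIso (OplaxOver.triple_Nc hF f.as g.as)).mpr ?_
    exact (congrArg IsIso (SplitFunctor.toOplaxOver_cut _ _ _ _)).mpr h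

/-- The lax Beck triple of the oplax functor of a lax Beck triple. -/
noncomputable abbrev functorTriple : LaxBeckTriple o :=
  OplaxOver.laxTriple (T.isGregarious_realize hadj) (T.isPseudo_restrictTensor_realize hadj)

/-- A lax Beck triple is recovered from its oplax functor. -/
noncomputable def ofFunctorTriple : T.functorTriple hadj ⟶ T where
  raw :=
    { β := OplaxOver.iconOfLoc (fun f => T.realDel f.as.unop)
        (fun X => (T.realDel_Di hadj X.as.unop).trans
          (OplaxOver.triple_Di (T.isGregarious_realize hadj) X.as.unop).symm)
        (fun f g => by
          have e := T.realDel_dc hadj (rfl : g.as.unop ≫ f.as.unop = _)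
          have e₁ := (OplaxOver.triple_Dc (T.isGregarious_realize hadj) g.as.unop f.as.unop).trans
            (SplitFunctor.toOplaxOver_cut _ _ _ _)
          rw [RawTriple.dc_rfl] at e
          exact e.trans (congrArg (· ≫ _) e₁.symm))
      γ := OplaxOver.iconOfLoc (fun f => T.realTen f.as)
        (fun X => (T.realTen_Ni hadj X.as).trans
          (OplaxOver.triple_Ni (T.isGregarious_realize hadj) X.as).symm)
        (fun f g => by
          have e := T.realTen_nc hadj (rfl : f.as ≫ g.as = _)
          have e₁ := (OplaxOver.triple_Nc (T.isGregarious_realize hadj) f.as g.as).trans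
            (SplitFunctor.toOplaxOver_cut _ _ _ _)
          rw [RawTriple.nc_rfl] at e
          exact e.trans (congrArg (· ≫ _) e₁.symm))
      comm {W X Y Z f' g' g f} sq := by
        have hF := T.isGregarious_realize hadj
        have hG := OplaxOver.isGregarious_toSplit hF
        have h₁ := hG.isIso_bIn g' f'
        have e₁ := T.bIn_realDel_realTen hadj g' f'
        have e₂ := T.bOut_realTen_realDel hadj sq
        have e₃ : (T.functor hadj).toSplit.bIn g' f' = (T.realize adj hadj).bIn g' f' :=
          SplitFunctor.toOplaxOver_cut _ _ _ _
        have e₄ : (T.functor hadj).toSplit.bOut sq = (T.realize adj hadj).bOut sq :=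
          SplitFunctor.toOplaxOver_cut _ _ _ _
        have e₅ := hG.bIn_bk sq
        have e₆ : ((T.functor hadj).triple hF).beck sq = hG.bk sq := OplaxOver.triple_beck hF sq
        change (T.realDel g' ▷ T.real (ten f') ≫ T.D g' ◁ T.realTen f') ≫ T.beck sq =
          ((T.functor hadj).triple hF).beck sq ≫ T.realTen f ▷ T.real (del g) ≫ T.N f ◁ T.realDel g
        -- After the invertible `bIn`, the realized Beck cell becomes `bOut`, and `e₁` and `e₂`
        -- express the two sides through the same Beck cell of `T`.
        refine (cancel_epi ((T.functor hadj).toSplit.bIn g' f')).1 ?_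
        refine Eq.trans ?_ ((congrArg (fun t => _ ≫ t ≫ _) e₆.symm))
        refine Eq.trans ?_ (congrArg (· ≫ _) e₅.symm |>.trans (Category.assoc _ _ _))
        refine Eq.trans ?_ (congrArg (· ≫ _) e₄.symm)
        refine (congrArg (· ≫ _) e₃).trans ?_
        refine Eq.trans ?_ e₂.symm
        exact (Category.assoc _ _ _).symm.trans
          ((congrArg (· ≫ T.beck sq) e₁).trans (Category.assoc _ _ _)) }
  isIso f := (inferInstance : IsIso (T.realDel f.as.unop))

lemma isIso_ofFunctorTriple : IsIso (T.ofFunctorTriple hadj) :=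
  isIso_of_isIso_appN _ fun f => inferInstanceAs (IsIso (T.realTen f))

end LaxBeckTriple

end

end PolyCart

namespace PolyCart

open PullbackChoice DistributivityChoice PolyCart.Poly

/-! ### Icons and morphisms of lax Beck triples -/

section

variable {C : Type u₂} [Bicategory.{w₂, v₂} C] {a b : C}

lemma eq_of_unit_whiskerLeft {l : a ⟶ b} {r r' : b ⟶ a} (adj : Bicategory.Adjunction l r)
    {α β : r ⟶ r'} (h : adj.unit ≫ l ◁ α = adj.unit ≫ l ◁ β) : α = β := by
  have key (γ : r ⟶ r') : γ = (ρ_ _).inv ≫ r ◁ (adj.unit ≫ l ◁ γ) ≫ (α_ _ _ _).inv ≫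
      adj.counit ▷ r' ≫ (λ_ _).hom := by
    symm
    calc
      _ = 𝟙 _ ⊗≫ r ◁ adj.unit ⊗≫ ((r ≫ l) ◁ γ ≫ adj.counit ▷ r') ⊗≫ 𝟙 _ := by bicategory
      _ = 𝟙 _ ⊗≫ rightZigzag adj.unit adj.counit ⊗≫ γ ⊗≫ 𝟙 _ := by
        rw [whisker_exchange]; dsimp only [rightZigzag]; bicategory
      _ = _ := by rw [adj.right_triangle]; bicategory
  rw [key α, key β, h]

section

variable {l l' : a ⟶ b} {r r' : b ⟶ a} (adj : Bicategory.Adjunction l r)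
  (adj' : Bicategory.Adjunction l' r') {α : l ⟶ l'} {β : r ⟶ r'}

/-- Preservation of counits makes the conjugate of `α` a right inverse of `β`; preservation of
units, in the next lemma, makes it a left inverse. -/
lemma comp_conjugate_of_counit (h : hc β α ≫ adj'.counit = adj.counit) :
    β ≫ conjugateEquiv adj' adj α = 𝟙 _ := by
  apply eq_of_whiskerRight_counit adj
  rw [comp_whiskerRight, Category.assoc, ← whiskerLeft_conjugate_counit, ← Category.assoc]
  exact h.trans (by simp)

lemma conjugate_comp_of_unit (h : adj.unit ≫ hc α β = adj'.unit) :
    conjugateEquiv adj' adj α ≫ β = 𝟙 _ := by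
  apply eq_of_unit_whiskerLeft adj'
  rw [whiskerLeft_comp, reassoc_of% unit_whiskerLeft_conjugate]
  exact h.trans (by simp)

end

end

section

variable {E : Type u} [Category.{v} E] {C : Type u₂} [Bicategory.{w₂, v₂} C] {o : E → C}

namespace SplitFunctor

variable {G G' : SplitFunctor o} (m : G.Hom G') (hG : G.IsGregarious) (hG' : G'.IsGregarious)
  {I J P Q X Y : E} {x : C}

lemma Hom.ut (f : X ⟶ Y) : hG.ut f ≫ hc (m.app (sig f)) (m.app (del f)) = hG'.ut f := by
  have := hG.isIso_counit X
  rw [← cancel_epi (G.counit X), ← Category.assoc, hG.counit_ut, ← m.counit, Category.assoc,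
    hG'.counit_ut]
  exact (m.app_cut _ _ _).symm

lemma Hom.ct (f : X ⟶ Y) : hc (m.app (del f)) (m.app (sig f)) ≫ hG'.ct f = hG.ct f := by
  have := hG.isIso_sIn f (𝟙 X) f
  rw [← cancel_epi (G.sIn f (𝟙 X) f), hG.sIn_ct, ← m.counit,
    ← Category.assoc (G.map₂ _), m.natural, Category.assoc, ← hG'.sIn_ct, ← Category.assoc,
    ← Category.assoc]
  exact congrArg (· ≫ _) (m.app_cut _ _ _).symm

/-- Icons preserve the units and counits of `Σ_f ⊣ Δ_f`, because these are built from cuts. The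
conjugate of the component at `Σ_f` is therefore a two-sided inverse of the component at `Δ_f`. -/
lemma Hom.isIso_app_del (hG : G.IsGregarious) (hG' : G'.IsGregarious) (f : X ⟶ Y) : IsIso (m.app (del f)) :=
  ⟨_, comp_conjugate_of_counit (hG.adj f) (hG'.adj f) (m.ct hG hG' f),
    conjugate_comp_of_unit (hG.adj f) (hG'.adj f) (m.ut hG hG' f)⟩

lemma Hom.app_sig (f : X ⟶ Y) [IsIso (m.app (del f))] :
    m.app (sig f) = (conjugateEquiv (hG'.adj f) (hG.adj f)).symm (inv (m.app (del f))) := by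
  rw [Equiv.eq_symm_apply]
  refine IsIso.eq_inv_of_hom_inv_id ?_
  exact comp_conjugate_of_counit (hG.adj f) (hG'.adj f) (m.ct hG hG' f)

lemma Hom.expand (s : P ⟶ I) (p : P ⟶ Q) (t : Q ⟶ J) {H H' : x ⟶ o I} (κ : H ⟶ H') :
    hc κ (m.app ⟨P, Q, s, p, t⟩) ≫ G'.expand s p t H' = G.expand s p t H ≫
      hc (hc (hc κ (m.app (del s))) (m.app (ten p))) (m.app (sig t)) := by
  simp only [SplitFunctor.expand, Category.assoc]
  have e₁ : m.app ⟨P, Q, s, p, t⟩ ≫ G'.sIn s p t = G.sIn s p t ≫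
      m.app ⟨P, Q, s, p, 𝟙 Q⟩ ▷ G.map (sig t) ≫ G'.map ⟨P, Q, s, p, 𝟙 Q⟩ ◁ m.app (sig t) :=
    m.app_cut _ _ _
  have e₂ : m.app ⟨P, Q, s, p, 𝟙 Q⟩ ≫ G'.bIn s p = G.bIn s p ≫
      m.app (del s) ▷ G.map (ten p) ≫ G'.map (del s) ◁ m.app (ten p) :=
    m.app_cut _ _ _
  rw [reassoc_of% hc_wSplit κ e₁, hc_whiskerRight (hc_wSplit κ e₂)]

lemma Hom.expand_id (s : P ⟶ I) (p : P ⟶ Q) (t : Q ⟶ J) :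
    m.app ⟨P, Q, s, p, t⟩ ≫ (λ_ _).inv ≫ G'.expand s p t (𝟙 _) =
      ((λ_ _).inv ≫ G.expand s p t (𝟙 _)) ≫
        hc (hc (hc (𝟙 _) (m.app (del s))) (m.app (ten p))) (m.app (sig t)) := by
  rw [Category.assoc, ← m.expand, hc_id]
  simp

variable (G)

/-- Expanding `Δ_f` adds only `⊗` and `Σ` of identities, which the counit laws remove again. Hence
`realDel` is a retraction of the recovery map at `Δ_f`. -/
lemma expand_drop_del (f : X ⟶ Y) {n r : G.map (one X) ⟶ 𝟙 (o X)} (hn : n = G.counit X)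
    (hr : r = G.counit X) :
    ((λ_ _).inv ≫ G.expand f (𝟙 X) (𝟙 X) (𝟙 _)) ≫ (wDrop r _ ≫ wDrop n _) ≫ (λ_ _).hom = 𝟙 _ := by
  subst hn hr
  have e₁ := G.split_counit_right (P := del f) (𝟙 _) rfl (𝟙 _)
  have e₂ : G.sIn f (𝟙 X) (𝟙 X) ≫ G.map (del f) ◁ G.counit X ≫ (ρ_ _).hom = 𝟙 _ := by
    refine (Category.assoc _ _ _).symm.trans ((congrArg (· ≫ (ρ_ _).hom) e₁).trans ?_)
    simp
  simp only [SplitFunctor.expand, Category.assoc]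
  rw [reassoc_of% wDrop_natural (G.counit X), reassoc_of% wSplit_drop_right e₂]
  have e₃ : G.bIn f (𝟙 X) ≫ G.map (del f) ◁ G.counit X ≫ (ρ_ _).hom = 𝟙 _ := e₂
  rw [reassoc_of% wSplit_drop_right e₃]
  simp

lemma expand_drop_ten (f : X ⟶ Y) {d : G.map (one X) ⟶ 𝟙 (o X)} {r : G.map (one Y) ⟶ 𝟙 (o Y)}
    (hd : d = G.counit X) (hr : r = G.counit Y) :
    ((λ_ _).inv ≫ G.expand (𝟙 X) f (𝟙 Y) (𝟙 _)) ≫ (wDrop r _ ≫ wDrop d _ ▷ G.map (ten f)) ≫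
      (λ_ _).hom = 𝟙 _ := by
  subst hd hr
  have e₁ := G.split_counit_right (P := ten f) (𝟙 _) rfl (𝟙 _)
  have e₂ : G.sIn (𝟙 X) f (𝟙 Y) ≫ G.map (ten f) ◁ G.counit Y ≫ (ρ_ _).hom = 𝟙 _ := by
    refine (Category.assoc _ _ _).symm.trans ((congrArg (· ≫ (ρ_ _).hom) e₁).trans ?_)
    simp
  have e₃ := G.split_counit_left (P := ten f) (𝟙 _) rfl (𝟙 _)
  have e₄ : G.bIn (𝟙 X) f ≫ G.counit X ▷ G.map (ten f) ≫ (λ_ _).hom = 𝟙 _ := by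
    refine (Category.assoc _ _ _).symm.trans ((congrArg (· ≫ (λ_ _).hom) e₃).trans ?_)
    simp
  simp only [SplitFunctor.expand, Category.assoc]
  rw [reassoc_of% wDrop_natural (G.counit Y), reassoc_of% wSplit_drop_right e₂,
    reassoc_of% wSplit_drop_left e₄]
  simp

end SplitFunctor

namespace LaxBeckTriple.Hom

variable {T T' : LaxBeckTriple o} (m : T ⟶ T') {adj : T.Adj} {adj' : T'.Adj}
  (hadj : adj.Compatible) (hadj' : adj'.Compatible) {X Y : E}

lemma realMap_realDel (hadj : adj.Compatible) (hadj' : adj'.Compatible) (f : X ⟶ Y) :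
    realMap m adj adj' (del f) ≫ T'.realDel f = T.realDel f ≫ appD m f := by
  dsimp only [realMap, actMap, realDel, stripDel]
  rw [Category.assoc, reassoc_of% hc_wDrop _ (τ_Si m hadj hadj' X),
    reassoc_of% hc_wDrop _ (γ_Ni m X), hc_id]
  simp

lemma realMap_realTen (hadj : adj.Compatible) (hadj' : adj'.Compatible) (f : X ⟶ Y) :
    realMap m adj adj' (ten f) ≫ T'.realTen f = T.realTen f ≫ appN m f := by
  dsimp only [realMap, actMap, realTen, stripTen]
  rw [Category.assoc, reassoc_of% hc_wDrop _ (τ_Si m hadj hadj' Y),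
    reassoc_of% hc_whiskerRight (hc_wDrop _ (β_Di m X)), hc_id]
  simp

end LaxBeckTriple.Hom

end

section

variable {E : Type u} [Category.{v} E] [PullbackChoice E] [DistributivityChoice E]
  {C : Type u₂} [Bicategory.{w₂, v₂} C] {o : PolyC E → C} {F G : OplaxOver o}
  (hF : F.IsGregarious) (hN : F.restrictTensor.IsPseudo) (hG : G.IsGregarious)
  (hM : G.restrictTensor.IsPseudo) {I J X Y : E}

namespace OplaxOver

/-- Icons as families of 2-cells compatible with comultiplications. -/
def splitOfIcon (κ : F ⟶ G) : F.toSplit.Hom G.toSplit where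
  app {I J} P := κ.app (a := ⟨I⟩) (b := ⟨J⟩) P
  natural {I J P Q} ρ := κ.naturality (a := ⟨I⟩) (b := ⟨J⟩) ρ
  counit I := κ.mapId ⟨I⟩
  split A := by
    have e := icon_cut κ A (𝟙 _) (𝟙 _)
    rw [SplitFunctor.cut_id, SplitFunctor.cut_id] at e
    exact e

/-- The morphism of lax Beck triples given by an icon. -/
noncomputable def laxTripleMap (κ : F ⟶ G) : laxTriple hF hN ⟶ laxTriple hG hM where
  raw := tripleMap hF hG κ
  isIso f := (splitOfIcon κ).isIso_app_del (isGregarious_toSplit hF) (isGregarious_toSplit hG)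
    f.as.unop

lemma laxTripleMap_appS (κ : F ⟶ G) (f : X ⟶ Y) :
    (laxTripleMap hF hN hG hM κ).appS (tripleAdj hF) (tripleAdj hG) f =
      κ.app (a := ⟨X⟩) (b := ⟨Y⟩) (sig f) := by
  have := (splitOfIcon κ).isIso_app_del (isGregarious_toSplit hF) (isGregarious_toSplit hG) f
  exact ((splitOfIcon κ).app_sig (isGregarious_toSplit hF) (isGregarious_toSplit hG) f).symm

/-- Naturality of the recovery map in icons. As that map is invertible, an icon is determined by the
morphism of triples that it induces. -/
lemma app_recoverApp (κ : F ⟶ G) (P : Poly I J) :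
    κ.app (a := ⟨I⟩) (b := ⟨J⟩) P ≫ recoverApp hG hM P = recoverApp hF hN P ≫
      (laxTripleMap hF hN hG hM κ).realMap (tripleAdj hF) (tripleAdj hG) P := by
  dsimp only [LaxBeckTriple.Hom.realMap, LaxBeckTriple.Hom.actMap]
  rw [laxTripleMap_appS]
  exact (splitOfIcon κ).expand_id P.s P.p P.t

lemma recoverApp_realDel (f : X ⟶ Y) :
    recoverApp hF hN (del f) ≫ (laxTriple hF hN).realDel f = 𝟙 _ :=
  F.toSplit.expand_drop_del f (triple_Ni hF X) (triple_Si hF X)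

lemma recoverApp_realTen (f : X ⟶ Y) :
    recoverApp hF hN (ten f) ≫ (laxTriple hF hN).realTen f = 𝟙 _ :=
  F.toSplit.expand_drop_ten f (triple_Di hF X) (triple_Si hF Y)

end OplaxOver

end

end PolyCart

namespace PolyCart

open PullbackChoice DistributivityChoice PolyCart.Poly

/-! ### Icons correspond to morphisms of lax Beck triples -/

/-- Both `x` and `z` correspond to `y`, the former through `r`, `r'` and the latter through their
retractions. It identifies the `Δ` and `⊗` components of a reconstructed icon. -/
lemma eq_of_retraction {D : Type u₁} [Category.{v₁} D] {a a' b b' : D} {x z : a ⟶ a'} {y : b ⟶ b'}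
    {r : a ⟶ b} {r' : a' ⟶ b'} {d : b ⟶ a} {d' : b' ⟶ a'} (h : x ≫ r' = r ≫ y) (hr : r ≫ d = 𝟙 a)
    (hr' : r' ≫ d' = 𝟙 a') (h' : y ≫ d' = d ≫ z) : x = z := by
  rw [← Category.comp_id x, ← hr', reassoc_of% h, h', reassoc_of% hr]

section

variable {E : Type u} [Category.{v} E] {C : Type u₂} [Bicategory.{w₂, v₂} C] {o : E → C}

namespace SplitFunctor

variable {G G' G'' : SplitFunctor o}

/-- Composition of families of 2-cells compatible with comultiplications. -/
def Hom.comp (m : G.Hom G') (n : G'.Hom G'') : G.Hom G'' where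
  app P := m.app P ≫ n.app P
  natural ρ := by rw [← Category.assoc, m.natural, Category.assoc, n.natural, Category.assoc]
  counit I := by rw [Category.assoc, n.counit, m.counit]
  split A := by
    have e := m.split A
    change m.app _ ≫ _ = _ ≫ hc _ _ at e
    have e' := n.split A
    change n.app _ ≫ _ = _ ≫ hc _ _ at e'
    change _ = _ ≫ hc _ _
    rw [Category.assoc, e', reassoc_of% e, hc_comp]

/-- The inverse of an invertible family. -/
noncomputable def Hom.inverse (m : G.Hom G') (h : ∀ {I J : E} (P : Poly I J), IsIso (m.app P)) :
    G'.Hom G where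
  app P := haveI := h P; inv (m.app P)
  natural {I J P Q} ρ := by
    have := h P
    have := h Q
    rw [IsIso.comp_inv_eq, Category.assoc, m.natural, IsIso.inv_hom_id_assoc]
  counit I := by
    have := h (one I)
    rw [IsIso.inv_comp_eq, m.counit]
  split {I J K X} A := by
    have := h X
    have := h A.left
    have := h A.right
    have e := m.split A
    change m.app _ ≫ _ = _ ≫ hc _ _ at e
    change _ = _ ≫ hc _ _
    rw [IsIso.inv_comp_eq, reassoc_of% e, hc_comp]
    simp [hc_id_id]

end SplitFunctor

end

section

variable {E : Type u} [Category.{v} E] [PullbackChoice E] [DistributivityChoice E]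
  {C : Type u₂} [Bicategory.{w₂, v₂} C] {o : PolyC E → C} {F G : OplaxOver o}
  (hF : F.IsGregarious) (hN : F.restrictTensor.IsPseudo) (hG : G.IsGregarious)
  (hM : G.restrictTensor.IsPseudo) {I J X Y : E}

namespace OplaxOver

lemma laxTripleMap_injective {κ κ' : F ⟶ G}
    (h : laxTripleMap hF hN hG hM κ = laxTripleMap hF hN hG hM κ') : κ = κ' := by
  refine hom_ext fun {I J} P => ?_
  have := isIso_recoverApp hG hM (I := I.as) (J := J.as) P
  refine (cancel_mono (recoverApp hG hM (I := I.as) (J := J.as) P)).1 ?_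
  refine (app_recoverApp hF hN hG hM κ (I := I.as) (J := J.as) P).trans ?_
  rw [h]
  exact (app_recoverApp hF hN hG hM κ' (I := I.as) (J := J.as) P).symm

/-- The icon of a morphism of lax Beck triples. -/
noncomputable def iconOfTripleMap (n : laxTriple hF hN ⟶ laxTriple hG hM) : F ⟶ G :=
  iconOfSplit (((recover hF hN).comp (n.realize (tripleAdj_compatible hF)
    (tripleAdj_compatible hG))).comp ((recover hG hM).inverse (isIso_recoverApp hG hM)))

lemma iconOfTripleMap_recoverApp (n : laxTriple hF hN ⟶ laxTriple hG hM) (P : Poly I J) :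
    (iconOfTripleMap hF hN hG hM n).app (a := ⟨I⟩) (b := ⟨J⟩) P ≫ recoverApp hG hM P =
      recoverApp hF hN P ≫ n.realMap (tripleAdj hF) (tripleAdj hG) P := by
  have := isIso_recoverApp hG hM P
  change ((recoverApp hF hN P ≫ n.realMap (tripleAdj hF) (tripleAdj hG) P) ≫
    inv (recoverApp hG hM P)) ≫ _ = _
  rw [Category.assoc, IsIso.inv_hom_id, Category.comp_id]

/-- Only the components at `Δ_f` and `⊗_f` need to be compared, and there `realDel` and `realTen`
undo the recovery maps. -/
lemma laxTripleMap_iconOfTripleMap (n : laxTriple hF hN ⟶ laxTriple hG hM) :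
    laxTripleMap hF hN hG hM (iconOfTripleMap hF hN hG hM n) = n := by
  refine LaxBeckTriple.hom_ext (fun {X Y} f => ?_) (fun {X Y} f => ?_)
  · exact eq_of_retraction (iconOfTripleMap_recoverApp hF hN hG hM n (del f))
      (recoverApp_realDel hF hN f) (recoverApp_realDel hG hM f)
      (n.realMap_realDel (tripleAdj_compatible hF) (tripleAdj_compatible hG) f)
  · exact eq_of_retraction (iconOfTripleMap_recoverApp hF hN hG hM n (ten f))
      (recoverApp_realTen hF hN f) (recoverApp_realTen hG hM f)
      (n.realMap_realTen (tripleAdj_compatible hF) (tripleAdj_compatible hG) f)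

end OplaxOver

end

end PolyCart

namespace PolyCart

open PullbackChoice DistributivityChoice PolyCart.Poly

/-! ### Invertibility of the constraint cells of a gregarious functor -/

namespace OplaxOver

section

variable {B : Type u₁} [Bicategory.{w₁, v₁} B] {C : Type u₂} [Bicategory.{w₂, v₂} C] {o : B → C}
  (F : OplaxOver o) {a b c d : B}

/-- The associativity coherence is a square of four constraint cells. Three invertible ones force
the fourth; this propagates invertibility along decompositions of polynomials. -/
lemma isIso_mapComp_comp_left {f : a ⟶ b} {g : b ⟶ c} {h : c ⟶ d} (h₁ : IsIso (F.mapComp g h))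
    (h₂ : IsIso (F.mapComp f (g ≫ h))) (h₃ : IsIso (F.mapComp f g)) :
    IsIso (F.mapComp (f ≫ g) h) := by
  have := F.isIso_map₂ (α_ f g h).hom
  have e := F.map₂_associator f g h
  refine @IsIso.of_isIso_comp_right _ _ _ _ _ (F.mapComp (f ≫ g) h)
    (F.mapComp f g ▷ F.map h ≫ (α_ (F.map f) (F.map g) (F.map h)).hom) inferInstance ?_
  rw [← e]
  infer_instance

lemma isIso_mapComp_comp_right {f : a ⟶ b} {g : b ⟶ c} {h : c ⟶ d} (h₁ : IsIso (F.mapComp f g))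
    (h₂ : IsIso (F.mapComp (f ≫ g) h)) (h₃ : IsIso (F.mapComp g h)) :
    IsIso (F.mapComp f (g ≫ h)) := by
  have := F.isIso_map₂ (α_ f g h).hom
  have e := F.map₂_associator f g h
  have : IsIso (F.map₂ (α_ f g h).hom ≫ F.mapComp f (g ≫ h) ≫ F.map f ◁ F.mapComp g h) := by
    rw [e]; infer_instance
  have := IsIso.of_isIso_comp_left (F.map₂ (α_ f g h).hom)
    (F.mapComp f (g ≫ h) ≫ F.map f ◁ F.mapComp g h)
  exact IsIso.of_isIso_comp_right _ (F.map f ◁ F.mapComp g h)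

lemma isIso_mapComp_iso_left {f f' : a ⟶ b} {g : b ⟶ c} (e : f ⟶ f') (he : IsIso e)
    (h : IsIso (F.mapComp f' g)) : IsIso (F.mapComp f g) := by
  have := F.isIso_map₂ e
  have := F.isIso_map₂ (e ▷ g)
  have e₁ := F.mapComp_naturality_left e g
  refine @IsIso.of_isIso_comp_right _ _ _ _ _ (F.mapComp f g) (F.map₂ e ▷ F.map g) inferInstance ?_
  rw [← e₁]
  infer_instance

lemma isIso_mapComp_iso_right {f : a ⟶ b} {g g' : b ⟶ c} (e : g ⟶ g') (he : IsIso e)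
    (h : IsIso (F.mapComp f g')) : IsIso (F.mapComp f g) := by
  have := F.isIso_map₂ e
  have := F.isIso_map₂ (f ◁ e)
  have e₁ := F.mapComp_naturality_right f e
  refine @IsIso.of_isIso_comp_right _ _ _ _ _ (F.mapComp f g) (F.map f ◁ F.map₂ e) inferInstance ?_
  rw [← e₁]
  infer_instance

end

section

variable {E : Type u} [Category.{v} E] [PullbackChoice E] [DistributivityChoice E]
  {C : Type u₂} [Bicategory.{w₂, v₂} C] {o : PolyC E → C} {F : OplaxOver o}
  {I J K L X Y Z : E} {P : Poly I J} {Q : Poly J K} {R : Poly K L}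

lemma isIso_polyMapComp_left {T : Poly I K} {A : Split T J} {a : A.left ⟶ P} {b : A.right ⟶ Q}
    (h : IsIso (lift A a b)) (h₁ : IsIso (F.polyMapComp Q R))
    (h₂ : IsIso (F.polyMapComp P (comp Q R))) (h₃ : IsIso (F.polyMapComp P Q)) :
    IsIso (F.polyMapComp T R) :=
  F.isIso_mapComp_iso_left (a := ⟨I⟩) (b := ⟨K⟩) (c := ⟨L⟩) (lift A a b) h
    (F.isIso_mapComp_comp_left (a := ⟨I⟩) (b := ⟨J⟩) (c := ⟨K⟩) (d := ⟨L⟩) h₁ h₂ h₃)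

lemma isIso_polyMapComp_right {T : Poly J L} {A : Split T K} {a : A.left ⟶ Q} {b : A.right ⟶ R}
    (h : IsIso (lift A a b)) (h₁ : IsIso (F.polyMapComp P Q))
    (h₂ : IsIso (F.polyMapComp (comp P Q) R)) (h₃ : IsIso (F.polyMapComp Q R)) :
    IsIso (F.polyMapComp P T) :=
  F.isIso_mapComp_iso_right (a := ⟨I⟩) (b := ⟨J⟩) (c := ⟨L⟩) (lift A a b) h
    (F.isIso_mapComp_comp_right (a := ⟨I⟩) (b := ⟨J⟩) (c := ⟨K⟩) (d := ⟨L⟩) h₁ h₂ h₃)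

lemma isIso_lift_del_ten {P Q I : E} (s : P ⟶ I) (p : P ⟶ Q) :
    IsIso (lift (X := ⟨P, Q, s, p, 𝟙 Q⟩) (P := del s) (Q := ten p) ⟨P, 𝟙 P, p, 𝟙 P, by simp⟩
      (𝟙 _) (𝟙 _)) := by
  have : IsIso (𝟙 (ten p) : Hom _ _).ν := IsIso.id _
  exact isIso_lift_of_isIso_t

lemma isIso_lift_sig {P Q I J : E} (s : P ⟶ I) (p : P ⟶ Q) (t : Q ⟶ J) :
    IsIso (lift (X := ⟨P, Q, s, p, t⟩) (P := ⟨P, Q, s, p, 𝟙 Q⟩) (Q := sig t)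
      ⟨Q, p, 𝟙 Q, 𝟙 Q, by simp⟩ (𝟙 _) (𝟙 _)) :=
  isIso_lift_of_isIso_p (IsPullback.id_horiz (𝟙 _))

lemma isIso_lift_ten_del {W : E} {f' : W ⟶ X} {g' : W ⟶ Y} {g : X ⟶ Z} {f : Y ⟶ Z}
    (sq : IsPullback f' g' g f) :
    IsIso (lift (X := ⟨W, X, g', f', 𝟙 X⟩) (P := ten f) (Q := del g) ⟨X, f', 𝟙 X, g, by simp⟩
      (SplitFunctor.sqMap sq) (𝟙 _)) :=
  isIso_lift_of_isIso_p (IsPullback.id_vert g)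

lemma isIso_lift_sig_del {W : E} {f' : W ⟶ X} {g' : W ⟶ Y} {g : X ⟶ Z} {f : Y ⟶ Z}
    (sq : IsPullback f' g' g f) {h : W ⟶ Z} (w₁ : f' ≫ g = h) (w₂ : g' ≫ f = h) :
    IsIso (lift (X := ⟨W, W, g', 𝟙 W, f'⟩) (P := sig f) (Q := del g) ⟨W, 𝟙 W, 𝟙 W, h, by simp⟩
      ⟨g', g', by simp, w₂, IsPullback.of_vert_isIso ⟨by simp⟩⟩
      ⟨f', f', w₁, by simp, IsPullback.of_vert_isIso ⟨by simp⟩⟩) :=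
  isIso_lift_of_isIso_p sq.flip

lemma isIso_polyMapComp_ten_ten (hF : F.IsGregarious) (hN : F.restrictTensor.IsPseudo) (f : X ⟶ Y)
    (g : Y ⟶ Z) : IsIso (F.polyMapComp (ten f) (ten g)) := by
  have h : IsIso ((F.triple hF).Nc f g) := hN.2 _ _
  rw [triple_Nc] at h
  exact isIso_polyMapComp_of_cut h (@isIso_lift_of_isIso_t _ _ _ _ _ _ _ _ _ (ten g) _ _ _
    inferInstance (IsIso.id _))

section

lemma isIso_polyMapComp_delTen {P Q I : E} (s : P ⟶ I) (p : P ⟶ Q) (R : Poly Q L)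
    (hF : F.IsGregarious) (h : IsIso (F.polyMapComp (ten p) R)) :
    IsIso (F.polyMapComp ⟨P, Q, s, p, 𝟙 Q⟩ R) :=
  isIso_polyMapComp_left (isIso_lift_del_ten s p) h (isIso_polyMapComp_del hF _ _)
    (isIso_polyMapComp_del hF _ _)

/-- Decompose `R` into `Δ`, `⊗` and `Σ`. The `Σ` part is harmless, the `Δ` part is the hypothesis,
and base change turns `⊗_f` followed by `Δ` into `Δ` followed by `⊗`, so what remains is a
constraint of the pseudofunctor `F_⊗`. -/
lemma isIso_polyMapComp_ten (hF : F.IsGregarious) (hN : F.restrictTensor.IsPseudo)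
    (hB : ∀ ⦃X Y Z : E⦄ (f : X ⟶ Z) (g : Y ⟶ Z), IsIso (F.polyMapComp (ten f) (del g)))
    (f : X ⟶ Y) (R : Poly Y L) : IsIso (F.polyMapComp (ten f) R) := by
  refine isIso_polyMapComp_right (isIso_lift_sig R.s R.p R.t) ?_ (isIso_polyMapComp_sig hF _ _)
    (isIso_polyMapComp_sig hF _ _)
  refine isIso_polyMapComp_right (isIso_lift_del_ten R.s R.p) (hB _ _) ?_
    (isIso_polyMapComp_del hF _ _)
  have h := isIso_lift_ten_del (pb f R.s).isPullback.flip
  exact F.isIso_mapComp_iso_left (a := ⟨X⟩) (b := ⟨R.pos⟩) (c := ⟨R.shp⟩) (@inv _ _ _ _ _ h)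
    (@IsIso.inv_isIso _ _ _ _ _ h) (isIso_polyMapComp_delTen _ _ _ hF (isIso_polyMapComp_ten_ten hF hN _ _))

/-- The polynomial `P` is `(s, p, 1)` followed by `Σ_t`. Since `isIso_polyMapComp_ten` disposes of
the first part, only `Σ_t` can obstruct invertibility. -/
lemma isIso_polyMapComp_of_sig (hF : F.IsGregarious) (hN : F.restrictTensor.IsPseudo)
    (hB : ∀ ⦃X Y Z : E⦄ (f : X ⟶ Z) (g : Y ⟶ Z), IsIso (F.polyMapComp (ten f) (del g)))
    (h : IsIso (F.polyMapComp (sig P.t) Q)) : IsIso (F.polyMapComp P Q) :=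
  isIso_polyMapComp_left (isIso_lift_sig P.s P.p P.t) h
    (isIso_polyMapComp_delTen _ _ _ hF (isIso_polyMapComp_ten hF hN hB _ _))
    (isIso_polyMapComp_sig hF _ _)

lemma isPseudo_restrictDeltaTensor_iff (hF : F.IsGregarious) (hN : F.restrictTensor.IsPseudo) :
    F.restrictDeltaTensor.IsPseudo ↔
      ∀ ⦃X Y Z : E⦄ (f : X ⟶ Z) (g : Y ⟶ Z), IsIso (F.polyMapComp (ten f) (del g)) := by
  refine ⟨fun h X Y Z f g => ?_, fun hB => ⟨fun X => ?_, fun X Y Z S T => ?_⟩⟩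
  · obtain ⟨_, h₀⟩ := h
    have h' := @h₀ ⟨⟨X⟩⟩ ⟨⟨Z⟩⟩ ⟨⟨Y⟩⟩ ⟨(⟨X, 𝟙 X, f⟩ : Sp X Z)⟩
      ⟨(⟨Y, g, 𝟙 Y⟩ : Sp Z Y)⟩
    have h₁ : IsIso (ofSpanComp' (⟨X, 𝟙 X, f⟩ : Sp X Z) ⟨Y, g, 𝟙 Y⟩) := inferInstance
    have := F.isIso_map₂ (a := ⟨X⟩) (b := ⟨Y⟩) (ofSpanComp' (⟨X, 𝟙 X, f⟩ : Sp X Z) ⟨Y, g, 𝟙 Y⟩)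
    exact @IsIso.of_isIso_comp_left _ _ _ _ _ (F.polyMap₂ (ofSpanComp' (⟨X, 𝟙 X, f⟩ : Sp X Z)
      ⟨Y, g, 𝟙 Y⟩)) _ this h'
  · have h₂ := F.isIso_map₂ ((spanIsoToPoly E).mapId X).hom
    exact @IsIso.comp_isIso _ _ _ _ _ _ _ h₂ (hF.1 _)
  · have h₂ := F.isIso_map₂ ((spanIsoToPoly E).mapComp S T).hom
    exact @IsIso.comp_isIso _ _ _ _ _ _ _ h₂
      (isIso_polyMapComp_delTen (I := X.as.as) S.of.l S.of.r (ofSpan' T.of) hF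
        (isIso_polyMapComp_ten hF hN hB _ _))

lemma isPseudo_restrictSigmaDelta_iff (hF : F.IsGregarious) (hN : F.restrictTensor.IsPseudo)
    (hB : ∀ ⦃X Y Z : E⦄ (f : X ⟶ Z) (g : Y ⟶ Z), IsIso (F.polyMapComp (ten f) (del g))) :
    F.restrictSigmaDelta.IsPseudo ↔
      ∀ ⦃X Y Z : E⦄ (f : X ⟶ Z) (g : Y ⟶ Z), IsIso (F.polyMapComp (sig f) (del g)) := by
  refine ⟨fun h X Y Z f g => ?_, fun hS => ⟨fun X => ?_, fun X Y Z S T => ?_⟩⟩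
  · obtain ⟨_, h₀⟩ := h
    have h' := @h₀ ⟨X⟩ ⟨Z⟩ ⟨Y⟩ (⟨X, 𝟙 X, f⟩ : Sp X Z)
      (⟨Y, g, 𝟙 Y⟩ : Sp Z Y)
    have h₁ : IsIso (ofSpanComp (⟨X, 𝟙 X, f⟩ : Sp X Z) ⟨Y, g, 𝟙 Y⟩) := inferInstance
    have := F.isIso_map₂ (a := ⟨X⟩) (b := ⟨Y⟩) (ofSpanComp (⟨X, 𝟙 X, f⟩ : Sp X Z) ⟨Y, g, 𝟙 Y⟩)
    exact @IsIso.of_isIso_comp_left _ _ _ _ _ (F.polyMap₂ (ofSpanComp (⟨X, 𝟙 X, f⟩ : Sp X Z)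
      ⟨Y, g, 𝟙 Y⟩)) _ this h'
  · have h₂ := F.isIso_map₂ ((spanToPoly E).mapId X).hom
    exact @IsIso.comp_isIso _ _ _ _ _ _ _ h₂ (hF.1 _)
  · have h₂ := F.isIso_map₂ ((spanToPoly E).mapComp S T).hom
    let S' : Sp X.as Y.as := S
    let T' : Sp Y.as Z.as := T
    refine @IsIso.comp_isIso _ _ _ _ _ _ _ h₂ (isIso_polyMapComp_of_sig (P := ofSpan S')
      (Q := ofSpan T') hF hN hB ?_)
    exact isIso_polyMapComp_right (isIso_lift_sig _ _ _) (hS _ _) (isIso_polyMapComp_sig hF _ _)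
      (isIso_polyMapComp_sig hF _ _)

/-- Only `Σ` in first position matters, and the second polynomial decomposes into `Δ`, `⊗` and `Σ`.
The pairs with `Δ` are covered by `hS` and those with `Σ` by gregariousness, which leaves `⊗`. -/
lemma isPseudo_iff (hF : F.IsGregarious) (hN : F.restrictTensor.IsPseudo)
    (hB : ∀ ⦃X Y Z : E⦄ (f : X ⟶ Z) (g : Y ⟶ Z), IsIso (F.polyMapComp (ten f) (del g)))
    (hS : ∀ ⦃X Y Z : E⦄ (f : X ⟶ Z) (g : Y ⟶ Z), IsIso (F.polyMapComp (sig f) (del g))) :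
    F.IsPseudo ↔
      ∀ ⦃X Y Z : E⦄ (f : X ⟶ Y) (g : Y ⟶ Z), IsIso (F.polyMapComp (sig f) (ten g)) := by
  refine ⟨fun ⟨_, h⟩ X Y Z f g => @h ⟨X⟩ ⟨Y⟩ ⟨Z⟩ _ _,
    fun hD => ⟨hF.1, fun X Y Z P Q => ?_⟩⟩
  let P' : Poly X.as Y.as := P
  let Q' : Poly Y.as Z.as := Q
  refine isIso_polyMapComp_of_sig (P := P') (Q := Q') hF hN hB ?_
  refine isIso_polyMapComp_right (isIso_lift_sig Q'.s Q'.p Q'.t) ?_ (isIso_polyMapComp_sig hF _ _)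
    (isIso_polyMapComp_sig hF _ _)
  exact isIso_polyMapComp_right (isIso_lift_del_ten Q'.s Q'.p) (hS _ _)
    (isIso_polyMapComp_of_sig hF hN hB (hD _ _)) (isIso_polyMapComp_del hF _ _)

end

end

end OplaxOver

end PolyCart

namespace PolyCart

open PullbackChoice DistributivityChoice PolyCart.Poly

/-! ### Beck and distributivity 2-cells in terms of comultiplications -/

section Whisker

variable {C : Type u₂} [Bicategory.{w₂, v₂} C] {a b c d x : C}

lemma mateEquiv_eq {g : a ⟶ c} {h : b ⟶ d} {l₁ : a ⟶ b} {r₁ : b ⟶ a} {l₂ : c ⟶ d} {r₂ : d ⟶ c}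
    (adj₁ : Bicategory.Adjunction l₁ r₁) (adj₂ : Bicategory.Adjunction l₂ r₂)
    (σ : g ≫ l₂ ⟶ l₁ ≫ h) :
    mateEquiv adj₁ adj₂ σ = wUnit adj₂.unit (r₁ ≫ g) ≫
      (wSwap σ r₁ ≫ adj₁.counit ▷ h ≫ (λ_ h).hom) ▷ r₂ := by
  rw [mateEquiv_apply']
  simp only [wUnit, wSwap]
  bicategory

lemma wSplit_wSplit_wCounit {f f' : a ⟶ b} {g : a ⟶ c} {h : c ⟶ b} {k : b ⟶ c} {η : f ⟶ g ≫ h}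
    {η' : g ⟶ f' ≫ k} {ζ : k ≫ h ⟶ 𝟙 b} (H : x ⟶ a) :
    wSplit η H ≫ wSplit η' H ▷ h ≫ wCounit ζ (H ≫ f') =
      H ◁ (η ≫ η' ▷ h ≫ (α_ _ _ _).hom ≫ f' ◁ ζ ≫ (ρ_ _).hom) := by
  simp only [wSplit, wCounit]
  bicategory

lemma eq_of_whiskerLeft_id {f g : a ⟶ b} {η θ : f ⟶ g} (h : 𝟙 a ◁ η = 𝟙 a ◁ θ) : η = θ := by
  simpa using h

end Whisker

section

variable {E : Type u} [Category.{v} E] {C : Type u₂} [Bicategory.{w₂, v₂} C] {o : E → C}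

namespace SplitFunctor

variable {G : SplitFunctor o} (hG : G.IsGregarious) {I J K P Q W X Y Z A B : E}

/-- The argument of `wUnit_ut` for a polynomial with arbitrary last map: inserting a unit at its
target is a cut, by the right counit law and coassociativity. -/
lemma wUnit_ut_map (s : P ⟶ I) (p : P ⟶ Q) {t : Q ⟶ J} {g : J ⟶ K} {h : Q ⟶ K} (w : t ≫ g = h) :
    wUnit (hG.ut g) (G.map ⟨P, Q, s, p, t⟩) =
      G.cut (X := ⟨P, Q, s, p, t⟩) (P := ⟨P, Q, s, p, h⟩) (Q := del g) ⟨Q, p, 𝟙 Q, h, by simp⟩ (𝟙 _)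
        ⟨t, t, w, by simp, IsPullback.of_vert_isIso ⟨by simp⟩⟩ ≫ G.gS s p w ▷ G.map (del g) := by
  let R : Poly I J := ⟨P, Q, s, p, t⟩
  have e₁ : G.cut (X := R) (P := ⟨P, Q, s, p, h⟩) (Q := del g) ⟨Q, p, 𝟙 Q, h, by simp [R]⟩ (𝟙 _)
        ⟨t, t, w, by simp [R], IsPullback.of_vert_isIso ⟨by simp⟩⟩ ≫
        G.gS s p w ▷ G.map (del g) ≫ (α_ _ _ _).hom =
      G.cut (splitR R) (𝟙 _) (toOne t) ≫ G.map R ◁ G.cU g := by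
    dsimp only [gS, cU]
    refine G.cut_cut (𝟙 Q) (Category.comp_id _) (Category.comp_id _) (.refl _)
      ⟨t, (Category.id_comp t).trans (Category.comp_id t).symm, by simpa using w,
        IsPullback.of_vert_isIso ⟨by simp [R]⟩⟩ ?_ ?_ ?_ <;>
      ext <;> simp [R]
  have e₂ := G.split_counit_right (P := R) (𝟙 _) rfl (toOne t)
  rw [← cancel_mono (α_ _ _ _).hom, Category.assoc]
  refine Eq.trans ?_ e₁.symm
  rw [← hG.counit_ut, whiskerLeft_comp, reassoc_of% e₂]
  simp [wUnit, R]

/-- The `ΣΔ` Beck 2-cell of a gregarious functor. -/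
lemma sIn_mateEquiv {f' : W ⟶ X} {g' : W ⟶ Y} {g : X ⟶ Z} {f : Y ⟶ Z} {h : W ⟶ Z}
    (w₁ : f' ≫ g = h) (w₂ : g' ≫ f = h)
    {σ : G.map (sig f') ≫ G.map (sig g) ⟶ G.map (sig g') ≫ G.map (sig f)}
    (hσ : G.cS w₁ ≫ σ = G.cS w₂) :
    G.sIn g' (𝟙 W) f' ≫ mateEquiv (hG.adj g') (hG.adj g) σ =
      G.cut (X := ⟨W, W, g', 𝟙 W, f'⟩) (P := sig f) (Q := del g) ⟨W, 𝟙 W, 𝟙 W, h, by simp⟩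
      ⟨g', g', by simp, w₂, IsPullback.of_vert_isIso ⟨by simp⟩⟩
      ⟨f', f', w₁, by simp, IsPullback.of_vert_isIso ⟨by simp⟩⟩ := by
  have e₁ : G.gS g' (𝟙 W) w₁ ≫ G.sIn g' (𝟙 W) f' ▷ G.map (sig g) ≫ wSwap σ (G.map (del g')) =
      G.gS g' (𝟙 W) w₂ ≫ G.sIn g' (𝟙 W) g' ▷ G.map (sig f) := by
    rw [wSwap, ← reassoc_of% G.sIn_cS g' (𝟙 W) w₁, ← whiskerLeft_comp_assoc, hσ,
      reassoc_of% G.sIn_cS g' (𝟙 W) w₂, Iso.hom_inv_id, Category.comp_id]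
  have e₂ : G.gS g' (𝟙 W) w₁ ≫ G.sIn g' (𝟙 W) f' ▷ G.map (sig g) ≫ wSwap σ (G.map (del g')) ≫
      hG.ct g' ▷ G.map (sig f) ≫ (λ_ _).hom = G.map₂ (P := ⟨W, W, g', 𝟙 W, h⟩) (Q := sig f)
        ⟨g', g', by simp, w₂, IsPullback.of_vert_isIso ⟨by simp⟩⟩ := by
    rw [reassoc_of% e₁, ← comp_whiskerRight_assoc, hG.sIn_ct, G.gS_counit]
  rw [mateEquiv_eq]
  refine (Category.assoc _ _ _).symm.trans ?_
  refine (congrArg (· ≫ _) ((wUnit_natural (hG.ut g) (G.sIn g' (𝟙 W) f')))).trans ?_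
  rw [wUnit_ut_map hG _ _ w₁, Category.assoc, Category.assoc, ← comp_whiskerRight,
    ← comp_whiskerRight]
  refine (congrArg (fun t => _ ≫ t ▷ _) e₂).trans ?_
  refine (G.cut_comp_left _ _ _ _).trans ?_
  congr 1
  exact Category.id_comp _

/-- The special case of `sIn_gR_ct` whose target is `⊗_f`, since `bOut` is an instance of `gR`. -/
lemma sIn_bOut_ct {f' : W ⟶ X} {g' : W ⟶ Y} {g : X ⟶ Z} {f : Y ⟶ Z} (sq : IsPullback f' g' g f) :
    G.sIn g' f' g ≫ G.bOut sq ▷ G.map (sig g) ≫ (α_ _ _ _).hom ≫ G.map (ten f) ◁ hG.ct g ≫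
      (ρ_ _).hom = G.map₂ (sqMap sq) := by
  have e := sIn_gR_ct hG (Category.comp_id g') sq (𝟙 _)
  rw [wSplit_wSplit_wCounit] at e
  exact eq_of_whiskerLeft_id e

/-- The first two cells of the distributivity morphism, the unit at `u` and the inverse constraint
of `F_Δ`, together form one cut of `Δ_p`, by the left counit law and coassociativity. -/
lemma cut_unit_del {p : W ⟶ X} {u : X ⟶ A} {h : W ⟶ A} (w : p ≫ u = h) [IsIso (G.cD w)] :
    (λ_ (G.map (del p))).inv ≫ hG.ut u ▷ G.map (del p) ≫ (α_ _ _ _).hom ≫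
        G.map (sig u) ◁ inv (G.cD w) =
      G.cut (X := del p) (P := sig u) (Q := del h) ⟨W, 𝟙 W, 𝟙 W, h, by simp⟩
        ⟨p, p, by simp, w, IsPullback.of_vert_isIso ⟨by simp⟩⟩ (𝟙 _) := by
  have e₁ : G.cut (splitL (del p)) (toOne p) (𝟙 _) ≫ G.cU u ▷ G.map (del p) ≫ (α_ _ _ _).hom =
      G.cut (X := del p) (P := sig u) (Q := del h) ⟨W, 𝟙 W, 𝟙 W, h, by simp⟩
        ⟨p, p, by simp, w, IsPullback.of_vert_isIso ⟨by simp⟩⟩ (𝟙 _) ≫ G.map (sig u) ◁ G.cD w := by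
    dsimp only [cU, cD]
    refine G.cut_cut (𝟙 W) (Category.comp_id _) (Category.comp_id _)
      ⟨p, by simp, by simpa using w, IsPullback.of_vert_isIso ⟨by simp⟩⟩ (.refl _) ?_ ?_ ?_ <;>
      ext <;> simp
  have e₂ := G.split_counit_left (P := del p) (𝟙 _) rfl (toOne p)
  rw [← cancel_mono (G.map (sig u) ◁ G.cD w), ← e₁, ← hG.counit_ut]
  simp only [Category.assoc, comp_whiskerRight]
  rw [reassoc_of% e₂, ← whiskerLeft_comp, IsIso.inv_hom_id, whiskerLeft_id, Category.comp_id]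

/-- The distributivity 2-cell of a gregarious functor. -/
lemma expand_distributivity {u : X ⟶ A} {f : A ⟶ B} (R : PullbackAround u f)
    {d : G.map (del (R.p ≫ u)) ⟶ G.map (del u) ≫ G.map (del R.p)} (hd : d = G.cD rfl) [hi : IsIso d]
    {n : G.map (del (R.p ≫ u)) ≫ G.map (ten R.q) ⟶ G.map (ten f) ≫ G.map (del R.r)}
    (hn : n = hG.bk R.isPullback.flip) :
    (G.sIn R.p R.q R.r ≫ G.bIn R.p R.q ▷ G.map (sig R.r)) ≫
      ((λ_ (G.map (del R.p))).inv ≫ hG.ut u ▷ G.map (del R.p) ≫ (α_ _ _ _).hom ≫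
        G.map (sig u) ◁ inv d) ▷ G.map (ten R.q) ▷ G.map (sig R.r) ≫
      ((α_ _ _ _).hom ≫ G.map (sig u) ◁ n) ▷ G.map (sig R.r) ≫
      (α_ _ _ _).hom ≫ G.map (sig u) ◁ ((α_ _ _ _).hom ≫ G.map (ten f) ◁ hG.ct R.r ≫ (ρ_ _).hom) =
    G.cut (splitDist R) (distL R) (distR R) := by
  subst hd hn
  rw [cut_unit_del hG (rfl : R.p ≫ u = _)]
  -- The cut of `Δ_p` is carried outwards, first over `bIn` here and then over `sIn` in `e₂`, to a
  -- cut of the whole polynomial `(p, q, r)`. The Beck cell and the counit then act on its right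
  -- half alone, giving the map to `⊗_f`.
  have e₁ : G.bIn R.p R.q ≫ G.cut (X := del R.p) (P := sig u) (Q := del (R.p ≫ u))
        ⟨R.T, 𝟙 _, 𝟙 _, R.p ≫ u, by simp⟩
        ⟨R.p, R.p, by simp, rfl, IsPullback.of_vert_isIso ⟨by simp⟩⟩ (𝟙 _) ▷ G.map (ten R.q) ≫
        (α_ _ _ _).hom =
      G.cut (X := ⟨R.T, R.Y, R.p, R.q, 𝟙 _⟩) (P := sig u) (Q := ⟨R.T, R.Y, R.p ≫ u, R.q, 𝟙 _⟩)
        ⟨R.T, 𝟙 _, R.q, R.p ≫ u, by simp⟩ (distL R) (𝟙 _) ≫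
        G.map (sig u) ◁ G.bIn (R.p ≫ u) R.q := by
    dsimp only [bIn]
    refine G.cut_cut (𝟙 _) (Category.comp_id _) (Category.id_comp _) (.refl _) (.refl _)
      ?_ ?_ ?_ <;> ext <;> simp
  have e₂ : G.sIn R.p R.q R.r ≫ G.cut (X := ⟨R.T, R.Y, R.p, R.q, 𝟙 _⟩) (P := sig u)
        (Q := ⟨R.T, R.Y, R.p ≫ u, R.q, 𝟙 _⟩) ⟨R.T, 𝟙 _, R.q, R.p ≫ u, by simp⟩ (distL R) (𝟙 _) ▷
          G.map (sig R.r) ≫ (α_ _ _ _).hom =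
      G.cut (X := ⟨R.T, R.Y, R.p, R.q, R.r⟩) (P := sig u) (Q := ⟨R.T, R.Y, R.p ≫ u, R.q, R.r⟩)
        (splitDist R) (distL R) (𝟙 _) ≫ G.map (sig u) ◁ G.sIn (R.p ≫ u) R.q R.r := by
    dsimp only [sIn]
    refine G.cut_cut R.q (Category.id_comp _) (Category.comp_id _) (.refl _) (.refl _)
      ?_ ?_ ?_ <;> ext <;> simp
  have e₃ := sIn_bOut_ct hG R.isPullback.flip
  have e₄ := congrArg (· ≫ G.map (sig u) ◁ hG.bk R.isPullback.flip) e₁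
  simp only [Category.assoc, ← whiskerLeft_comp, hG.bIn_bk] at e₄
  have e₅ := congrArg (· ▷ G.map (sig R.r)) e₄
  simp only [comp_whiskerRight, Category.assoc] at e₅ ⊢
  rw [reassoc_of% e₅, whisker_assoc]
  simp only [Category.assoc, Iso.inv_hom_id_assoc]
  rw [reassoc_of% e₂, ← whiskerLeft_comp, ← whiskerLeft_comp]
  refine (congrArg (fun t => _ ≫ _ ◁ t) e₃).trans ?_
  refine (G.cut_comp_right _ _ _ _).trans ?_
  congr 1
  exact Category.id_comp _

end SplitFunctor

end

end PolyCart

namespace PolyCart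

open PullbackChoice DistributivityChoice PolyCart.Poly

/-! ### Invariance of the Beck and distributivity conditions -/

section Whisker

variable {C : Type u₂} [Bicategory.{w₂, v₂} C] {a b c d x : C}

lemma hc_associator {f f' : a ⟶ b} {g g' : b ⟶ c} {h h' : c ⟶ d} (φ : f ⟶ f') (ψ : g ⟶ g')
    (χ : h ⟶ h') : hc (hc φ ψ) χ ≫ (α_ _ _ _).hom = (α_ _ _ _).hom ≫ hc φ (hc ψ χ) := by
  simp [hc]

lemma hc_whiskerLeft {H H' : x ⟶ a} (κ : H ⟶ H') {f f' g g' : a ⟶ b} {φ : f ⟶ f'} {ψ : g ⟶ g'}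
    {θ : f ⟶ g} {θ' : f' ⟶ g'} (e : φ ≫ θ' = θ ≫ ψ) :
    hc κ φ ≫ H' ◁ θ' = H ◁ θ ≫ hc κ ψ := by
  simp only [hc, Category.assoc]
  rw [← whiskerLeft_comp, e, whiskerLeft_comp, whisker_exchange_assoc]

lemma isIso_iff_of_comm {D : Type u₁} [Category.{v₁} D] {a b a' b' : D} {f : a ⟶ b} {f' : a' ⟶ b'}
    {i : a ⟶ a'} {j : b ⟶ b'} [IsIso i] [IsIso j] (e : i ≫ f' = f ≫ j) : IsIso f ↔ IsIso f' := by
  refine ⟨fun h => ?_, fun h => ?_⟩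
  · refine @IsIso.of_isIso_comp_left _ _ _ _ _ i f' _ ?_
    rw [e]; infer_instance
  · refine @IsIso.of_isIso_comp_right _ _ _ _ _ f j _ ?_
    rw [← e]; infer_instance

end Whisker

section

variable {E : Type u} [Category.{v} E] {C : Type u₂} [Bicategory.{w₂, v₂} C] {o : E → C}

lemma RawTriple.sc_sigmaSquare (T : RawTriple o) (hS : T.Sig.IsPseudo) {W X Y Z : E} {f' : W ⟶ X}
    {g' : W ⟶ Y} {g : X ⟶ Z} {f : Y ⟶ Z} (w : f' ≫ g = g' ≫ f) :
    T.sc w ≫ T.sigmaSquare hS w = T.sc rfl := by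
  have : IsIso (T.Sc f' g) := hS.2 f'.toLoc g.toLoc
  have e : T.sigmaSquare hS w = inv (T.Sc f' g) ≫ eqToHom (by rw [w]) ≫ T.Sc g' f := rfl
  rw [e, sc, sc, Category.assoc, IsIso.hom_inv_id_assoc, eqToHom_trans_assoc]

namespace LaxBeckTriple

variable {T T' : LaxBeckTriple o} (m : T ⟶ T') {adj : T.Adj} {adj' : T'.Adj}
  {W X Y Z A B : E}

namespace Hom

lemma hc_counit (adj : T.Adj) (adj' : T'.Adj) (f : X ⟶ Y) :
    hc (appD m f) (appS m adj adj' f) ≫ (adj' f).counit = (adj f).counit ≫ 𝟙 _ :=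
  (β_counit m adj adj' f).trans (Category.comp_id _).symm

lemma appS_sigmaSquare (hadj : adj.Compatible) (hadj' : adj'.Compatible) {f' : W ⟶ X} {g' : W ⟶ Y}
    {g : X ⟶ Z} {f : Y ⟶ Z} (w : f' ≫ g = g' ≫ f) :
    hc (appS m adj adj' f') (appS m adj adj' g) ≫ T'.sigmaSquare T'.sig_pseudo w =
      T.sigmaSquare T.sig_pseudo w ≫ hc (appS m adj adj' g') (appS m adj adj' f) := by
  have e₁ := τ_sc m w hadj hadj'
  have e₂ := τ_sc m (rfl : g' ≫ f = _) hadj hadj'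
  have e₃ := T'.sc_sigmaSquare T'.sig_pseudo w
  have e₄ := T.sc_sigmaSquare T.sig_pseudo w
  rw [← cancel_epi (T.sc w)]
  simp only [hc, Category.assoc] at e₁ e₂ ⊢
  rw [← reassoc_of% e₁, e₃, e₂, reassoc_of% e₄]

lemma appS_sigmaDeltaBeck (hadj : adj.Compatible) (hadj' : adj'.Compatible) {f' : W ⟶ X}
    {g' : W ⟶ Y} {g : X ⟶ Z} {f : Y ⟶ Z} (w : f' ≫ g = g' ≫ f) :
    hc (appD m g') (appS m adj adj' f') ≫ adj'.sigmaDeltaBeck T'.sig_pseudo w =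
      adj.sigmaDeltaBeck T.sig_pseudo w ≫ hc (appS m adj adj' f) (appD m g) := by
  have e : hc (hc (appD m g') (appS m adj adj' g')) (appS m adj adj' f) ≫
      (adj' g').counit ▷ T'.S f ≫ (λ_ _).hom =
      ((adj g').counit ▷ T.S f ≫ (λ_ _).hom) ≫ appS m adj adj' f := by
    rw [reassoc_of% hc_whiskerRight (hc_counit m adj adj' g'), hc_id]
    simp
  have e' : hc (hc (appD m g') (appS m adj adj' f')) (appS m adj adj' g) ≫
      wSwap (T'.sigmaSquare T'.sig_pseudo w) (T'.D g') ≫ (adj' g').counit ▷ T'.S f ≫ (λ_ _).hom =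
      (wSwap (T.sigmaSquare T.sig_pseudo w) (T.D g') ≫ (adj g').counit ▷ T.S f ≫ (λ_ _).hom) ≫
        appS m adj adj' f := by
    rw [reassoc_of% hc_wSwap (appD m g') (appS_sigmaSquare m hadj hadj' w), e]
    simp only [Category.assoc]
  dsimp only [RawTriple.Adj.sigmaDeltaBeck]
  rw [mateEquiv_eq, mateEquiv_eq, reassoc_of% hc_wUnit _ (unit_β m adj adj' g), Category.assoc,
    hc_whiskerRight e']

lemma appD_unit (u : X ⟶ A) (p : W ⟶ X) [IsIso (T.Dc p u)] [IsIso (T'.Dc p u)] :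
    appD m p ≫ (λ_ (T'.D p)).inv ≫ (adj' u).unit ▷ T'.D p ≫ (α_ _ _ _).hom ≫
        T'.S u ◁ inv (T'.Dc p u) =
      ((λ_ (T.D p)).inv ≫ (adj u).unit ▷ T.D p ≫ (α_ _ _ _).hom ≫ T.S u ◁ inv (T.Dc p u)) ≫
        hc (appS m adj adj' u) (appD m (p ≫ u)) := by
  have e₁ := β_dc m (rfl : p ≫ u = _)
  rw [RawTriple.dc_rfl, RawTriple.dc_rfl] at e₁
  change _ = _ ≫ hc _ _ at e₁
  have e₂ : hc (appD m u) (appD m p) ≫ inv (T'.Dc p u) = inv (T.Dc p u) ≫ appD m (p ≫ u) := by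
    rw [IsIso.comp_inv_eq, Category.assoc, e₁, IsIso.inv_hom_id_assoc]
  have e₃ : appD m p ≫ (λ_ (T'.D p)).inv ≫ (adj' u).unit ▷ T'.D p = (λ_ (T.D p)).inv ≫
      (adj u).unit ▷ T.D p ≫ hc (hc (appS m adj adj' u) (appD m u)) (appD m p) := by
    have e := unit_β m adj adj' u
    change _ ≫ hc _ _ = _ at e
    rw [whiskerRight_hc, e, hc, ← whisker_exchange, leftUnitor_inv_naturality_assoc]
  simp only [Category.assoc]
  rw [← hc_whiskerLeft (appS m adj adj' u) e₂, ← reassoc_of% hc_associator, reassoc_of% e₃]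

/-- Each ingredient, namely the unit at `u`, the constraint of `F_Δ`, the Beck cell and the counit
at `r`, commutes with the components of `m`, where `appS` is the component at `Σ`. -/
lemma distributivity (adj : T.Adj) (adj' : T'.Adj) {u : X ⟶ A} {f : A ⟶ B}
    (R : PullbackAround u f) :
    hc (hc (appD m R.p) (appN m R.q)) (appS m adj adj' R.r) ≫ adj'.distributivity T'.del_pseudo R =
      adj.distributivity T.del_pseudo R ≫ hc (appS m adj adj' u) (appN m f) := by
  have : IsIso (T.Dc R.p u) := T.del_pseudo.2 _ _
  have : IsIso (T'.Dc R.p u) := T'.del_pseudo.2 _ _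
  have e₁ := appD_unit m (adj := adj) (adj' := adj') u R.p
  have e₀ : hc (appD m (R.p ≫ u)) (appN m R.q) ≫ T'.beck R.isPullback.flip =
      T.beck R.isPullback.flip ≫ hc (appN m f) (appD m R.r) := m.raw.comm R.isPullback.flip
  have e₂ : hc (hc (appS m adj adj' u) (appD m (R.p ≫ u))) (appN m R.q) ≫ (α_ _ _ _).hom ≫
      T'.S u ◁ T'.beck R.isPullback.flip = ((α_ _ _ _).hom ≫ T.S u ◁ T.beck R.isPullback.flip) ≫
        hc (appS m adj adj' u) (hc (appN m f) (appD m R.r)) := by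
    rw [reassoc_of% hc_associator, hc_whiskerLeft _ e₀, Category.assoc]
  have e₃ : hc (hc (appN m f) (appD m R.r)) (appS m adj adj' R.r) ≫ (α_ _ _ _).hom ≫
      T'.N f ◁ (adj' R.r).counit ≫ (ρ_ _).hom =
      ((α_ _ _ _).hom ≫ T.N f ◁ (adj R.r).counit ≫ (ρ_ _).hom) ≫ appN m f := by
    rw [reassoc_of% hc_associator, reassoc_of% hc_whiskerLeft _ (hc_counit m adj adj' R.r)]
    simp [hc]
  dsimp only [RawTriple.Adj.distributivity]
  rw [reassoc_of% hc_whiskerRight (hc_whiskerRight e₁ (appN m R.q)) (appS m adj adj' R.r),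
    reassoc_of% hc_whiskerRight e₂ (appS m adj adj' R.r), reassoc_of% hc_associator,
    hc_whiskerLeft _ e₃]
  simp only [Category.assoc]

end Hom

instance [IsIso m] {X Y : E} (f : X ⟶ Y) : IsIso (Hom.appN m f) :=
  ⟨Hom.appN (inv m) f, congrArg (Hom.appN · f) (IsIso.hom_inv_id m),
    congrArg (Hom.appN · f) (IsIso.inv_hom_id m)⟩

lemma isIso_beck_iff (m : T ⟶ T') [IsIso m] {f' : W ⟶ X} {g' : W ⟶ Y} {g : X ⟶ Z} {f : Y ⟶ Z}
    (sq : IsPullback f' g' g f) : IsIso (T.beck sq) ↔ IsIso (T'.beck sq) := by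
  have e := m.raw.comm sq
  change hc (Hom.appD m g') (Hom.appN m f') ≫ _ = _ ≫ hc (Hom.appN m f) (Hom.appD m g) at e
  exact isIso_iff_of_comm e

lemma isIso_sigmaDeltaBeck_iff (m : T ⟶ T') (hadj : adj.Compatible) (hadj' : adj'.Compatible) {f' : W ⟶ X}
    {g' : W ⟶ Y} {g : X ⟶ Z} {f : Y ⟶ Z} (w : f' ≫ g = g' ≫ f) :
    IsIso (adj.sigmaDeltaBeck T.sig_pseudo w) ↔ IsIso (adj'.sigmaDeltaBeck T'.sig_pseudo w) :=
  isIso_iff_of_comm (Hom.appS_sigmaDeltaBeck m hadj hadj' w)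

lemma isIso_distributivity_iff (m : T ⟶ T') [IsIso m] (adj : T.Adj) (adj' : T'.Adj)
    {u : X ⟶ A} {f : A ⟶ B} (R : PullbackAround u f) :
    IsIso (adj.distributivity T.del_pseudo R) ↔ IsIso (adj'.distributivity T'.del_pseudo R) :=
  isIso_iff_of_comm (Hom.distributivity m adj adj' R)

/-- The commuting squares with invertible sides compare any two compatible choices of adjunctions,
also across an isomorphism of triples. So the existential choice in `IsBeck` may be replaced by a
fixed one. -/
lemma isBeck_iff (m : T ⟶ T') [IsIso m] (hadj' : adj'.Compatible) :
    T.IsBeck ↔ ∀ ⦃W X Y Z : E⦄ ⦃f' : W ⟶ X⦄ ⦃g' : W ⟶ Y⦄ ⦃g : X ⟶ Z⦄ ⦃f : Y ⟶ Z⦄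
      (sq : IsPullback f' g' g f),
      IsIso (T'.beck sq) ∧ IsIso (adj'.sigmaDeltaBeck T'.sig_pseudo sq.w) := by
  refine ⟨fun ⟨adj, hadj, h⟩ W X Y Z f' g' g f sq => ?_, fun h => ?_⟩
  · rw [← isIso_beck_iff m, ← isIso_sigmaDeltaBeck_iff m hadj hadj']
    exact h sq
  · obtain ⟨adj, hadj⟩ := T.exists_adj
    refine ⟨adj, hadj, fun W X Y Z f' g' g f sq => ?_⟩
    rw [isIso_beck_iff m, isIso_sigmaDeltaBeck_iff m hadj hadj']
    exact h sq

lemma isDistBeck_iff (m : T ⟶ T') [IsIso m] (adj' : T'.Adj) :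
    T.IsDistBeck ↔ T.IsBeck ∧ ∀ ⦃X A B : E⦄ ⦃u : X ⟶ A⦄ ⦃f : A ⟶ B⦄ (P : DistributivityPullback u f),
      IsIso (adj'.distributivity T'.del_pseudo P.toPullbackAround) := by
  refine and_congr_right fun _ => ⟨fun ⟨adj, _, h⟩ X A B u f P => ?_, fun h => ?_⟩
  · rw [← isIso_distributivity_iff m adj adj']
    exact h P
  · obtain ⟨adj, hadj⟩ := T.exists_adj
    refine ⟨adj, hadj, fun X A B u f P => ?_⟩
    rw [isIso_distributivity_iff m adj adj']
    exact h P

end LaxBeckTriple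

end

section

variable {E : Type u} [Category.{v} E] [PullbackChoice E] [DistributivityChoice E]
  {C : Type u₂} [Bicategory.{w₂, v₂} C] {o : PolyC E → C} {F : OplaxOver o}
  (hF : F.IsGregarious) (hN : F.restrictTensor.IsPseudo) {W X Y Z A B : E}

namespace OplaxOver

lemma isIso_cut_iff {I J K : E} {X : Poly I K} {P : Poly I J} {Q : Poly J K} {A : Split X J}
    {a : A.left ⟶ P} {b : A.right ⟶ Q} (h : IsIso (lift A a b)) :
    IsIso (F.toSplit.cut A a b) ↔ IsIso (F.polyMapComp P Q) :=
  ⟨fun h' => isIso_polyMapComp_of_cut h' h, fun h' => isIso_cut h' h⟩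

lemma isIso_iff_of_eq_comp {D : Type u₁} [Category.{v₁} D] {a b c : D} {i : a ⟶ b} {f : b ⟶ c}
    {g : a ⟶ c} (hi : IsIso i) (e : i ≫ f = g) : IsIso f ↔ IsIso g := by
  subst e
  exact ⟨fun _ => inferInstance, fun _ => IsIso.of_isIso_comp_left i f⟩

/-- The Beck cell is the cut `bOut` up to the invertible `bIn`, and the pullback square makes the
corresponding `lift` invertible. The next two lemmas argue likewise with `sIn` and with
distributivity pullbacks. -/
lemma isIso_triple_beck_iff {f' : W ⟶ X} {g' : W ⟶ Y} {g : X ⟶ Z} {f : Y ⟶ Z}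
    (sq : IsPullback f' g' g f) :
    IsIso ((F.triple hF).beck sq) ↔ IsIso (F.polyMapComp (ten f) (del g)) := by
  rw [← isIso_cut_iff (isIso_lift_ten_del sq), triple_beck]
  exact isIso_iff_of_eq_comp ((isGregarious_toSplit hF).isIso_bIn g' f')
    ((isGregarious_toSplit hF).bIn_bk sq)

lemma isIso_triple_sigmaDeltaBeck_iff (hS : (F.triple hF).Sig.IsPseudo) {f' : W ⟶ X} {g' : W ⟶ Y}
    {g : X ⟶ Z} {f : Y ⟶ Z} (sq : IsPullback f' g' g f) :
    IsIso ((tripleAdj hF).sigmaDeltaBeck hS sq.w) ↔ IsIso (F.polyMapComp (sig f) (del g)) := by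
  rw [← isIso_cut_iff (isIso_lift_sig_del sq sq.w rfl)]
  have e := (F.triple hF).sc_sigmaSquare hS sq.w
  rw [triple_sc, triple_sc] at e
  exact isIso_iff_of_eq_comp ((isGregarious_toSplit hF).isIso_sIn g' (𝟙 W) f')
    (SplitFunctor.sIn_mateEquiv (isGregarious_toSplit hF) sq.w rfl e)

lemma isIso_triple_distributivity_iff (hD : (F.triple hF).Del.IsPseudo) {u : X ⟶ A} {f : A ⟶ B}
    (R : DistributivityPullback u f) :
    IsIso ((tripleAdj hF).distributivity hD R.toPullbackAround) ↔
      IsIso (F.polyMapComp (sig u) (ten f)) := by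
  rw [← isIso_cut_iff (isIso_lift_dist R)]
  have h₁ := (isGregarious_toSplit hF).isIso_sIn R.p R.q R.r
  have h₂ := (isGregarious_toSplit hF).isIso_bIn R.p R.q
  have h₃ : IsIso ((F.triple hF).Dc R.p u) := hD.2 _ _
  have h₄ : IsIso (F.toSplit.sIn R.p R.q R.r ≫ F.toSplit.bIn R.p R.q ▷ F.toSplit.map (sig R.r)) :=
    inferInstance
  exact isIso_iff_of_eq_comp h₄ (SplitFunctor.expand_distributivity (hi := h₃) (isGregarious_toSplit hF)
    R.toPullbackAround (triple_Dc hF R.p u) (triple_beck hF R.isPullback.flip))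

variable {T : LaxBeckTriple (fun X : E => o ⟨X⟩)}

lemma isBeck_iff (m : T ⟶ laxTriple hF hN) [IsIso m] :
    T.IsBeck ↔ F.restrictSigmaDelta.IsPseudo ∧ F.restrictDeltaTensor.IsPseudo := by
  rw [LaxBeckTriple.isBeck_iff m (tripleAdj_compatible hF), isPseudo_restrictDeltaTensor_iff hF hN]
  refine ⟨fun h => ?_, fun ⟨h₁, h₂⟩ W X Y Z f' g' g f sq =>
    ⟨(isIso_triple_beck_iff hF sq).2 (h₂ f g), (isIso_triple_sigmaDeltaBeck_iff hF _ sq).2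
      ((isPseudo_restrictSigmaDelta_iff hF hN h₂).1 h₁ f g)⟩⟩
  -- The chosen pullback supplies a square for every cospan, so the condition on squares covers all
  -- pairs `(f, g)`.
  have h₂ : ∀ ⦃X Y Z : E⦄ (f : X ⟶ Z) (g : Y ⟶ Z), IsIso (F.polyMapComp (ten f) (del g)) :=
    fun X Y Z f g => (isIso_triple_beck_iff hF (pb f g).isPullback.flip).1 (h _).1
  exact ⟨(isPseudo_restrictSigmaDelta_iff hF hN h₂).2 fun X Y Z f g =>
    (isIso_triple_sigmaDeltaBeck_iff hF _ (pb f g).isPullback.flip).1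
      (h (pb f g).isPullback.flip).2, h₂⟩

lemma isDistBeck_iff (m : T ⟶ laxTriple hF hN) [IsIso m] : T.IsDistBeck ↔ F.IsPseudo := by
  rw [LaxBeckTriple.isDistBeck_iff m (tripleAdj hF), isBeck_iff hF hN m]
  have key (h₁ : F.restrictSigmaDelta.IsPseudo) (h₂ : F.restrictDeltaTensor.IsPseudo) :=
    isPseudo_iff hF hN ((isPseudo_restrictDeltaTensor_iff hF hN).1 h₂)
      ((isPseudo_restrictSigmaDelta_iff hF hN
        ((isPseudo_restrictDeltaTensor_iff hF hN).1 h₂)).1 h₁)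
  -- One chosen distributivity pullback for each pair suffices in this direction. Conversely,
  -- invertibility at the pair yields the condition for every distributivity pullback around it.
  refine ⟨fun ⟨⟨h₁, h₂⟩, h⟩ => (key h₁ h₂).2 fun X Y Z f g =>
    (isIso_triple_distributivity_iff hF _ (dpb f g)).1 (h _), fun h => ?_⟩
  have h₁ : F.restrictSigmaDelta.IsPseudo := h.precomp _
  have h₂ : F.restrictDeltaTensor.IsPseudo := h.precomp _
  exact ⟨⟨h₁, h₂⟩, fun X A B u f P => (isIso_triple_distributivity_iff hF _ P).2
    ((key h₁ h₂).1 h u f)⟩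

end OplaxOver

end

end PolyCart

namespace PolyCart

open PullbackChoice DistributivityChoice PolyCart.Poly

/-! ### The equivalence -/

lemma restrictsToEquivalence_of_forall {A : Type u₁} [Category.{v₁} A] {B : Type u₂}
    [Category.{v₂} B] (F : A ⥤ B) [F.Full] [F.Faithful] {P : ObjectProperty A}
    {Q : ObjectProperty B} (h : ∀ X, P X → Q (F.obj X))
    (h' : ∀ Y, Q Y → ∃ X, P X ∧ Nonempty (F.obj X ≅ Y)) : RestrictsToEquivalence F P Q := by
  refine ⟨fun X => h X.obj X.property, ?_⟩
  have : (Q.lift (P.ι ⋙ F) fun X => h X.obj X.property).EssSurj := ⟨fun Y => by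
    obtain ⟨X, hX, ⟨e⟩⟩ := h' Y.obj Y.property
    exact ⟨⟨X, hX⟩, ⟨Q.isoMk e⟩⟩⟩
  exact { }

lemma fst_eq_of_hom {I : Type u₁} {D : I → Type u₂} [∀ i, Category.{v₂} (D i)] {F G : Σ i, D i}
    (n : F ⟶ G) : F.1 = G.1 := by
  obtain ⟨_⟩ := n
  rfl

section

variable (E : Type u) [Category.{v} E] [PullbackChoice E] [DistributivityChoice E]
  (C : Type u₂) [Bicategory.{w₂, v₂} C]

variable {E C} in
/-- The action of `Υ` on icons. -/
noncomputable def toTriplesMap : ∀ {F G : Greg (PolyC E) C} (hF : gregTensor E C F)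
    (hG : gregTensor E C G) (_ : F ⟶ G),
    (⟨fun X => F.1 ⟨X⟩, OplaxOver.laxTriple F.2.property hF⟩ : LaxBeckTriples E C) ⟶
      ⟨fun X => G.1 ⟨X⟩, OplaxOver.laxTriple G.2.property hG⟩
  | _, _, hF, hG, .mk κ => .mk (OplaxOver.laxTripleMap _ hF _ hG κ.hom)

/-- The functor `Υ` from gregarious functors to lax Beck triples. -/
noncomputable def toTriples : GregTensor E C ⥤ LaxBeckTriples E C where
  obj F := ⟨fun X => F.obj.1 ⟨X⟩, OplaxOver.laxTriple F.obj.2.property F.property⟩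
  map {F G} κ := toTriplesMap F.property G.property κ.hom
  map_id F := rfl
  map_comp := by
    rintro ⟨⟨o, F⟩, hF⟩ ⟨⟨_, G⟩, hG⟩ ⟨⟨_, H⟩, hH⟩ ⟨⟨κ⟩⟩ ⟨⟨θ⟩⟩
    rfl

lemma toTriples_forget :
    toTriples E C ⋙ LaxBeckTriples.forget E C = (gregTensor E C).ι ⋙ comparison E C := by
  refine CategoryTheory.Functor.ext (fun F => rfl) ?_
  rintro ⟨⟨o, F⟩, hF⟩ ⟨⟨_, G⟩, hG⟩ ⟨⟨κ⟩⟩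
  exact ((Category.id_comp _).trans (Category.comp_id _)).symm

instance : (toTriples E C).Faithful where
  map_injective := by
    rintro ⟨⟨o, F⟩, hF⟩ ⟨⟨_, G⟩, hG⟩ ⟨@⟨_, _, G, κ⟩⟩ ⟨⟨κ'⟩⟩ h
    have h' : OplaxOver.laxTripleMap F.property hF G.property hG κ.hom =
        OplaxOver.laxTripleMap F.property hF G.property hG κ'.hom :=
      (CategoryTheory.Sigma.incl (C := fun o : E → C => LaxBeckTriple o) _).map_injective h
    obtain rfl : κ = κ' := by
      ext1
      exact OplaxOver.laxTripleMap_injective _ _ _ _ h'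
    rfl

instance : (toTriples E C).Full where
  map_surjective := by
    rintro ⟨⟨o, F⟩, hF⟩ ⟨⟨o', G⟩, hG⟩ n
    -- Morphisms in the disjoint union exist only over equal indices, and an action on the objects
    -- of `PolyC E` is determined by the action on `E`.
    obtain rfl : o = o' := funext fun X => congrFun (fst_eq_of_hom n) X.as
    obtain ⟨m, rfl⟩ := (CategoryTheory.Sigma.incl (C := fun o : E → C => LaxBeckTriple o)
      (fun X => o ⟨X⟩)).map_surjective (X := OplaxOver.laxTriple F.property hF)
      (Y := OplaxOver.laxTriple G.property hG) n
    refine ⟨ObjectProperty.homMk (.mk (ObjectProperty.homMk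
      (OplaxOver.iconOfTripleMap F.property hF G.property hG m))), ?_⟩
    exact congrArg CategoryTheory.Sigma.SigmaHom.mk
      (OplaxOver.laxTripleMap_iconOfTripleMap F.property hF G.property hG m)

variable {E C} in
/-- The gregarious functor of a lax Beck triple. -/
noncomputable def ofTriple {o : E → C} (T : LaxBeckTriple o) : GregTensor E C :=
  ⟨⟨fun X => o X.as, ⟨T.functor T.exists_adj.choose_spec, T.isGregarious_realize _⟩⟩,
    T.isPseudo_restrictTensor_realize _⟩

variable {E C} in
/-- The lax Beck triple of the gregarious functor of a lax Beck triple. -/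
noncomputable def toTriplesOfTriple {o : E → C} (T : LaxBeckTriple o) :
    (toTriples E C).obj (ofTriple T) ≅ ⟨o, T⟩ :=
  (CategoryTheory.Sigma.incl (C := fun o : E → C => LaxBeckTriple o) o).mapIso
    (@asIso _ _ _ _ (T.ofFunctorTriple T.exists_adj.choose_spec) (T.isIso_ofFunctorTriple _))

instance : (toTriples E C).EssSurj := ⟨fun ⟨_, T⟩ => ⟨ofTriple T, ⟨toTriplesOfTriple T⟩⟩⟩

instance : (toTriples E C).IsEquivalence where

lemma restrictsToEquivalence_beck :
    RestrictsToEquivalence (toTriples E C) (GregTensor.sigmaDeltaTensor E C)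
      (LaxBeckTriples.beck E C) := by
  refine restrictsToEquivalence_of_forall _ (fun F h => ?_) (fun ⟨o, T⟩ h =>
    ⟨ofTriple T, ?_, ⟨toTriplesOfTriple T⟩⟩)
  · exact (OplaxOver.isBeck_iff F.obj.2.property F.property (𝟙 _)).2 h
  -- The Beck condition on `T` passes to the realized functor along the inverse of the isomorphism
  -- that recovers `T`.
  · have := T.isIso_ofFunctorTriple T.exists_adj.choose_spec
    exact (OplaxOver.isBeck_iff (T.isGregarious_realize _) (T.isPseudo_restrictTensor_realize _)
      (inv (T.ofFunctorTriple T.exists_adj.choose_spec))).1 h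

lemma restrictsToEquivalence_distBeck :
    RestrictsToEquivalence (toTriples E C) (GregTensor.pseudo E C)
      (LaxBeckTriples.distBeck E C) := by
  refine restrictsToEquivalence_of_forall _ (fun F h => ?_) (fun ⟨o, T⟩ h =>
    ⟨ofTriple T, ?_, ⟨toTriplesOfTriple T⟩⟩)
  · exact (OplaxOver.isDistBeck_iff F.obj.2.property F.property (𝟙 _)).2 h
  · have := T.isIso_ofFunctorTriple T.exists_adj.choose_spec
    exact (OplaxOver.isDistBeck_iff (T.isGregarious_realize _) (T.isPseudo_restrictTensor_realize _)
      (inv (T.ofFunctorTriple T.exists_adj.choose_spec))).1 h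

end

end PolyCart

theorem theorem4 (E : Type u) [Category.{v} E] [PolyCart.PullbackChoice E]
    [PolyCart.DistributivityChoice E] (C : Type u₂) [Bicategory.{w₂, v₂} C] :
    ∃ Υ : PolyCart.GregTensor E C ⥤ PolyCart.LaxBeckTriples E C,
      Υ ⋙ PolyCart.LaxBeckTriples.forget E C =
        (PolyCart.gregTensor E C).ι ⋙ PolyCart.comparison E C ∧
      Υ.IsEquivalence ∧
      PolyCart.RestrictsToEquivalence Υ (PolyCart.GregTensor.sigmaDeltaTensor E C)
        (PolyCart.LaxBeckTriples.beck E C) ∧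
      PolyCart.RestrictsToEquivalence Υ (PolyCart.GregTensor.pseudo E C)
        (PolyCart.LaxBeckTriples.distBeck E C) :=
  ⟨PolyCart.toTriples E C, PolyCart.toTriples_forget E C, inferInstance,
    PolyCart.restrictsToEquivalence_beck E C, PolyCart.restrictsToEquivalence_distBeck E C⟩
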